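/- **Setting.** Let $\mathbb A=\{x\in\mathbb R^3: x_1+x_2+x_3=0\}$ be the standard Euclidean apartment with affine Weyl group $S_3\ltimes\mathbb R^2$: its walls are the lines $x_i-x_j=c$, its half-apartments the half-planes $x_i-x_j\ge c$, an enclosure is an intersection of half-apartments, and the hull of a set is the smallest enclosure containing it. Its facets are the filters $\sigma_{x,F}$ ($x\in\mathbb A$, $F$ a vectorial facet), where $Z\in\sigma_{x,F}$ iff $Z$ contains a finite intersection of walls and open half-apartments that contains $U\cap(x+F)$ for some neighbourhood $U$ of $x$. A *building* is a set with a family of filters (facets) and a family of subsets with metrics (apartments) such that each apartment, with its metric and the facets contained in it, is isomorphic to $\mathbb A$; any two facets lie in a common apartment; and the intersection of two apartments $A,A'$ is a union of facets, any two facets $F,F'$ in $A\cap A'$ being fixed pointwise, with their closures, by some isometry $A\to A'$ that carries the facets of $A$ to those of $A'$. The distance of two points is measured in any apartment containing both. A *pre-building* is a set with facets and a family of subsets with metrics (cubicles), each isomorphic, with the facets contained in it, to an enclosure of $\mathbb A$. Morphisms map facets to facets; an *isometry of pre-buildings* is a morphism that preserves distances on every cubicle (apartment); a *folding map* of buildings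 is a morphism $f$ such that every apartment has a locally finite collection of affine hyperplanes with $f$ an isometry on the closure of every connected component of their complement. **The pre-building $\mathcal B_{\rm pre}$.** Let $X=\mathbb C$, and let $\pi:\Sigma\to X$ be the cameral cover of the spectral curve $p^3-3p+x=0$, whose points over $x$ are the orderings $(p_1,p_2,p_3)$ of the roots. For $P,Q$ in $\Sigma$ put $\psi_P(Q)=\big(\mathrm{Re}\int_P^Q p_i\,dx\big)_{i=1,2,3}\in\mathbb A$, where $\int p\,dx=\tfrac32p^2-\tfrac34p^4$ on the spectral curve. The spectral network together with its backward collision line is the set of $x$ over which $\mathrm{Re}(\tfrac32p_i^2-\tfrac34p_i^4)$ takes the same value for two of the three (indexed) roots. Its complement has ten components: eight exterior regions $R_0,\dots,R_7$, in counterclockwise order starting from the positive real axis, and the right half $R_8$ and the left half $R_9$ of the central region. The ten maximal abelian regions $U_\alpha$ are the interiors of the closures of the unions of the regions with indices $\{0,1,2,3,8,9\}$, $\{4,5,6,7,8,9\}$, $\{1,2,3,4\}$, $\{2,3,4,5\}$, $\{3,4,5,6\}$, $\{5,6,7,0\}$, $\{6,7,0,1\}$, $\{7,0,1,2\}$, $\{0,8,9,4\}$,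 $\{7,8,9,3\}$. For open $U$ and $P\in\pi^{-1}(U)$ let $K_U(P)$ be the component of $P$ in $\pi^{-1}(U)$. Then $\mathcal B_{\rm pre}$ is the set of triples $(\alpha,P,v)$ with $P\in\pi^{-1}(U_\alpha)$ and $v\in\mathrm{hull}\,\psi_P(K_{U_\alpha}(P))$, modulo the equivalence relation generated by $(\alpha,P,v)\sim(\alpha,wP,wv)$ for $w\in S_3$; $(\alpha,P,v)\sim(\alpha,Q,\psi_Q(P)+v)$ for $Q\in K_{U_\alpha}(P)$; and $(\alpha,P,v)\sim(\beta,P,v)$ for $v\in\mathrm{hull}\,\psi_P(K_{U_\alpha\cap U_\beta}(P))$. Its cubicles are the images of the sets $\{(\alpha,P)\}\times\mathrm{hull}\,\psi_P(K_{U_\alpha}(P))$ with the metric of $\mathbb A$; its facets are the images of the facets of $\mathbb A$ contained in these hulls. Let $h^{\rm pre}:X\setminus\{\pm2\}\to\mathcal B_{\rm pre}$ be the map $x\mapsto[(\alpha,P,0)]$ for $\pi(P)=x\in U_\alpha$. **The building $\mathcal B^\phi$.** Let $G_0$ be the graph with vertices $v_0,\dots,v_7,u$ and edges $\epsilon_k=\{v_k,v_{k+1}\}$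 ($0\le k\le7$, $v_8=v_0$), $\epsilon_8=\{v_0,u\}$, $\epsilon_9=\{u,v_4\}$ (the link of $\mathcal B_{\rm pre}$ at the common image of the two collision points, one edge for each region). Given $G_{n-1}$, let $G_n$ be obtained by adding, for every pair of vertices that are the end points of a path of four edges not contained in a hexagon, one new vertex joined to both. Let $\mathcal B^8=\bigcup_nG_n$, and let $\mathcal B^\phi$ be the cone over $\mathcal B^8$: every edge of $\mathcal B^8$ gives a Euclidean sector of angle $60^\circ$ with apex $o$, and the apartments are the cones over the hexagons of $\mathcal B^8$, each identified with $\mathbb A$ so that the six rays lie on the walls through $0$. **Proposition.** $\mathcal B_{\rm pre}$ is a pre-building and $\mathcal B^\phi$ is a building, and there is an isometry of pre-buildings $i:\mathcal B_{\rm pre}\to\mathcal B^\phi$ that maps $h^{\rm pre}(R_k)$ into the closed sector over $\epsilon_k$, for $0\le k\le9$, and has the following universal property: for every building $\mathcal B$ and every isometry of pre-buildings $j:\mathcal B_{\rm pre}\to\mathcal B$ there is a folding map of buildings $\theta:\mathcal B^\phi\to\mathcal B$ with $\theta\circ i=j$. -/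

import Mathlib

open Set Filter Topology

universe u v u' v'

noncomputable section

namespace BNR

/-! ### The standard Euclidean apartment of type A₂ with Weyl group `S₃ ⋉ ℝ²` -/

/-- The Euclidean plane `{x ∈ ℝ³ | x₀ + x₁ + x₂ = 0}`. -/
def planeSubmodule : Submodule ℝ (EuclideanSpace ℝ (Fin 3)) where
  carrier := {v | ∑ i, v i = 0}
  add_mem' := by
    intro a b ha hb
    simp only [Set.mem_ofPred_eq] at ha hb ⊢
    simp [Finset.sum_add_distrib, ha, hb]
  zero_mem' := by simp
  smul_mem' := by
    intro c x hx
    simp only [Set.mem_ofPred_eq] at hx ⊢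
    simp [← Finset.mul_sum, hx]

abbrev Plane : Type := planeSubmodule

/-- The `i`-th coordinate of a point of the plane. -/
def coord (v : Plane) (i : Fin 3) : ℝ := (v : EuclideanSpace ℝ (Fin 3)) i

/-- The point with given coordinates of sum zero. -/
def mkPlane (f : Fin 3 → ℝ) (hf : ∑ i, f i = 0) : Plane :=
  ⟨WithLp.toLp 2 f, hf⟩

/-- The spherical Weyl group `S₃` acts by permuting coordinates. -/
def permPlane (w : Equiv.Perm (Fin 3)) (v : Plane) : Plane :=
  mkPlane (fun i => coord v (w.symm i)) (by
    have h : ∑ i, coord v i = 0 := v.2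
    rw [← h]
    exact Equiv.sum_comp w.symm (coord v))

/-- Walls: the fixed lines of the reflections in `S₃ ⋉ ℝ²`. -/
def IsWall (S : Set Plane) : Prop :=
  ∃ i j : Fin 3, i ≠ j ∧ ∃ c : ℝ, S = {v | coord v i - coord v j = c}

def IsOpenHalfApartment (S : Set Plane) : Prop :=
  ∃ i j : Fin 3, i ≠ j ∧ ∃ c : ℝ, S = {v | c < coord v i - coord v j}

def IsHalfApartment (S : Set Plane) : Prop :=
  ∃ i j : Fin 3, i ≠ j ∧ ∃ c : ℝ, S = {v | c ≤ coord v i - coord v j}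

/-- An enclosure is an intersection of half-apartments. -/
def IsEnclosure (E : Set Plane) : Prop :=
  ∃ 𝒞 : Set (Set Plane), (∀ S ∈ 𝒞, IsHalfApartment S) ∧ E = ⋂₀ 𝒞

/-- The smallest enclosure that contains `S`. -/
def hull (S : Set Plane) : Set Plane := ⋂₀ {H | IsHalfApartment H ∧ S ⊆ H}

/-- The vectorial facet through `a`: all vectors that lie in the same linear walls and the same
linear open half-apartments as `a`. -/
def vectorFacet (a : Plane) : Set Plane :=
  {y | ∀ i j, (coord a i = coord a j ↔ coord y i = coord y j) ∧
    (coord a i < coord a j ↔ coord y i < coord y j)}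

/-- The facet based at `x` in the direction of the vectorial facet `F` through `a`: the filter of
the sets that contain a finite intersection of open half-apartments and walls, each containing
`U ∩ (x + F)` for a neighbourhood `U` of `x`. -/
def facetFilter (x a : Plane) : Filter Plane :=
  Filter.generate {S | (IsOpenHalfApartment S ∨ IsWall S) ∧
    ∃ U : Set Plane, IsOpen U ∧ x ∈ U ∧ ∀ y ∈ vectorFacet a, x + y ∈ U → x + y ∈ S}

def planeFacets : Set (Filter Plane) := {σ | ∃ x a, σ = facetFilter x a}

/-! ### Pre-buildings, buildings and their maps -/

/-- A generalized chamber system (a set with a family of filters, its facets) with a family of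
subsets, each with a distance function. It carries the data of a pre-building (the pieces are the
cubicles) and of a building (the pieces are the apartments). Only the values of `dist c` on
`carrier c` matter. -/
structure MetricChamberSystem (X : Type u) where
  facets : Set (Filter X)
  Piece : Type v
  carrier : Piece → Set X
  dist : Piece → X → X → ℝ

namespace MetricChamberSystem

variable {X : Type u} {Y : Type u'}

/-- `g` is an isomorphism of the subset `E` of the standard apartment with the piece `c`, as metric
spaces and as chamber systems. (Facets of a subset are the facets that contain it as an element.) -/
def IsChart (B : MetricChamberSystem.{u, v} X) (c : B.Piece) (E : Set Plane) (g : E → X) : Prop :=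
  Function.Injective g ∧ range g = B.carrier c ∧
  (∀ a b : E, B.dist c (g a) (g b) = Dist.dist a b) ∧
  ∀ σ : Filter E, σ.map g ∈ B.facets ↔ σ.map Subtype.val ∈ planeFacets

def IsPreBuilding (B : MetricChamberSystem.{u, v} X) : Prop :=
  ∀ c : B.Piece, ∃ E : Set Plane, IsEnclosure E ∧ ∃ g : E → X, B.IsChart c E g

/-- The closure of `S` in the metric space `A`. -/
def pieceClosure (B : MetricChamberSystem.{u, v} X) (A : B.Piece) (S : Set X) : Set X :=
  {z ∈ B.carrier A | ∀ ε > 0, ∃ s ∈ S ∩ B.carrier A, B.dist A z s < ε}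

/-- `e` fixes the closure (in `A`) of the facet `σ` pointwise. -/
def FixesClosure (B : MetricChamberSystem.{u, v} X) (A : B.Piece) (e : X → X) (σ : Filter X) :
    Prop :=
  ∃ S ∈ σ, S ⊆ B.carrier A ∧ ∀ z ∈ B.pieceClosure A S, e z = z

/-- Affine buildings with Weyl group `S₃ ⋉ ℝ²`. -/
structure IsBuilding (B : MetricChamberSystem.{u, v} X) : Prop where
  /-- Every apartment is isomorphic to the standard one. -/
  apartment : ∀ A : B.Piece, ∃ g : ↥(univ : Set Plane) → X, B.IsChart A univ g
  /-- Any two facets lie in a common apartment (which then contains their closures, these being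
  taken inside apartments). -/
  common : ∀ σ ∈ B.facets, ∀ τ ∈ B.facets, ∃ A : B.Piece, B.carrier A ∈ σ ∧ B.carrier A ∈ τ
  /-- The intersection of two apartments is a union of facets. -/
  inter_union : ∀ A A' : B.Piece, ∀ x ∈ B.carrier A ∩ B.carrier A',
    ∃ σ ∈ B.facets, pure x ≤ σ ∧ B.carrier A ∩ B.carrier A' ∈ σ
  /-- For any two facets in `A ∩ A'` there is an isomorphism of `A` with `A'` that fixes their
  closures pointwise. -/
  inter_iso : ∀ A A' : B.Piece, ∀ σ ∈ B.facets, ∀ τ ∈ B.facets,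
    B.carrier A ∩ B.carrier A' ∈ σ → B.carrier A ∩ B.carrier A' ∈ τ →
    ∃ e : X → X, BijOn e (B.carrier A) (B.carrier A') ∧
      (∀ a ∈ B.carrier A, ∀ b ∈ B.carrier A, B.dist A' (e a) (e b) = B.dist A a b) ∧
      (∀ ρ : Filter X, B.carrier A ∈ ρ → (ρ ∈ B.facets ↔ ρ.map e ∈ B.facets)) ∧
      B.FixesClosure A e σ ∧ B.FixesClosure A e τ

/-- In a building: `a` and `b` have distance `r`. The distance of a building is computed in any
apartment that contains both points. -/
def HasDist (B : MetricChamberSystem.{u, v} X) (a b : X) (r : ℝ) : Prop :=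
  ∃ A : B.Piece, a ∈ B.carrier A ∧ b ∈ B.carrier A ∧ B.dist A a b = r

/-- Morphisms of generalized chamber systems map facets to facets. -/
def IsMorphism (P : MetricChamberSystem.{u, v} X) (B : MetricChamberSystem.{u', v'} Y)
    (f : X → Y) : Prop :=
  ∀ σ ∈ P.facets, σ.map f ∈ B.facets

/-- An isometry of pre-buildings from `P` to a building `B`: a morphism that preserves distances on
every cubicle. -/
def IsIsometry (P : MetricChamberSystem.{u, v} X) (B : MetricChamberSystem.{u', v'} Y)
    (f : X → Y) : Prop :=
  P.IsMorphism B f ∧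
  ∀ c : P.Piece, ∀ a ∈ P.carrier c, ∀ b ∈ P.carrier c, B.HasDist (f a) (f b) (P.dist c a b)

/-- A folding map of buildings: a morphism such that for every apartment `A` there is a locally
finite collection of affine hyperplanes of `A` with the property that `f` is an isometry on the
closure of each connected component of their complement in `A`. -/
def IsFolding (B : MetricChamberSystem.{u, v} X) (B' : MetricChamberSystem.{u', v'} Y)
    (f : X → Y) : Prop :=
  B.IsMorphism B' f ∧
  ∀ A : B.Piece, ∃ g : ↥(univ : Set Plane) → X, B.IsChart A univ g ∧
    ∃ ℋ : Set (AffineSubspace ℝ Plane),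
      (∀ H ∈ ℋ, (H : Set Plane).Nonempty ∧
        Module.finrank ℝ H.direction + 1 = Module.finrank ℝ Plane) ∧
      LocallyFinite (fun H : ℋ => ((H : AffineSubspace ℝ Plane) : Set Plane)) ∧
      ∀ x ∈ (⋃ H ∈ ℋ, (H : Set Plane))ᶜ,
        ∀ a ∈ closure (connectedComponentIn (⋃ H ∈ ℋ, (H : Set Plane))ᶜ x),
        ∀ b ∈ closure (connectedComponentIn (⋃ H ∈ ℋ, (H : Set Plane))ᶜ x),
          B'.HasDist (f (g ⟨a, mem_univ a⟩)) (f (g ⟨b, mem_univ b⟩)) (Dist.dist a b)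

end MetricChamberSystem

/-! ### The spectral curve `p³ - 3p + x = 0` and its cameral cover -/

/-- The cameral cover: points `x ∈ ℂ` with an ordering of the roots of `p³ - 3p + x`. The
tautological forms are `p₀ dx`, `p₁ dx`, `p₂ dx`. -/
abbrev Cameral : Type :=
  {q : ℂ × (Fin 3 → ℂ) // ∀ z : ℂ, z ^ 3 - 3 * z + q.1 = ∏ i, (z - q.2 i)}

/-- The covering map to the `x`-line. -/
def proj (P : Cameral) : ℂ := P.1.1

def root (P : Cameral) (i : Fin 3) : ℂ := P.1.2 i

/-- The action of `S₃` on the cameral cover. -/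
def permCameral (w : Equiv.Perm (Fin 3)) (P : Cameral) : Cameral :=
  ⟨(P.1.1, fun i => P.1.2 (w.symm i)), fun z => by
    rw [P.2 z]
    exact (Equiv.prod_comp w.symm (fun i => z - P.1.2 i)).symm⟩

/-- A primitive of `p dx` on the spectral curve, where `x = 3p - p³`. -/
def primitive (p : ℂ) : ℂ := 3 / 2 * p ^ 2 - 3 / 4 * p ^ 4

/-- Along every `C¹` path of the spectral curve the integral of `p dx` is the increment of
`primitive`. -/
theorem integral_form_eq (p p' x x' : ℝ → ℂ) (hp : ∀ t, HasDerivAt p (p' t) t)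
    (hx : ∀ t, HasDerivAt x (x' t) t) (hp' : Continuous p')
    (hcurve : ∀ t, p t ^ 3 - 3 * p t + x t = 0) (a b : ℝ) :
    ∫ t in a..b, p t * x' t = primitive (p b) - primitive (p a) := by
  have hcont : Continuous p := continuous_iff_continuousAt.2 fun t => (hp t).continuousAt
  have hxe : x = fun t => 3 * p t - p t ^ 3 := by
    funext t
    linear_combination hcurve t
  have hx' : ∀ t, x' t = 3 * p' t - 3 * p t ^ 2 * p' t := by
    intro t
    have h1 : HasDerivAt x (3 * p' t - 3 * p t ^ 2 * p' t) t := by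
      rw [hxe]
      have h2 := ((hp t).const_mul 3).sub ((hp t).pow 3)
      refine h2.congr_deriv ?_
      push_cast
      ring
    exact (hx t).unique h1
  have hF : ∀ t, HasDerivAt (fun s => primitive (p s)) (p t * x' t) t := by
    intro t
    unfold primitive
    have h2 := (((hp t).pow 2).const_mul (3 / 2)).sub (((hp t).pow 4).const_mul (3 / 4))
    refine h2.congr_deriv ?_
    rw [hx' t]
    push_cast
    ring
  refine intervalIntegral.integral_eq_sub_of_hasDerivAt (fun t _ => hF t) ?_
  apply Continuous.intervalIntegrable
  have : x' = fun t => 3 * p' t - 3 * p t ^ 2 * p' t := funext hx'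
  rw [this]
  fun_prop

theorem sum_primitive (P : Cameral) : ∑ i, primitive (root P i) = -(9 / 2) := by
  obtain ⟨⟨x, r⟩, h⟩ := P
  have h0 := h 0
  have h1 := h 1
  have h2 := h (-1)
  simp only [Fin.prod_univ_three] at h0 h1 h2
  simp only [root, Fin.sum_univ_three, primitive]
  generalize r 0 = a at *
  generalize r 1 = b at *
  generalize r 2 = c at *
  have e1 : a + b + c = 0 := by linear_combination (h1 + h2) / 2 - h0
  have e2 : a * b + a * c + b * c = -3 := by linear_combination (h2 - h1) / 2
  have ha : a = -b - c := by linear_combination e1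
  subst ha
  linear_combination (3 / 2) * (b ^ 2 + b * c + c ^ 2 + 1) * e2

/-- The real period map `Q ↦ (Re ∫_P^Q p₀ dx, Re ∫_P^Q p₁ dx, Re ∫_P^Q p₂ dx)`. -/
def period (P Q : Cameral) : Plane :=
  mkPlane (fun i => (primitive (root Q i)).re - (primitive (root P i)).re) (by
    rw [Finset.sum_sub_distrib, ← Complex.re_sum, ← Complex.re_sum, sum_primitive, sum_primitive,
      sub_self])

/-! ### The ten regions and the ten maximal abelian regions -/

/-- The spectral network with the backward collision line: the points `x` over which
`Re (primitive pᵢ - primitive pⱼ) = 0` for two of the three roots. -/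
def network : Set ℂ :=
  {x | ∃ P : Cameral, proj P = x ∧
    ∃ i j, i ≠ j ∧ (primitive (root P i)).re = (primitive (root P j)).re}

/-- One point in each of the ten components of the complement of the network. The first eight
regions are the exterior ones, in counterclockwise order from the positive real axis; the last two
are the right and left half of the central region. -/
def regionPoint : Fin 10 → ℂ :=
  ![3 + Complex.I, 1 + 10 * Complex.I, -1 + 10 * Complex.I, -3 + Complex.I,
    -3 - Complex.I, -1 - 10 * Complex.I, 1 - 10 * Complex.I, 3 - Complex.I,
    1, -1]

def region (k : Fin 10) : Set ℂ := connectedComponentIn networkᶜ (regionPoint k)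

/-- The regions that make up each of the ten maximal abelian regions. -/
def marRegions : Fin 10 → Finset (Fin 10) :=
  ![{0, 1, 2, 3, 8, 9}, {4, 5, 6, 7, 8, 9},
    {1, 2, 3, 4}, {2, 3, 4, 5}, {3, 4, 5, 6}, {5, 6, 7, 0}, {6, 7, 0, 1}, {7, 0, 1, 2},
    {0, 8, 9, 4}, {7, 8, 9, 3}]

/-- The maximal abelian regions, as open sets. -/
def mar (α : Fin 10) : Set ℂ := interior (closure (⋃ k ∈ marRegions α, region k))

/-! ### The pre-building glued from the maximal abelian regions -/

/-- The connected component of `P` in the part of the cameral cover over `U`. -/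
def sheet (U : Set ℂ) (P : Cameral) : Set Cameral := connectedComponentIn (proj ⁻¹' U) P

/-- The hull of the image of `U` under the period map based at `P`. -/
def periodHull (U : Set ℂ) (P : Cameral) : Set Plane := hull (period P '' sheet U P)

/-- Pairs `(P, v)` over the `α`-th region: `P` lies over the region and `v` in the hull of its
image. -/
structure Rep where
  α : Fin 10
  P : Cameral
  v : Plane
  mem_mar : proj P ∈ mar α
  mem_hull : v ∈ periodHull (mar α) P

/-- The gluing relations. -/
inductive Glue : Rep → Rep → Prop
  /-- `(P, v) ∼ (wP, wv)` for `w` in the Weyl group. -/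
  | weyl (a b : Rep) (w : Equiv.Perm (Fin 3)) (hα : b.α = a.α) (hP : b.P = permCameral w a.P)
      (hv : b.v = permPlane w a.v) : Glue a b
  /-- Change of base point within a component of the cameral cover over the region. -/
  | base (a b : Rep) (hα : b.α = a.α) (hP : b.P ∈ sheet (mar a.α) a.P)
      (hv : b.v = period b.P a.P + a.v) : Glue a b
  /-- The pieces of two regions are identified along the piece of their intersection. -/
  | overlap (a b : Rep) (hP : b.P = a.P) (hv : b.v = a.v)
      (hmem : a.v ∈ periodHull (mar a.α ∩ mar b.α) a.P) : Glue a b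

/-- The underlying set of the pre-building: the coequalizer. -/
def BPre : Type := Quot Glue

abbrev Cubicle : Type := (α : Fin 10) × {P : Cameral // proj P ∈ mar α}

def cubicleHull (c : Cubicle) : Set Plane := periodHull (mar c.1) c.2.1

def cubicleChart (c : Cubicle) (x : cubicleHull c) : BPre :=
  Quot.mk Glue ⟨c.1, c.2.1, x.1, c.2.2, x.2⟩

/-- The pre-building structure: cubicles are the images of the hulls, with the metric of the plane,
and facets are the images of facets. -/
def bPre : MetricChamberSystem BPre where
  facets := {τ | ∃ (c : Cubicle) (σ : Filter (cubicleHull c)),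
    σ.map Subtype.val ∈ planeFacets ∧ τ = σ.map (cubicleChart c)}
  Piece := Cubicle
  carrier := fun c => range (cubicleChart c)
  dist := fun c x y => sInf {r | ∃ a b : cubicleHull c,
    cubicleChart c a = x ∧ cubicleChart c b = y ∧ r = Dist.dist a b}

/-! ### The free spherical building generated by the link -/

structure Stage where
  V : Type
  G : SimpleGraph V

/-- `x` and `y` are the end points of a path of four edges that is not contained in a hexagon. -/
def IsOpenFour {V : Type} (G : SimpleGraph V) (x y : V) : Prop :=
  ∃ p : G.Walk x y, p.IsPath ∧ p.length = 4 ∧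
    ¬ ∃ (z : V) (c : G.Walk z z), c.IsCycle ∧ c.length = 6 ∧ ∀ e ∈ p.edges, e ∈ c.edges

/-- The pairs of vertices to be joined by a new pair of edges. -/
def NewVertex {V : Type} (G : SimpleGraph V) : Type :=
  {s : Sym2 V // ∃ x y, s = s(x, y) ∧ IsOpenFour G x y}

def completeRel {V : Type} (G : SimpleGraph V) : V ⊕ NewVertex G → V ⊕ NewVertex G → Prop
  | Sum.inl a, Sum.inl b => G.Adj a b
  | Sum.inl a, Sum.inr s => a ∈ s.1
  | Sum.inr s, Sum.inl a => a ∈ s.1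
  | Sum.inr _, Sum.inr _ => False

/-- Glue in a pair of edges (with a new middle vertex) between the end points of the paths of four
edges that are not contained in a hexagon, at most one pair for any two end points. -/
def Stage.complete (S : Stage) : Stage where
  V := S.V ⊕ NewVertex S.G
  G := SimpleGraph.fromRel (completeRel S.G)

/-- The relation of the octagon `0, 1, …, 7` with the vertex `8` joined to `0` and `4`. -/
def linkRel (a b : Fin 9) : Prop :=
  (a.val < 8 ∧ b.val < 8 ∧ (b.val = a.val + 1 ∨ (a.val = 7 ∧ b.val = 0))) ∨
    ((a = 0 ∨ a = 4) ∧ b = 8)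

/-- The link: an octagon and a pair of edges that joins two opposite vertices. Its ten edges
correspond to the ten regions. -/
def linkStage : Stage where
  V := Fin 9
  G := SimpleGraph.fromRel linkRel

/-- The end points of the edge of the link that corresponds to a region. -/
def edgeVertices : Fin 10 → Fin 9 × Fin 9 :=
  ![(0, 1), (1, 2), (2, 3), (3, 4), (4, 5), (5, 6), (6, 7), (7, 0), (0, 8), (8, 4)]

def stage : ℕ → Stage
  | 0 => linkStage
  | n + 1 => (stage n).complete

/-- The vertices of the union of the increasing sequence of graphs. -/
def B8 : Type :=
  Quot (fun a b : (n : ℕ) × (stage n).V => b = ⟨a.1 + 1, Sum.inl a.2⟩)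

def B8.mk (n : ℕ) (x : (stage n).V) : B8 := Quot.mk _ ⟨n, x⟩

/-- The union of the increasing sequence of graphs. -/
def b8Graph : SimpleGraph B8 :=
  SimpleGraph.fromRel fun x y =>
    ∃ (n : ℕ) (a b : (stage n).V), (stage n).G.Adj a b ∧ x = B8.mk n a ∧ y = B8.mk n b

/-- Hexagons, that is, apartments of the spherical building. -/
structure Hexagon where
  vertex : Fin 6 → B8
  injective : Function.Injective vertex
  adj : ∀ k, b8Graph.Adj (vertex k) (vertex (k + 1))

/-! ### The cone over the spherical building -/

/-- Points of the cone: the apex `0`, the points of the rays over the vertices and the points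
`s x + t y` with `s, t > 0` of the sectors over the edges `{x, y}`. -/
def BPhi : Type :=
  {c : B8 →₀ ℝ // (∀ x, 0 ≤ c x) ∧ ∀ x y, c x ≠ 0 → c y ≠ 0 → x ≠ y → b8Graph.Adj x y}

/-- Generators of the six singular rays from the origin, in cyclic order; neighbours include an
angle of 60 degrees. -/
def ray (k : Fin 6) : Plane :=
  mkPlane ((![![2, -1, -1], ![1, 1, -2], ![-1, 2, -1], ![-2, 1, 1], ![-1, -1, 2], ![1, -2, 1]] :
    Fin 6 → Fin 3 → ℝ) k) (by
      fin_cases k <;> simp [Fin.sum_univ_three] <;> norm_num)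

/-- The coordinates on the cone over a hexagon. -/
def develop (h : Hexagon) (c : BPhi) : Plane := ∑ k, c.1 (h.vertex k) • ray k

def coneApartment (h : Hexagon) : Set BPhi := {c | ∀ x, c.1 x ≠ 0 → x ∈ range h.vertex}

/-- The cone: its apartments are the cones over the hexagons, with the metric and the facets of the
plane. -/
def bPhi : MetricChamberSystem BPhi where
  facets := {τ | ∃ h : Hexagon, coneApartment h ∈ τ ∧ τ.map (develop h) ∈ planeFacets}
  Piece := Hexagon
  carrier := coneApartment
  dist := fun h a b => Dist.dist (develop h a) (develop h b)

/-- The closed sector of the cone over the edge of the link that corresponds to a region. -/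
def coneSector (k : Fin 10) : Set BPhi :=
  {c | ∀ x, c.1 x ≠ 0 →
    x = B8.mk 0 (edgeVertices k).1 ∨ x = B8.mk 0 (edgeVertices k).2}

end BNR

end

/-! ### Geometry of the standard apartment: rays, sectors and facets -/

noncomputable section

namespace BNR

/-! The source. With `x = 2 cosh 3ζ` and roots `-2 cosh (ζ + shift i)` the cameral cover is
uniformized by `ζ`, and the differences of the real periods factor into sines and one function
`wall`. The ten regions become explicit connected subsets of the strip `0 < Im ζ < π/3`, each mapped
by the periods `phi` into one Weyl sector. Over a maximal abelian region each sheet carries one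
label in `S₃`. Every maximal abelian region contains two unbounded regions whose periods reach
arbitrarily deep into opposite sectors, so the hull of its periods is the whole plane
(`hull_periods_eq_univ`). Hence each cubicle is a full plane, and all cubicles of one maximal
abelian region are the same plane (`mk_eq_flatPt`): the pre-building is ten planes glued along hulls
of periods over common regions.

The target. Each completion step keeps the graph bipartite, connected and free of quadrangles
(`IsLinear.complete`), and it gives a common neighbour to the ends of every path of four edges. In
the union, vertices of equal colour have a common neighbour (`b8_common`), so any two edges lie in a
hexagon (`exists_hexagon_of_edges`), and the common vertices of two hexagons are matched by a
symmetry (`Hexagon.exists_dihedral`). These two facts are the building axioms for the cone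
(`isBuilding_bPhi`).

The map. The regions of a maximal abelian region are edges of one hexagon, closed up where necessary
by one of three vertices of the first completion step. The plane is sent to the cone over that
hexagon. A finite check (`tab_change`) shows that two such planes agree on the hull of their common
sectors, which contains everything that is glued.

The universal property. An isometry `j` into a building makes each of the ten planes a flat, and
these prescribe singular rays over the vertices of the link and over the three extra vertices. The
crucial fact is `exists_common_neighbour`: two rays with the same origin and of the same type bound
60 degree sectors with a common third ray. They coincide up to some parameter, then span a 120
degree flat sector because their types agree; the bisector of that sector is pushed back along the
common part. Since a new vertex has just two neighbours, rays can be chosen stage by stage without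
further conditions. The rays over an edge determine the map on its sector by distances alone, so the
resulting map is isometric on every closed sector and folds at most along the three walls through
the apex.

The building theory behind this is derived from the axioms: retractions centred at a chamber do not
increase distances, hence the triangle inequality and the uniqueness of geodesics; and types of
singular directions can be chosen consistently (`IsBuilding.exists_parity`). The latter is needed
because isomorphisms of apartments are only required to permute facets, which rotation by 60 degrees
also does although it exchanges the two types. -/

@[elab_as_elim]
lemma fin_six_cases {P : Fin 6 → Prop} (k : Fin 6) (h0 : P 0) (h1 : P 1) (h2 : P 2) (h3 : P 3)
    (h4 : P 4) (h5 : P 5) : P k := by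
  fin_cases k <;> assumption

@[elab_as_elim]
lemma fin_three_cases {P : Fin 3 → Prop} (k : Fin 3) (h0 : P 0) (h1 : P 1) (h2 : P 2) : P k := by
  fin_cases k <;> assumption

/-! ### Coordinates, rays and sectors of the plane -/

@[simp] lemma coord_add (v w : Plane) (i : Fin 3) : coord (v + w) i = coord v i + coord w i := rfl
@[simp] lemma coord_sub (v w : Plane) (i : Fin 3) : coord (v - w) i = coord v i - coord w i := rfl
@[simp] lemma coord_neg (v : Plane) (i : Fin 3) : coord (-v) i = -coord v i := rfl
@[simp] lemma coord_smul (c : ℝ) (v : Plane) (i : Fin 3) : coord (c • v) i = c * coord v i := rfl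
@[simp] lemma coord_zero (i : Fin 3) : coord 0 i = 0 := rfl
@[simp] lemma coord_mkPlane (f : Fin 3 → ℝ) (hf : ∑ i, f i = 0) (i : Fin 3) :
    coord (mkPlane f hf) i = f i := rfl
@[simp] lemma coord_permPlane (w : Equiv.Perm (Fin 3)) (v : Plane) (i : Fin 3) :
    coord (permPlane w v) i = coord v (w.symm i) := rfl

lemma coord_sum (v : Plane) : coord v 0 + coord v 1 + coord v 2 = 0 := by
  have h : ∑ i, coord v i = 0 := v.2
  rwa [Fin.sum_univ_three] at h

lemma plane_ext {v w : Plane} (h : ∀ i, coord v i = coord w i) : v = w := by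
  apply Subtype.ext
  ext i
  exact h i

lemma plane_ext' {v w : Plane} (h0 : coord v 0 = coord w 0) (h1 : coord v 1 = coord w 1) :
    v = w := by
  have hv := coord_sum v
  have hw := coord_sum w
  refine plane_ext fun i => ?_
  induction i using fin_three_cases
  · exact h0
  · exact h1
  · linarith

lemma continuous_coord (i : Fin 3) : Continuous fun v : Plane => coord v i := by
  unfold coord
  fun_prop

lemma inner_plane (v w : Plane) : inner ℝ v w =
    coord v 0 * coord w 0 + coord v 1 * coord w 1 + coord v 2 * coord w 2 := by
  rw [Submodule.coe_inner, PiLp.inner_apply, Fin.sum_univ_three]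
  simp [coord, mul_comm]

lemma inner_smul_plane (c : ℝ) (v w : Plane) : inner ℝ v (c • w) = c * inner ℝ v w := by
  simp only [inner_plane, coord_smul]
  ring

lemma norm_sq_plane (v : Plane) : ‖v‖ ^ 2 = coord v 0 ^ 2 + coord v 1 ^ 2 + coord v 2 ^ 2 := by
  rw [← real_inner_self_eq_norm_sq, inner_plane]
  ring

@[simp] lemma coord_ray_0_0 : coord (ray 0) 0 = 2 := rfl
@[simp] lemma coord_ray_0_1 : coord (ray 0) 1 = -1 := rfl
@[simp] lemma coord_ray_0_2 : coord (ray 0) 2 = -1 := rfl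
@[simp] lemma coord_ray_1_0 : coord (ray 1) 0 = 1 := rfl
@[simp] lemma coord_ray_1_1 : coord (ray 1) 1 = 1 := rfl
@[simp] lemma coord_ray_1_2 : coord (ray 1) 2 = -2 := rfl
@[simp] lemma coord_ray_2_0 : coord (ray 2) 0 = -1 := rfl
@[simp] lemma coord_ray_2_1 : coord (ray 2) 1 = 2 := rfl
@[simp] lemma coord_ray_2_2 : coord (ray 2) 2 = -1 := rfl
@[simp] lemma coord_ray_3_0 : coord (ray 3) 0 = -2 := rfl
@[simp] lemma coord_ray_3_1 : coord (ray 3) 1 = 1 := rfl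
@[simp] lemma coord_ray_3_2 : coord (ray 3) 2 = 1 := rfl
@[simp] lemma coord_ray_4_0 : coord (ray 4) 0 = -1 := rfl
@[simp] lemma coord_ray_4_1 : coord (ray 4) 1 = -1 := rfl
@[simp] lemma coord_ray_4_2 : coord (ray 4) 2 = 2 := rfl
@[simp] lemma coord_ray_5_0 : coord (ray 5) 0 = 1 := rfl
@[simp] lemma coord_ray_5_1 : coord (ray 5) 1 = -2 := rfl
@[simp] lemma coord_ray_5_2 : coord (ray 5) 2 = 1 := rfl

@[simp] lemma fin_six_1_add_1 : (1 : Fin 6) + 1 = 2 := rfl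
@[simp] lemma fin_six_1_add_2 : (1 : Fin 6) + 2 = 3 := rfl
@[simp] lemma fin_six_1_add_3 : (1 : Fin 6) + 3 = 4 := rfl
@[simp] lemma fin_six_2_add_1 : (2 : Fin 6) + 1 = 3 := rfl
@[simp] lemma fin_six_2_add_2 : (2 : Fin 6) + 2 = 4 := rfl
@[simp] lemma fin_six_2_add_3 : (2 : Fin 6) + 3 = 5 := rfl
@[simp] lemma fin_six_3_add_1 : (3 : Fin 6) + 1 = 4 := rfl
@[simp] lemma fin_six_3_add_2 : (3 : Fin 6) + 2 = 5 := rfl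
@[simp] lemma fin_six_3_add_3 : (3 : Fin 6) + 3 = 0 := rfl
@[simp] lemma fin_six_4_add_1 : (4 : Fin 6) + 1 = 5 := rfl
@[simp] lemma fin_six_4_add_2 : (4 : Fin 6) + 2 = 0 := rfl
@[simp] lemma fin_six_4_add_3 : (4 : Fin 6) + 3 = 1 := rfl
@[simp] lemma fin_six_5_add_1 : (5 : Fin 6) + 1 = 0 := rfl
@[simp] lemma fin_six_5_add_2 : (5 : Fin 6) + 2 = 1 := rfl
@[simp] lemma fin_six_5_add_3 : (5 : Fin 6) + 3 = 2 := rfl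

lemma ray_add_two (k : Fin 6) : ray k + ray (k + 2) = ray (k + 1) := by
  apply plane_ext' <;> induction k using fin_six_cases <;> norm_num

lemma ray_add_three (k : Fin 6) : ray (k + 3) = -ray k := by
  apply plane_ext' <;> induction k using fin_six_cases <;> norm_num

lemma norm_sq_ray (k : Fin 6) : ‖ray k‖ ^ 2 = 6 := by
  rw [norm_sq_plane]
  induction k using fin_six_cases <;> norm_num

lemma ray_ne_zero (k : Fin 6) : ray k ≠ 0 := by
  intro h
  have := norm_sq_ray k
  rw [h] at this
  norm_num at this

lemma norm_ray_pos (k : Fin 6) : 0 < ‖ray k‖ := norm_pos_iff.2 (ray_ne_zero k)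

lemma norm_ray_eq (k j : Fin 6) : ‖ray k‖ = ‖ray j‖ := by
  have := norm_sq_ray k
  have := norm_sq_ray j
  have := norm_ray_pos k
  have := norm_ray_pos j
  nlinarith

lemma inner_ray_succ (k : Fin 6) : inner ℝ (ray k) (ray (k + 1)) = 3 := by
  rw [inner_plane]
  induction k using fin_six_cases <;> norm_num

lemma ray_injective : Function.Injective ray := by
  intro j k h
  have h0 := congrArg (fun v => coord v 0) h
  have h1 := congrArg (fun v => coord v 1) h
  induction j using fin_six_cases <;> induction k using fin_six_cases <;> first | rfl | (norm_num at h0; done) | norm_num at h1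

lemma inner_ray_eq_three {j k : Fin 6} (h : inner ℝ (ray j) (ray k) = 3) :
    k = j + 1 ∨ k = j - 1 := by
  rw [inner_plane] at h
  revert h
  induction j using fin_six_cases <;> induction k using fin_six_cases <;> intro h <;>
    first | (left; rfl) | (right; rfl) | (exfalso; norm_num at h)

/-- The point of the closed sector between `ray k` and `ray (k + 1)` with given coordinates. -/
def sectorPt (k : Fin 6) (s t : ℝ) : Plane := s • ray k + t • ray (k + 1)

lemma sectorPt_add (k : Fin 6) (s t s' t' : ℝ) :
    sectorPt k s t + sectorPt k s' t' = sectorPt k (s + s') (t + t') := by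
  simp only [sectorPt]; module

lemma smul_sectorPt (k : Fin 6) (c s t : ℝ) :
    c • sectorPt k s t = sectorPt k (c * s) (c * t) := by
  simp only [sectorPt]; module

@[simp] lemma sectorPt_zero (k : Fin 6) : sectorPt k 0 0 = 0 := by simp [sectorPt]

lemma norm_sq_sectorPt (k : Fin 6) (s t : ℝ) :
    ‖sectorPt k s t‖ ^ 2 = 6 * (s ^ 2 + s * t + t ^ 2) := by
  rw [norm_sq_plane]
  induction k using fin_six_cases <;> simp [sectorPt] <;> ring

/-- The order of the coordinates selects the sector, and the coefficients are the two consecutive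
differences divided by 3. The two cyclic patterns of inequalities force all coordinates to be equal.
-/
lemma exists_sectorPt (v : Plane) : ∃ k s t, 0 ≤ s ∧ 0 ≤ t ∧ v = sectorPt k s t := by
  have hv := coord_sum v
  have key : ∀ (k : Fin 6) (s t : ℝ), 0 ≤ s → 0 ≤ t →
      coord v 0 = s * coord (ray k) 0 + t * coord (ray (k + 1)) 0 →
      coord v 1 = s * coord (ray k) 1 + t * coord (ray (k + 1)) 1 →
      ∃ k s t, 0 ≤ s ∧ 0 ≤ t ∧ v = sectorPt k s t := fun k s t hs ht h0 h1 =>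
    ⟨k, s, t, hs, ht, plane_ext' h0 h1⟩
  rcases le_total (coord v 0) (coord v 1) with h1 | h1 <;>
  rcases le_total (coord v 1) (coord v 2) with h2 | h2 <;>
  rcases le_total (coord v 0) (coord v 2) with h3 | h3
  · refine key 3 ((coord v 1 - coord v 0) / 3) ((coord v 2 - coord v 1) / 3) ?_ ?_ ?_ ?_ <;>
      norm_num <;> linarith
  · refine key 3 ((coord v 1 - coord v 0) / 3) ((coord v 2 - coord v 1) / 3) ?_ ?_ ?_ ?_ <;>
      norm_num <;> linarith
  · refine key 2 ((coord v 1 - coord v 2) / 3) ((coord v 2 - coord v 0) / 3) ?_ ?_ ?_ ?_ <;>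
      norm_num <;> linarith
  · refine key 1 ((coord v 0 - coord v 2) / 3) ((coord v 1 - coord v 0) / 3) ?_ ?_ ?_ ?_ <;>
      norm_num <;> linarith
  · refine key 4 ((coord v 2 - coord v 0) / 3) ((coord v 0 - coord v 1) / 3) ?_ ?_ ?_ ?_ <;>
      norm_num <;> linarith
  · refine key 5 ((coord v 2 - coord v 1) / 3) ((coord v 0 - coord v 2) / 3) ?_ ?_ ?_ ?_ <;>
      norm_num <;> linarith
  · refine key 0 ((coord v 0 - coord v 1) / 3) ((coord v 1 - coord v 2) / 3) ?_ ?_ ?_ ?_ <;>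
      norm_num <;> linarith
  · refine key 0 ((coord v 0 - coord v 1) / 3) ((coord v 1 - coord v 2) / 3) ?_ ?_ ?_ ?_ <;>
      norm_num <;> linarith

/-- A point of the plane is determined by its distances to three points in general position. -/
lemma eq_of_dist_eq {v w x : Plane} {k : Fin 6} {s t : ℝ} (hs : s ≠ 0) (ht : t ≠ 0)
    (h0 : dist v x = dist w x) (h1 : dist v (x + s • ray k) = dist w (x + s • ray k))
    (h2 : dist v (x + t • ray (k + 1)) = dist w (x + t • ray (k + 1))) : v = w := by
  -- Expanding the squared distances to `x` and to `x + c • r`, everything but the inner product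
  -- with `r` cancels.
  have key : ∀ (c : ℝ) (r : Plane), c ≠ 0 → dist v (x + c • r) = dist w (x + c • r) →
      inner ℝ (v - x) r = inner ℝ (w - x) r := by
    intro c r hc h
    have e0 : ‖v - x‖ ^ 2 = ‖w - x‖ ^ 2 := by rw [← dist_eq_norm, ← dist_eq_norm, h0]
    have e1 : ‖(v - x) - c • r‖ ^ 2 = ‖(w - x) - c • r‖ ^ 2 := by
      rw [sub_sub, sub_sub, ← dist_eq_norm, ← dist_eq_norm, h]
    rw [norm_sub_sq_real (v - x), norm_sub_sq_real (w - x), e0, inner_smul_plane,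
      inner_smul_plane] at e1
    have : c * inner ℝ (v - x) r = c * inner ℝ (w - x) r := by linarith
    exact mul_left_cancel₀ hc this
  have k1 := key s _ hs h1
  have k2 := key t _ ht h2
  simp only [inner_plane, coord_sub] at k1 k2
  have hv := coord_sum v
  have hw := coord_sum w
  apply plane_ext' <;> revert k1 k2 <;> induction k using fin_six_cases <;> norm_num <;> intros <;> linarith

/-! ### Facets of the plane -/

lemma self_mem_vectorFacet (a : Plane) : a ∈ vectorFacet a := fun _ _ => ⟨Iff.rfl, Iff.rfl⟩

lemma smul_mem_vectorFacet {a y : Plane} {c : ℝ} (hc : 0 < c) (hy : y ∈ vectorFacet a) :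
    c • y ∈ vectorFacet a := by
  intro i j
  rw [coord_smul, coord_smul, mul_right_inj' hc.ne', mul_lt_mul_iff_right₀ hc]
  exact hy i j

lemma vectorFacet_eq {a y : Plane} (hy : y ∈ vectorFacet a) : vectorFacet y = vectorFacet a := by
  ext z
  constructor
  · intro hz i j
    exact ⟨(hy i j).1.trans (hz i j).1, (hy i j).2.trans (hz i j).2⟩
  · intro hz i j
    exact ⟨(hy i j).1.symm.trans (hz i j).1, (hy i j).2.symm.trans (hz i j).2⟩

/-- The coordinates sum to zero, so each is a third of the sum of two differences. Thus finitely
many half-apartments cut out small neighbourhoods. -/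
lemma norm_le_of_coord_sub {v : Plane} {ε : ℝ}
    (h : ∀ i j, coord v i - coord v j < ε) : ‖v‖ ≤ 2 * ε := by
  have hv := coord_sum v
  have hε : 0 < ε := by simpa using h 0 0
  have hb : ∀ i, |coord v i| ≤ ε := by
    intro i
    have h01 := h 0 1
    have h02 := h 0 2
    have h12 := h 1 2
    have h10 := h 1 0
    have h20 := h 2 0
    have h21 := h 2 1
    rw [abs_le]
    induction i using fin_three_cases <;> constructor <;> linarith
  have h2 : ‖v‖ ^ 2 ≤ (2 * ε) ^ 2 := by
    rw [norm_sq_plane]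
    have h0 := sq_le_sq.2 ((hb 0).trans (le_abs_self ε))
    have h1 := sq_le_sq.2 ((hb 1).trans (le_abs_self ε))
    have h2 := sq_le_sq.2 ((hb 2).trans (le_abs_self ε))
    nlinarith
  exact abs_le_of_sq_le_sq' h2 (by linarith) |>.2

/-- Small hexagons around `x` are finite intersections of open half-apartments, and `x + F` is
itself cut out by walls and open half-apartments through `x`. This replaces the generated filter by
a neighbourhood filter, accessible to `ε`-arguments. -/
lemma facetFilter_eq (x a : Plane) :
    facetFilter x a = 𝓝[(fun y => x + y) '' vectorFacet a] x := by
  apply le_antisymm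
  · have half : ∀ (i j : Fin 3) (c : ℝ), i ≠ j → (∃ U : Set Plane, IsOpen U ∧ x ∈ U ∧
        ∀ y ∈ vectorFacet a, x + y ∈ U → x + y ∈ {v | c < coord v i - coord v j}) →
        {v | c < coord v i - coord v j} ∈ facetFilter x a := fun i j c hij h =>
      mem_generate_of_mem ⟨Or.inl ⟨i, j, hij, c, rfl⟩, h⟩
    refine le_inf ?_ ?_
    · intro N hN
      obtain ⟨ε, hε, hball⟩ := Metric.mem_nhds_iff.1 hN
      -- The intersection over all `i`, `j` is a hexagon contained in the ball of radius `2ε/3`; for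
      -- `i = j` there is no condition.
      have hall : ∀ i j : Fin 3, {v : Plane | -(ε / 3) < coord v i - coord v j -
          (coord x i - coord x j)} ∈ facetFilter x a := by
        intro i j
        by_cases hij : i = j
        · subst hij
          convert univ_mem using 1
          ext v
          simp
          linarith
        · have := half i j (coord x i - coord x j - ε / 3) hij
            ⟨{v | coord x i - coord x j - ε / 3 < coord v i - coord v j},
              isOpen_lt continuous_const ((continuous_coord i).sub (continuous_coord j)),
              by simp only [mem_ofPred_eq]; linarith, fun y _ h => h⟩
          refine mem_of_superset this fun v hv => ?_
          simp only [mem_ofPred_eq] at hv ⊢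
          linarith
      have : (⋂ i, ⋂ j, {v : Plane | -(ε / 3) < coord v i - coord v j -
          (coord x i - coord x j)}) ∈ facetFilter x a :=
        iInter_mem.2 fun i => iInter_mem.2 fun j => hall i j
      refine mem_of_superset this fun v hv => hball ?_
      simp only [mem_iInter, mem_ofPred_eq] at hv
      rw [Metric.mem_ball, dist_eq_norm]
      have : ‖v - x‖ ≤ 2 * (ε / 3) := norm_le_of_coord_sub fun i j => by
        have := hv j i
        simp only [coord_sub]
        linarith
      linarith
    · rw [le_principal_iff]
      -- For each pair the sign of `coord a i - coord a j` tells whether a wall or one of the two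
      -- open half-apartments through `x` is used.
      have hall : ∀ i j : Fin 3, {v : Plane | (coord a i = coord a j ↔ coord (v - x) i =
          coord (v - x) j) ∧ (coord a i < coord a j ↔ coord (v - x) i < coord (v - x) j)} ∈
          facetFilter x a := by
        intro i j
        by_cases hij : i = j
        · subst hij
          simp
        rcases lt_trichotomy (coord a i) (coord a j) with h | h | h
        · have := half j i (coord x j - coord x i) (Ne.symm hij) ⟨univ, isOpen_univ, mem_univ _,
            fun y hy _ => by
              have := (hy i j).2.1 h
              simp only [mem_ofPred_eq, coord_add]; linarith⟩
          refine mem_of_superset this fun v hv => ?_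
          simp only [mem_ofPred_eq, coord_sub] at hv ⊢
          refine ⟨iff_of_false h.ne (by intro h; linarith), iff_of_true h (by linarith)⟩
        · have : {v : Plane | coord v i - coord v j = coord x i - coord x j} ∈ facetFilter x a :=
            mem_generate_of_mem ⟨Or.inr ⟨i, j, hij, _, rfl⟩, univ, isOpen_univ, mem_univ _,
              fun y hy _ => by
                have := (hy i j).1.1 h
                simp only [mem_ofPred_eq, coord_add]; linarith⟩
          refine mem_of_superset this fun v hv => ?_
          simp only [mem_ofPred_eq, coord_sub] at hv ⊢
          exact ⟨iff_of_true h (by linarith), iff_of_false h.not_lt (by intro h; linarith)⟩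
        · have := half i j (coord x i - coord x j) hij ⟨univ, isOpen_univ, mem_univ _,
            fun y hy _ => by
              have := (vectorFacet_eq hy ▸ self_mem_vectorFacet a) j i |>.2.2 h
              simp only [mem_ofPred_eq, coord_add]; linarith⟩
          refine mem_of_superset this fun v hv => ?_
          simp only [mem_ofPred_eq, coord_sub] at hv ⊢
          refine ⟨iff_of_false h.ne' (by intro h; linarith),
            iff_of_false h.le.not_gt (by intro h; linarith)⟩
      have := iInter_mem.2 fun i => iInter_mem.2 fun j => hall i j
      refine mem_of_superset this fun v hv => ?_
      simp only [mem_iInter] at hv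
      exact ⟨v - x, fun i j => hv i j, by simp⟩
  · rw [facetFilter, le_generate_iff]
    rintro S ⟨-, U, hU, hx, hS⟩
    rw [Filter.mem_sets, mem_nhdsWithin]
    refine ⟨U, hU, hx, ?_⟩
    rintro _ ⟨hz, y, hy, rfl⟩
    exact hS y hy hz

lemma facetFilter_mem_planeFacets (x a : Plane) : facetFilter x a ∈ planeFacets := ⟨x, a, rfl⟩

lemma vectorFacet_zero : vectorFacet 0 = {0} := by
  ext y
  constructor
  · intro hy
    have h1 := (hy 0 1).1.1 rfl
    have h2 := (hy 1 2).1.1 rfl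
    have := coord_sum y
    refine plane_ext' ?_ ?_ <;> simp <;> linarith
  · rintro rfl
    exact self_mem_vectorFacet 0

lemma facetFilter_zero (x : Plane) : facetFilter x 0 = pure x := by
  rw [facetFilter_eq, vectorFacet_zero]
  simp

lemma pure_mem_planeFacets (x : Plane) : pure x ∈ planeFacets := ⟨x, 0, (facetFilter_zero x).symm⟩

lemma facetFilter_le_nhds (x a : Plane) : facetFilter x a ≤ 𝓝 x := by
  rw [facetFilter_eq]
  exact nhdsWithin_le_nhds

lemma mem_facetFilter {x a : Plane} {S : Set Plane} : S ∈ facetFilter x a ↔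
    ∃ ε > (0 : ℝ), ∀ y ∈ vectorFacet a, ‖y‖ < ε → x + y ∈ S := by
  rw [facetFilter_eq, Metric.mem_nhdsWithin_iff]
  constructor
  · rintro ⟨ε, hε, h⟩
    exact ⟨ε, hε, fun y hy hn => h ⟨by simpa [dist_eq_norm] using hn, y, hy, rfl⟩⟩
  · rintro ⟨ε, hε, h⟩
    refine ⟨ε, hε, ?_⟩
    rintro _ ⟨hb, y, hy, rfl⟩
    exact h y hy (by simpa [dist_eq_norm] using hb)

lemma facetFilter_congr {x a b : Plane} (h : b ∈ vectorFacet a) :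
    facetFilter x b = facetFilter x a := by
  rw [facetFilter_eq, facetFilter_eq, vectorFacet_eq h]

lemma exists_mem_of_mem_facetFilter {x a d : Plane} {S : Set Plane} (h : S ∈ facetFilter x a)
    (hd : d ∈ vectorFacet a) : ∃ ε > (0 : ℝ), ∀ s ∈ Ioc 0 ε, x + s • d ∈ S := by
  obtain ⟨ε, hε, h⟩ := mem_facetFilter.1 h
  refine ⟨ε / (‖d‖ + 1) / 2, by positivity, fun s hs => h _ (smul_mem_vectorFacet hs.1 hd) ?_⟩
  rw [norm_smul, Real.norm_eq_abs, abs_of_pos hs.1]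
  calc s * ‖d‖ ≤ ε / (‖d‖ + 1) / 2 * (‖d‖ + 1) :=
        mul_le_mul hs.2 (by linarith) (norm_nonneg _) (by positivity)
    _ = ε / 2 := by field_simp
    _ < ε := by linarith

instance facetFilter_neBot (x a : Plane) : (facetFilter x a).NeBot := by
  rw [← empty_mem_iff_bot.not.trans neBot_iff.symm]
  intro h
  obtain ⟨ε, hε, h⟩ := exists_mem_of_mem_facetFilter h (self_mem_vectorFacet a)
  exact h ε ⟨hε, le_rfl⟩

/-- Passing to the closure adds the base point `s = 0`. Closures appear because the building axioms
fix closures of facets pointwise. -/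
lemma exists_mem_closure_of_mem_facetFilter {x a d : Plane} {S : Set Plane}
    (h : S ∈ facetFilter x a) (hd : d ∈ vectorFacet a) :
    ∃ ε > (0 : ℝ), ∀ s ∈ Icc 0 ε, x + s • d ∈ closure S := by
  obtain ⟨ε, hε, h⟩ := exists_mem_of_mem_facetFilter h hd
  refine ⟨ε, hε, fun s hs => ?_⟩
  rcases hs.1.eq_or_lt with rfl | h0
  · have hc : Tendsto (fun s : ℝ => x + s • d) (𝓝[>] 0) (𝓝 (x + (0 : ℝ) • d)) :=
      ((by fun_prop : Continuous fun s : ℝ => x + s • d).tendsto 0).mono_left nhdsWithin_le_nhds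
    refine mem_closure_of_tendsto hc ?_
    filter_upwards [Ioc_mem_nhdsGT hε] with s hs using h s hs
  · exact subset_closure (h s ⟨h0, hs.2⟩)

lemma sectorPt_mem_vectorFacet {k : Fin 6} {s t s' t' : ℝ} (hs : 0 < s) (ht : 0 < t)
    (hs' : 0 < s') (ht' : 0 < t') : sectorPt k s t ∈ vectorFacet (sectorPt k s' t') := by
  intro i j
  simp only [sectorPt, coord_add, coord_smul]
  induction k using fin_six_cases <;> induction i using fin_three_cases <;> induction j using fin_three_cases <;> norm_num <;>
    constructor <;>
    first
    | (apply iff_of_true <;> linarith)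
    | (apply iff_of_false <;> intro h <;> linarith)

lemma vectorFacet_ray (k : Fin 6) {y : Plane} (hy : y ∈ vectorFacet (ray k)) :
    ∃ s > (0 : ℝ), y = s • ray k := by
  have hsum := coord_sum y
  have key : ∀ s > (0 : ℝ), coord y 0 = s * coord (ray k) 0 → coord y 1 = s * coord (ray k) 1 →
      ∃ s > (0 : ℝ), y = s • ray k := fun s hs h0 h1 => ⟨s, hs, plane_ext' h0 h1⟩
  have h01 := hy 0 1
  have h02 := hy 0 2
  have h12 := hy 1 2
  have h10 := hy 1 0
  have h20 := hy 2 0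
  have h21 := hy 2 1
  induction k using fin_six_cases <;> norm_num at h01 h02 h12 h10 h20 h21 key
  · exact key (coord y 0 / 2) (by linarith) (by linarith) (by linarith)
  · exact key (coord y 0) (by linarith) (by linarith) (by linarith)
  · exact key (coord y 1 / 2) (by linarith) (by linarith) (by linarith)
  · exact key (coord y 1) (by linarith) (by linarith) (by linarith)
  · exact key (coord y 2 / 2) (by linarith) (by linarith) (by linarith)
  · exact key (coord y 0) (by linarith) (by linarith) (by linarith)

end BNR

end

/-! ### Automorphisms of the apartment and isometric curves in it -/

noncomputable section

namespace BNR

lemma norm_ray_le (k : Fin 6) : ‖ray k‖ ≤ 3 := by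
  have := norm_sq_ray k
  nlinarith [norm_nonneg (ray k)]

lemma norm_sectorPt_le (k : Fin 6) {s t : ℝ} (hs : 0 ≤ s) (ht : 0 ≤ t) :
    ‖sectorPt k s t‖ ≤ 3 * (s + t) := by
  have h := norm_add_le (s • ray k) (t • ray (k + 1))
  rw [norm_smul, norm_smul, Real.norm_of_nonneg hs, Real.norm_of_nonneg ht] at h
  have h1 := mul_le_mul_of_nonneg_left (norm_ray_le k) hs
  have h2 := mul_le_mul_of_nonneg_left (norm_ray_le (k + 1)) ht
  unfold sectorPt
  linarith

lemma sectorPt_eq_zero {k : Fin 6} {s t : ℝ} (h : sectorPt k s t = 0) : s = 0 ∧ t = 0 := by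
  have h1 := norm_sq_sectorPt k s t
  rw [h, norm_zero] at h1
  constructor <;> nlinarith [sq_nonneg (s + t), sq_nonneg s, sq_nonneg t]

/-- A member of a chamber germ contains the interior of a small parallelogram at `x`, so its closure
contains the closed one. Three corners of it are enough to pin down a chart. -/
lemma exists_sectorPt_mem_closure {x : Plane} {k : Fin 6} {S : Set Plane}
    (h : S ∈ facetFilter x (sectorPt k 1 1)) :
    ∃ ε > (0 : ℝ), ∀ s ∈ Icc 0 ε, ∀ t ∈ Icc 0 ε, x + sectorPt k s t ∈ closure S := by
  obtain ⟨ε, hε, h⟩ := mem_facetFilter.1 h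
  -- Boundary points are pushed inward by `δ ≤ ε/13`; then both coefficients are at most `2ε/13` and
  -- the norm is at most `12ε/13`.
  refine ⟨ε / 13, by positivity, fun s hs t ht => ?_⟩
  have hc : Tendsto (fun δ : ℝ => x + sectorPt k (s + δ) (t + δ)) (𝓝[>] 0)
      (𝓝 (x + sectorPt k (s + 0) (t + 0))) :=
    ((by unfold sectorPt; fun_prop : Continuous fun δ : ℝ =>
      x + sectorPt k (s + δ) (t + δ)).tendsto 0).mono_left nhdsWithin_le_nhds
  rw [add_zero, add_zero] at hc
  refine mem_closure_of_tendsto hc ?_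
  filter_upwards [Ioc_mem_nhdsGT (show (0 : ℝ) < ε / 13 by positivity)] with δ hδ
  refine h _ (sectorPt_mem_vectorFacet (by linarith [hs.1, hδ.1]) (by linarith [ht.1, hδ.1])
    one_pos one_pos) ?_
  have := norm_sectorPt_le k (show 0 ≤ s + δ by linarith [hs.1, hδ.1])
    (show 0 ≤ t + δ by linarith [ht.1, hδ.1])
  linarith [hs.2, ht.2, hδ.2]

/-! ### Automorphisms of the plane -/

/-- Isometries of the plane that permute the facets. -/
def IsAut (D : Plane → Plane) : Prop :=
  Isometry D ∧ Function.Surjective D ∧ ∀ σ : Filter Plane, σ.map D ∈ planeFacets ↔ σ ∈ planeFacets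

lemma IsAut.comp {D E : Plane → Plane} (hD : IsAut D) (hE : IsAut E) : IsAut (D ∘ E) :=
  ⟨hD.1.comp hE.1, hD.2.1.comp hE.2.1, fun σ => by rw [← Filter.map_map, hD.2.2, hE.2.2]⟩

/-- By `facetFilter_eq` a facet is the neighbourhood filter of `x` within `x + F`, so it is enough
to follow these sets under the map and its inverse. -/
lemma isAut_of_inverse {D E : Plane → Plane} (hD : Isometry D) (hE : Isometry E)
    (hED : ∀ v, E (D v) = v) (hDE : ∀ v, D (E v) = v)
    (h1 : ∀ x a, ∃ y b, D '' ((fun y => x + y) '' vectorFacet a) =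
      (fun z => y + z) '' vectorFacet b ∧ D x = y)
    (h2 : ∀ x a, ∃ y b, E '' ((fun y => x + y) '' vectorFacet a) =
      (fun z => y + z) '' vectorFacet b ∧ E x = y) : IsAut D := by
  have key : ∀ {F : Plane → Plane}, Isometry F → (∀ x a, ∃ y b,
      F '' ((fun y => x + y) '' vectorFacet a) = (fun z => y + z) '' vectorFacet b ∧ F x = y) →
      ∀ σ ∈ planeFacets, σ.map F ∈ planeFacets := by
    rintro F hF h _ ⟨x, a, rfl⟩
    obtain ⟨y, b, e, rfl⟩ := h x a
    refine ⟨F x, b, ?_⟩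
    rw [facetFilter_eq, facetFilter_eq, hF.isUniformInducing.isInducing.map_nhdsWithin_eq, e]
  refine ⟨hD, fun v => ⟨E v, hDE v⟩, fun σ => ⟨fun h => ?_, key hD h1 σ⟩⟩
  have := key hE h2 _ h
  rwa [Filter.map_map, show E ∘ D = id from funext hED, Filter.map_id] at this

lemma isAut_add (b : Plane) : IsAut fun v => b + v := by
  have : ∀ b x a : Plane, ∃ y c, (fun v => b + v) '' ((fun y => x + y) '' vectorFacet a) =
      (fun z => y + z) '' vectorFacet c ∧ (fun v => b + v) x = y := fun b x a =>
    ⟨b + x, a, by rw [image_image]; simp only [add_assoc], rfl⟩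
  exact isAut_of_inverse (E := fun v => -b + v) (isometry_add_left b) (isometry_add_left (-b))
    (by simp) (by simp) (this b) (this (-b))

lemma isAut_linear {L M : Plane →ₗ[ℝ] Plane} (hL : ∀ v, ‖L v‖ = ‖v‖) (hM : ∀ v, ‖M v‖ = ‖v‖)
    (hML : ∀ v, M (L v) = v) (hLM : ∀ v, L (M v) = v)
    (h : ∀ a y, L y ∈ vectorFacet (L a) ↔ y ∈ vectorFacet a) : IsAut L := by
  refine isAut_of_inverse (E := M) (AddMonoidHomClass.isometry_of_norm L hL)
    (AddMonoidHomClass.isometry_of_norm M hM) hML hLM (fun x a => ⟨L x, L a, ?_, rfl⟩)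
    (fun x a => ⟨M x, M a, ?_, rfl⟩)
  · ext z
    simp only [image_image, mem_image, map_add]
    constructor
    · rintro ⟨y, hy, rfl⟩
      exact ⟨L y, (h _ _).2 hy, rfl⟩
    · rintro ⟨y, hy, rfl⟩
      exact ⟨M y, (h _ _).1 (by rwa [hLM]), by rw [hLM]⟩
  · ext z
    simp only [image_image, mem_image, map_add]
    constructor
    · rintro ⟨y, hy, rfl⟩
      exact ⟨M y, (h _ _).1 (by rwa [hLM, hLM]), rfl⟩
    · rintro ⟨y, hy, rfl⟩
      exact ⟨L y, by have := (h _ _).2 hy; rwa [hLM] at this, by rw [hML]⟩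

/-- The action of a permutation of the coordinates, as a linear map. -/
def permLin (w : Equiv.Perm (Fin 3)) : Plane →ₗ[ℝ] Plane where
  toFun := permPlane w
  map_add' _ _ := plane_ext fun _ => rfl
  map_smul' _ _ := plane_ext fun _ => rfl

@[simp] lemma permLin_apply (w : Equiv.Perm (Fin 3)) (v : Plane) : permLin w v = permPlane w v := rfl

lemma norm_permPlane (w : Equiv.Perm (Fin 3)) (v : Plane) : ‖permPlane w v‖ = ‖v‖ := by
  have key : ∀ v : Plane, ‖v‖ ^ 2 = ∑ i, coord v i ^ 2 := fun v => by
    rw [norm_sq_plane, Fin.sum_univ_three]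
  have : ‖permPlane w v‖ ^ 2 = ‖v‖ ^ 2 := by
    rw [key, key]
    exact Equiv.sum_comp w.symm fun i => coord v i ^ 2
  exact (sq_eq_sq₀ (norm_nonneg _) (norm_nonneg _)).1 this

@[simp] lemma permPlane_permPlane (w w' : Equiv.Perm (Fin 3)) (v : Plane) :
    permPlane w (permPlane w' v) = permPlane (w * w') v := plane_ext fun _ => rfl

@[simp] lemma permPlane_one (v : Plane) : permPlane 1 v = v := plane_ext fun _ => rfl

lemma permPlane_add (w : Equiv.Perm (Fin 3)) (v v' : Plane) :
    permPlane w (v + v') = permPlane w v + permPlane w v' := (permLin w).map_add v v'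

lemma isAut_permLin (w : Equiv.Perm (Fin 3)) : IsAut (permLin w) := by
  refine isAut_linear (M := permLin w⁻¹) (norm_permPlane w) (norm_permPlane _) (by simp) (by simp)
    fun a y => ⟨fun h i j => ?_, fun h i j => h _ _⟩
  simpa using h (w i) (w j)

lemma isAut_neg : IsAut (-LinearMap.id : Plane →ₗ[ℝ] Plane) := by
  refine isAut_linear (M := -LinearMap.id) (by simp) (by simp) (by simp) (by simp)
    fun a y => ⟨fun h i j => ?_, fun h i j => ?_⟩
  · have := h j i
    simp only [LinearMap.neg_apply, LinearMap.id_apply, coord_neg, neg_inj, neg_lt_neg_iff] at this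
    exact ⟨eq_comm.trans (this.1.trans eq_comm), this.2⟩
  · have := h j i
    simp only [LinearMap.neg_apply, LinearMap.id_apply, coord_neg, neg_inj, neg_lt_neg_iff]
    exact ⟨(h i j).1, this.2⟩

lemma exists_rotation (k : Fin 6) :
    ∃ L : Plane →ₗ[ℝ] Plane, IsAut L ∧ ∀ i, L (ray i) = ray (i + k) := by
  have h1 : ∃ L : Plane →ₗ[ℝ] Plane, IsAut L ∧ ∀ i, L (ray i) = ray (i + 1) := by
    -- The rotation by 60 degrees is minus a cyclic permutation. It is not in the Weyl group, but it
    -- permutes the facets.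
    refine ⟨-LinearMap.id ∘ₗ permLin (finRotate 3)⁻¹, isAut_neg.comp (isAut_permLin _), fun i => ?_⟩
    have h0 : (Equiv.symm (finRotate 3)⁻¹) 0 = 1 := by decide
    have h1 : (Equiv.symm (finRotate 3)⁻¹) 1 = 2 := by decide
    apply plane_ext' <;> induction i using fin_six_cases <;> simp [h0, h1]
  obtain ⟨L, hL, e⟩ := h1
  refine Fin.induction ?_ ?_ k
  · exact ⟨LinearMap.id, ⟨isometry_id, Function.surjective_id, fun σ => by simp⟩, by simp⟩
  · rintro i ⟨M, hM, e'⟩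
    refine ⟨L ∘ₗ M, hL.comp hM, fun j => ?_⟩
    rw [LinearMap.comp_apply, e', e, add_assoc, Fin.coeSucc_eq_succ]

lemma exists_reflection (k : Fin 6) :
    ∃ L : Plane →ₗ[ℝ] Plane, IsAut L ∧ ∀ i, L (ray i) = ray (k - i) := by
  obtain ⟨M, hM, e⟩ := exists_rotation k
  refine ⟨M ∘ₗ permLin (Equiv.swap 1 2), hM.comp (isAut_permLin _), fun i => ?_⟩
  have : permPlane (Equiv.swap 1 2) (ray i) = ray (-i) := by
    have h0 : (Equiv.swap (1 : Fin 3) 2) 0 = 0 := by decide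
    have h1 : (Equiv.swap (1 : Fin 3) 2) 1 = 2 := by decide
    apply plane_ext' <;> induction i using fin_six_cases <;> simp [h0, h1] <;> rfl
  rw [LinearMap.comp_apply, permLin_apply, this, e, neg_add_eq_sub]

/-- Any two pairs of adjacent singular rays are conjugate. -/
lemma exists_aut (k j j' : Fin 6) (h : j' = j + 1 ∨ j' = j - 1) :
    ∃ L : Plane →ₗ[ℝ] Plane, IsAut L ∧ L (ray k) = ray j ∧ L (ray (k + 1)) = ray j' := by
  rcases h with rfl | rfl
  · obtain ⟨L, hL, e⟩ := exists_rotation (j - k)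
    exact ⟨L, hL, by rw [e]; congr 1; abel, by rw [e]; congr 1; abel⟩
  · obtain ⟨L, hL, e⟩ := exists_reflection (j + k)
    exact ⟨L, hL, by rw [e]; congr 1; abel, by rw [e]; congr 1; abel⟩

/-! ### Isometric curves -/

/-- Distances add up along the curve, so strict convexity of the norm puts every point on the
segment between the ends. -/
lemma eq_add_smul_of_dist {f : ℝ → Plane} {c r : ℝ} (hr : 0 < r)
    (hf : ∀ s ∈ Icc 0 r, ∀ t ∈ Icc 0 r, dist (f s) (f t) = |s - t| * c) :
    ∀ s ∈ Icc 0 r, f s = f 0 + s • (r⁻¹ • (f r - f 0)) := by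
  intro s hs
  have h0 : (0 : ℝ) ∈ Icc 0 r := ⟨le_rfl, hr.le⟩
  have hr' : r ∈ Icc 0 r := ⟨hr.le, le_rfl⟩
  have e1 := hf 0 h0 s hs
  have e2 := hf s hs r hr'
  have e3 := hf 0 h0 r hr'
  rw [abs_of_nonpos (by linarith [hs.1])] at e1
  rw [abs_of_nonpos (by linarith [hs.2])] at e2
  rw [abs_of_nonpos (by linarith)] at e3
  have := eq_lineMap_of_dist_eq_mul_of_dist_eq_mul (x := f 0) (y := f s) (z := f r) (r := s / r)
    (by rw [e1, e3]; field_simp; ring) (by rw [e2, e3]; field_simp; ring)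
  rw [this, AffineMap.lineMap_apply, vsub_eq_sub, vadd_eq_add, smul_smul, add_comm, div_eq_mul_inv]

/-- An isometric curve whose germ is a facet follows a singular ray. -/
lemma exists_ray_of_facet {f : ℝ → Plane} {k : Fin 6} {r : ℝ} (hr : 0 < r)
    (hf : ∀ s ∈ Icc 0 r, ∀ t ∈ Icc 0 r, dist (f s) (f t) = |s - t| * ‖ray k‖) {y a : Plane}
    (hy : ∀ δ ∈ Ioc 0 r, f '' Ioc 0 δ ∈ facetFilter y a) :
    y = f 0 ∧ ∃ j, ∀ s ∈ Icc 0 r, f s = f 0 + s • ray j := by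
  have h0 : (0 : ℝ) ∈ Icc 0 r := ⟨le_rfl, hr.le⟩
  -- The base point of the facet lies in the closure of arbitrarily short initial pieces of the
  -- curve.
  have hy0 : y = f 0 := by
    have key : ∀ δ ∈ Ioc 0 r, dist y (f 0) ≤ δ * ‖ray k‖ := by
      intro δ hδ
      have hcl : y ∈ closure (f '' Ioc 0 δ) := by
        rw [mem_closure_iff_clusterPt]
        exact (facetFilter_neBot y a).mono (le_inf (facetFilter_le_nhds y a)
          (le_principal_iff.2 (hy δ hδ)))
      have hsub : f '' Ioc 0 δ ⊆ Metric.closedBall (f 0) (δ * ‖ray k‖) := by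
        rintro _ ⟨s, hs, rfl⟩
        rw [Metric.mem_closedBall, hf s ⟨hs.1.le, hs.2.trans hδ.2⟩ 0 h0, sub_zero,
          abs_of_pos hs.1]
        exact mul_le_mul_of_nonneg_right hs.2 (norm_nonneg _)
      exact closure_minimal hsub Metric.isClosed_closedBall hcl
    by_contra hne
    have hpos := dist_pos.2 hne
    have hn := norm_ray_pos k
    have := key (min r (dist y (f 0) / (2 * ‖ray k‖))) ⟨by positivity, min_le_left _ _⟩
    have h2 : min r (dist y (f 0) / (2 * ‖ray k‖)) * ‖ray k‖ ≤ dist y (f 0) / 2 := by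
      calc _ ≤ dist y (f 0) / (2 * ‖ray k‖) * ‖ray k‖ :=
            mul_le_mul_of_nonneg_right (min_le_right _ _) hn.le
        _ = _ := by field_simp
    linarith
  refine ⟨hy0, ?_⟩
  subst hy0
  have hst := eq_add_smul_of_dist hr hf
  set w := r⁻¹ • (f r - f 0) with hw
  have hwn : ‖w‖ = ‖ray k‖ := by
    have := hf r ⟨hr.le, le_rfl⟩ 0 h0
    rw [dist_eq_norm, sub_zero, abs_of_pos hr] at this
    rw [hw, norm_smul, this, norm_inv, Real.norm_of_nonneg hr.le]
    field_simp
  clear_value w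
  obtain ⟨ε, hε, h⟩ := mem_facetFilter.1 (hy r ⟨hr, le_rfl⟩)
  have hmul : ∀ v ∈ vectorFacet a, ‖v‖ < ε → ∃ s > (0 : ℝ), v = s • w := by
    intro v hv hn
    obtain ⟨s, hs, e⟩ := h v hv hn
    rw [hst s ⟨hs.1.le, hs.2⟩] at e
    exact ⟨s, hs.1, (add_left_cancel e).symm⟩
  -- The direction `a` is zero, singular or regular. Only the singular case is compatible with the
  -- germ of a segment: a point is too small and a chamber is too large.
  obtain ⟨j, p, q, hp, hq, rfl⟩ := exists_sectorPt a
  have hray : ∀ i : Fin 6, ray i ∈ vectorFacet (sectorPt j p q) → ∃ j, ∀ s ∈ Icc 0 r,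
      f s = f 0 + s • ray j := by
    intro i hi
    have hc : 0 < ε / 4 := by positivity
    obtain ⟨s, hs, e⟩ := hmul _ (smul_mem_vectorFacet hc hi) (by
      rw [norm_smul, Real.norm_of_nonneg hc.le]
      nlinarith [norm_ray_le i])
    have hn := congrArg norm e
    rw [norm_smul, norm_smul, hwn, Real.norm_of_nonneg hc.le, Real.norm_of_nonneg hs.le,
      norm_ray_eq i k] at hn
    have hcs := mul_right_cancel₀ (norm_ray_pos k).ne' hn
    rw [hcs] at e
    have hwi := smul_right_injective Plane hs.ne' e
    exact ⟨i, fun s hs => by rw [hst s hs, hwi]⟩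
  rcases hp.eq_or_lt with rfl | hp
  · rcases hq.eq_or_lt with rfl | hq
    · exfalso
      obtain ⟨s, hs, e⟩ := hmul 0 (by rw [sectorPt_zero, vectorFacet_zero]; rfl) (by simpa)
      have : w = 0 := (smul_eq_zero.1 e.symm).resolve_left hs.ne'
      rw [this, norm_zero] at hwn
      exact (norm_ray_pos k).ne hwn
    · refine hray (j + 1) ?_
      have : ray (j + 1) = q⁻¹ • sectorPt j 0 q := by
        simp [sectorPt, smul_smul, inv_mul_cancel₀ hq.ne']
      rw [this]
      exact smul_mem_vectorFacet (inv_pos.2 hq) (self_mem_vectorFacet _)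
  · rcases hq.eq_or_lt with rfl | hq
    · refine hray j ?_
      have : ray j = p⁻¹ • sectorPt j p 0 := by
        simp [sectorPt, smul_smul, inv_mul_cancel₀ hp.ne']
      rw [this]
      exact smul_mem_vectorFacet (inv_pos.2 hp) (self_mem_vectorFacet _)
    · exfalso
      have hc : 0 < ε / 10 := by positivity
      obtain ⟨s, hs, e⟩ := hmul (sectorPt j (ε / 10) (ε / 10))
        (sectorPt_mem_vectorFacet hc hc hp hq) (by
          have := norm_sectorPt_le j hc.le hc.le
          linarith)
      obtain ⟨s', hs', e'⟩ := hmul (sectorPt j (2 * (ε / 10)) (ε / 10))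
        (sectorPt_mem_vectorFacet (by positivity) hc hp hq) (by
          have := norm_sectorPt_le j (by positivity : 0 ≤ 2 * (ε / 10)) hc.le
          linarith)
      -- Two vectors of the open sector with different slopes would both be multiples of `w`.
      have e2 : sectorPt j (s * (2 * (ε / 10)) + (-s') * (ε / 10)) (s * (ε / 10) + (-s') * (ε / 10))
          = 0 := by
        rw [← sectorPt_add, ← smul_sectorPt, ← smul_sectorPt, e, e', smul_smul, smul_smul, ← add_smul]
        convert zero_smul ℝ w using 2
        ring
      obtain ⟨h1, h2⟩ := sectorPt_eq_zero e2
      nlinarith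

/-- Induction along an interval. -/
lemma interval_induction {P : ℝ → Prop} {a b : ℝ} (hab : a ≤ b) (ha : P a)
    (hright : ∀ t ∈ Ico a b, (∀ s ∈ Icc a t, P s) → ∃ ε > 0, ∀ s ∈ Icc t (t + ε), s ≤ b → P s)
    (hleft : ∀ t ∈ Ioc a b, (∀ s ∈ Ico a t, P s) → P t) : ∀ t ∈ Icc a b, P t := by
  set T := {t ∈ Icc a b | ∀ s ∈ Icc a t, P s} with hT
  have haT : a ∈ T := ⟨⟨le_rfl, hab⟩, fun s hs => by rwa [le_antisymm hs.2 hs.1]⟩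
  have hbdd : BddAbove T := ⟨b, fun t ht => ht.1.2⟩
  set m := sSup T with hm
  have ham : a ≤ m := le_csSup hbdd haT
  have hmb : m ≤ b := csSup_le ⟨a, haT⟩ fun t ht => ht.1.2
  have hlt : ∀ s ∈ Ico a m, P s := by
    intro s hs
    obtain ⟨t, ht, hst⟩ := exists_lt_of_lt_csSup ⟨a, haT⟩ hs.2
    exact ht.2 s ⟨hs.1, hst.le⟩
  have hPm : P m := by
    rcases ham.eq_or_lt with h | h
    · rwa [← h]
    · exact hleft m ⟨h, hmb⟩ hlt
  have hle : ∀ s ∈ Icc a m, P s := fun s hs => by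
    rcases hs.2.eq_or_lt with h | h
    · rwa [h]
    · exact hlt s ⟨hs.1, h⟩
  rcases hmb.eq_or_lt with h | h
  · rwa [h] at hle
  · exfalso
    obtain ⟨ε, hε, hP⟩ := hright m ⟨ham, h⟩ hle
    have : min (m + ε) b ∈ T := by
      refine ⟨⟨le_min (by linarith) hab, min_le_right _ _⟩, fun s hs => ?_⟩
      rcases le_total s m with h' | h'
      · exact hle s ⟨hs.1, h'⟩
      · exact hP s ⟨h', hs.2.trans (min_le_left _ _)⟩ (hs.2.trans (min_le_right _ _))
    have h1 := le_csSup hbdd this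
    have h2 : m < min (m + ε) b := lt_min (by linarith) h
    linarith

end BNR

end

/-! ### Charts, retractions and geodesics of a building -/

noncomputable section

namespace BNR

namespace MetricChamberSystem

/-! ### Charts of apartments -/

variable {Y : Type u} {B : MetricChamberSystem.{u, v} Y}

/-- `g` is an isomorphism of the standard apartment with the piece `A`. -/
structure Chart (B : MetricChamberSystem.{u, v} Y) (A : B.Piece) (g : Plane → Y) : Prop where
  inj : Function.Injective g
  range_eq : range g = B.carrier A
  dist_eq : ∀ a b, B.dist A (g a) (g b) = Dist.dist a b
  facets : ∀ σ : Filter Plane, σ.map g ∈ B.facets ↔ σ ∈ planeFacets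

lemma chart_of_isChart {A : B.Piece} {g : ↥(univ : Set Plane) → Y} (h : B.IsChart A univ g) :
    Chart B A fun v => g ⟨v, mem_univ v⟩ := by
  obtain ⟨h1, h2, h3, h4⟩ := h
  refine ⟨fun a b hab => congrArg Subtype.val (h1 hab), ?_, fun a b => h3 _ _, fun σ => ?_⟩
  · rw [← h2]
    ext y
    exact ⟨fun ⟨v, hv⟩ => ⟨⟨v, mem_univ v⟩, hv⟩, fun ⟨v, hv⟩ => ⟨v.1, hv⟩⟩
  · have := h4 (σ.map fun v => ⟨v, mem_univ v⟩)
    rw [Filter.map_map, Filter.map_map] at this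
    exact this.trans (by
      rw [show Subtype.val ∘ (fun v : Plane => (⟨v, mem_univ v⟩ : ↥(univ : Set Plane))) = id from rfl,
        Filter.map_id])

lemma Chart.isChart {A : B.Piece} {g : Plane → Y} (h : Chart B A g) :
    B.IsChart A univ fun v => g v.1 := by
  refine ⟨fun a b hab => Subtype.ext (h.inj hab), ?_, fun a b => h.dist_eq _ _, fun σ => ?_⟩
  · rw [← h.range_eq]
    ext y
    exact ⟨fun ⟨v, hv⟩ => ⟨v.1, hv⟩, fun ⟨v, hv⟩ => ⟨⟨v, mem_univ v⟩, hv⟩⟩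
  · rw [← h.facets, Filter.map_map]
    rfl

lemma Chart.comp_aut {A : B.Piece} {D : Plane → Plane} {g : Plane → Y} (h : Chart B A g)
    (hD : IsAut D) : Chart B A (g ∘ D) :=
  ⟨h.inj.comp hD.1.injective, by rw [hD.2.1.range_comp, h.range_eq],
    fun a b => by rw [Function.comp_apply, Function.comp_apply, h.dist_eq, hD.1.dist_eq],
    fun σ => by rw [← Filter.map_map, h.facets, hD.2.2]⟩

lemma Chart.mem {A : B.Piece} {g : Plane → Y} (h : Chart B A g) (v : Plane) : g v ∈ B.carrier A :=
  h.range_eq ▸ mem_range_self v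

lemma Chart.exists_eq {A : B.Piece} {g : Plane → Y} (h : Chart B A g) {y : Y}
    (hy : y ∈ B.carrier A) : ∃ v, g v = y := by
  rwa [← h.range_eq] at hy

lemma Chart.hasDist {A : B.Piece} {g : Plane → Y} (h : Chart B A g) (a b : Plane) :
    B.HasDist (g a) (g b) (Dist.dist a b) := ⟨A, h.mem a, h.mem b, h.dist_eq a b⟩

lemma Chart.carrier_mem_map {A : B.Piece} {g : Plane → Y} (h : Chart B A g) (σ : Filter Plane) :
    B.carrier A ∈ σ.map g :=
  Filter.mem_map.2 (mem_of_superset univ_mem fun v _ => h.mem v)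

lemma Chart.exists_facet {A : B.Piece} {g : Plane → Y} (h : Chart B A g) {s : Filter Y}
    (hs : s ∈ B.facets) (hA : B.carrier A ∈ s) : ∃ x a, s = (facetFilter x a).map g := by
  have e : (s.comap g).map g = s := Filter.map_comap_of_mem (h.range_eq ▸ hA)
  obtain ⟨x, a, hxa⟩ := (h.facets (s.comap g)).1 (e.symm ▸ hs)
  exact ⟨x, a, by rw [← hxa, e]⟩

lemma Chart.pure_mem {A : B.Piece} {g : Plane → Y} (h : Chart B A g) (v : Plane) :
    pure (g v) ∈ B.facets := by
  rw [← Filter.map_pure]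
  exact (h.facets _).2 (pure_mem_planeFacets v)

/-- Both charts have the same image and the same distance, and a point of the plane is determined by
its distances to three non-collinear points. -/
lemma Chart.eq_of_three {A : B.Piece} {g g' : Plane → Y} (h : Chart B A g) (h' : Chart B A g')
    {x : Plane} {k : Fin 6} {s t : ℝ} (hs : s ≠ 0) (ht : t ≠ 0) (h0 : g x = g' x)
    (h1 : g (x + s • ray k) = g' (x + s • ray k))
    (h2 : g (x + t • ray (k + 1)) = g' (x + t • ray (k + 1))) : g = g' := by
  funext v
  obtain ⟨w, hw⟩ := h'.exists_eq (h.mem v)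
  have key : ∀ q, g q = g' q → Dist.dist v q = Dist.dist w q := fun q hq => by
    rw [← h.dist_eq, ← h'.dist_eq, hw, hq]
  rw [← hw, eq_of_dist_eq hs ht (key _ h0) (key _ h1) (key _ h2)]

namespace IsBuilding

lemma exists_chart (hB : B.IsBuilding) (A : B.Piece) : ∃ g, Chart B A g :=
  let ⟨_, hg⟩ := hB.apartment A
  ⟨_, chart_of_isChart hg⟩

/-- Two apartments that share two facets have charts that agree on these facets. -/
lemma exists_chart_agreeing (hB : B.IsBuilding) {A A' : B.Piece} {g : Plane → Y}
    (h : Chart B A g) {σ τ : Filter Plane} (hσ : σ ∈ planeFacets) (hτ : τ ∈ planeFacets)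
    (hAσ : B.carrier A' ∈ σ.map g) (hAτ : B.carrier A' ∈ τ.map g) :
    ∃ g', Chart B A' g' ∧ (∃ S ∈ σ, EqOn g' g (closure S)) ∧ ∃ S ∈ τ, EqOn g' g (closure S) := by
  obtain ⟨e, he, hd, hf, h1, h2⟩ := hB.inter_iso A A' _ ((h.facets σ).2 hσ) _ ((h.facets τ).2 hτ)
    (inter_mem (h.carrier_mem_map σ) hAσ) (inter_mem (h.carrier_mem_map τ) hAτ)
  have key : ∀ {σ : Filter Plane}, B.FixesClosure A e (σ.map g) →
      ∃ S ∈ σ, EqOn (e ∘ g) g (closure S) := by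
    rintro σ ⟨S, hS, -, hfix⟩
    refine ⟨g ⁻¹' S, hS, fun v hv => hfix _ ⟨h.mem v, fun ε hε => ?_⟩⟩
    obtain ⟨s, hs, hsε⟩ := Metric.mem_closure_iff.1 hv ε hε
    exact ⟨g s, ⟨hs, h.mem s⟩, by rwa [h.dist_eq]⟩
  refine ⟨e ∘ g, ⟨fun a b hab => h.inj (he.injOn (h.mem a) (h.mem b) hab), ?_, fun a b => ?_,
    fun σ => ?_⟩, key h1, key h2⟩
  · rw [range_comp, h.range_eq, he.image_eq]
  · rw [Function.comp_apply, Function.comp_apply, hd _ (h.mem a) _ (h.mem b), h.dist_eq]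
  · rw [← Filter.map_map, ← hf _ (h.carrier_mem_map σ), h.facets]

lemma exists_chart_common (hB : B.IsBuilding) {A : B.Piece} {g : Plane → Y} (h : Chart B A g)
    {σ : Filter Plane} (hσ : σ ∈ planeFacets) {t : Filter Y} (ht : t ∈ B.facets) :
    ∃ A' g', Chart B A' g' ∧ (∃ S ∈ σ, EqOn g' g (closure S)) ∧ B.carrier A' ∈ t := by
  obtain ⟨A', h1, h2⟩ := hB.common _ ((h.facets σ).2 hσ) t ht
  obtain ⟨g', hg', hS, -⟩ := hB.exists_chart_agreeing h hσ hσ h1 h1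
  exact ⟨A', g', hg', hS, h2⟩

lemma exists_chart_through (hB : B.IsBuilding) {A A' : B.Piece} {g : Plane → Y} (h : Chart B A g)
    {v w : Plane} (hv : g v ∈ B.carrier A') (hw : g w ∈ B.carrier A') :
    ∃ g', Chart B A' g' ∧ g' v = g v ∧ g' w = g w := by
  obtain ⟨g', hg', ⟨S, hS, h1⟩, T, hT, h2⟩ := hB.exists_chart_agreeing h
    (pure_mem_planeFacets v) (pure_mem_planeFacets w) (by simpa using hv) (by simpa using hw)
  exact ⟨g', hg', h1 (subset_closure hS), h2 (subset_closure hT)⟩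

lemma exists_chart_of_hasDist (hB : B.IsBuilding) {y z : Y} {r : ℝ} (h : B.HasDist y z r) :
    ∃ A g, Chart B A g ∧ ∃ a b, g a = y ∧ g b = z ∧ Dist.dist a b = r := by
  obtain ⟨A, hy, hz, hr⟩ := h
  obtain ⟨g, hg⟩ := hB.exists_chart A
  obtain ⟨a, rfl⟩ := hg.exists_eq hy
  obtain ⟨b, rfl⟩ := hg.exists_eq hz
  exact ⟨A, g, hg, a, b, rfl, rfl, by rw [← hr, hg.dist_eq]⟩

/-- Any two apartments through both points have charts that agree at them; points count as facets,
with zero direction. -/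
lemma hasDist_unique (hB : B.IsBuilding) {y z : Y} {r r' : ℝ} (h : B.HasDist y z r)
    (h' : B.HasDist y z r') : r = r' := by
  obtain ⟨A, g, hg, a, b, rfl, rfl, rfl⟩ := hB.exists_chart_of_hasDist h
  obtain ⟨A', hy, hz, rfl⟩ := h'
  obtain ⟨g', hg', h1, h2⟩ := hB.exists_chart_through hg hy hz
  rw [← hg'.dist_eq, h1, h2]

lemma hasDist_symm (hB : B.IsBuilding) {y z : Y} {r : ℝ} (h : B.HasDist y z r) :
    B.HasDist z y r := by
  obtain ⟨A, g, hg, a, b, rfl, rfl, rfl⟩ := hB.exists_chart_of_hasDist h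
  rw [dist_comm]
  exact hg.hasDist b a

lemma pure_mem_of_hasDist (hB : B.IsBuilding) {y z : Y} {r : ℝ} (h : B.HasDist y z r) :
    pure y ∈ B.facets := by
  obtain ⟨A, g, hg, a, b, rfl, rfl, rfl⟩ := hB.exists_chart_of_hasDist h
  exact hg.pure_mem a

lemma exists_hasDist (hB : B.IsBuilding) {y z : Y} (hy : pure y ∈ B.facets)
    (hz : pure z ∈ B.facets) : ∃ r, B.HasDist y z r := by
  obtain ⟨A, h1, h2⟩ := hB.common _ hy _ hz
  exact ⟨_, A, h1, h2, rfl⟩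

lemma eq_of_hasDist_zero (hB : B.IsBuilding) {y z : Y} (h : B.HasDist y z 0) : y = z := by
  obtain ⟨A, g, hg, a, b, rfl, rfl, hab⟩ := hB.exists_chart_of_hasDist h
  rw [dist_eq_zero.1 hab]

/-! ### Retractions -/

/-- The retraction onto an apartment that is centred at a chamber. -/
lemma exists_retraction (hB : B.IsBuilding) {A : B.Piece} {g : Plane → Y} (h : Chart B A g)
    (x : Plane) (k : Fin 6) : ∃ ρ : Y → Plane, ∀ A' g', Chart B A' g' →
      (∃ S ∈ facetFilter x (sectorPt k 1 1), EqOn g' g (closure S)) → ∀ v, ρ (g' v) = v := by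
  classical
  -- Well-definedness: if `g' v = g'' w`, a chart of the second apartment agrees with `g'` on the
  -- central chamber and at `v`. Agreeing with `g''` on a chamber, it equals `g''`, whence `v = w`.
  have huniq : ∀ A' g' A'' g'' v w, Chart B A' g' → Chart B A'' g'' →
      (∃ S ∈ facetFilter x (sectorPt k 1 1), EqOn g' g (closure S)) →
      (∃ S ∈ facetFilter x (sectorPt k 1 1), EqOn g'' g (closure S)) → g' v = g'' w → v = w := by
    rintro A' g' A'' g'' v w h' h'' ⟨S, hS, e'⟩ ⟨T, hT, e''⟩ hvw
    obtain ⟨g₃, h₃, ⟨U, hU, e₃⟩, V, hV, e₄⟩ := hB.exists_chart_agreeing (A' := A'') h'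
      (facetFilter_mem_planeFacets x (sectorPt k 1 1)) (pure_mem_planeFacets v)
      (by
        rw [Filter.mem_map]
        filter_upwards [inter_mem hS hT] with z hz
        rw [mem_preimage, e' (subset_closure hz.1), ← e'' (subset_closure hz.2)]
        exact h''.mem z)
      (by simpa [hvw] using h''.mem w)
    obtain ⟨ε, hε, hcl⟩ := exists_sectorPt_mem_closure (inter_mem (inter_mem hS hT) hU)
    have hall : ∀ s ∈ Icc 0 ε, ∀ t ∈ Icc 0 ε,
        g₃ (x + sectorPt k s t) = g'' (x + sectorPt k s t) := by
      intro s hs t ht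
      have := hcl s hs t ht
      rw [e₃ (closure_mono inter_subset_right this),
        e' (closure_mono (inter_subset_left.trans inter_subset_left) this),
        e'' (closure_mono (inter_subset_left.trans inter_subset_right) this)]
    have h0 : (0 : ℝ) ∈ Icc 0 ε := ⟨le_rfl, hε.le⟩
    have hε' : ε ∈ Icc 0 ε := ⟨hε.le, le_rfl⟩
    have heq : g₃ = g'' := h₃.eq_of_three h'' (x := x) (k := k) hε.ne' hε.ne'
      (by simpa using hall 0 h0 0 h0) (by simpa [sectorPt] using hall ε hε' 0 h0)
      (by simpa [sectorPt] using hall 0 h0 ε hε')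
    have := e₄ (subset_closure hV)
    rw [heq, hvw] at this
    exact h''.inj this
  let R : Y → Plane → Prop := fun y v => ∃ A' g', Chart B A' g' ∧
    (∃ S ∈ facetFilter x (sectorPt k 1 1), EqOn g' g (closure S)) ∧ g' v = y
  -- The value 0 is a default for elements that lie in no apartment containing the central chamber.
  refine ⟨fun y => if hy : ∃ v, R y v then hy.choose else 0, fun A' g' h' hS v => ?_⟩
  have hy : ∃ w, R (g' v) w := ⟨v, A', g', h', hS, rfl⟩
  simp only [hy, dif_pos]
  obtain ⟨A'', g'', h'', hT, e⟩ := hy.choose_spec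
  exact huniq _ _ _ _ _ _ h'' h' hT hS e

/-- An apartment through the central chamber and the given facet compares `g₁` near the facet with a
chart on which the retraction is the identity; the change of charts is an automorphism of the plane.
-/
lemma retraction_local (hB : B.IsBuilding) {A A₁ : B.Piece} {g g₁ : Plane → Y} (h : Chart B A g)
    (h₁ : Chart B A₁ g₁) {x : Plane} {k : Fin 6} {ρ : Y → Plane}
    (hρ : ∀ A' g', Chart B A' g' →
      (∃ S ∈ facetFilter x (sectorPt k 1 1), EqOn g' g (closure S)) → ∀ v, ρ (g' v) = v)
    {σ : Filter Plane} (hσ : σ ∈ planeFacets) :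
    ∃ S ∈ σ, ∃ D : Plane → Plane, IsAut D ∧ ∀ v ∈ closure S, ρ (g₁ v) = D v := by
  obtain ⟨A', g', h', hS, hA'⟩ := hB.exists_chart_common h
    (facetFilter_mem_planeFacets x (sectorPt k 1 1)) ((h₁.facets σ).2 hσ)
  obtain ⟨g'', h'', ⟨T, hT, e⟩, -⟩ := hB.exists_chart_agreeing h₁ hσ hσ hA' hA'
  choose D hD using fun v => h'.exists_eq (h''.mem v)
  have hcomp : g'' = g' ∘ D := funext fun v => (hD v).symm
  refine ⟨T, hT, D, ⟨Isometry.of_dist_eq fun a b => ?_, fun v => ?_, fun τ => ?_⟩, fun v hv => ?_⟩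
  · rw [← h'.dist_eq, hD, hD, h''.dist_eq]
  · obtain ⟨w, hw⟩ := h''.exists_eq (h'.mem v)
    exact ⟨w, h'.inj (by rw [hD, hw])⟩
  · rw [← h'.facets, Filter.map_map, ← hcomp, h''.facets]
  · rw [← e hv, ← hD v, hρ A' g' h' hS]

/-- The image of a segment is locally isometric to it on either side of each of its points, and the
length estimate is continued along the segment by `interval_induction`. -/
lemma retraction_dist_le (hB : B.IsBuilding) {A A₁ : B.Piece} {g g₁ : Plane → Y}
    (h : Chart B A g) (h₁ : Chart B A₁ g₁) {x : Plane} {k : Fin 6} {ρ : Y → Plane}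
    (hρ : ∀ A' g', Chart B A' g' →
      (∃ S ∈ facetFilter x (sectorPt k 1 1), EqOn g' g (closure S)) → ∀ v, ρ (g' v) = v)
    (a b : Plane) : Dist.dist (ρ (g₁ a)) (ρ (g₁ b)) ≤ Dist.dist a b := by
  have hloc : ∀ c d : Plane, ∃ ε > (0 : ℝ), ∀ s ∈ Icc 0 ε,
      Dist.dist (ρ (g₁ c)) (ρ (g₁ (c + s • d))) = s * ‖d‖ := by
    intro c d
    obtain ⟨S, hS, D, hD, e⟩ := hB.retraction_local h h₁ hρ (facetFilter_mem_planeFacets c d)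
    obtain ⟨ε, hε, hcl⟩ := exists_mem_closure_of_mem_facetFilter hS (self_mem_vectorFacet d)
    refine ⟨ε, hε, fun s hs => ?_⟩
    have h0 := hcl 0 ⟨le_rfl, hε.le⟩
    rw [zero_smul, add_zero] at h0
    rw [e _ h0, e _ (hcl s hs), hD.1.dist_eq, dist_self_add_right, norm_smul,
      Real.norm_of_nonneg hs.1]
  have key : ∀ s ∈ Icc (0 : ℝ) 1,
      Dist.dist (ρ (g₁ a)) (ρ (g₁ (a + s • (b - a)))) ≤ s * ‖b - a‖ := by
    refine interval_induction zero_le_one (by simp) ?_ ?_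
    · intro t ht hP
      obtain ⟨ε, hε, hl⟩ := hloc (a + t • (b - a)) (b - a)
      refine ⟨ε, hε, fun s hs _ => ?_⟩
      have h1 := hP t ⟨ht.1, le_rfl⟩
      have h2 := hl (s - t) ⟨by linarith [hs.1], by linarith [hs.2]⟩
      rw [add_assoc, ← add_smul, add_sub_cancel] at h2
      have h3 := dist_triangle (ρ (g₁ a)) (ρ (g₁ (a + t • (b - a)))) (ρ (g₁ (a + s • (b - a))))
      rw [h2] at h3
      linarith
    · intro t ht hP
      obtain ⟨ε, hε, hl⟩ := hloc (a + t • (b - a)) (-(b - a))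
      have hm : 0 < min ε t := lt_min hε ht.1
      have h1 := hP (t - min ε t) ⟨by linarith [min_le_right ε t], by linarith⟩
      have h2 := hl (min ε t) ⟨hm.le, min_le_left _ _⟩
      rw [smul_neg, add_assoc, ← sub_eq_add_neg, ← sub_smul, norm_neg, dist_comm] at h2
      have h3 := dist_triangle (ρ (g₁ a)) (ρ (g₁ (a + (t - min ε t) • (b - a))))
        (ρ (g₁ (a + t • (b - a))))
      rw [h2] at h3
      linarith
  have := key 1 ⟨zero_le_one, le_rfl⟩
  rw [one_smul, one_mul, add_sub_cancel] at this
  rwa [dist_eq_norm a b, norm_sub_rev]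

lemma retraction_hasDist_le (hB : B.IsBuilding) {A : B.Piece} {g : Plane → Y}
    (h : Chart B A g) {x : Plane} {k : Fin 6} {ρ : Y → Plane}
    (hρ : ∀ A' g', Chart B A' g' →
      (∃ S ∈ facetFilter x (sectorPt k 1 1), EqOn g' g (closure S)) → ∀ v, ρ (g' v) = v)
    {y z : Y} {r : ℝ} (hyz : B.HasDist y z r) : Dist.dist (ρ y) (ρ z) ≤ r := by
  obtain ⟨A₁, g₁, h₁, a, b, rfl, rfl, rfl⟩ := hB.exists_chart_of_hasDist hyz
  exact hB.retraction_dist_le h h₁ hρ a b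

lemma retraction_self {A : B.Piece} {g : Plane → Y} (h : Chart B A g) {x : Plane} {k : Fin 6}
    {ρ : Y → Plane} (hρ : ∀ A' g', Chart B A' g' →
      (∃ S ∈ facetFilter x (sectorPt k 1 1), EqOn g' g (closure S)) → ∀ v, ρ (g' v) = v)
    (v : Plane) : ρ (g v) = v := hρ A g h ⟨univ, univ_mem, fun _ _ => rfl⟩ v

/-- Retract `z` onto an apartment through `y` and `w`, where the Euclidean triangle inequality
applies. -/
lemma hasDist_triangle (hB : B.IsBuilding) {y z w : Y} {p q r : ℝ} (hyz : B.HasDist y z p)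
    (hzw : B.HasDist z w q) (hyw : B.HasDist y w r) : r ≤ p + q := by
  obtain ⟨A, g, h, a, b, rfl, rfl, rfl⟩ := hB.exists_chart_of_hasDist hyw
  obtain ⟨ρ, hρ⟩ := hB.exists_retraction h 0 0
  have h1 := hB.retraction_hasDist_le h hρ hyz
  have h2 := hB.retraction_hasDist_le h hρ hzw
  rw [retraction_self h hρ] at h1 h2
  exact (dist_triangle a (ρ z) b).trans (add_le_add h1 h2)

/-- Points on a geodesic are determined by their distances to its ends. -/
lemma geodesic_unique (hB : B.IsBuilding) {a b z z' : Y} {p q : ℝ} (haz : B.HasDist a z p)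
    (haz' : B.HasDist a z' p) (hzb : B.HasDist z b q) (hzb' : B.HasDist z' b q)
    (hab : B.HasDist a b (p + q)) : z = z' := by
  obtain ⟨r, hr⟩ := hB.exists_hasDist (hB.pure_mem_of_hasDist hzb) (hB.pure_mem_of_hasDist hzb')
  obtain ⟨A, g, h, u, u', rfl, rfl, -⟩ := hB.exists_chart_of_hasDist hr
  by_contra hne
  have huu : u ≠ u' := fun e => hne (by rw [e])
  set m : Plane := midpoint ℝ u u' with hm
  obtain ⟨ρ, hρ⟩ := hB.exists_retraction h m 0
  -- The retraction centred at a chamber at the midpoint `m` keeps the distance from `y` to `g m`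
  -- and does not increase those to `g u` and `g u'`. By the parallelogram law `g m` is strictly
  -- closer to `y` than `l`.
  have key : ∀ (y : Y) (l : ℝ), B.HasDist y (g u) l → B.HasDist y (g u') l →
      ∃ l' < l, B.HasDist y (g m) l' := by
    intro y l h1 h2
    have hy := hB.pure_mem_of_hasDist h1
    obtain ⟨A', g', h', ⟨S, hS, e⟩, hA'⟩ := hB.exists_chart_common h
      (facetFilter_mem_planeFacets m (sectorPt 0 1 1)) hy
    obtain ⟨w, rfl⟩ := h'.exists_eq (mem_pure.1 hA')
    obtain ⟨ε, hε, hcl⟩ := exists_sectorPt_mem_closure hS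
    have hmS := hcl 0 ⟨le_rfl, hε.le⟩ 0 ⟨le_rfl, hε.le⟩
    rw [sectorPt_zero, add_zero] at hmS
    refine ⟨Dist.dist w m, ?_, by rw [← e hmS]; exact h'.hasDist w m⟩
    have k1 := hB.retraction_hasDist_le h hρ h1
    have k2 := hB.retraction_hasDist_le h hρ h2
    rw [hρ A' g' h' ⟨S, hS, e⟩, retraction_self h hρ] at k1 k2
    by_contra hlt
    push Not at hlt
    have hpl := parallelogram_law_with_norm ℝ (w - u) (w - u')
    have e1 : (w - u) + (w - u') = (2 : ℝ) • (w - m) := by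
      rw [hm, midpoint_eq_smul_add, smul_sub, smul_smul]
      norm_num
      module
    have n1 : ‖w - u‖ = Dist.dist w u := (dist_eq_norm _ _).symm
    have n2 : ‖w - u'‖ = Dist.dist w u' := (dist_eq_norm _ _).symm
    have n3 : ‖w - m‖ = Dist.dist w m := (dist_eq_norm _ _).symm
    rw [e1, norm_smul, n1, n2, n3, Real.norm_of_nonneg zero_le_two] at hpl
    have hpos : 0 < ‖(w - u) - (w - u')‖ := by
      rw [norm_pos_iff, sub_sub_sub_cancel_left, sub_ne_zero]
      exact huu.symm
    have d0 := dist_nonneg (x := w) (y := u)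
    have d1 := dist_nonneg (x := w) (y := u')
    have d2 := dist_nonneg (x := w) (y := m)
    nlinarith [mul_self_le_mul_self d0 k1, mul_self_le_mul_self d1 k2,
      mul_self_le_mul_self (d0.trans k1) hlt, mul_pos hpos hpos]
  -- Applied at both ends, this gives a path from `a` to `b` through `g m` that is shorter than
  -- their distance.
  obtain ⟨p', hp', h1⟩ := key a p haz haz'
  obtain ⟨q', hq', h2⟩ := key b q (hB.hasDist_symm hzb) (hB.hasDist_symm hzb')
  have := hB.hasDist_triangle h1 (hB.hasDist_symm h2) hab
  linarith

end IsBuilding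

end MetricChamberSystem

end BNR

end

/-! ### Flats in a building -/

noncomputable section

namespace BNR

/-- Facets of the plane that meet are equal. -/
lemma facetFilter_eq_of_neBot {x a y b : Plane} (h : (facetFilter x a ⊓ facetFilter y b).NeBot) :
    facetFilter x a = facetFilter y b := by
  have hxy : x = y := eq_of_nhds_neBot
    (h.mono (inf_le_inf (facetFilter_le_nhds x a) (facetFilter_le_nhds y b)))
  subst hxy
  have hm : ∀ a : Plane, (fun y => x + y) '' vectorFacet a ∈ facetFilter x a := fun a =>
    mem_facetFilter.2 ⟨1, one_pos, fun y hy _ => ⟨y, hy, rfl⟩⟩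
  obtain ⟨z, ⟨c, hc, rfl⟩, d, hd, hdc⟩ := h.nonempty_of_mem (inter_mem_inf (hm a) (hm b))
  have : d = c := add_left_cancel hdc
  subst this
  rw [← facetFilter_congr hc, ← facetFilter_congr hd]

/-- The vectorial facet through `ray k` is an open half-line, so short initial segments are members
of the germ. This turns facet preservation into statements about singular curves. -/
lemma segment_mem_facetFilter (a : Plane) (k : Fin 6) {δ : ℝ} (hδ : 0 < δ) :
    (fun s : ℝ => a + s • ray k) '' Ioc 0 δ ∈ facetFilter a (ray k) := by
  refine mem_facetFilter.2 ⟨δ * ‖ray k‖, mul_pos hδ (norm_ray_pos k), fun y hy hn => ?_⟩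
  obtain ⟨s, hs, rfl⟩ := vectorFacet_ray k hy
  rw [norm_smul, Real.norm_of_nonneg hs.le] at hn
  exact ⟨s, ⟨hs, (lt_of_mul_lt_mul_right hn (norm_nonneg _)).le⟩, rfl⟩

lemma dist_ray_curve (a d : Plane) (s t : ℝ) :
    dist (a + s • d) (a + t • d) = |s - t| * ‖d‖ := by
  rw [dist_add_left, dist_eq_norm, ← sub_smul, norm_smul, Real.norm_eq_abs]

namespace MetricChamberSystem

variable {Y : Type u} {B : MetricChamberSystem.{u, v} Y}

/-! ### Flat maps of the plane into a building -/

/-- `J` preserves distances and facets. -/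
structure IsFlat (B : MetricChamberSystem.{u, v} Y) (J : Plane → Y) : Prop where
  hasDist : ∀ a b, B.HasDist (J a) (J b) (Dist.dist a b)
  facets : ∀ σ ∈ planeFacets, σ.map J ∈ B.facets

lemma Chart.isFlat {A : B.Piece} {g : Plane → Y} (h : Chart B A g) : IsFlat B g :=
  ⟨h.hasDist, fun σ hσ => (h.facets σ).2 hσ⟩

lemma IsFlat.exists_pair {J : Plane → Y} (hJ : IsFlat B J) (v w : Plane) :
    ∃ A, J v ∈ B.carrier A ∧ J w ∈ B.carrier A :=
  let ⟨A, h1, h2, _⟩ := hJ.hasDist v w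
  ⟨A, h1, h2⟩

namespace IsBuilding

lemma dist_eq_of_flat (hB : B.IsBuilding) {J : Plane → Y} (hJ : IsFlat B J) {A : B.Piece}
    {g : Plane → Y} (h : Chart B A g) {v₁ v₂ u₁ u₂ : Plane} (h1 : J v₁ = g u₁) (h2 : J v₂ = g u₂) :
    Dist.dist u₁ u₂ = Dist.dist v₁ v₂ :=
  hB.hasDist_unique (h.hasDist u₁ u₂) (h1 ▸ h2 ▸ hJ.hasDist v₁ v₂)

/-- Both sides have the same distances to the two end points, so `geodesic_unique` applies. No
apartment containing the flat is needed. -/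
lemma flat_segment (hB : B.IsBuilding) {J : Plane → Y} (hJ : IsFlat B J) {A : B.Piece}
    {g : Plane → Y} (h : Chart B A g) {v₁ v₂ u₁ u₂ : Plane} (h1 : J v₁ = g u₁) (h2 : J v₂ = g u₂)
    {t : ℝ} (ht : t ∈ Icc (0 : ℝ) 1) :
    J (v₁ + t • (v₂ - v₁)) = g (u₁ + t • (u₂ - u₁)) := by
  have hd := hB.dist_eq_of_flat hJ h h1 h2
  have e1 : ∀ a b : Plane, Dist.dist a (a + t • (b - a)) = t * Dist.dist a b := fun a b => by
    rw [dist_self_add_right, norm_smul, Real.norm_of_nonneg ht.1, dist_comm, dist_eq_norm]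
  have e2 : ∀ a b : Plane, Dist.dist (a + t • (b - a)) b = (1 - t) * Dist.dist a b := fun a b => by
    rw [dist_eq_norm, show a + t • (b - a) - b = (1 - t) • (a - b) by module, norm_smul,
      Real.norm_of_nonneg (by linarith [ht.2]), dist_eq_norm]
  refine hB.geodesic_unique (a := J v₁) (b := J v₂) (p := t * Dist.dist v₁ v₂)
    (q := (1 - t) * Dist.dist v₁ v₂) ?_ ?_ ?_ ?_ ?_
  · rw [← e1]; exact hJ.hasDist _ _
  · rw [← hd, ← e1, h1]; exact h.hasDist _ _
  · rw [← e2]; exact hJ.hasDist _ _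
  · rw [← hd, ← e2, h2]; exact h.hasDist _ _
  · rw [← add_mul, add_sub_cancel, one_mul]; exact hJ.hasDist _ _

/-- Both facets lie in one apartment, where the claim is about vectorial facets of the plane. -/
lemma eq_of_facets_meet (hB : B.IsBuilding) {s t : Filter Y} (hs : s ∈ B.facets)
    (ht : t ∈ B.facets) (h : (s ⊓ t).NeBot) : s = t := by
  obtain ⟨A, hAs, hAt⟩ := hB.common s hs t ht
  obtain ⟨g, hg⟩ := hB.exists_chart A
  obtain ⟨x, a, rfl⟩ := hg.exists_facet hs hAs
  obtain ⟨y, b, rfl⟩ := hg.exists_facet ht hAt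
  rw [← Filter.map_inf hg.inj] at h
  rw [facetFilter_eq_of_neBot ((Filter.map_neBot_iff g).1 h)]

/-- An apartment that contains two points of a flat contains the germ of the segment. -/
lemma flat_germ (hB : B.IsBuilding) {J : Plane → Y} (hJ : IsFlat B J) {A : B.Piece}
    {v₁ v₂ : Plane} (h1 : J v₁ ∈ B.carrier A) (h2 : J v₂ ∈ B.carrier A) :
    B.carrier A ∈ (facetFilter v₁ (v₂ - v₁)).map J := by
  obtain ⟨g, h⟩ := hB.exists_chart A
  obtain ⟨u₁, e1⟩ := h.exists_eq h1
  obtain ⟨u₂, e2⟩ := h.exists_eq h2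
  suffices (facetFilter v₁ (v₂ - v₁)).map J = (facetFilter u₁ (u₂ - u₁)).map g by
    rw [this]; exact h.carrier_mem_map _
  refine hB.eq_of_facets_meet (hJ.facets _ (facetFilter_mem_planeFacets _ _))
    ((h.facets _).2 (facetFilter_mem_planeFacets _ _)) ?_
  rw [Filter.inf_neBot_iff]
  intro S hS T hT
  obtain ⟨ε, hε, hS⟩ := exists_mem_of_mem_facetFilter (Filter.mem_map.1 hS)
    (self_mem_vectorFacet _)
  obtain ⟨δ, hδ, hT⟩ := exists_mem_of_mem_facetFilter (Filter.mem_map.1 hT)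
    (self_mem_vectorFacet _)
  have hm : 0 < min 1 (min ε δ) := lt_min one_pos (lt_min hε hδ)
  refine ⟨_, hS (min 1 (min ε δ)) ⟨hm, (min_le_right _ _).trans (min_le_left _ _)⟩, ?_⟩
  rw [hB.flat_segment hJ h e1.symm e2.symm ⟨hm.le, min_le_left _ _⟩]
  exact hT (min 1 (min ε δ)) ⟨hm, (min_le_right _ _).trans (min_le_right _ _)⟩

/-- A convergent sequence in the preimage gives a Cauchy sequence in the complete apartment. The
limits in the flat and in the apartment have distance zero, hence coincide. -/
lemma isClosed_flat_preimage (hB : B.IsBuilding) {J : Plane → Y} (hJ : IsFlat B J) (A : B.Piece) :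
    IsClosed (J ⁻¹' B.carrier A) := by
  obtain ⟨g, h⟩ := hB.exists_chart A
  refine isClosed_of_closure_subset fun v hv => ?_
  obtain ⟨x, hx, hxv⟩ := mem_closure_iff_seq_limit.1 hv
  choose w hw using fun n => h.exists_eq (hx n)
  have hd : ∀ m n, Dist.dist (w m) (w n) = Dist.dist (x m) (x n) := fun m n =>
    hB.dist_eq_of_flat hJ h (hw m).symm (hw n).symm
  have hc : CauchySeq w := by
    have := hxv.cauchySeq
    rw [Metric.cauchySeq_iff] at this ⊢
    simpa only [hd] using this
  obtain ⟨w₀, hw₀⟩ := cauchySeq_tendsto_of_complete hc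
  obtain ⟨r, hr⟩ := hB.exists_hasDist (hB.pure_mem_of_hasDist (hJ.hasDist v v)) (h.pure_mem w₀)
  have hle : ∀ n, r ≤ Dist.dist v (x n) + Dist.dist (w n) w₀ := fun n =>
    hB.hasDist_triangle (hJ.hasDist v (x n)) (by rw [← hw n]; exact h.hasDist _ _) hr
  have hlim : Tendsto (fun n => Dist.dist v (x n) + Dist.dist (w n) w₀) atTop (𝓝 (0 + 0)) := by
    refine Tendsto.add ?_ (tendsto_iff_dist_tendsto_zero.1 hw₀)
    simpa only [dist_comm v] using tendsto_iff_dist_tendsto_zero.1 hxv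
  have hr0 : r ≤ 0 := by
    rw [add_zero] at hlim
    exact ge_of_tendsto' hlim hle
  have hr1 : 0 ≤ r := by
    obtain ⟨A', g', h', a, b, -, -, rfl⟩ := hB.exists_chart_of_hasDist hr
    exact dist_nonneg
  rw [le_antisymm hr0 hr1] at hr
  rw [mem_preimage, hB.eq_of_hasDist_zero hr]
  exact h.mem w₀

lemma exists_Icc_of_germ (hB : B.IsBuilding) {J : Plane → Y} (hJ : IsFlat B J) {A : B.Piece}
    {x a d : Plane} (h : B.carrier A ∈ (facetFilter x a).map J) (hd : d ∈ vectorFacet a) :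
    ∃ ε > (0 : ℝ), ∀ s ∈ Icc 0 ε, J (x + s • d) ∈ B.carrier A := by
  obtain ⟨ε, hε, hcl⟩ := exists_mem_closure_of_mem_facetFilter (Filter.mem_map.1 h) hd
  exact ⟨ε, hε, fun s hs => (hB.isClosed_flat_preimage hJ A).closure_subset (hcl s hs)⟩

/-- An apartment that contains two points of a flat contains their hull. -/
lemma flat_hull (hB : B.IsBuilding) {J : Plane → Y} (hJ : IsFlat B J) {A : B.Piece}
    {a : Plane} {k : Fin 6} {s t : ℝ} (hs : 0 < s) (ht : 0 < t) (h1 : J a ∈ B.carrier A)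
    (h2 : J (a + sectorPt k s t) ∈ B.carrier A) {s' t' : ℝ} (hs' : s' ∈ Icc 0 s)
    (ht' : t' ∈ Icc 0 t) : J (a + sectorPt k s' t') ∈ B.carrier A := by
  have hK := hB.isClosed_flat_preimage hJ A
  have key : ∀ r ∈ Icc (0 : ℝ) 1, J (a + r • sectorPt k s' t') ∈ B.carrier A := by
    refine interval_induction zero_le_one (by simpa using h1) ?_ ?_
    · intro r hr hP
      have hc := hP r ⟨hr.1, le_rfl⟩
      -- As long as the far corner is not reached, the direction towards it is regular. The
      -- apartment therefore contains a chamber germ of the flat at the current point, which leaves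
      -- room to move towards the target.
      have hgerm := hB.flat_germ hJ hc h2
      have hp : 0 < s - r * s' := by nlinarith [hs'.2, hr.1, hr.2, hs'.1]
      have hq : 0 < t - r * t' := by nlinarith [ht'.2, hr.1, hr.2, ht'.1]
      have e : a + sectorPt k s t - (a + r • sectorPt k s' t') =
          sectorPt k (s - r * s') (t - r * t') := by
        simp only [sectorPt]; module
      rw [e, ← facetFilter_congr (sectorPt_mem_vectorFacet one_pos one_pos hp hq)] at hgerm
      obtain ⟨ε, hε, hcl⟩ := exists_sectorPt_mem_closure (Filter.mem_map.1 hgerm)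
      -- Since `s' ≤ s` and `t' ≤ t`, such a step changes both sector coordinates by at most `ε`.
      refine ⟨ε / (s + t), by positivity, fun r' hr' _ => ?_⟩
      have hr0 : 0 ≤ r' - r := by linarith [hr'.1]
      have hb : (r' - r) * (s + t) ≤ ε := by
        have : r' - r ≤ ε / (s + t) := by linarith [hr'.2]
        rwa [le_div_iff₀ (by positivity)] at this
      have := hK.closure_subset (hcl ((r' - r) * s') ⟨mul_nonneg hr0 hs'.1, by
        nlinarith [hs'.2, hs'.1]⟩ ((r' - r) * t') ⟨mul_nonneg hr0 ht'.1, by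
        nlinarith [ht'.2, ht'.1]⟩)
      rw [← smul_sectorPt, add_assoc, ← add_smul, add_sub_cancel] at this
      exact this
    · intro r hr hP
      have hc : Tendsto (fun r' : ℝ => a + r' • sectorPt k s' t') (𝓝[<] r)
          (𝓝 (a + r • sectorPt k s' t')) :=
        ((by fun_prop : Continuous fun r' : ℝ => a + r' • sectorPt k s' t').tendsto r).mono_left
          nhdsWithin_le_nhds
      refine hK.mem_of_tendsto hc ?_
      filter_upwards [Ico_mem_nhdsLT hr.1] with r' hr'
      exact hP r' hr'
  simpa using key 1 ⟨zero_le_one, le_rfl⟩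

/-- A singular segment of a flat that lies in an apartment is a singular segment there. -/
lemma flat_ray (hB : B.IsBuilding) {J : Plane → Y} (hJ : IsFlat B J) {A : B.Piece}
    {g : Plane → Y} (h : Chart B A g) {a : Plane} {k : Fin 6} {R : ℝ} (hR : 0 < R)
    (hA : ∀ s ∈ Icc 0 R, J (a + s • ray k) ∈ B.carrier A) :
    ∃ u j, ∀ s ∈ Icc 0 R, J (a + s • ray k) = g (u + s • ray j) := by
  have : ∀ s : ℝ, ∃ w, s ∈ Icc 0 R → g w = J (a + s • ray k) := fun s => by
    by_cases hs : s ∈ Icc 0 R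
    · obtain ⟨w, hw⟩ := h.exists_eq (hA s hs)
      exact ⟨w, fun _ => hw⟩
    · exact ⟨0, fun h => absurd h hs⟩
  choose f hf using this
  have h0 : (0 : ℝ) ∈ Icc 0 R := ⟨le_rfl, hR.le⟩
  have hgerm : B.carrier A ∈ (facetFilter a (ray k)).map J := by
    refine mem_of_superset (image_mem_map (segment_mem_facetFilter a k hR)) ?_
    rintro _ ⟨_, ⟨s, hs, rfl⟩, rfl⟩
    exact hA s ⟨hs.1.le, hs.2⟩
  -- The flat carries the germ of the ray to a facet inside the apartment; read in the chart, an
  -- isometric curve whose germ is a facet must be singular.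
  obtain ⟨y, b, hyb⟩ := h.exists_facet (hJ.facets _ (facetFilter_mem_planeFacets _ _)) hgerm
  obtain ⟨hy, j, hj⟩ := exists_ray_of_facet (f := f) (k := k) hR
    (fun s hs t ht => by
      rw [hB.dist_eq_of_flat hJ h (hf s hs).symm (hf t ht).symm, dist_ray_curve])
    (y := y) (a := b) (fun δ hδ => by
      have := image_mem_map (m := J) (segment_mem_facetFilter a k hδ.1)
      rw [hyb, Filter.mem_map] at this
      refine mem_of_superset this ?_
      rintro z ⟨_, ⟨s, hs, rfl⟩, hz⟩
      refine ⟨s, hs, h.inj ?_⟩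
      rw [hf s ⟨hs.1.le, hs.2.trans hδ.2⟩, ← hz])
  exact ⟨f 0, j, fun s hs => by rw [← hj s hs, hf s hs]⟩

/-- A parallelogram of a flat that has two opposite corners in an apartment is given by a chart of
the apartment. -/
lemma exists_chart_parallelogram (hB : B.IsBuilding) {J : Plane → Y} (hJ : IsFlat B J)
    {A : B.Piece} {a : Plane} {k : Fin 6} {s t : ℝ} (hs : 0 < s) (ht : 0 < t)
    (h1 : J a ∈ B.carrier A) (h2 : J (a + sectorPt k s t) ∈ B.carrier A) :
    ∃ g, Chart B A g ∧ ∀ s' ∈ Icc 0 s, ∀ t' ∈ Icc 0 t,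
      J (a + sectorPt k s' t') = g (a + sectorPt k s' t') := by
  obtain ⟨g, h⟩ := hB.exists_chart A
  have hull := fun s' hs' t' ht' => hB.flat_hull hJ hs ht h1 h2 (s' := s') hs' (t' := t') ht'
  have hs0 : (0 : ℝ) ∈ Icc 0 s := ⟨le_rfl, hs.le⟩
  have ht0 : (0 : ℝ) ∈ Icc 0 t := ⟨le_rfl, ht.le⟩
  have hss : s ∈ Icc 0 s := ⟨hs.le, le_rfl⟩
  have htt : t ∈ Icc 0 t := ⟨ht.le, le_rfl⟩
  have p1 : ∀ s : ℝ, sectorPt k s 0 = s • ray k := fun s => by simp [sectorPt]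
  have p2 : ∀ s : ℝ, sectorPt k 0 s = s • ray (k + 1) := fun s => by simp [sectorPt]
  obtain ⟨u, j, hj⟩ := hB.flat_ray hJ h hs fun s' hs' => by
    rw [← p1]; exact hull s' hs' 0 ht0
  obtain ⟨u', j', hj'⟩ := hB.flat_ray hJ h ht fun t' ht' => by
    rw [← p2]; exact hull 0 hs0 t' ht'
  have huu : u' = u := by
    have e1 := hj 0 hs0
    have e2 := hj' 0 ht0
    simp only [zero_smul, add_zero] at e1 e2
    exact h.inj (e2.symm.trans e1)
  subst huu
  -- The distance of the two end points is preserved, so the angle of 60 degrees is, and only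
  -- neighbouring rays have inner product 3.
  have hjj : j' = j + 1 ∨ j' = j - 1 := by
    have hd := hB.dist_eq_of_flat hJ h (hj s hss) (hj' t htt)
    rw [dist_add_left, dist_add_left, dist_eq_norm, dist_eq_norm] at hd
    have hd2 : ‖s • ray j - t • ray j'‖ ^ 2 = ‖s • ray k - t • ray (k + 1)‖ ^ 2 := by rw [hd]
    have ex : ∀ i i' : Fin 6, ‖s • ray i - t • ray i'‖ ^ 2 =
        s ^ 2 * 6 - 2 * (s * t * inner ℝ (ray i) (ray i')) + t ^ 2 * 6 := by
      intro i i'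
      have e1 : inner ℝ (s • ray i) (t • ray i') = s * t * inner ℝ (ray i) (ray i') := by
        rw [inner_smul_plane, real_inner_comm, inner_smul_plane, real_inner_comm]
        ring
      rw [norm_sub_sq_real, e1, norm_smul, norm_smul, mul_pow, mul_pow, norm_sq_ray, norm_sq_ray,
        Real.norm_eq_abs, Real.norm_eq_abs, sq_abs, sq_abs]
    rw [ex, ex, inner_ray_succ] at hd2
    have hst : s * t ≠ 0 := (mul_pos hs ht).ne'
    refine inner_ray_eq_three (mul_left_cancel₀ hst ?_)
    linarith
  obtain ⟨L, hL, l1, l2⟩ := exists_aut k j j' hjj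
  have hg' : Chart B A (g ∘ ((fun v => u' + v) ∘ L ∘ fun v => -a + v)) :=
    h.comp_aut ((isAut_add u').comp (hL.comp (isAut_add (-a))))
  have hval : ∀ v, (g ∘ ((fun v => u' + v) ∘ L ∘ fun v => -a + v)) (a + v) = g (u' + L v) :=
    fun v => by simp
  refine ⟨_, hg', fun s' hs' t' ht' => ?_⟩
  -- The adjusted chart agrees with the flat at three corners; the remaining points are determined
  -- by their distances to these.
  obtain ⟨w, hw⟩ := hg'.exists_eq (hull s' hs' t' ht')
  have c0 : J a = (g ∘ ((fun v => u' + v) ∘ L ∘ fun v => -a + v)) a := by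
    have := hj 0 hs0
    have h3 := hval 0
    simp only [zero_smul, add_zero, map_zero] at this h3
    rw [this, h3]
  have c1 : J (a + s • ray k) = (g ∘ ((fun v => u' + v) ∘ L ∘ fun v => -a + v)) (a + s • ray k) := by
    rw [hj s hss, hval, map_smul, l1]
  have c2 : J (a + t • ray (k + 1)) =
      (g ∘ ((fun v => u' + v) ∘ L ∘ fun v => -a + v)) (a + t • ray (k + 1)) := by
    rw [hj' t htt, hval, map_smul, l2]
  rw [← hw, eq_of_dist_eq hs.ne' ht.ne' (hB.dist_eq_of_flat hJ hg' hw.symm c0)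
    (hB.dist_eq_of_flat hJ hg' hw.symm c1) (hB.dist_eq_of_flat hJ hg' hw.symm c2)]

end IsBuilding

end MetricChamberSystem

end BNR

end

/-! ### A consistent choice of types for singular directions -/

noncomputable section

namespace BNR

/-! ### The type of a singular direction -/

/-- The type of a singular direction: there are two orbits of the spherical Weyl group. -/
def rayType (k : Fin 6) : ZMod 2 := (k : ℕ)

lemma rayType_add_one (k : Fin 6) : rayType (k + 1) = rayType k + 1 := by
  revert k; decide

lemma rayType_of_adj {j j' : Fin 6} (h : j' = j + 1 ∨ j' = j - 1) :
    rayType j' = rayType j + 1 := by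
  revert j j'; decide

lemma smul_ray_inj {x : Plane} {s : ℝ} {j j' : Fin 6} (hs : 0 < s)
    (h : x + s • ray j = x + s • ray j') : j = j' :=
  ray_injective (smul_right_injective _ hs.ne' (add_left_cancel h))

/-- A surjective isometry is affine, and preserving facets it permutes the six rays. Neighbouring
rays go to neighbouring rays, so the type changes by the same amount for all of them. -/
lemma IsAut.exists_linear {D : Plane → Plane} (hD : IsAut D) :
    ∃ (L : Plane →ₗ[ℝ] Plane) (c : ZMod 2), (∀ v w, D (v + w) = D v + L w) ∧
      ∀ k, ∃ j, L (ray k) = ray j ∧ rayType j = rayType k + c := by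
  let e : Plane ≃ᵢ Plane := IsometryEquiv.mk (Equiv.ofBijective D ⟨hD.1.injective, hD.2.1⟩) hD.1
  let E := e.toRealAffineIsometryEquiv
  have hE : ∀ v, E v = D v := fun v => rfl
  let L : Plane →ₗ[ℝ] Plane := E.linearIsometryEquiv.toLinearEquiv.toLinearMap
  have hL : ∀ v w, D (v + w) = D v + L w := fun v w => by
    have := E.map_vadd v w
    rw [vadd_eq_add, vadd_eq_add, hE, hE] at this
    rw [add_comm v w, this, add_comm]
    rfl
  have hnorm : ∀ v, ‖L v‖ = ‖v‖ := fun v => E.linearIsometryEquiv.norm_map v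
  have hray : ∀ k, ∃ j, L (ray k) = ray j := by
    intro k
    obtain ⟨y, b, hyb⟩ := (hD.2.2 (facetFilter 0 (ray k))).2 (facetFilter_mem_planeFacets _ _)
    obtain ⟨-, j, hj⟩ := exists_ray_of_facet (f := fun s => D (0 + s • ray k)) (k := k) one_pos
      (fun s _ t _ => by rw [hD.1.dist_eq, dist_ray_curve]) (y := y) (a := b) (fun δ hδ => by
        rw [← hyb, ← image_image (g := D) (f := fun s : ℝ => (0 : Plane) + s • ray k)]
        exact image_mem_map (segment_mem_facetFilter 0 k hδ.1))
    have := hj 1 ⟨zero_le_one, le_rfl⟩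
    simp only [zero_smul, add_zero, one_smul, hL] at this
    exact ⟨j, add_left_cancel this⟩
  choose J hJ using hray
  have hinner : ∀ v w, inner ℝ (L v) (L w) = inner ℝ v w := fun v w =>
    E.linearIsometryEquiv.inner_map_map v w
  have hstep : ∀ k, rayType (J (k + 1)) = rayType (J k) + 1 := fun k =>
    rayType_of_adj (inner_ray_eq_three (by rw [← hJ, ← hJ, hinner, inner_ray_succ]))
  refine ⟨L, rayType (J 0), hL, fun k => ⟨J k, hJ k, ?_⟩⟩
  refine Fin.induction (motive := fun k : Fin 6 => rayType (J k) = rayType k + rayType (J 0))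
    ?_ ?_ k
  · simp [rayType]
  · intro i hi
    have e1 : i.succ = i.castSucc + 1 := by clear hi; revert i; decide
    rw [e1, hstep, hi, rayType_add_one]
    ring

/-- Near `z` the map `f` is affine in each closed sector and changes types by `c`. -/
def HasTypeShift (f : Plane → Plane) (c : ZMod 2) (z : Plane) : Prop :=
  ∀ k, ∃ ε > (0 : ℝ), ∃ j, rayType j = rayType k + c ∧
    ∀ s ∈ Icc 0 ε, f (z + s • ray k) = f z + s • ray j

lemma typeShift_unique {f : Plane → Plane} {c c' : ZMod 2} {z : Plane} {k j j' : Fin 6} {ε ε' : ℝ}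
    (hε : 0 < ε) (hε' : 0 < ε') (hj : rayType j = rayType k + c)
    (h : ∀ s ∈ Icc 0 ε, f (z + s • ray k) = f z + s • ray j) (hj' : rayType j' = rayType k + c')
    (h' : ∀ s ∈ Icc 0 ε', f (z + s • ray k) = f z + s • ray j') : c = c' := by
  have hm : 0 < min ε ε' := lt_min hε hε'
  have e1 := h _ ⟨hm.le, min_le_left _ _⟩
  rw [h' _ ⟨hm.le, min_le_right _ _⟩] at e1
  rw [← smul_ray_inj hm e1, hj'] at hj
  exact (add_left_cancel hj).symm

/-- The type shift of the local automorphisms is the same in all six sectors at a point and is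
locally constant in the point. Connectedness of the plane makes it a single constant; this will be
applied to retractions composed with charts. -/
lemma exists_typeShift {f : Plane → Plane}
    (hf : ∀ σ ∈ planeFacets, ∃ S ∈ σ, ∃ D : Plane → Plane, IsAut D ∧ ∀ v ∈ closure S, f v = D v) :
    ∃ c, ∀ z, HasTypeShift f c z := by
  have hloc : ∀ z k, ∃ ε > (0 : ℝ), ∃ (L : Plane →ₗ[ℝ] Plane) (c : ZMod 2),
      (∀ i, ∃ j, L (ray i) = ray j ∧ rayType j = rayType i + c) ∧
      ∀ s ∈ Icc 0 ε, ∀ t ∈ Icc 0 ε, f (z + sectorPt k s t) = f z + L (sectorPt k s t) := by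
    intro z k
    obtain ⟨S, hS, D, hD, e⟩ := hf _ (facetFilter_mem_planeFacets z (sectorPt k 1 1))
    obtain ⟨ε, hε, hcl⟩ := exists_sectorPt_mem_closure hS
    obtain ⟨L, c, hL, hc⟩ := hD.exists_linear
    refine ⟨ε, hε, L, c, hc, fun s hs t ht => ?_⟩
    have h0 := hcl 0 ⟨le_rfl, hε.le⟩ 0 ⟨le_rfl, hε.le⟩
    rw [sectorPt_zero, add_zero] at h0
    rw [e _ (hcl s hs t ht), e _ h0, hL]
  choose ε hε L c hLc hfe using hloc
  -- Neighbouring sectors share a ray, whose image can be read off in either one.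
  have hcs : ∀ z k, c z (k + 1) = c z k := by
    intro z k
    obtain ⟨j, hj, hj'⟩ := hLc z k (k + 1)
    obtain ⟨i, hi, hi'⟩ := hLc z (k + 1) (k + 1)
    refine typeShift_unique (f := f) (z := z) (hε z (k + 1)) (hε z k) hi' (fun s hs => ?_) hj'
      (fun s hs => ?_)
    · have := hfe z (k + 1) s hs 0 ⟨le_rfl, (hε _ _).le⟩
      simpa [sectorPt, hi] using this
    · have := hfe z k 0 ⟨le_rfl, (hε _ _).le⟩ s hs
      simpa [sectorPt, hj] using this
  have hc0 : ∀ z k, c z k = c z 0 := by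
    intro z k
    refine Fin.induction (motive := fun k : Fin 6 => c z k = c z 0) rfl (fun i hi => ?_) k
    have e1 : i.succ = i.castSucc + 1 := by clear hi; revert i; decide
    rw [e1, hcs, hi]
  have hshift : ∀ z, HasTypeShift f (c z 0) z := by
    intro z k
    obtain ⟨j, hj, hj'⟩ := hLc z k k
    refine ⟨ε z k, hε z k, j, by rw [hj', hc0], fun s hs => ?_⟩
    have := hfe z k s hs 0 ⟨le_rfl, (hε _ _).le⟩
    simpa [sectorPt, hj] using this
  have hconst : IsLocallyConstant fun z => c z 0 := by
    rw [IsLocallyConstant.iff_eventually_eq]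
    intro z
    obtain ⟨δ, hδ, hδε⟩ : ∃ δ > (0 : ℝ), ∀ k, δ ≤ ε z k := by
      refine ⟨Finset.univ.inf' Finset.univ_nonempty (ε z), ?_, fun k => Finset.inf'_le _ (by simp)⟩
      rw [gt_iff_lt, Finset.lt_inf'_iff]
      exact fun k _ => hε z k
    filter_upwards [Metric.ball_mem_nhds z hδ] with z' hz'
    obtain ⟨k, s, t, hs, ht, hst⟩ := exists_sectorPt (z' - z)
    have hn := norm_sq_sectorPt k s t
    rw [← hst, ← dist_eq_norm] at hn
    have hd : Dist.dist z' z < δ := hz'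
    have hd0 : 0 ≤ Dist.dist z' z := dist_nonneg
    have hsδ : s < δ := by nlinarith
    have htδ : t < δ := by nlinarith
    have hz : z' = z + sectorPt k s t := by rw [← hst]; abel
    obtain ⟨ε', hε', j', hj', h'⟩ := hshift z' k
    obtain ⟨j, hj, hjt⟩ := hLc z k k
    rw [← hc0 z k]
    -- Starting at the nearby point `z'`, a short segment in direction `ray k` stays in the closed
    -- sector `k` at `z`, where `f` is affine with the known shift.
    refine typeShift_unique (f := f) (z := z') hε' (sub_pos.2 (hsδ.trans_le (hδε k))) hj' h' hjt fun r hr => ?_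
    have e1 : z' + r • ray k = z + sectorPt k (s + r) t := by
      rw [hz]; simp only [sectorPt]; module
    have e2 : sectorPt k (s + r) t = sectorPt k s t + r • ray k := by
      simp only [sectorPt]; module
    rw [e1, hfe z k (s + r) ⟨by linarith [hr.1], by linarith [hr.2]⟩ t ⟨ht, (htδ.trans_le (hδε k)).le⟩,
      hz, hfe z k s ⟨hs, (hsδ.trans_le (hδε k)).le⟩ t ⟨ht, (htδ.trans_le (hδε k)).le⟩, e2, map_add,
      map_smul, hj]
    abel
  refine ⟨c 0 0, fun z => ?_⟩
  rw [← hconst.apply_eq_of_preconnectedSpace z 0]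
  exact hshift z

namespace MetricChamberSystem

variable {Y : Type u} {B : MetricChamberSystem.{u, v} Y}

/-- `par` assigns to every chart the difference between the types of its singular directions and a
consistent choice of types in the building. -/
def IsParity (B : MetricChamberSystem.{u, v} Y) (par : (Plane → Y) → ZMod 2) : Prop :=
  ∀ ⦃A A' : B.Piece⦄ ⦃g g' : Plane → Y⦄, Chart B A g → Chart B A' g' →
    ∀ ⦃z z' : Plane⦄ ⦃k k' : Fin 6⦄ ⦃ε : ℝ⦄, 0 < ε →
    (∀ s ∈ Icc 0 ε, g (z + s • ray k) = g' (z' + s • ray k')) →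
    rayType k + par g = rayType k' + par g'

/-- The parity of a chart is the type shift of a fixed retraction composed with it. Two charts that
parametrize the same singular segment have the same image under the retraction, and its type can be
computed either way. -/
lemma IsBuilding.exists_parity (hB : B.IsBuilding) : ∃ par, IsParity B par := by
  classical
  by_cases hne : Nonempty B.Piece
  swap
  · exact ⟨fun _ => 0, fun A => (hne ⟨A⟩).elim⟩
  obtain ⟨A₀⟩ := hne
  obtain ⟨g₀, h₀⟩ := hB.exists_chart A₀
  obtain ⟨ρ, hρ⟩ := hB.exists_retraction h₀ 0 0
  have hex : ∀ ⦃A g⦄, Chart B A g → ∃ c, ∀ z, HasTypeShift (ρ ∘ g) c z := fun A g h =>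
    exists_typeShift fun σ hσ => hB.retraction_local h₀ h hρ hσ
  refine ⟨fun g => if h : ∃ c, ∀ z, HasTypeShift (ρ ∘ g) c z then h.choose else 0, ?_⟩
  intro A A' g g' h h' z z' k k' ε hε he
  simp only [dif_pos (hex h), dif_pos (hex h')]
  obtain ⟨δ, hδ, j, hj, e⟩ := (hex h).choose_spec z k
  obtain ⟨δ', hδ', j', hj', e'⟩ := (hex h').choose_spec z' k'
  have hm : 0 < min ε (min δ δ') := lt_min hε (lt_min hδ hδ')
  have e1 := e _ ⟨hm.le, (min_le_right _ _).trans (min_le_left _ _)⟩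
  have e2 := e' _ ⟨hm.le, (min_le_right _ _).trans (min_le_right _ _)⟩
  have e3 := he _ ⟨hm.le, min_le_left _ _⟩
  have e4 := he 0 ⟨le_rfl, hε.le⟩
  simp only [zero_smul, add_zero] at e4
  simp only [Function.comp_apply] at e1 e2
  rw [e3, e4, e2] at e1
  rw [← hj, ← hj', smul_ray_inj hm e1]

end MetricChamberSystem

end BNR

end

/-! ### Singular rays in a building and the sectors they bound -/

noncomputable section

namespace BNR

namespace MetricChamberSystem

variable {Y : Type u} {B : MetricChamberSystem.{u, v} Y}

namespace IsBuilding

/-! ### Straight curves -/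

/-- A straight segment of a flat that lies in an apartment is straight there. -/
lemma flat_straight (hB : B.IsBuilding) {J : Plane → Y} (hJ : IsFlat B J) {A : B.Piece}
    {g : Plane → Y} (h : Chart B A g) {w d u d' : Plane} {ε R : ℝ} (hε : 0 < ε) (hεR : ε ≤ R)
    (hA : ∀ s ∈ Icc 0 R, J (w + s • d) ∈ B.carrier A)
    (he : ∀ s ∈ Icc 0 ε, J (w + s • d) = g (u + s • d')) :
    ∀ s ∈ Icc 0 R, J (w + s • d) = g (u + s • d') := by
  have : ∀ s : ℝ, ∃ w', s ∈ Icc 0 R → g w' = J (w + s • d) := fun s => by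
    by_cases hs : s ∈ Icc 0 R
    · obtain ⟨w', hw⟩ := h.exists_eq (hA s hs)
      exact ⟨w', fun _ => hw⟩
    · exact ⟨0, fun h => absurd h hs⟩
  choose f hf using this
  have hs := eq_add_smul_of_dist (f := f) (c := ‖d‖) (hε.trans_le hεR) fun s hs t ht => by
    rw [hB.dist_eq_of_flat hJ h (hf s hs).symm (hf t ht).symm, dist_ray_curve]
  have hu : ∀ s ∈ Icc 0 ε, f s = u + s • d' := fun s hs =>
    h.inj ((hf s ⟨hs.1, hs.2.trans hεR⟩).trans (he s hs))
  have h0 := hu 0 ⟨le_rfl, hε.le⟩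
  have h1 := hu ε ⟨hε.le, le_rfl⟩
  rw [zero_smul, add_zero] at h0
  rw [hs ε ⟨hε.le, hεR⟩, h0] at h1
  have h2 := smul_right_injective _ hε.ne' (add_left_cancel h1)
  intro s hsR
  rw [← hf s hsR, hs s hsR, h0, h2]

/-- Two curves that start in nearly opposite directions and lie in an apartment can be moved to any
apartment that contains their ends. -/
lemma transfer_opposite (hB : B.IsBuilding) {k : Fin 6} {a b a' b' : ℝ} (ha : 0 ≤ a) (hb : 0 ≤ b)
    (ha' : 0 ≤ a') (hb' : 0 ≤ b') (haa : 0 < a + a') (hbb : 0 < b + b') {A A' : B.Piece}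
    {g : Plane → Y} (h : Chart B A g) {σ τ : ℝ} (hσ : 0 < σ) (hτ : 0 < τ)
    (h1 : g (σ • -sectorPt k a b) ∈ B.carrier A') (h2 : g (τ • sectorPt k a' b') ∈ B.carrier A') :
    ∃ g', Chart B A' g' ∧ (∀ s ∈ Icc 0 σ, g (s • -sectorPt k a b) = g' (s • -sectorPt k a b)) ∧
      ∀ s ∈ Icc 0 τ, g (s • sectorPt k a' b') = g' (s • sectorPt k a' b') := by
  have pos : ∀ p q : ℝ, 0 ≤ p → 0 ≤ q → 0 < p + q → 0 < σ * p + τ * q := by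
    intro p q hp hq hpq
    rcases hp.eq_or_lt with rfl | hp
    · rw [zero_add] at hpq; positivity
    · positivity
  -- The two end points are opposite corners of a nondegenerate parallelogram containing both
  -- segments, so `exists_chart_parallelogram` provides the chart.
  have e2 : τ • sectorPt k a' b' =
      σ • -sectorPt k a b + sectorPt k (σ * a + τ * a') (σ * b + τ * b') := by
    simp only [sectorPt]; module
  rw [e2] at h2
  obtain ⟨g', hg', e⟩ := hB.exists_chart_parallelogram h.isFlat (pos a a' ha ha' haa)
    (pos b b' hb hb' hbb) h1 h2
  refine ⟨g', hg', fun s hs => ?_, fun s hs => ?_⟩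
  · have := e ((σ - s) * a) ⟨mul_nonneg (by linarith [hs.2]) ha, by nlinarith [hs.1]⟩
      ((σ - s) * b) ⟨mul_nonneg (by linarith [hs.2]) hb, by nlinarith [hs.1]⟩
    rwa [show σ • -sectorPt k a b + sectorPt k ((σ - s) * a) ((σ - s) * b) = s • -sectorPt k a b by
      simp only [sectorPt]; module] at this
  · have := e (σ * a + s * a') ⟨by nlinarith [hs.1], by nlinarith [hs.2]⟩
      (σ * b + s * b') ⟨by nlinarith [hs.1], by nlinarith [hs.2]⟩
    rwa [show σ • -sectorPt k a b + sectorPt k (σ * a + s * a') (σ * b + s * b') =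
      s • sectorPt k a' b' by simp only [sectorPt]; module] at this

/-- Two straight curves that start in nearly opposite directions in an apartment lie in a common
apartment. -/
lemma exists_chart_opposite (hB : B.IsBuilding) {k : Fin 6} {a b a' b' : ℝ} (ha : 0 ≤ a)
    (hb : 0 ≤ b) (ha' : 0 ≤ a') (hb' : 0 ≤ b') (haa : 0 < a + a') (hbb : 0 < b + b')
    {J₁ J₂ : Plane → Y} (h₁ : IsFlat B J₁) (h₂ : IsFlat B J₂) {ε R : ℝ} (hε : 0 < ε)
    {A : B.Piece} {g : Plane → Y} (h : Chart B A g)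
    (hst : ∀ s ∈ Icc 0 ε, J₁ (s • -sectorPt k a b) = g (s • -sectorPt k a b) ∧
      J₂ (s • sectorPt k a' b') = g (s • sectorPt k a' b')) :
    ∃ A' g', Chart B A' g' ∧ ∀ s ∈ Icc 0 R,
      J₁ (s • -sectorPt k a b) = g' (s • -sectorPt k a b) ∧
      J₂ (s • sectorPt k a' b') = g' (s • sectorPt k a' b') := by
  rcases le_total R ε with hR | hR
  · exact ⟨A, g, h, fun s hs => hst s ⟨hs.1, hs.2.trans hR⟩⟩
  set d₁ := -sectorPt k a b with hd₁
  set d₂ := sectorPt k a' b' with hd₂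
  have transfer : ∀ {A A' : B.Piece} {g : Plane → Y} {σ τ : ℝ}, Chart B A g → 0 < σ → 0 < τ →
      (∀ s ∈ Icc 0 σ, J₁ (s • d₁) = g (s • d₁)) → (∀ s ∈ Icc 0 τ, J₂ (s • d₂) = g (s • d₂)) →
      J₁ (σ • d₁) ∈ B.carrier A' → J₂ (τ • d₂) ∈ B.carrier A' → ∃ g', Chart B A' g' ∧
      (∀ s ∈ Icc 0 σ, J₁ (s • d₁) = g' (s • d₁)) ∧ ∀ s ∈ Icc 0 τ, J₂ (s • d₂) = g' (s • d₂) := by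
    intro A A' g σ τ h hσ hτ e1 e2 m1 m2
    rw [e1 σ ⟨hσ.le, le_rfl⟩] at m1
    rw [e2 τ ⟨hτ.le, le_rfl⟩] at m2
    obtain ⟨g', hg', f1, f2⟩ := hB.transfer_opposite ha hb ha' hb' haa hbb h hσ hτ m1 m2
    exact ⟨g', hg', fun s hs => (e1 s hs).trans (f1 s hs), fun s hs => (e2 s hs).trans (f2 s hs)⟩
  have extend : ∀ {J : Plane → Y} {A : B.Piece} {g : Plane → Y} {d : Plane} {σ σ' : ℝ}, IsFlat B J →
      Chart B A g → 0 < σ → σ ≤ σ' → (∀ s ∈ Icc 0 σ, J (s • d) = g (s • d)) →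
      (∀ s ∈ Icc σ σ', J (s • d) ∈ B.carrier A) → ∀ s ∈ Icc 0 σ', J (s • d) = g (s • d) := by
    intro J A g d σ σ' hJ h hσ hσ' e hA
    have := hB.flat_straight hJ h (w := 0) (u := 0) (d := d) (d' := d) hσ hσ' (fun s hs => by
      rw [zero_add]
      rcases le_total s σ with hl | hl
      · rw [e s ⟨hs.1, hl⟩]; exact h.mem _
      · exact hA s ⟨hl, hs.2⟩) (by simpa only [zero_add] using e)
    simpa only [zero_add] using this
  suffices key : ∀ σ ∈ Icc ε R, ∃ A' g', Chart B A' g' ∧ ∀ s ∈ Icc 0 σ,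
      J₁ (s • d₁) = g' (s • d₁) ∧ J₂ (s • d₂) = g' (s • d₂) from key R ⟨hR, le_rfl⟩
  refine interval_induction hR ⟨A, g, h, hst⟩ ?_ ?_
  · intro σ hσ hP
    have hσ0 : 0 < σ := hε.trans_le hσ.1
    obtain ⟨A₀, g₀, hg₀, e₀⟩ := hP σ ⟨hσ.1, le_rfl⟩
    -- The curves are prolonged one after the other: first an apartment with the forward germ of
    -- `J₁` and the end of `J₂`, then one with the forward germ of `J₂` and the prolonged end of
    -- `J₁`. After each change the earlier parts are transferred.
    obtain ⟨A₁, m₁, n₁⟩ := hB.common _ (h₁.facets _ (facetFilter_mem_planeFacets (σ • d₁) d₁)) _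
      (h₂.facets _ (pure_mem_planeFacets (σ • d₂)))
    obtain ⟨ε₁, hε₁, i₁⟩ := hB.exists_Icc_of_germ h₁ m₁ (self_mem_vectorFacet _)
    have i₁' : ∀ s ∈ Icc σ (σ + ε₁), J₁ (s • d₁) ∈ B.carrier A₁ := fun s hs => by
      have := i₁ (s - σ) ⟨by linarith [hs.1], by linarith [hs.2]⟩
      rwa [← add_smul, add_sub_cancel] at this
    obtain ⟨g₁, hg₁, e₁, f₁⟩ := transfer (A' := A₁) hg₀ hσ0 hσ0 (fun s hs => (e₀ s hs).1)
      (fun s hs => (e₀ s hs).2) (i₁' σ ⟨le_rfl, by linarith⟩) (by simpa using n₁)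
    have e₁' := extend h₁ hg₁ hσ0 (by linarith) e₁ i₁'
    obtain ⟨A₂, m₂, n₂⟩ := hB.common _ (h₂.facets _ (facetFilter_mem_planeFacets (σ • d₂) d₂)) _
      (h₁.facets _ (pure_mem_planeFacets ((σ + ε₁) • d₁)))
    obtain ⟨ε₂, hε₂, i₂⟩ := hB.exists_Icc_of_germ h₂ m₂ (self_mem_vectorFacet _)
    have i₂' : ∀ s ∈ Icc σ (σ + ε₂), J₂ (s • d₂) ∈ B.carrier A₂ := fun s hs => by
      have := i₂ (s - σ) ⟨by linarith [hs.1], by linarith [hs.2]⟩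
      rwa [← add_smul, add_sub_cancel] at this
    obtain ⟨g₂, hg₂, e₂, f₂⟩ := transfer (A' := A₂) hg₁ (by linarith) hσ0 e₁' f₁
      (by simpa using n₂) (i₂' σ ⟨le_rfl, by linarith⟩)
    have f₂' := extend h₂ hg₂ hσ0 (by linarith) f₂ i₂'
    refine ⟨min ε₁ ε₂, lt_min hε₁ hε₂, fun s hs _ => ⟨A₂, g₂, hg₂, fun s' hs' => ⟨e₂ s' ⟨hs'.1, ?_⟩,
      f₂' s' ⟨hs'.1, ?_⟩⟩⟩⟩
    · linarith [hs'.2, hs.2, min_le_left ε₁ ε₂]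
    · linarith [hs'.2, hs.2, min_le_right ε₁ ε₂]
  · intro σ hσ hP
    -- At a limit parameter the apartment is chosen to contain both backward germs, hence both
    -- curves on a whole interval before `σ`; a chart that works just before `σ` is transferred to
    -- it.
    obtain ⟨A₁, m₁, n₁⟩ := hB.common _ (h₁.facets _ (facetFilter_mem_planeFacets (σ • d₁) (-d₁))) _
      (h₂.facets _ (facetFilter_mem_planeFacets (σ • d₂) (-d₂)))
    obtain ⟨ε₁, hε₁, i₁⟩ := hB.exists_Icc_of_germ h₁ m₁ (self_mem_vectorFacet _)
    obtain ⟨ε₂, hε₂, i₂⟩ := hB.exists_Icc_of_germ h₂ n₁ (self_mem_vectorFacet _)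
    have i₁' : ∀ s ∈ Icc (σ - ε₁) σ, J₁ (s • d₁) ∈ B.carrier A₁ := fun s hs => by
      have := i₁ (σ - s) ⟨by linarith [hs.2], by linarith [hs.1]⟩
      rwa [show σ • d₁ + (σ - s) • -d₁ = s • d₁ by module] at this
    have i₂' : ∀ s ∈ Icc (σ - ε₂) σ, J₂ (s • d₂) ∈ B.carrier A₁ := fun s hs => by
      have := i₂ (σ - s) ⟨by linarith [hs.2], by linarith [hs.1]⟩
      rwa [show σ • d₂ + (σ - s) • -d₂ = s • d₂ by module] at this
    set σ' := max ε (σ - min ε₁ ε₂) with hσ'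
    have hm : 0 < min ε₁ ε₂ := lt_min hε₁ hε₂
    have hlt : σ' < σ := max_lt hσ.1 (by linarith)
    have hpos : 0 < σ' := hε.trans_le (le_max_left _ _)
    have hge : σ - min ε₁ ε₂ ≤ σ' := le_max_right _ _
    have hge₁ : σ - ε₁ ≤ σ' := by linarith [min_le_left ε₁ ε₂]
    have hge₂ : σ - ε₂ ≤ σ' := by linarith [min_le_right ε₁ ε₂]
    obtain ⟨A₀, g₀, hg₀, e₀⟩ := hP σ' ⟨le_max_left _ _, hlt⟩
    obtain ⟨g₁, hg₁, e₁, f₁⟩ := transfer (A' := A₁) hg₀ hpos hpos (fun s hs => (e₀ s hs).1)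
      (fun s hs => (e₀ s hs).2) (i₁' σ' ⟨hge₁, hlt.le⟩) (i₂' σ' ⟨hge₂, hlt.le⟩)
    have e₁' := extend h₁ hg₁ hpos hlt.le e₁ fun s hs => i₁' s ⟨hge₁.trans hs.1, hs.2⟩
    have f₁' := extend h₂ hg₁ hpos hlt.le f₁ fun s hs => i₂' s ⟨hge₂.trans hs.1, hs.2⟩
    exact ⟨A₁, g₁, hg₁, fun s hs => ⟨e₁' s hs, f₁' s hs⟩⟩

end IsBuilding

/-! ### Singular rays -/

/-- A singular ray of type `m`. -/
def IsRay (B : MetricChamberSystem.{u, v} Y) (par : (Plane → Y) → ZMod 2) (m : ZMod 2)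
    (r : ℝ → Y) : Prop :=
  ∀ R : ℝ, ∃ A g, Chart B A g ∧ par g = m ∧ ∀ s ∈ Icc 0 R, r s = g (s • ray 0)

/-- Two rays that bound a sector. -/
def FlatPair (B : MetricChamberSystem.{u, v} Y) (r r' : ℝ → Y) : Prop :=
  ∀ R : ℝ, ∃ A g, Chart B A g ∧ ∀ s ∈ Icc 0 R, r s = g (s • ray 0) ∧ r' s = g (s • ray 1)

lemma FlatPair.symm {r r' : ℝ → Y} (h : FlatPair B r r') : FlatPair B r' r := by
  intro R
  obtain ⟨A, g, hg, e⟩ := h R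
  obtain ⟨L, hL, hLr⟩ := exists_reflection 1
  refine ⟨A, g ∘ L, hg.comp_aut hL, fun s hs => ⟨?_, ?_⟩⟩
  · rw [(e s hs).2, Function.comp_apply, map_smul, hLr]; rfl
  · rw [(e s hs).1, Function.comp_apply, map_smul, hLr]; rfl

/-- Exchanging the two sides of the sector by a reflection changes the parity of the chart by one.
-/
lemma FlatPair.isRay {par : (Plane → Y) → ZMod 2} (hpar : IsParity B par) {r r' : ℝ → Y}
    (h : FlatPair B r r') {m : ZMod 2} (hr : IsRay B par m r) : IsRay B par (m + 1) r' := by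
  -- The parity of a chart along `r` is already determined by an initial segment, so all the charts
  -- for different `R` have the same one.
  have hm : ∀ A g, Chart B A g → (∀ s ∈ Icc (0 : ℝ) 1, r s = g (s • ray 0)) → par g = m := by
    intro A g hg e
    obtain ⟨A', g', hg', hm, e'⟩ := hr 1
    have := hpar hg hg' one_pos (z := 0) (z' := 0) (k := 0) (k' := 0)
      (fun s hs => by rw [zero_add, ← e s hs, ← e' s hs])
    rw [← hm]
    exact add_left_cancel this
  intro R
  obtain ⟨A, g, hg, e⟩ := h (max R 1)
  have hgm := hm A g hg fun s hs => (e s ⟨hs.1, hs.2.trans (le_max_right _ _)⟩).1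
  obtain ⟨L, hL, hLr⟩ := exists_reflection 1
  refine ⟨A, g ∘ L, hg.comp_aut hL, ?_, fun s hs => ?_⟩
  · have := hpar (hg.comp_aut hL) hg one_pos (z := 0) (z' := 0) (k := 0) (k' := 1) (fun s hs => by
      rw [zero_add, zero_add, Function.comp_apply, map_smul, hLr]; rfl)
    rw [hgm] at this
    have t0 : rayType 0 = 0 := rfl
    have t1 : rayType 1 = 1 := rfl
    rw [t0, t1, zero_add, add_comm] at this
    exact this
  · rw [(e s ⟨hs.1, hs.2.trans (le_max_left _ _)⟩).2, Function.comp_apply, map_smul, hLr]; rfl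

namespace IsBuilding

/-- The sector between the continuation of a ray and another ray based at one of its points can be
moved back along the ray. -/
lemma exists_chart_back (hB : B.IsBuilding) {r : ℝ → Y} {t S : ℝ} (ht : 0 < t) (hS : 0 < S)
    {A₁ A : B.Piece} {J g : Plane → Y} (hJ : Chart B A₁ J)
    (hr : ∀ s ∈ Icc 0 (t + S), r s = J (s • ray 0)) (h : Chart B A g)
    (e : ∀ s ∈ Icc 0 S, r (t + s) = g (s • ray 0)) :
    ∃ A' k, Chart B A' k ∧ (∀ s ∈ Icc 0 (t + S), r s = k (s • ray 0)) ∧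
      ∀ s ∈ Icc 0 S, k (t • ray 0 + s • ray 1) = g (s • ray 1) := by
  -- The ray is straight in `J`. So a chart in which it continues past `t` along `ray 0` also sees
  -- the part before `t` along the same line, as far as that part lies in the apartment.
  have back : ∀ {A' : B.Piece} {k : Plane → Y} {ε ε' : ℝ}, Chart B A' k → 0 < ε → ε ≤ S →
      ε' ∈ Icc 0 t → (∀ s ∈ Icc 0 ε, r (t + s) = k (s • ray 0)) →
      (∀ s ∈ Icc 0 ε', r (t - s) ∈ B.carrier A') →
      ∀ s ∈ Icc (t - ε') (t + ε), r s = k ((s - t) • ray 0) := by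
    intro A' k ε ε' hk hε hεS hε' e1 e2 s hs
    have hc : ∀ s ∈ Icc 0 (ε + ε'), J ((t + ε) • ray 0 + s • -ray 0) = r (t + ε - s) := by
      intro s hs
      rw [hr _ ⟨by linarith [hs.2, hε'.2], by linarith [hs.1]⟩]
      congr 1
      module
    have := hB.flat_straight hJ.isFlat hk (w := (t + ε) • ray 0) (d := -ray 0) (u := ε • ray 0)
      (d' := -ray 0) (R := ε + ε') hε (by linarith [hε'.1]) (fun s hs => by
        rw [hc s hs]
        rcases le_total s ε with hl | hl
        · rw [add_sub_assoc, e1 _ ⟨by linarith, by linarith [hs.1]⟩]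
          exact hk.mem _
        · rw [show t + ε - s = t - (s - ε) by ring]
          exact e2 _ ⟨by linarith, by linarith [hs.2]⟩) (fun s hs => by
        rw [hc s ⟨hs.1, by linarith [hs.2, hε'.1]⟩, add_sub_assoc,
          e1 _ ⟨by linarith [hs.2], by linarith [hs.1]⟩]
        congr 1
        module) (t + ε - s) ⟨by linarith [hs.2], by linarith [hs.1]⟩
    rw [hc _ ⟨by linarith [hs.2], by linarith [hs.1]⟩, sub_sub_cancel] at this
    rw [this]
    congr 1
    module
  -- An apartment that contains the chamber germ of the sector at `r t` and the germ of the ray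
  -- pointing backwards.
  obtain ⟨A₂, g₂, h₂, ⟨T, hT, e₂⟩, m₂⟩ := hB.exists_chart_common h
    (facetFilter_mem_planeFacets 0 (sectorPt 0 1 1))
    (hJ.isFlat.facets _ (facetFilter_mem_planeFacets (t • ray 0) (-ray 0)))
  obtain ⟨ε, hε, hcl⟩ := exists_sectorPt_mem_closure hT
  obtain ⟨ε', hε', i₂⟩ := hB.exists_Icc_of_germ hJ.isFlat m₂ (self_mem_vectorFacet _)
  have e₂' : ∀ s ∈ Icc 0 ε, ∀ s' ∈ Icc 0 ε, g₂ (sectorPt 0 s s') = g (sectorPt 0 s s') :=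
    fun s hs s' hs' => by simpa using e₂ (hcl s hs s' hs')
  have hray : ∀ s : ℝ, sectorPt 0 s 0 = s • ray 0 := fun s => by simp [sectorPt]
  have hm : 0 < min ε S := lt_min hε hS
  have hm' : 0 < min ε' t := lt_min hε' ht
  have b₂ := back (ε := min ε S) (ε' := min ε' t) h₂ hm (min_le_right _ _)
    ⟨hm'.le, min_le_right _ _⟩ (fun s hs => by
      rw [e s ⟨hs.1, hs.2.trans (min_le_right _ _)⟩, ← hray,
        e₂' s ⟨hs.1, hs.2.trans (min_le_left _ _)⟩ 0 ⟨le_rfl, hε.le⟩]) (fun s hs => by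
      have := i₂ s ⟨hs.1, hs.2.trans (min_le_left _ _)⟩
      rw [hr _ ⟨by linarith [hs.2, min_le_right ε' t], by linarith [hs.1]⟩]
      rwa [smul_neg, ← sub_eq_add_neg, ← sub_smul] at this)
  have hJt : Chart B A₁ (J ∘ fun v => t • ray 0 + v) := hJ.comp_aut (isAut_add _)
  have hJr : ∀ s ∈ Icc (0 : ℝ) 1, (J ∘ fun v => t • ray 0 + v) (s • -sectorPt 0 t 0) =
      r (t - s * t) := fun s hs => by
    rw [hr _ ⟨by nlinarith [hs.2], by nlinarith [hs.1]⟩, hray, Function.comp_apply]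
    congr 1
    module
  have hδ : 0 < min 1 (min (min ε' t / t) (ε / S)) := by positivity
  -- The backward ray and the interior diagonal of the sector start in opposite closed sectors. They
  -- fit into one apartment at full length, and the diagonal brings the whole parallelogram with it.
  obtain ⟨A₃, g₃, h₃, e₃⟩ := hB.exists_chart_opposite (k := 0) (a := t) (b := 0) (a' := S) (b' := S)
    ht.le le_rfl hS.le hS.le (by linarith) (by linarith) hJt.isFlat h.isFlat (R := 1) hδ h₂
    (fun s hs => by
      have s1 : s ≤ 1 := hs.2.trans (min_le_left _ _)
      have s2 : s * t ≤ min ε' t := by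
        have := hs.2.trans ((min_le_right _ _).trans (min_le_left _ _))
        rwa [le_div_iff₀ ht] at this
      have s3 : s * S ≤ ε := by
        have := hs.2.trans ((min_le_right _ _).trans (min_le_right _ _))
        rwa [le_div_iff₀ hS] at this
      have s0 : 0 ≤ s * S := mul_nonneg hs.1 hS.le
      constructor
      · rw [hJr s ⟨hs.1, s1⟩, b₂ _ ⟨by linarith, by nlinarith [hs.1]⟩, hray]
        congr 1
        module
      · rw [smul_sectorPt, e₂' _ ⟨s0, s3⟩ _ ⟨s0, s3⟩])
  have m₀ : g 0 ∈ B.carrier A₃ := by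
    have := (e₃ 0 ⟨le_rfl, zero_le_one⟩).2
    rw [zero_smul] at this
    exact this ▸ h₃.mem _
  have m₁ : g (0 + sectorPt 0 S S) ∈ B.carrier A₃ := by
    have := (e₃ 1 ⟨zero_le_one, le_rfl⟩).2
    rw [one_smul] at this
    rw [zero_add, this]
    exact h₃.mem _
  obtain ⟨k, hk, ek⟩ := hB.exists_chart_parallelogram h.isFlat hS hS m₀ m₁
  simp only [zero_add] at ek
  have hS0 : (0 : ℝ) ∈ Icc 0 S := ⟨le_rfl, hS.le⟩
  have bk := back (ε := S) (ε' := t) hk hS le_rfl ⟨ht.le, le_rfl⟩ (fun s hs => by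
      rw [e s hs, ← hray, ek s hs 0 hS0]) (fun s hs => by
      have := (e₃ (s / t) ⟨div_nonneg hs.1 ht.le, (div_le_one ht).2 hs.2⟩).1
      rw [hJr _ ⟨div_nonneg hs.1 ht.le, (div_le_one ht).2 hs.2⟩, div_mul_cancel₀ _ ht.ne'] at this
      exact this ▸ h₃.mem _)
  refine ⟨A₃, k ∘ fun v => -(t • ray 0) + v, hk.comp_aut (isAut_add _), fun s hs => ?_,
    fun s hs => ?_⟩
  · rw [bk s ⟨by linarith [hs.1], hs.2⟩, Function.comp_apply]
    congr 1
    module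
  · have := ek 0 hS0 s hs
    rw [show sectorPt 0 0 s = s • ray 1 by simp [sectorPt]] at this
    rw [Function.comp_apply, neg_add_cancel_left, this]

/-- Three corners of a parallelogram, two of them opposite, determine the rest: the second apartment
contains the opposite corners, hence the first parallelogram, and a chart is fixed by three corners.
-/
lemma parallel_unique (hB : B.IsBuilding) {A₁ A₂ : B.Piece} {k₁ k₂ : Plane → Y}
    (h₁ : Chart B A₁ k₁) (h₂ : Chart B A₂ k₂) {t S : ℝ} (ht : 0 < t) (hS : 0 < S)
    (e0 : k₁ 0 = k₂ 0) (e1 : k₁ (t • ray 0) = k₂ (t • ray 0))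
    (e2 : k₁ (t • ray 0 + S • ray 1) = k₂ (t • ray 0 + S • ray 1)) {s : ℝ} (hs : s ∈ Icc 0 S) :
    k₁ (s • ray 1) = k₂ (s • ray 1) := by
  obtain ⟨k, hk, e⟩ := hB.exists_chart_parallelogram (A := A₂) (a := 0) (k := 0) h₁.isFlat ht hS
    (e0 ▸ h₂.mem _) (by
      rw [zero_add, show sectorPt 0 t S = t • ray 0 + S • ray 1 from rfl, e2]
      exact h₂.mem _)
  simp only [zero_add] at e
  have ht0 : (0 : ℝ) ∈ Icc 0 t := ⟨le_rfl, ht.le⟩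
  have htt : t ∈ Icc 0 t := ⟨ht.le, le_rfl⟩
  have hS0 : (0 : ℝ) ∈ Icc 0 S := ⟨le_rfl, hS.le⟩
  have hSS : S ∈ Icc 0 S := ⟨hS.le, le_rfl⟩
  have a0 := e 0 ht0 0 hS0
  have a1 := e t htt 0 hS0
  have a2 := e t htt S hSS
  have a3 := e 0 ht0 s hs
  rw [sectorPt_zero] at a0
  rw [show sectorPt 0 t 0 = t • ray 0 by simp [sectorPt]] at a1
  rw [show sectorPt 0 t S = t • ray 0 + S • ray 1 from rfl] at a2
  rw [show sectorPt 0 0 s = s • ray 1 by simp [sectorPt]] at a3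
  have : k = k₂ := hk.eq_of_three h₂ (x := t • ray 0) (k := 0) (s := -t) (t := S) (by linarith)
    hS.ne' (by rw [← a1, e1]) (by rw [neg_smul, add_neg_cancel, ← a0, e0])
    (by rw [zero_add, ← a2, e2])
  rw [a3, this]

/-- The point on the middle ray is the midpoint of points at twice the parameter on the outer rays.
-/
lemma bisector_unique (hB : B.IsBuilding) {A₁ A₂ : B.Piece} {k₁ k₂ : Plane → Y}
    (h₁ : Chart B A₁ k₁) (h₂ : Chart B A₂ k₂) {s : ℝ}
    (e1 : k₁ ((2 * s) • ray 0) = k₂ ((2 * s) • ray 0))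
    (e2 : k₁ ((2 * s) • ray 2) = k₂ ((2 * s) • ray 2)) : k₁ (s • ray 1) = k₂ (s • ray 1) := by
  have := hB.flat_segment h₁.isFlat h₂ e1 e2 (t := 1 / 2) ⟨by norm_num, by norm_num⟩
  rwa [show (2 * s) • ray 0 + (1 / 2 : ℝ) • ((2 * s) • ray 2 - (2 * s) • ray 0) = s • ray 1 by
    have := ray_add_two 0
    rw [zero_add, zero_add] at this
    rw [← this]; module] at this

/-- Where two rays of the same type separate, they span a flat sector of angle 120 degrees. -/
lemma exists_branch (hB : B.IsBuilding) {par : (Plane → Y) → ZMod 2} (hpar : IsParity B par)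
    {m : ZMod 2} {r r' : ℝ → Y} (hr : IsRay B par m r) (hr' : IsRay B par m r') (h0 : r 0 = r' 0)
    {s₀ : ℝ} (hs₀ : 0 ≤ s₀) (hne : r s₀ ≠ r' s₀) :
    ∃ t, 0 ≤ t ∧ (∀ s ∈ Icc 0 t, r s = r' s) ∧ ∀ R, ∃ A g, Chart B A g ∧
      ∀ s ∈ Icc 0 R, r (t + s) = g (s • ray 0) ∧ r' (t + s) = g (s • ray 2) := by
  -- The last parameter up to which the rays agree. If they never separated, `interval_induction`
  -- would carry the equality to `s₀`; the limit step compares distances.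
  obtain ⟨t, ht, htr, hbr⟩ : ∃ t, 0 ≤ t ∧ (∀ s ∈ Icc 0 t, r s = r' s) ∧
      ∀ ε > 0, ∃ s ∈ Icc t (t + ε), r s ≠ r' s := by
    by_contra hcon
    push Not at hcon
    refine hne (interval_induction (P := fun s => r s = r' s) hs₀ h0 (fun t ht hP => ?_)
      (fun t ht hP => ?_) s₀ ⟨hs₀, le_rfl⟩)
    · obtain ⟨ε, hε, h⟩ := hcon t ht.1 hP
      exact ⟨ε, hε, fun s hs _ => h s hs⟩
    · obtain ⟨A, g, hg, -, e⟩ := hr t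
      obtain ⟨A', g', hg', -, e'⟩ := hr' t
      have htt : t ∈ Icc 0 t := ⟨ht.1.le, le_rfl⟩
      obtain ⟨q, hq⟩ := hB.exists_hasDist (hg.pure_mem (t • ray 0)) (hg'.pure_mem (t • ray 0))
      have hle : ∀ s ∈ Ioo 0 t, q ≤ 2 * ((t - s) * ‖ray 0‖) := by
        intro s hs
        have h1 := hg.hasDist (t • ray 0) (s • ray 0)
        have h2 := hg'.hasDist (s • ray 0) (t • ray 0)
        have hss : s ∈ Icc 0 t := ⟨hs.1.le, hs.2.le⟩
        rw [← e' s hss, ← hP s ⟨hs.1.le, hs.2⟩, e s hss] at h2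
        have h3 := hB.hasDist_triangle h1 h2 hq
        rw [dist_comm (s • ray 0), dist_eq_norm, ← sub_smul, norm_smul,
          Real.norm_of_nonneg (by linarith [hs.2])] at h3
        linarith
      have hq0 : q ≤ 0 := by
        by_contra hq0
        push Not at hq0
        have hn := norm_ray_pos 0
        have hx : 0 < min (q / (4 * ‖ray 0‖)) (t / 2) := lt_min (by positivity) (by linarith [ht.1])
        have := hle (t - min (q / (4 * ‖ray 0‖)) (t / 2))
          ⟨by linarith [min_le_right (q / (4 * ‖ray 0‖)) (t / 2), ht.1], by linarith⟩
        rw [sub_sub_cancel] at this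
        have h5 : min (q / (4 * ‖ray 0‖)) (t / 2) * ‖ray 0‖ ≤ q / 4 :=
          calc _ ≤ q / (4 * ‖ray 0‖) * ‖ray 0‖ :=
                mul_le_mul_of_nonneg_right (min_le_left _ _) hn.le
            _ = q / 4 := by field_simp
        linarith
      have hq1 : 0 ≤ q := by
        obtain ⟨A', g', h', a, b, -, -, rfl⟩ := hB.exists_chart_of_hasDist hq
        exact dist_nonneg
      rw [le_antisymm hq0 hq1, ← e t htt, ← e' t htt] at hq
      exact hB.eq_of_hasDist_zero hq
  refine ⟨t, ht, htr, fun R => ?_⟩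
  obtain ⟨A₁, J, hJ, hJm, e⟩ := hr (t + max R 1)
  obtain ⟨A₂, J', hJ', hJm', e'⟩ := hr' (t + max R 1)
  have e1 : ∀ s ∈ Icc 0 (max R 1), r (t + s) = J (t • ray 0 + s • ray 0) := fun s hs => by
    rw [← add_smul]; exact e _ ⟨by linarith [hs.1], by linarith [hs.2]⟩
  have e1' : ∀ s ∈ Icc 0 (max R 1), r' (t + s) = J' (t • ray 0 + s • ray 0) := fun s hs => by
    rw [← add_smul]; exact e' _ ⟨by linarith [hs.1], by linarith [hs.2]⟩
  obtain ⟨A, hA, hA'⟩ := hB.common _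
    (hJ.isFlat.facets _ (facetFilter_mem_planeFacets (t • ray 0) (ray 0))) _
    (hJ'.isFlat.facets _ (facetFilter_mem_planeFacets (t • ray 0) (ray 0)))
  obtain ⟨g, hg⟩ := hB.exists_chart A
  obtain ⟨ε₁, hε₁, i₁⟩ := hB.exists_Icc_of_germ hJ.isFlat hA (self_mem_vectorFacet _)
  obtain ⟨ε₂, hε₂, i₂⟩ := hB.exists_Icc_of_germ hJ'.isFlat hA' (self_mem_vectorFacet _)
  obtain ⟨u, j, hj⟩ := hB.flat_ray hJ.isFlat hg hε₁ i₁
  obtain ⟨u', j', hj'⟩ := hB.flat_ray hJ'.isFlat hg hε₂ i₂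
  have hM : 0 < max R 1 := one_pos.trans_le (le_max_right _ _)
  set ε := min (max R 1) (min ε₁ ε₂) with hεdef
  have hε : 0 < ε := lt_min hM (lt_min hε₁ hε₂)
  have le0 : ε ≤ max R 1 := min_le_left _ _
  have le1 : ε ≤ ε₁ := (min_le_right _ _).trans (min_le_left _ _)
  have le2 : ε ≤ ε₂ := (min_le_right _ _).trans (min_le_right _ _)
  have f1 : ∀ s ∈ Icc 0 ε, r (t + s) = g (u + s • ray j) := fun s hs => by
    rw [e1 s ⟨hs.1, hs.2.trans le0⟩, hj s ⟨hs.1, hs.2.trans le1⟩]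
  have f2 : ∀ s ∈ Icc 0 ε, r' (t + s) = g (u' + s • ray j') := fun s hs => by
    rw [e1' s ⟨hs.1, hs.2.trans le0⟩, hj' s ⟨hs.1, hs.2.trans le2⟩]
  have hu : u' = u := by
    have a1 := f1 0 ⟨le_rfl, hε.le⟩
    have a2 := f2 0 ⟨le_rfl, hε.le⟩
    simp only [zero_smul, add_zero] at a1 a2
    exact hg.inj (by rw [← a1, ← a2, htr t ⟨ht, le_rfl⟩])
  subst hu
  have hjj : j ≠ j' := by
    rintro rfl
    obtain ⟨s, hs, hsne⟩ := hbr ε hε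
    have hs' : s - t ∈ Icc 0 ε := ⟨by linarith [hs.1], by linarith [hs.2]⟩
    have a1 := f1 _ hs'
    have a2 := f2 _ hs'
    rw [add_sub_cancel] at a1 a2
    exact hsne (a1.trans a2.symm)
  -- Here the equal types of the rays enter. Distinct directions of equal type differ by two steps,
  -- so the angle after separation is 120 degrees and never 60 or 180.
  have hty : rayType j = rayType j' := by
    have p1 := hpar hJ hg hε (z := t • ray 0) (z' := u') (k := 0) (k' := j)
      fun s hs => hj s ⟨hs.1, hs.2.trans le1⟩
    have p2 := hpar hJ' hg hε (z := t • ray 0) (z' := u') (k := 0) (k' := j')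
      fun s hs => hj' s ⟨hs.1, hs.2.trans le2⟩
    rw [hJm] at p1
    rw [hJm', p1] at p2
    exact add_right_cancel p2
  obtain ⟨L, hL, l0, l2⟩ : ∃ L : Plane →ₗ[ℝ] Plane, IsAut L ∧ L (ray 0) = ray j ∧
      L (ray 2) = ray j' := by
    have hcase : ∀ j j' : Fin 6, j ≠ j' → rayType j = rayType j' → j' = j + 2 ∨ j = j' + 2 := by
      decide
    have hr2 : ray 2 = ray 1 - ray 0 := by
      have := ray_add_two 0
      rw [zero_add, zero_add] at this
      rw [← this, add_sub_cancel_left]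
    rcases hcase j j' hjj hty with rfl | rfl
    · obtain ⟨L, hL, l0, l1⟩ := exists_aut 0 j (j + 1) (Or.inl rfl)
      refine ⟨L, hL, l0, ?_⟩
      rw [zero_add] at l1
      rw [hr2, map_sub, l0, l1, ← ray_add_two j, add_sub_cancel_left]
    · obtain ⟨L, hL, l0, l1⟩ := exists_aut 0 (j' + 2) (j' + 1) (Or.inr (by abel_nf; rfl))
      refine ⟨L, hL, l0, ?_⟩
      rw [zero_add] at l1
      rw [hr2, map_sub, l0, l1, ← ray_add_two j', add_sub_cancel_right]
  have hg₁ : Chart B A (g ∘ ((fun v => u' + v) ∘ L)) := hg.comp_aut ((isAut_add u').comp hL)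
  -- Directions at 120 degrees lie on the boundaries of opposite closed sectors, which is the
  -- degenerate case still allowed in `exists_chart_opposite`.
  have d1 : ray 0 = -sectorPt 2 0 1 := by
    have := ray_add_three 0
    rw [zero_add] at this
    rw [sectorPt, zero_smul, one_smul, zero_add, show (2 : Fin 6) + 1 = 3 from rfl, this, neg_neg]
  have d2 : ray 2 = sectorPt 2 1 0 := by simp [sectorPt]
  -- The second ray is given along `ray 0` in its own chart; rotation by four steps makes it the
  -- curve along `ray 2`.
  obtain ⟨M, hM', hMr⟩ := exists_rotation 4
  obtain ⟨A', g', hg', e₃⟩ := hB.exists_chart_opposite (k := 2) (a := 0) (b := 1) (a' := 1) (b' := 0)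
    le_rfl zero_le_one zero_le_one le_rfl (by norm_num) (by norm_num)
    (hJ.comp_aut (isAut_add (t • ray 0))).isFlat
    (hJ'.comp_aut ((isAut_add (t • ray 0)).comp hM')).isFlat (R := max R 1) hε hg₁ (by
      rw [← d1, ← d2]
      intro s hs
      constructor
      · simp only [Function.comp_apply, map_smul, l0]
        exact hj s ⟨hs.1, hs.2.trans le1⟩
      · simp only [Function.comp_apply, map_smul, l2, hMr]
        exact hj' s ⟨hs.1, hs.2.trans le2⟩)
  rw [← d1, ← d2] at e₃
  refine ⟨A', g', hg', fun s hs => ?_⟩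
  have hs' : s ∈ Icc 0 (max R 1) := ⟨hs.1, hs.2.trans (le_max_left _ _)⟩
  obtain ⟨a1, a2⟩ := e₃ s hs'
  simp only [Function.comp_apply, map_smul, hMr] at a1 a2
  exact ⟨by rw [e1 s hs', a1], by rw [e1' s hs', ← a2]; rfl⟩

/-- Two rays of the same type with the same origin bound sectors with a common third ray. -/
theorem exists_common_neighbour (hB : B.IsBuilding) {par : (Plane → Y) → ZMod 2}
    (hpar : IsParity B par) {m : ZMod 2} {r r' : ℝ → Y} (hr : IsRay B par m r)
    (hr' : IsRay B par m r') (h0 : r 0 = r' 0) (hn : ∃ q, FlatPair B r q) :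
    ∃ q, FlatPair B r q ∧ FlatPair B r' q := by
  -- Only for equal rays must a neighbour be supplied by `hn`; otherwise it is constructed.
  by_cases hne : ∀ s, 0 ≤ s → r s = r' s
  · obtain ⟨q, hq⟩ := hn
    refine ⟨q, hq, fun R => ?_⟩
    obtain ⟨A, g, hg, e⟩ := hq R
    exact ⟨A, g, hg, fun s hs => ⟨by rw [← hne s hs.1, (e s hs).1], (e s hs).2⟩⟩
  push Not at hne
  obtain ⟨s₀, hs₀, hne⟩ := hne
  obtain ⟨t, ht, htr, hch⟩ := hB.exists_branch hpar hr hr' h0 hs₀ hne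
  choose A g hg e using hch
  obtain ⟨L, hL, hLr⟩ := exists_reflection 2
  -- The bisectors seen in the charts for different lengths fit together to a single ray.
  have hbis : ∀ R s, s ∈ Icc 0 R → g (2 * R) (s • ray 1) = g (2 * s) (s • ray 1) := by
    intro R s hs
    have m1 : 2 * s ∈ Icc 0 (2 * R) := ⟨by linarith [hs.1], by linarith [hs.2]⟩
    have m2 : 2 * s ∈ Icc 0 (2 * s) := ⟨by linarith [hs.1], le_rfl⟩
    exact hB.bisector_unique (hg _) (hg _)
      (by rw [← (e _ _ m1).1, ← (e _ _ m2).1]) (by rw [← (e _ _ m1).2, ← (e _ _ m2).2])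
  have eL : ∀ R, ∀ s ∈ Icc 0 (2 * R), r' (t + s) = (g (2 * R) ∘ L) (s • ray 0) := by
    intro R s hs
    rw [(e _ s hs).2, Function.comp_apply, map_smul, hLr]; rfl
  have L1 : ∀ R (s : ℝ), (g (2 * R) ∘ L) (s • ray 1) = g (2 * R) (s • ray 1) := by
    intro R s
    rw [Function.comp_apply, map_smul, hLr]; rfl
  -- If the rays separate at the origin, the bisector is the common neighbour. Otherwise it starts
  -- at `r t` and must be moved back along the common segment.
  rcases ht.eq_or_lt with rfl | ht
  · refine ⟨fun s => g (2 * s) (s • ray 1), fun R => ⟨_, g (2 * R), hg _, fun s hs => ⟨?_, ?_⟩⟩,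
      fun R => ⟨_, g (2 * R) ∘ L, (hg _).comp_aut hL, fun s hs => ⟨?_, ?_⟩⟩⟩
    · have := (e (2 * R) s ⟨hs.1, by linarith [hs.2, hs.1]⟩).1
      rwa [zero_add] at this
    · exact (hbis R s hs).symm
    · have := eL R s ⟨hs.1, by linarith [hs.2, hs.1]⟩
      rwa [zero_add] at this
    · rw [L1, hbis R s hs]
  have hone : ∀ R : ℝ, 0 < max R 1 := fun R => one_pos.trans_le (le_max_right _ _)
  have hK : ∀ R : ℝ, ∃ A' k, Chart B A' k ∧ (∀ s ∈ Icc 0 (t + max R 1), r s = k (s • ray 0)) ∧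
      ∀ s ∈ Icc 0 (max R 1), k (t • ray 0 + s • ray 1) = g (2 * s) (s • ray 1) := by
    intro R
    obtain ⟨A₁, J, hJ, -, eJ⟩ := hr (t + max R 1)
    obtain ⟨A', k, hk, k1, k2⟩ := hB.exists_chart_back ht (hone R) hJ eJ (hg (2 * max R 1))
      fun s hs => (e _ s ⟨hs.1, by linarith [hs.2, hs.1]⟩).1
    exact ⟨A', k, hk, k1, fun s hs => by rw [k2 s hs, hbis _ s hs]⟩
  have hK' : ∀ R : ℝ, ∃ A' k, Chart B A' k ∧ (∀ s ∈ Icc 0 (t + max R 1), r' s = k (s • ray 0)) ∧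
      ∀ s ∈ Icc 0 (max R 1), k (t • ray 0 + s • ray 1) = g (2 * s) (s • ray 1) := by
    intro R
    obtain ⟨A₁, J, hJ, -, eJ⟩ := hr' (t + max R 1)
    obtain ⟨A', k, hk, k1, k2⟩ := hB.exists_chart_back ht (hone R) hJ eJ
      ((hg (2 * max R 1)).comp_aut hL) fun s hs => eL _ s ⟨hs.1, by linarith [hs.2, hs.1]⟩
    exact ⟨A', k, hk, k1, fun s hs => by rw [k2 s hs, L1, hbis _ s hs]⟩
  choose A₁ k hk k1 k2 using hK
  choose A₂ k' hk' k1' k2' using hK'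
  have z0 : ∀ R : ℝ, (0 : ℝ) ∈ Icc 0 (t + max R 1) := fun R => ⟨le_rfl, by linarith [hone R]⟩
  have zt : ∀ R : ℝ, t ∈ Icc 0 (t + max R 1) := fun R => ⟨ht.le, by linarith [hone R]⟩
  have hsm : ∀ {R s : ℝ}, s ∈ Icc 0 R → max s 1 ∈ Icc 0 (max R 1) := fun {R s} hs =>
    ⟨(hone s).le, max_le_max_right _ hs.2⟩
  -- The new ray is the parallel to the bisector through the origin, each point being taken in a
  -- chart that is long enough for it. By `parallel_unique` it does not depend on the chart, nor on
  -- whether `r` or `r'` was used.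
  refine ⟨fun s => k s (s • ray 1), fun R => ⟨_, k R, hk R, fun s hs => ⟨?_, ?_⟩⟩,
    fun R => ⟨_, k' R, hk' R, fun s hs => ⟨?_, ?_⟩⟩⟩
  · exact k1 R s ⟨hs.1, by linarith [hs.2, le_max_left R 1]⟩
  · refine hB.parallel_unique (hk s) (hk R) ht (hone s) ?_ ?_ ?_ ⟨hs.1, le_max_left _ _⟩
    · have a := k1 s 0 (z0 s); have b := k1 R 0 (z0 R)
      rw [zero_smul] at a b
      rw [← a, ← b]
    · rw [← k1 s t (zt s), ← k1 R t (zt R)]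
    · rw [k2 s _ ⟨(hone s).le, le_rfl⟩, k2 R _ (hsm hs)]
  · exact k1' R s ⟨hs.1, by linarith [hs.2, le_max_left R 1]⟩
  · refine hB.parallel_unique (hk s) (hk' R) ht (hone s) ?_ ?_ ?_ ⟨hs.1, le_max_left _ _⟩
    · have a := k1 s 0 (z0 s); have b := k1' R 0 (z0 R)
      rw [zero_smul] at a b
      rw [← a, ← b, h0]
    · rw [← k1 s t (zt s), ← k1' R t (zt R), htr t ⟨ht.le, le_rfl⟩]
    · rw [k2 s _ ⟨(hone s).le, le_rfl⟩, k2' R _ (hsm hs)]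

end IsBuilding

end MetricChamberSystem

end BNR

end

/-! ### The completion process on graphs -/

noncomputable section

namespace BNR

/-! ### Bipartite graphs without quadrangles -/

/-- A connected bipartite graph of girth at least six without end vertices. -/
structure IsLinear {V : Type} (G : SimpleGraph V) (col : V → ZMod 2) : Prop where
  col_adj : ∀ {x y}, G.Adj x y → col y = col x + 1
  uniq : ∀ {x y a b}, x ≠ y → G.Adj x a → G.Adj a y → G.Adj x b → G.Adj b y → a = b
  deg : ∀ x, ∃ a b, a ≠ b ∧ G.Adj x a ∧ G.Adj x b
  reach : ∀ x y, G.Reachable x y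

namespace IsLinear

variable {V : Type} {G : SimpleGraph V} {col : V → ZMod 2}

lemma col_two (h : IsLinear G col) {x a y : V} (h1 : G.Adj x a) (h2 : G.Adj a y) :
    col y = col x := by
  rw [h.col_adj h2, h.col_adj h1, add_assoc, show (1 : ZMod 2) + 1 = 0 from rfl, add_zero]

lemma ne_of_col {x y : V} (h : col y = col x + 1) : x ≠ y := by
  rintro rfl
  have : ∀ c : ZMod 2, c ≠ c + 1 := by decide
  exact this _ h

lemma exists_adj_ne (h : IsLinear G col) (x a : V) : ∃ b, G.Adj x b ∧ b ≠ a := by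
  obtain ⟨b, c, hbc, hb, hc⟩ := h.deg x
  by_cases hba : b = a
  · exact ⟨c, hc, fun hca => hbc (hba.trans hca.symm)⟩
  · exact ⟨b, hb, hba⟩

end IsLinear

lemma exists_hexagon_of_cycle {V : Type} {G : SimpleGraph V} {z : V} {c : G.Walk z z}
    (hc : c.IsCycle) (h6 : c.length = 6) : ∃ f : Fin 6 → V, Function.Injective f ∧
      (∀ k, G.Adj (f k) (f (k + 1))) ∧ ∀ e ∈ c.edges, ∃ k, e = s(f k, f (k + 1)) := by
  match c, hc, h6 with
  | .cons (v := a) h1 (.cons (v := b) h2 (.cons (v := d) h3 (.cons (v := e) h4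
      (.cons (v := i) h5 (.cons h6 .nil))))), hc, _ =>
    have hn := hc.support_nodup
    simp at hn
    refine ⟨![z, a, b, d, e, i], ?_, ?_, ?_⟩
    · intro k l
      induction k using fin_six_cases <;> induction l using fin_six_cases <;> simp <;> grind
    · intro k
      induction k using fin_six_cases
      exacts [h1, h2, h3, h4, h5, h6]
    · intro e' he'
      simp at he'
      rcases he' with rfl | rfl | rfl | rfl | rfl | rfl
      exacts [⟨0, rfl⟩, ⟨1, rfl⟩, ⟨2, rfl⟩, ⟨3, rfl⟩, ⟨4, rfl⟩, ⟨5, rfl⟩]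

lemma exists_cycle_of_hexagon {V : Type} {G : SimpleGraph V} {f : Fin 6 → V}
    (hf : Function.Injective f) (ha : ∀ k, G.Adj (f k) (f (k + 1))) :
    ∃ c : G.Walk (f 0) (f 0), c.IsCycle ∧ c.length = 6 ∧ ∀ k, s(f k, f (k + 1)) ∈ c.edges := by
  refine ⟨.cons (ha 0) (.cons (ha 1) (.cons (ha 2) (.cons (ha 3) (.cons (ha 4) (.cons
    (by simpa using ha 5) .nil))))), ?_, rfl, ?_⟩
  · rw [SimpleGraph.Walk.cons_isCycle_iff]
    have hne : ∀ {k l : Fin 6}, k ≠ l → f k ≠ f l := fun h e => h (hf e)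
    constructor
    · rw [SimpleGraph.Walk.isPath_def]
      simp [hf.eq_iff]
    · simp [hf.eq_iff]
  · intro k
    induction k using fin_six_cases <;> simp

/-- Consecutive edges of a hexagon. -/
lemma hexagon_step {V : Type} {f : Fin 6 → V} (hf : Function.Injective f) {i : Fin 6} {v : V}
    (hv : ∃ k, s(f (i + 1), v) = s(f k, f (k + 1))) (hne : v ≠ f i) : v = f (i + 1 + 1) := by
  obtain ⟨k, hk⟩ := hv
  rcases Sym2.eq_iff.1 hk with ⟨h1, rfl⟩ | ⟨h1, rfl⟩
  · rw [hf h1]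
  · have : i = k := add_right_cancel (hf h1)
    exact absurd (congrArg f this.symm) hne

lemma hexagon_step' {V : Type} {f : Fin 6 → V} (hf : Function.Injective f) {i : Fin 6} {v : V}
    (hv : ∃ k, s(f i, v) = s(f k, f (k + 1))) (hne : v ≠ f (i + 1)) : v = f (i - 1) := by
  obtain ⟨k, hk⟩ := hv
  rcases Sym2.eq_iff.1 hk with ⟨h1, rfl⟩ | ⟨h1, rfl⟩
  · exact absurd (by rw [hf h1]) hne
  · rw [hf h1, add_sub_cancel_right]

namespace IsLinear

variable {V : Type} {G : SimpleGraph V} {col : V → ZMod 2}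

lemma hexagon_injective (h : IsLinear G col) {x a b c y d : V} (h1 : G.Adj x a) (h2 : G.Adj a b)
    (h3 : G.Adj b c) (h4 : G.Adj c y) (h5 : G.Adj y d) (h6 : G.Adj d x) (hxb : x ≠ b)
    (hac : a ≠ c) (hby : b ≠ y) (hxy : x ≠ y) (had : a ≠ d) (hcd : c ≠ d) :
    Function.Injective ![x, a, b, c, y, d] := by
  have o1 := ne_of_col (h.col_adj h1)
  have o2 := ne_of_col (h.col_adj h2)
  have o3 := ne_of_col (h.col_adj h3)
  have o4 := ne_of_col (h.col_adj h4)
  have o5 := ne_of_col (h.col_adj h5)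
  have o6 := ne_of_col (h.col_adj h6)
  have p1 : x ≠ c := ne_of_col (col := col) (by rw [h.col_adj h3, h.col_two h1 h2])
  have p2 : a ≠ y := ne_of_col (col := col) (by rw [h.col_adj h4, h.col_two h2 h3])
  have p3 : b ≠ d := ne_of_col (col := col) (by rw [h.col_adj h5, h.col_two h3 h4])
  intro k l
  induction k using fin_six_cases <;> induction l using fin_six_cases <;> simp <;> grind

/-- If the sixth vertex coincided with one on the path, the remaining edges would form a quadrangle.
So closing a path of four edges always gives a genuine hexagon. -/
lemma common_ne (h : IsLinear G col) {x a b c y d : V} (h1 : G.Adj x a) (h2 : G.Adj a b)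
    (h3 : G.Adj b c) (h4 : G.Adj c y) (h5 : G.Adj y d) (h6 : G.Adj d x) (hxb : x ≠ b)
    (hac : a ≠ c) (hby : b ≠ y) : a ≠ d ∧ c ≠ d := by
  constructor
  · rintro rfl
    exact hby (h.uniq hac h2 h3 h5.symm h4.symm)
  · rintro rfl
    exact hxb (h.uniq hac h1.symm h6.symm h2 h3)

/-- The end points of an open path of four edges are those without a common neighbour. -/
lemma isOpenFour_iff (h : IsLinear G col) {x y : V} : IsOpenFour G x y ↔
    (∃ a b c, G.Adj x a ∧ G.Adj a b ∧ G.Adj b c ∧ G.Adj c y ∧ x ≠ b ∧ a ≠ c ∧ b ≠ y ∧ x ≠ y) ∧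
      ¬ ∃ d, G.Adj x d ∧ G.Adj d y := by
  constructor
  · rintro ⟨p, hp, hl, hno⟩
    match p, hp, hl, hno with
    | .cons (v := a) h1 (.cons (v := b) h2 (.cons (v := c) h3 (.cons h4 .nil))), hp, _, hno =>
      rw [SimpleGraph.Walk.isPath_def] at hp
      simp at hp
      have hxb : x ≠ b := by grind
      have hac : a ≠ c := by grind
      have hby : b ≠ y := by grind
      have hxy : x ≠ y := by grind
      refine ⟨⟨a, b, c, h1, h2, h3, h4, hxb, hac, hby, hxy⟩, ?_⟩
      rintro ⟨d, h6, h5⟩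
      obtain ⟨had, hcd⟩ := h.common_ne h1 h2 h3 h4 h5.symm h6.symm hxb hac hby
      obtain ⟨w, hw, hw6, hwe⟩ := exists_cycle_of_hexagon (G := G)
        (h.hexagon_injective h1 h2 h3 h4 h5.symm h6.symm hxb hac hby hxy had hcd) (by
          intro k
          induction k using fin_six_cases
          exacts [h1, h2, h3, h4, h5.symm, h6.symm])
      refine hno ⟨_, w, hw, hw6, fun e he => ?_⟩
      simp at he
      rcases he with rfl | rfl | rfl | rfl
      exacts [hwe 0, hwe 1, hwe 2, hwe 3]
  · rintro ⟨⟨a, b, c, h1, h2, h3, h4, hxb, hac, hby, hxy⟩, hno⟩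
    refine ⟨.cons h1 (.cons h2 (.cons h3 (.cons h4 .nil))), ?_, rfl, ?_⟩
    · have p1 : x ≠ c := ne_of_col (col := col) (by rw [h.col_adj h3, h.col_two h1 h2])
      have p2 : a ≠ y := ne_of_col (col := col) (by rw [h.col_adj h4, h.col_two h2 h3])
      rw [SimpleGraph.Walk.isPath_def]
      simp [h1.ne, h2.ne, h3.ne, h4.ne, hxb, hac, hby, hxy, p1, p2]
    · rintro ⟨z, w, hw, hw6, hwe⟩
      obtain ⟨f, hf, hfa, hfe⟩ := exists_hexagon_of_cycle hw hw6
      have e1 := hfe _ (hwe s(x, a) (by simp))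
      have e2 := hfe _ (hwe s(a, b) (by simp))
      have e3 := hfe _ (hwe s(b, c) (by simp))
      have e4 := hfe _ (hwe s(c, y) (by simp))
      refine hno ?_
      -- The path runs through the hexagon in increasing or decreasing direction and cannot turn
      -- back; the remaining vertex is a common neighbour of its ends.
      obtain ⟨k, hk⟩ := e1
      rcases Sym2.eq_iff.1 hk with ⟨rfl, rfl⟩ | ⟨rfl, rfl⟩
      · have e := hexagon_step hf e2 hxb.symm
        subst e
        have e := hexagon_step hf e3 hac.symm
        subst e
        have e := hexagon_step hf e4 hby.symm
        subst e
        refine ⟨f (k + 1 + 1 + 1 + 1 + 1), ?_, (hfa _).symm⟩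
        have e6 : ∀ k : Fin 6, k + 1 + 1 + 1 + 1 + 1 + 1 = k := by decide
        have := (hfa (k + 1 + 1 + 1 + 1 + 1)).symm
        rwa [e6] at this
      · have e := hexagon_step' hf e2 hxb.symm
        subst e
        have e := hexagon_step' hf e3 (by rw [sub_add_cancel]; exact hac.symm)
        subst e
        have e := hexagon_step' hf e4 (by rw [sub_add_cancel]; exact hby.symm)
        subst e
        refine ⟨f (k + 1 + 1), hfa _, ?_⟩
        have e6 : ∀ k : Fin 6, k + 1 + 1 + 1 = k - 1 - 1 - 1 := by decide
        have := hfa (k + 1 + 1)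
        rwa [e6] at this

lemma openFour_col (h : IsLinear G col) {x y : V} (ho : IsOpenFour G x y) : col y = col x := by
  obtain ⟨⟨a, b, c, h1, h2, h3, h4, -⟩, -⟩ := h.isOpenFour_iff.1 ho
  rw [h.col_two h3 h4, h.col_two h1 h2]

end IsLinear

/-! ### Adding the new vertices -/

lemma complete_adj_inl {S : Stage} {a b : S.V} :
    S.complete.G.Adj (Sum.inl a) (Sum.inl b) ↔ S.G.Adj a b := by
  simp only [Stage.complete, SimpleGraph.fromRel_adj, completeRel, ne_eq, Sum.inl.injEq]
  exact ⟨fun h => h.2.elim id fun h => h.symm, fun h => ⟨h.ne, Or.inl h⟩⟩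

lemma complete_adj_inr {S : Stage} {a : S.V} {s : NewVertex S.G} :
    S.complete.G.Adj (Sum.inl a) (Sum.inr s) ↔ a ∈ s.1 := by
  simp [Stage.complete, SimpleGraph.fromRel_adj, completeRel]

lemma complete_adj_inr_inr {S : Stage} {s t : NewVertex S.G} :
    ¬ S.complete.G.Adj (Sum.inr s) (Sum.inr t) := by
  simp [Stage.complete, SimpleGraph.fromRel_adj, completeRel]

/-- The extension of a 2-colouring to the new vertices. -/
def completeCol (S : Stage) (col : S.V → ZMod 2) : S.complete.V → ZMod 2 :=
  Sum.elim col fun s => col s.1.out.1 + 1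

/-- Ends of a path of even length have the same colour, so it does not matter which end defines the
colour of the new vertex. -/
lemma completeCol_inr {S : Stage} {col : S.V → ZMod 2} (h : IsLinear S.G col) {a : S.V}
    {s : NewVertex S.G} (ha : a ∈ s.1) : completeCol S col (Sum.inr s) = col a + 1 := by
  obtain ⟨s, x, y, rfl, ho⟩ := s
  have hc := h.openFour_col ho
  have key : ∀ z ∈ s(x, y), col z = col x := by
    intro z hz
    rcases Sym2.mem_iff.1 hz with rfl | rfl
    · rfl
    · exact hc
  have hout : (s(x, y)).out.1 ∈ s(x, y) := Sym2.out_fst_mem _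
  change col (s(x, y)).out.1 + 1 = _
  rw [key _ hout, key a ha]

lemma newVertex_ends {S : Stage} {col : S.V → ZMod 2} (h : IsLinear S.G col)
    (s : NewVertex S.G) : ∃ x y, x ≠ y ∧ s.1 = s(x, y) ∧ IsOpenFour S.G x y := by
  obtain ⟨s, x, y, rfl, ho⟩ := s
  obtain ⟨⟨a, b, c, -, -, -, -, -, -, -, hne⟩, -⟩ := h.isOpenFour_iff.1 ho
  exact ⟨x, y, hne, rfl, ho⟩

/-- By `isOpenFour_iff` new vertices are only attached to pairs without a common neighbour. This is
what prevents quadrangles of one new and three old vertices. -/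
lemma no_common_of_mem {S : Stage} {col : S.V → ZMod 2} (h : IsLinear S.G col)
    {s : NewVertex S.G} {a b d : S.V} (hab : a ≠ b) (ha : a ∈ s.1) (hb : b ∈ s.1)
    (h1 : S.G.Adj a d) (h2 : S.G.Adj d b) : False := by
  obtain ⟨x, y, hne, hs, ho⟩ := newVertex_ends h s
  rw [hs, Sym2.mem_iff] at ha hb
  have hno := (h.isOpenFour_iff.1 ho).2
  rcases ha with rfl | rfl <;> rcases hb with rfl | rfl
  · exact hab rfl
  · exact hno ⟨d, h1, h2⟩
  · exact hno ⟨d, h2.symm, h1.symm⟩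
  · exact hab rfl

lemma newVertex_eq {S : Stage} {s t : NewVertex S.G} {a b : S.V} (hab : a ≠ b) (ha : a ∈ s.1)
    (hb : b ∈ s.1) (ha' : a ∈ t.1) (hb' : b ∈ t.1) : s = t :=
  Subtype.ext (((Sym2.mem_and_mem_iff hab).1 ⟨ha, hb⟩).trans
    ((Sym2.mem_and_mem_iff hab).1 ⟨ha', hb'⟩).symm)

/-- A quadrangle in the completed graph could use new vertices only at opposite corners, since these
are not adjacent. One new corner is excluded by `no_common_of_mem`, two by `newVertex_eq`: a pair
gets at most one new vertex. -/
lemma IsLinear.complete {S : Stage} {col : S.V → ZMod 2} (h : IsLinear S.G col) :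
    IsLinear S.complete.G (completeCol S col) := by
  have two : ∀ c : ZMod 2, c = c + 1 + 1 := by decide
  refine ⟨?_, ?_, ?_, ?_⟩
  · rintro (x | s) (y | t) hxy
    · exact h.col_adj (complete_adj_inl.1 hxy)
    · exact completeCol_inr h (complete_adj_inr.1 hxy)
    · rw [completeCol_inr h (complete_adj_inr.1 hxy.symm), ← two]; rfl
    · exact (complete_adj_inr_inr hxy).elim
  · rintro (x | s) (y | t) (a | p) (b | q) hne h1 h2 h3 h4
    · exact congrArg _ (h.uniq (fun e => hne (congrArg _ e)) (complete_adj_inl.1 h1)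
        (complete_adj_inl.1 h2) (complete_adj_inl.1 h3) (complete_adj_inl.1 h4))
    · exact (no_common_of_mem h (fun e => hne (congrArg _ e)) (complete_adj_inr.1 h3)
        (complete_adj_inr.1 h4.symm) (complete_adj_inl.1 h1) (complete_adj_inl.1 h2)).elim
    · exact (no_common_of_mem h (fun e => hne (congrArg _ e)) (complete_adj_inr.1 h1)
        (complete_adj_inr.1 h2.symm) (complete_adj_inl.1 h3) (complete_adj_inl.1 h4)).elim
    · exact congrArg _ (newVertex_eq (fun e => hne (congrArg _ e)) (complete_adj_inr.1 h1)
        (complete_adj_inr.1 h2.symm) (complete_adj_inr.1 h3) (complete_adj_inr.1 h4.symm))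
    · by_contra hab
      exact no_common_of_mem h (fun e => hab (congrArg _ e)) (complete_adj_inr.1 h2)
        (complete_adj_inr.1 h4) (complete_adj_inl.1 h1).symm (complete_adj_inl.1 h3)
    · exact (complete_adj_inr_inr h4).elim
    · exact (complete_adj_inr_inr h2).elim
    · exact (complete_adj_inr_inr h2).elim
    · by_contra hab
      exact no_common_of_mem h (fun e => hab (congrArg _ e)) (complete_adj_inr.1 h1.symm)
        (complete_adj_inr.1 h3.symm) (complete_adj_inl.1 h2) (complete_adj_inl.1 h4).symm
    · exact (complete_adj_inr_inr h3).elim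
    · exact (complete_adj_inr_inr h1).elim
    · exact (complete_adj_inr_inr h1).elim
    · by_contra hab
      exact hne (congrArg _ (newVertex_eq (fun e => hab (congrArg _ e)) (complete_adj_inr.1 h1.symm)
        (complete_adj_inr.1 h3.symm) (complete_adj_inr.1 h2) (complete_adj_inr.1 h4)))
    · exact (complete_adj_inr_inr h3).elim
    · exact (complete_adj_inr_inr h1).elim
    · exact (complete_adj_inr_inr h1).elim
  · rintro (x | s)
    · obtain ⟨a, b, hab, ha, hb⟩ := h.deg x
      exact ⟨Sum.inl a, Sum.inl b, fun e => hab (Sum.inl.inj e), complete_adj_inl.2 ha,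
        complete_adj_inl.2 hb⟩
    · obtain ⟨x, y, hne, hs, -⟩ := newVertex_ends h s
      refine ⟨Sum.inl x, Sum.inl y, fun e => hne (Sum.inl.inj e),
        (complete_adj_inr.2 ?_).symm, (complete_adj_inr.2 ?_).symm⟩ <;> simp [hs]
  · have hold : ∀ x y : S.V, S.complete.G.Reachable (Sum.inl x) (Sum.inl y) := fun x y =>
      (h.reach x y).map ⟨Sum.inl, fun hab => complete_adj_inl.2 hab⟩
    have hnew : ∀ z : S.complete.V, ∃ x, S.complete.G.Reachable z (Sum.inl x) := by
      rintro (x | s)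
      · exact ⟨x, SimpleGraph.Reachable.refl _⟩
      · obtain ⟨x, y, -, hs, -⟩ := newVertex_ends h s
        exact ⟨x, (complete_adj_inr.2 (by simp [hs])).symm.reachable⟩
    intro x y
    obtain ⟨x', hx⟩ := hnew x
    obtain ⟨y', hy⟩ := hnew y
    exact hx.trans ((hold x' y').trans hy.symm)

/-! ### The link -/

def linkCol (a : Fin 9) : ZMod 2 := if a = 8 then 1 else (a : ℕ)

def LinkAdj (a b : Fin 9) : Prop := a ≠ b ∧ (linkRel a b ∨ linkRel b a)

instance (a b : Fin 9) : Decidable (LinkAdj a b) := by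
  unfold LinkAdj linkRel; infer_instance

lemma linkStage_adj {a b : Fin 9} : linkStage.G.Adj a b ↔ LinkAdj a b :=
  SimpleGraph.fromRel_adj _ _ _

lemma isLinear_link : IsLinear linkStage.G linkCol := by
  have key : ∀ a b : Fin 9, LinkAdj a b → linkCol b = linkCol a + 1 := by
    unfold linkCol; decide
  have hu : ∀ x a : Fin 9, LinkAdj x a → ∀ y : Fin 9, LinkAdj a y → x ≠ y → ∀ b : Fin 9,
      LinkAdj x b → LinkAdj b y → a = b := by
    decide
  have hd : ∀ x : Fin 9, ∃ a b : Fin 9, a ≠ b ∧ LinkAdj x a ∧ LinkAdj x b := by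
    decide
  refine ⟨fun {x y} hxy => key x y (linkStage_adj.1 hxy), fun {x y a b} hne h1 h2 h3 h4 =>
    hu x a (linkStage_adj.1 h1) y (linkStage_adj.1 h2) hne b (linkStage_adj.1 h3)
      (linkStage_adj.1 h4), fun x => ?_, ?_⟩
  · obtain ⟨a, b, hab, h1, h2⟩ := hd x
    exact ⟨a, b, hab, linkStage_adj.2 h1, linkStage_adj.2 h2⟩
  · have hstep : ∀ a b : Fin 9, LinkAdj a b → linkStage.G.Reachable a b := fun a b h =>
      (linkStage_adj.2 h).reachable
    have e01 := hstep 0 1 (by decide)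
    have e12 := hstep 1 2 (by decide)
    have e23 := hstep 2 3 (by decide)
    have e34 := hstep 3 4 (by decide)
    have e45 := hstep 4 5 (by decide)
    have e56 := hstep 5 6 (by decide)
    have e67 := hstep 6 7 (by decide)
    have e08 := hstep 0 8 (by decide)
    have e2 := e01.trans e12
    have e3 := e2.trans e23
    have e4 := e3.trans e34
    have e5 := e4.trans e45
    have e6 := e5.trans e56
    have e7 := e6.trans e67
    have h0 : ∀ x : Fin 9, linkStage.G.Reachable (0 : Fin 9) x := by
      intro x
      fin_cases x
      exacts [SimpleGraph.Reachable.refl _, e01, e2, e3, e4, e5, e6, e7, e08]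
    exact fun x y => (h0 x).symm.trans (h0 y)

def stageCol : (n : ℕ) → (stage n).V → ZMod 2
  | 0 => linkCol
  | n + 1 => completeCol (stage n) (stageCol n)

lemma isLinear_stage (n : ℕ) : IsLinear (stage n).G (stageCol n) := by
  induction n with
  | zero => exact isLinear_link
  | succ n ih => exact ih.complete

end BNR

end

/-! ### The limit graph and its hexagons -/

noncomputable section

namespace BNR

/-! ### The union of the stages -/

def stageSucc (a : (n : ℕ) × (stage n).V) : (n : ℕ) × (stage n).V := ⟨a.1 + 1, Sum.inl a.2⟩

lemma stageSucc_injective : Function.Injective stageSucc := by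
  rintro ⟨n, a⟩ ⟨m, b⟩ h
  have h1 : n + 1 = m + 1 := congrArg Sigma.fst h
  obtain rfl : n = m := Nat.succ.inj h1
  have h2 : (Sum.inl a : (stage (n + 1)).V) = Sum.inl b := eq_of_heq (Sigma.mk.inj h).2
  rw [Sum.inl.inj h2]

lemma stageSucc_iterate_fst (k : ℕ) (a : (n : ℕ) × (stage n).V) :
    (stageSucc^[k] a).1 = a.1 + k := by
  induction k with
  | zero => rfl
  | succ k ih => rw [Function.iterate_succ_apply']; change _ + 1 = _; rw [ih]; rfl

lemma B8.mk_succ (n : ℕ) (a : (stage n).V) : B8.mk (n + 1) (Sum.inl a) = B8.mk n a :=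
  (Quot.sound (r := fun a b : (n : ℕ) × (stage n).V => b = ⟨a.1 + 1, Sum.inl a.2⟩)
    (a := ⟨n, a⟩) (b := ⟨n + 1, Sum.inl a⟩) rfl).symm

/-- Identified vertices have a common iterated image under the injective map to the next stage; for
vertices of the same stage the numbers of iterations agree. -/
lemma B8.mk_injective (n : ℕ) : Function.Injective (B8.mk n) := by
  intro a b h
  have key : ∀ p q : (n : ℕ) × (stage n).V,
      Relation.EqvGen (fun a b : (n : ℕ) × (stage n).V => b = ⟨a.1 + 1, Sum.inl a.2⟩) p q →
      ∃ i j, stageSucc^[i] p = stageSucc^[j] q := by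
    intro p q h
    induction h with
    | rel p q h => exact ⟨1, 0, h.symm⟩
    | refl p => exact ⟨0, 0, rfl⟩
    | symm p q _ ih => obtain ⟨i, j, h⟩ := ih; exact ⟨j, i, h.symm⟩
    | trans p q r _ _ ih1 ih2 =>
      obtain ⟨i, j, h⟩ := ih1
      obtain ⟨i', j', h'⟩ := ih2
      refine ⟨i' + i, j + j', ?_⟩
      rw [Function.iterate_add_apply, h, ← Function.iterate_add_apply, add_comm,
        Function.iterate_add_apply, h', ← Function.iterate_add_apply]
  obtain ⟨i, j, hij⟩ := key _ _ (Quot.eqvGen_exact h)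
  have h1 := congrArg Sigma.fst hij
  rw [stageSucc_iterate_fst, stageSucc_iterate_fst] at h1
  obtain rfl : i = j := Nat.add_left_cancel h1
  exact eq_of_heq (Sigma.mk.inj (stageSucc_injective.iterate i hij)).2

lemma B8.exists_rep (x : B8) : ∃ N, ∀ n ≥ N, ∃ a, x = B8.mk n a := by
  induction x using Quot.ind with
  | mk p =>
    obtain ⟨N, a⟩ := p
    refine ⟨N, fun n hn => ?_⟩
    induction n, hn using Nat.le_induction with
    | base => exact ⟨a, rfl⟩
    | succ n _ ih =>
      obtain ⟨b, hb⟩ := ih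
      exact ⟨Sum.inl b, hb.trans (B8.mk_succ n b).symm⟩

lemma B8.adj_lift {n N : ℕ} (h : n ≤ N) (a b : (stage n).V) : ∃ a' b' : (stage N).V,
    B8.mk n a = B8.mk N a' ∧ B8.mk n b = B8.mk N b' ∧
      ((stage n).G.Adj a b ↔ (stage N).G.Adj a' b') := by
  induction N, h using Nat.le_induction with
  | base => exact ⟨a, b, rfl, rfl, Iff.rfl⟩
  | succ N _ ih =>
    obtain ⟨a', b', h1, h2, h3⟩ := ih
    exact ⟨Sum.inl a', Sum.inl b', h1.trans (B8.mk_succ _ _).symm, h2.trans (B8.mk_succ _ _).symm,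
      h3.trans complete_adj_inl.symm⟩

/-- Completion adds no edge between old vertices, so adjacency can be tested at any common stage. -/
lemma b8_adj_mk {n : ℕ} {a b : (stage n).V} :
    b8Graph.Adj (B8.mk n a) (B8.mk n b) ↔ (stage n).G.Adj a b := by
  have key : ∀ {n : ℕ} {a b : (stage n).V} {m : ℕ} {a' b' : (stage m).V}, (stage m).G.Adj a' b' →
      B8.mk n a = B8.mk m a' → B8.mk n b = B8.mk m b' → (stage n).G.Adj a b := by
    intro n a b m a' b' hadj ha hb
    obtain ⟨a₁, b₁, h1, h2, h3⟩ := B8.adj_lift (le_max_left n m) a b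
    obtain ⟨a₂, b₂, h4, h5, h6⟩ := B8.adj_lift (le_max_right n m) a' b'
    rw [h3, B8.mk_injective _ (h1.symm.trans (ha.trans h4)),
      B8.mk_injective _ (h2.symm.trans (hb.trans h5)), ← h6]
    exact hadj
  rw [b8Graph, SimpleGraph.fromRel_adj]
  constructor
  · rintro ⟨-, ⟨m, a', b', hadj, h1, h2⟩ | ⟨m, a', b', hadj, h1, h2⟩⟩
    · exact key hadj h1 h2
    · exact (key hadj h1 h2).symm
  · exact fun h => ⟨fun e => h.ne (B8.mk_injective n e), Or.inl ⟨n, a, b, h, rfl, rfl⟩⟩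

def b8Col : B8 → ZMod 2 :=
  Quot.lift (fun p => stageCol p.1 p.2) fun p q h => by subst h; rfl

lemma isLinear_b8 : IsLinear b8Graph b8Col := by
  refine ⟨fun {x y} hxy => ?_, fun {x y a b} hne h1 h2 h3 h4 => ?_, fun x => ?_, fun x y => ?_⟩
  · obtain ⟨N, hN⟩ := x.exists_rep
    obtain ⟨M, hM⟩ := y.exists_rep
    obtain ⟨x, rfl⟩ := hN (max N M) (le_max_left _ _)
    obtain ⟨y, rfl⟩ := hM (max N M) (le_max_right _ _)
    exact (isLinear_stage _).col_adj (b8_adj_mk.1 hxy)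
  · obtain ⟨N₁, h₁⟩ := x.exists_rep
    obtain ⟨N₂, h₂⟩ := y.exists_rep
    obtain ⟨N₃, h₃⟩ := a.exists_rep
    obtain ⟨N₄, h₄⟩ := b.exists_rep
    obtain ⟨x, rfl⟩ := h₁ (N₁ + N₂ + N₃ + N₄) (by omega)
    obtain ⟨y, rfl⟩ := h₂ (N₁ + N₂ + N₃ + N₄) (by omega)
    obtain ⟨a, rfl⟩ := h₃ (N₁ + N₂ + N₃ + N₄) (by omega)
    obtain ⟨b, rfl⟩ := h₄ (N₁ + N₂ + N₃ + N₄) (by omega)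
    exact congrArg _ ((isLinear_stage _).uniq (fun e => hne (congrArg _ e)) (b8_adj_mk.1 h1)
      (b8_adj_mk.1 h2) (b8_adj_mk.1 h3) (b8_adj_mk.1 h4))
  · obtain ⟨N, hN⟩ := x.exists_rep
    obtain ⟨x, rfl⟩ := hN N le_rfl
    obtain ⟨a, b, hab, h1, h2⟩ := (isLinear_stage _).deg x
    exact ⟨_, _, fun e => hab (B8.mk_injective _ e), b8_adj_mk.2 h1, b8_adj_mk.2 h2⟩
  · obtain ⟨N, hN⟩ := x.exists_rep
    obtain ⟨M, hM⟩ := y.exists_rep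
    obtain ⟨x, rfl⟩ := hN (max N M) (le_max_left _ _)
    obtain ⟨y, rfl⟩ := hM (max N M) (le_max_right _ _)
    exact ((isLinear_stage _).reach x y).map ⟨B8.mk _, fun h => b8_adj_mk.2 h⟩

/-- The path lives at a finite stage. If its ends have no common neighbour there, the next stage
adds one; paths that turn back already provide one. -/
lemma b8_common_of_path {x a b c y : B8} (h1 : b8Graph.Adj x a) (h2 : b8Graph.Adj a b)
    (h3 : b8Graph.Adj b c) (h4 : b8Graph.Adj c y) (hxy : x ≠ y) :
    ∃ d, b8Graph.Adj x d ∧ b8Graph.Adj d y := by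
  by_cases hxb : x = b
  · exact ⟨c, hxb ▸ h3, h4⟩
  by_cases hac : a = c
  · exact ⟨a, h1, hac ▸ h4⟩
  by_cases hby : b = y
  · exact ⟨a, h1, hby ▸ h2⟩
  obtain ⟨N₁, h₁⟩ := x.exists_rep
  obtain ⟨N₂, h₂⟩ := y.exists_rep
  obtain ⟨N₃, h₃⟩ := a.exists_rep
  obtain ⟨N₄, h₄⟩ := b.exists_rep
  obtain ⟨N₅, h₅⟩ := c.exists_rep
  obtain ⟨x, rfl⟩ := h₁ (N₁ + N₂ + N₃ + N₄ + N₅) (by omega)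
  obtain ⟨y, rfl⟩ := h₂ (N₁ + N₂ + N₃ + N₄ + N₅) (by omega)
  obtain ⟨a, rfl⟩ := h₃ (N₁ + N₂ + N₃ + N₄ + N₅) (by omega)
  obtain ⟨b, rfl⟩ := h₄ (N₁ + N₂ + N₃ + N₄ + N₅) (by omega)
  obtain ⟨c, rfl⟩ := h₅ (N₁ + N₂ + N₃ + N₄ + N₅) (by omega)
  generalize N₁ + N₂ + N₃ + N₄ + N₅ = N at *
  by_cases hd : ∃ d, (stage N).G.Adj x d ∧ (stage N).G.Adj d y
  · obtain ⟨d, h5, h6⟩ := hd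
    exact ⟨_, b8_adj_mk.2 h5, b8_adj_mk.2 h6⟩
  have ho : IsOpenFour (stage N).G x y := (isLinear_stage N).isOpenFour_iff.2
    ⟨⟨a, b, c, b8_adj_mk.1 h1, b8_adj_mk.1 h2, b8_adj_mk.1 h3, b8_adj_mk.1 h4,
      fun e => hxb (congrArg _ e), fun e => hac (congrArg _ e), fun e => hby (congrArg _ e),
      fun e => hxy (congrArg _ e)⟩, hd⟩
  let s : NewVertex (stage N).G := ⟨s(x, y), x, y, rfl, ho⟩
  have key : ∀ z ∈ s(x, y), b8Graph.Adj (B8.mk N z) (B8.mk (N + 1) (Sum.inr s)) := fun z hz => by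
    have := (b8_adj_mk (n := N + 1)).2 (complete_adj_inr (S := stage N) (s := s).2 hz)
    rwa [B8.mk_succ] at this
  exact ⟨_, key x (Sym2.mem_mk_left x y), (key y (Sym2.mem_mk_right x y)).symm⟩

/-- Two vertices of the same colour have a common neighbour. -/
lemma b8_common {x y : B8} (hc : b8Col y = b8Col x) : ∃ d, b8Graph.Adj x d ∧ b8Graph.Adj d y := by
  have two : ∀ c : ZMod 2, c + 1 + 1 = c := by decide
  -- Induction along a path from `x`: each time it would reach length four, `b8_common_of_path`
  -- shortens it to length two. So distances never exceed three.
  have key : ∀ y, Relation.ReflTransGen b8Graph.Adj x y →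
      (b8Col y = b8Col x → ∃ d, b8Graph.Adj x d ∧ b8Graph.Adj d y) ∧
      (b8Col y = b8Col x + 1 → ∃ d e, b8Graph.Adj x d ∧ b8Graph.Adj d e ∧ b8Graph.Adj e y) := by
    intro y h
    induction h with
    | refl =>
      obtain ⟨a, b, -, ha, -⟩ := isLinear_b8.deg x
      exact ⟨fun _ => ⟨a, ha, ha.symm⟩, fun h => (IsLinear.ne_of_col h rfl).elim⟩
    | tail _ hyz ih =>
      rename_i y z _
      have hz := isLinear_b8.col_adj hyz
      refine ⟨fun h => ?_, fun h => ?_⟩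
      · obtain ⟨d, e, h1, h2, h3⟩ := ih.2 (by rw [← h, hz, two])
        by_cases hxz : x = z
        · subst hxz
          exact ⟨d, h1, h1.symm⟩
        · exact b8_common_of_path h1 h2 h3 hyz hxz
      · obtain ⟨d, h1, h2⟩ := ih.1 (by rw [hz] at h; exact add_right_cancel h)
        exact ⟨d, y, h1, h2, hyz⟩
  exact (key y ((SimpleGraph.reachable_iff_reflTransGen x y).1 (isLinear_b8.reach x y))).1 hc

/-! ### Hexagons -/

/-- Hexagons have no chords: vertices two steps apart have the same colour, and a chord between
opposite vertices would create a quadrangle. -/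
lemma Hexagon.adj_iff (h : Hexagon) {k l : Fin 6} :
    b8Graph.Adj (h.vertex k) (h.vertex l) ↔ l = k + 1 ∨ k = l + 1 := by
  constructor
  · intro hadj
    have hcase : ∀ k l : Fin 6, (l = k + 1 ∨ k = l + 1) ∨ k = l ∨ l = k + 1 + 1 ∨ k = l + 1 + 1 ∨
        l = k + 1 + 1 + 1 := by decide
    have ne2 : ∀ k : Fin 6, k ≠ k + 1 + 1 := by decide
    rcases hcase k l with h1 | rfl | rfl | rfl | rfl
    · exact h1
    · exact (hadj.ne rfl).elim
    · exact absurd (isLinear_b8.col_adj hadj) (by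
          rw [isLinear_b8.col_two (h.adj k) (h.adj (k + 1))]
          exact (by decide : ∀ c : ZMod 2, c ≠ c + 1) _)
    · exact absurd (isLinear_b8.col_adj hadj) (by
          rw [isLinear_b8.col_two (h.adj l) (h.adj (l + 1))]
          exact (by decide : ∀ c : ZMod 2, c ≠ c + 1) _)
    · have := isLinear_b8.uniq (fun e => ne2 k (h.injective e)) (h.adj k) (h.adj (k + 1)) hadj
        (h.adj (k + 1 + 1)).symm
      exact absurd (h.injective this) (ne2 _)
  · rintro (rfl | rfl)
    · exact h.adj k
    · exact (h.adj l).symm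

lemma Hexagon.col (h : Hexagon) (k : Fin 6) : b8Col (h.vertex k) = b8Col (h.vertex 0) + rayType k := by
  refine Fin.induction (motive := fun k : Fin 6 => b8Col (h.vertex k) =
    b8Col (h.vertex 0) + rayType k) ?_ (fun i hi => ?_) k
  · simp [rayType]
  · have e1 : i.succ = i.castSucc + 1 := by clear hi; revert i; decide
    rw [e1, isLinear_b8.col_adj (h.adj _), hi, rayType_add_one, add_assoc]

/-- A rotation or reflection of a hexagon. -/
def Hexagon.comp (h : Hexagon) (f : Fin 6 → Fin 6) (hf : Function.Injective f)
    (ha : ∀ k, f (k + 1) = f k + 1 ∨ f k = f (k + 1) + 1) : Hexagon where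
  vertex := h.vertex ∘ f
  injective := h.injective.comp hf
  adj := fun k => h.adj_iff.2 (ha k)

/-- Two hexagons with a common edge in corresponding positions have their common vertices in
corresponding positions. -/
lemma Hexagon.eq_of_common_edge {h h' : Hexagon} (h0 : h.vertex 0 = h'.vertex 0)
    (h1 : h.vertex 1 = h'.vertex 1) {k l : Fin 6} (hkl : h.vertex k = h'.vertex l) : k = l := by
  have e0 : k = 0 ↔ l = 0 := by
    constructor <;> rintro rfl
    · exact (h'.injective (h0.symm.trans hkl)).symm
    · exact h.injective (hkl.trans h0.symm)
  have e1 : k = 1 ↔ l = 1 := by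
    constructor <;> rintro rfl
    · exact (h'.injective (h1.symm.trans hkl)).symm
    · exact h.injective (hkl.trans h1.symm)
  have a0 : (k = 0 + 1 ∨ 0 = k + 1) ↔ (l = 0 + 1 ∨ 0 = l + 1) := by
    rw [← h.adj_iff, ← h'.adj_iff, h0, hkl]
  have a1 : (k = 1 + 1 ∨ 1 = k + 1) ↔ (l = 1 + 1 ∨ 1 = l + 1) := by
    rw [← h.adj_iff, ← h'.adj_iff, h1, hkl]
  have c : rayType k = rayType l := by
    have := h.col k
    rw [hkl, h'.col l, h0] at this
    exact (add_left_cancel this).symm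
  -- A position in a hexagon is determined by its colour together with equality and adjacency to
  -- positions 0 and 1; the rest is a finite check.
  clear hkl
  revert k l
  decide +kernel

/-- A symmetry of the hexagon. -/
def IsDihedral (f : Fin 6 → Fin 6) : Prop :=
  Function.Injective f ∧ ((∃ c, ∀ k, f k = k + c) ∨ ∃ c, ∀ k, f k = c - k)

/-- Between any two hexagons there is an isomorphism that fixes their common vertices. -/
lemma Hexagon.exists_dihedral (h h' : Hexagon) : ∃ f, IsDihedral f ∧
    ∀ k l, h.vertex k = h'.vertex l → l = f k := by
  have rot : ∀ c : Fin 6, IsDihedral fun k => k + c := fun c =>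
    ⟨fun a b hab => add_right_cancel hab, Or.inl ⟨c, fun _ => rfl⟩⟩
  have refl : ∀ c : Fin 6, IsDihedral fun k => c - k := fun c =>
    ⟨fun a b hab => sub_right_injective hab, Or.inr ⟨c, fun _ => rfl⟩⟩
  by_cases hedge : ∃ k l l', h.vertex k = h'.vertex l ∧ h.vertex (k + 1) = h'.vertex l'
  · obtain ⟨k, l, l', hk, hk'⟩ := hedge
    have hll : l' = l + 1 ∨ l = l' + 1 := h'.adj_iff.1 (by rw [← hk, ← hk']; exact h.adj k)
    let g : Hexagon := h.comp (fun i => i + k) (rot k).1 fun i => Or.inl (by abel)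
    rcases hll with rfl | rfl
    · let g' : Hexagon := h'.comp (fun i => i + l) (rot l).1 fun i => Or.inl (by abel)
      refine ⟨fun i => i + (l - k), rot _, fun i j hij => ?_⟩
      have := Hexagon.eq_of_common_edge (h := g) (h' := g') (k := i - k) (l := j - l)
        (by simpa [g, g', Hexagon.comp] using hk)
        (by simpa [g, g', Hexagon.comp, add_comm] using hk')
        (by simpa [g, g', Hexagon.comp] using hij)
      exact (by decide +kernel : ∀ i j k l : Fin 6, i - k = j - l → j = i + (l - k)) i j k l this
    · let g' : Hexagon := h'.comp (fun i => (l' + 1) - i) (refl _).1 fun i => Or.inr (by abel)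
      refine ⟨fun i => (l' + 1 + k) - i, refl _, fun i j hij => ?_⟩
      have := Hexagon.eq_of_common_edge (h := g) (h' := g') (k := i - k) (l := l' + 1 - j)
        (by simpa [g, g', Hexagon.comp] using hk)
        (by simpa [g, g', Hexagon.comp, add_comm] using hk')
        (by simpa [g, g', Hexagon.comp] using hij)
      exact (by decide +kernel : ∀ i j k l : Fin 6, i - k = l + 1 - j → j = (l + 1 + k) - i)
        i j k l' this
  · push Not at hedge
    -- Without two consecutive common vertices, at most one vertex and its opposite are shared, and
    -- a rotation matches them.
    by_cases hv : ∃ k l, h.vertex k = h'.vertex l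
    · obtain ⟨k, l, hkl⟩ := hv
      refine ⟨fun i => i + (l - k), rot _, fun i j hij => ?_⟩
      have hcase : ∀ i k : Fin 6, i = k ∨ i = k + 1 ∨ k = i + 1 ∨ i = k + 1 + 1 ∨ k = i + 1 + 1 ∨
          i = k + 3 := by decide
      -- Common vertices two steps apart have equal colours, hence are two steps apart in both
      -- hexagons. Their middle vertex is unique, so the hexagons would share an edge.
      have hadj : ∀ {a b c : Fin 6}, h.vertex a = h'.vertex b → h.vertex (a + 1 + 1) = h'.vertex c →
          False := by
        intro a b c hb hc
        have hne : b ≠ c := fun e => by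
          subst e
          have := h.injective (hb.trans hc.symm)
          exact (by decide : ∀ a : Fin 6, a ≠ a + 1 + 1) a this
        have hcol : b8Col (h'.vertex c) = b8Col (h'.vertex b) := by
          rw [← hb, ← hc, isLinear_b8.col_two (h.adj a) (h.adj (a + 1))]
        rw [h'.col, h'.col b] at hcol
        have hcol := add_left_cancel hcol
        have h2 : ∀ b c : Fin 6, b ≠ c → rayType c = rayType b → c = b + 1 + 1 ∨ b = c + 1 + 1 := by
          decide
        have hne2 : h.vertex a ≠ h.vertex (a + 1 + 1) := fun e =>
          (by decide : ∀ a : Fin 6, a ≠ a + 1 + 1) a (h.injective e)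
        rcases h2 b c hne hcol with rfl | rfl
        · have := isLinear_b8.uniq hne2 (h.adj a) (h.adj (a + 1)) (a := h.vertex (a + 1))
            (b := h'.vertex (b + 1)) (by rw [hb]; exact h'.adj b) (by rw [hc]; exact h'.adj _)
          exact hedge a b _ hb this
        · have := isLinear_b8.uniq hne2 (h.adj a) (h.adj (a + 1)) (a := h.vertex (a + 1))
            (b := h'.vertex (c + 1)) (by rw [hb]; exact (h'.adj (c + 1)).symm)
            (by rw [hc]; exact (h'.adj c).symm)
          exact hedge a _ _ hb this
      rcases hcase i k with rfl | rfl | rfl | rfl | rfl | rfl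
      · rw [h'.injective (hij.symm.trans hkl)]
        exact (by decide : ∀ l i : Fin 6, l = i + (l - i)) l i
      · exact (hedge _ _ _ hkl hij).elim
      · exact (hedge _ _ _ hij hkl).elim
      · exact (hadj hkl hij).elim
      · exact (hadj hij hkl).elim
      · have hcol : rayType j = rayType l + 1 := by
          have e1 := h.col (k + 3)
          have e2 := h.col k
          rw [hij, h'.col] at e1
          rw [hkl, h'.col] at e2
          have e3 : ∀ k, rayType (k + 3) = rayType k + 1 := by decide
          rw [e3, ← add_assoc, ← e2, add_assoc] at e1
          exact add_left_cancel e1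
        have hnadj : ¬ b8Graph.Adj (h'.vertex l) (h'.vertex j) := by
          rw [← hkl, ← hij, h.adj_iff]
          exact (by decide : ∀ k : Fin 6, ¬ (k + 3 = k + 1 ∨ k = k + 3 + 1)) k
        rw [h'.adj_iff] at hnadj
        have : ∀ j l : Fin 6, rayType j = rayType l + 1 → ¬ (j = l + 1 ∨ l = j + 1) → j = l + 3 := by
          decide
        rw [this j l hcol hnadj]
        exact (by decide : ∀ l k : Fin 6, l + 3 = k + 3 + (l - k)) l k
    · push Not at hv
      exact ⟨fun k => k + 0, rot 0, fun k l hkl => (hv k l hkl).elim⟩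

/-- A path of four edges lies in a hexagon. -/
lemma exists_hexagon_of_path {x a b c y : B8} (h1 : b8Graph.Adj x a) (h2 : b8Graph.Adj a b)
    (h3 : b8Graph.Adj b c) (h4 : b8Graph.Adj c y) (hxb : x ≠ b) (hac : a ≠ c) (hby : b ≠ y)
    (hxy : x ≠ y) : ∃ (h : Hexagon) (d : B8), h.vertex = ![x, a, b, c, y, d] := by
  obtain ⟨d, h5, h6⟩ := b8_common_of_path h1 h2 h3 h4 hxy
  obtain ⟨had, hcd⟩ := isLinear_b8.common_ne h1 h2 h3 h4 h6.symm h5.symm hxb hac hby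
  exact ⟨⟨_, isLinear_b8.hexagon_injective h1 h2 h3 h4 h6.symm h5.symm hxb hac hby hxy had hcd, by
    intro k
    induction k using fin_six_cases
    exacts [h1, h2, h3, h4, h6.symm, h5.symm]⟩, d, rfl⟩

/-- A path of three edges is prolonged by a fourth one that does not turn back; it cannot return to
`x` because there are no quadrangles. -/
lemma exists_hexagon_of_three {x a b c : B8} (h1 : b8Graph.Adj x a) (h2 : b8Graph.Adj a b)
    (h3 : b8Graph.Adj b c) (hxb : x ≠ b) (hac : a ≠ c) :
    ∃ (h : Hexagon) (y d : B8), h.vertex = ![x, a, b, c, y, d] := by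
  obtain ⟨y, h4, hyb⟩ := isLinear_b8.exists_adj_ne c b
  have hxy : x ≠ y := by
    rintro rfl
    exact hac (isLinear_b8.uniq hxb h1 h2 h4.symm h3.symm)
  obtain ⟨h, d, hd⟩ := exists_hexagon_of_path h1 h2 h3 h4 hxb hac hyb.symm hxy
  exact ⟨h, y, d, hd⟩

/-- Any two edges lie in a common hexagon. -/
lemma exists_hexagon_of_edges {p l q m : B8} (hpl : b8Graph.Adj p l) (hqm : b8Graph.Adj q m)
    (hc : b8Col q = b8Col p) :
    ∃ h : Hexagon, p ∈ range h.vertex ∧ l ∈ range h.vertex ∧ q ∈ range h.vertex ∧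
      m ∈ range h.vertex := by
  have hcl : b8Col m = b8Col l := by rw [isLinear_b8.col_adj hqm, hc, isLinear_b8.col_adj hpl]
  have three : ∀ {x a b c : B8}, b8Graph.Adj x a → b8Graph.Adj a b → b8Graph.Adj b c → x ≠ b →
      a ≠ c → ∃ h : Hexagon, x ∈ range h.vertex ∧ a ∈ range h.vertex ∧ b ∈ range h.vertex ∧
      c ∈ range h.vertex := by
    intro x a b c h1 h2 h3 h4 h5
    obtain ⟨h, y, d, e⟩ := exists_hexagon_of_three h1 h2 h3 h4 h5
    exact ⟨h, ⟨0, by rw [e]; rfl⟩, ⟨1, by rw [e]; rfl⟩, ⟨2, by rw [e]; rfl⟩, ⟨3, by rw [e]; rfl⟩⟩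
  by_cases hpm : b8Graph.Adj p m
  · by_cases hpq : p = q
    · subst hpq
      by_cases hlm : l = m
      · subst hlm
        obtain ⟨r, h1, h2⟩ := isLinear_b8.exists_adj_ne l p
        obtain ⟨t, h3, h4⟩ := isLinear_b8.exists_adj_ne r l
        obtain ⟨h, m1, m2, -, -⟩ := three hpl h1 h3 h2.symm h4.symm
        exact ⟨h, m1, m2, m1, m2⟩
      · obtain ⟨t, h3, h4⟩ := isLinear_b8.exists_adj_ne m p
        obtain ⟨h, m1, m2, m3, -⟩ := three hpl.symm hpm h3 hlm h4.symm
        exact ⟨h, m2, m1, m2, m3⟩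
    · by_cases hlm : l = m
      · subst hlm
        obtain ⟨t, h3, h4⟩ := isLinear_b8.exists_adj_ne q l
        obtain ⟨h, m1, m2, m3, -⟩ := three hpl hqm.symm h3 hpq h4.symm
        exact ⟨h, m1, m2, m3, m2⟩
      · obtain ⟨h, m1, m2, m3, m4⟩ := three hpl.symm hpm hqm.symm hlm hpq
        exact ⟨h, m2, m1, m4, m3⟩
  by_cases hql : b8Graph.Adj q l
  · by_cases hpq : p = q
    · subst hpq; exact (hpm hqm).elim
    · by_cases hlm : l = m
      · subst hlm; exact (hpm hpl).elim
      · obtain ⟨h, m1, m2, m3, m4⟩ := three hpl hql.symm hqm hpq hlm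
        exact ⟨h, m1, m2, m3, m4⟩
  -- In the generic position the path `p, l, r, m, q` has four edges and contains both given ones.
  obtain ⟨r, hr1, hr2⟩ := b8_common hcl
  have hpr : p ≠ r := fun e => hpm (e ▸ hr2)
  have hrq : r ≠ q := fun e => hql (e ▸ hr1.symm)
  have hpq : p ≠ q := fun e => hpm (e ▸ hqm)
  have hlm : l ≠ m := fun e => hpm (e ▸ hpl)
  obtain ⟨h, d, e⟩ := exists_hexagon_of_path hpl hr1 hr2 hqm.symm hpr hlm hrq hpq
  exact ⟨h, ⟨0, by rw [e]; rfl⟩, ⟨1, by rw [e]; rfl⟩, ⟨4, by rw [e]; rfl⟩, ⟨3, by rw [e]; rfl⟩⟩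

end BNR

end

/-! ### The cone over the limit graph is a building -/

noncomputable section

namespace BNR

/-! ### Coordinates on the sectors -/

/-- The linear forms that are nonnegative on half of the sectors, in cyclic order. -/
def rootForm (k : Fin 6) (v : Plane) : ℝ :=
  coord v (![1, 1, 2, 2, 0, 0] k) - coord v (![2, 0, 0, 1, 1, 2] k)

@[simp] lemma rootForm_zero (v : Plane) : rootForm 0 v = coord v 1 - coord v 2 := rfl
@[simp] lemma rootForm_one (v : Plane) : rootForm 1 v = coord v 1 - coord v 0 := rfl
@[simp] lemma rootForm_two (v : Plane) : rootForm 2 v = coord v 2 - coord v 0 := rfl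
@[simp] lemma rootForm_three (v : Plane) : rootForm 3 v = coord v 2 - coord v 1 := rfl
@[simp] lemma rootForm_four (v : Plane) : rootForm 4 v = coord v 0 - coord v 1 := rfl
@[simp] lemma rootForm_five (v : Plane) : rootForm 5 v = coord v 0 - coord v 2 := rfl

lemma eq_sectorPt (k : Fin 6) (v : Plane) :
    v = sectorPt k (rootForm (k + 4) v / 3) (rootForm k v / 3) := by
  have := coord_sum v
  apply plane_ext' <;> simp only [sectorPt, coord_add, coord_smul] <;>
    induction k using fin_six_cases <;> simp <;> linarith

/-- The closed sector between `ray k` and `ray (k + 1)`. -/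
def closedSector (k : Fin 6) : Set Plane := {v | 0 ≤ rootForm (k + 4) v ∧ 0 ≤ rootForm k v}

lemma rootForm_sectorPt (k : Fin 6) (s t : ℝ) : rootForm (k + 4) (sectorPt k s t) = 3 * s ∧
    rootForm k (sectorPt k s t) = 3 * t := by
  simp only [sectorPt]
  induction k using fin_six_cases <;> simp <;> constructor <;> ring

lemma sectorPt_mem_closedSector (k : Fin 6) {s t : ℝ} (hs : 0 ≤ s) (ht : 0 ≤ t) :
    sectorPt k s t ∈ closedSector k := by
  obtain ⟨h1, h2⟩ := rootForm_sectorPt k s t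
  exact ⟨by rw [h1]; positivity, by rw [h2]; positivity⟩

lemma exists_of_mem_closedSector {k : Fin 6} {v : Plane} (h : v ∈ closedSector k) :
    ∃ s t, 0 ≤ s ∧ 0 ≤ t ∧ v = sectorPt k s t :=
  ⟨_, _, div_nonneg h.1 (by norm_num), div_nonneg h.2 (by norm_num), eq_sectorPt k v⟩

/-- Every facet of the plane lies in a closed sector. -/
lemma exists_closedSector_mem {σ : Filter Plane} (hσ : σ ∈ planeFacets) :
    ∃ k, closedSector k ∈ σ := by
  obtain ⟨x, a, rfl⟩ := hσ
  -- Every comparison of coordinates is decided on the facet: by the base point if its coordinates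
  -- differ, by the direction otherwise.
  have key : ∀ i j, {v | coord v i ≤ coord v j} ∈ facetFilter x a ∨
      {v | coord v j ≤ coord v i} ∈ facetFilter x a := by
    have strict : ∀ i j, coord x i < coord x j → {v | coord v i ≤ coord v j} ∈ facetFilter x a := by
      intro i j hij
      refine facetFilter_le_nhds x a ?_
      have : IsOpen {v : Plane | coord v i < coord v j} :=
        isOpen_lt (continuous_coord i) (continuous_coord j)
      exact mem_of_superset (this.mem_nhds hij) fun v (hv : coord v i < coord v j) => hv.le
    have weak : ∀ i j, coord x i = coord x j → coord a i ≤ coord a j →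
        {v | coord v i ≤ coord v j} ∈ facetFilter x a := by
      intro i j hij ha
      refine mem_facetFilter.2 ⟨1, one_pos, fun y hy _ => ?_⟩
      have h1 := (hy j i).2
      simp only [mem_ofPred_eq, coord_add, hij]
      by_contra hlt
      exact absurd (h1.2 (by linarith)) (not_lt.2 ha)
    intro i j
    rcases lt_trichotomy (coord x i) (coord x j) with h | h | h
    · exact Or.inl (strict i j h)
    · rcases le_total (coord a i) (coord a j) with h' | h'
      · exact Or.inl (weak i j h h')
      · exact Or.inr (weak j i h.symm h')
    · exact Or.inr (strict j i h)
  rcases key 0 1 with h1 | h1 <;> rcases key 1 2 with h2 | h2 <;> rcases key 0 2 with h3 | h3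
  · exact ⟨3, by
      filter_upwards [h1, h2] with v p q
      constructor <;> simp <;> linarith⟩
  · exact ⟨3, by
      filter_upwards [h1, h2] with v p q
      constructor <;> simp <;> linarith⟩
  · exact ⟨2, by
      filter_upwards [h3, h2] with v p q
      constructor <;> simp <;> linarith⟩
  · exact ⟨1, by
      filter_upwards [h1, h3] with v p q
      constructor <;> simp <;> linarith⟩
  · exact ⟨4, by
      filter_upwards [h1, h3] with v p q
      constructor <;> simp <;> linarith⟩
  · exact ⟨5, by
      filter_upwards [h2, h3] with v p q
      constructor <;> simp <;> linarith⟩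
  · exact ⟨0, by
      filter_upwards [h1, h2] with v p q
      constructor <;> simp <;> linarith⟩
  · exact ⟨0, by
      filter_upwards [h1, h2] with v p q
      constructor <;> simp <;> linarith⟩

/-- The coefficient of `ray k` in the expression of a point by the rays of its closed sector. -/
def coef (k : Fin 6) (v : Plane) : ℝ := max 0 (min (rootForm (k + 4) v) (rootForm (k + 5) v)) / 3

lemma coef_nonneg (k : Fin 6) (v : Plane) : 0 ≤ coef k v :=
  div_nonneg (le_max_left _ _) (by norm_num)

/-- On each of the two sectors at `ray j` one of the two root forms is three times the coefficient,
and the other is three times the sum of both coefficients, so larger. On the remaining sectors one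
of them is nonpositive. -/
lemma coef_sectorPt (j k : Fin 6) {s t : ℝ} (hs : 0 ≤ s) (ht : 0 ≤ t) :
    coef j (sectorPt k s t) = if j = k then s else if j = k + 1 then t else 0 := by
  have aux : ∀ a b : ℝ, (a ≤ 0 ∨ b ≤ 0) → max 0 (min a b) / 3 = 0 := fun a b h => by
    rw [max_eq_left (min_le_iff.2 h), zero_div]
  have h5 : 3 * s ≤ rootForm (k + 5) (sectorPt k s t) ∧
      3 * t ≤ rootForm (k + 5) (sectorPt k s t) := by
    simp only [sectorPt]
    induction k using fin_six_cases <;> simp <;> constructor <;> linarith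
  obtain ⟨h3, h4⟩ := rootForm_sectorPt k s t
  split_ifs with h1 h2
  · subst h1
    rw [coef, h3, min_eq_left h5.1, max_eq_right (by linarith)]
    ring
  · subst h2
    have e1 : k + 1 + 4 = k + 5 := (by decide : ∀ k : Fin 6, k + 1 + 4 = k + 5) k
    have e2 : k + 1 + 5 = k := (by decide : ∀ k : Fin 6, k + 1 + 5 = k) k
    rw [coef, e1, e2, h4, min_eq_right h5.2, max_eq_right (by linarith)]
    ring
  · refine aux _ _ ?_
    clear h3 h4 h5
    simp only [sectorPt]
    induction j using fin_six_cases <;> induction k using fin_six_cases <;>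
      first
      | exact absurd rfl h1
      | exact absurd rfl h2
      | (left; simp; linarith)
      | (right; simp; linarith)

lemma continuous_coef (k : Fin 6) : Continuous (coef k) := by
  unfold coef rootForm
  have := continuous_coord
  fun_prop

lemma sum_coef_smul_ray (v : Plane) : ∑ k, coef k v • ray k = v := by
  obtain ⟨k, s, t, hs, ht, rfl⟩ := exists_sectorPt v
  have hk : k ≠ k + 1 := by revert k; decide
  simp only [coef_sectorPt _ _ hs ht, ite_smul, zero_smul]
  rw [Finset.sum_eq_add (a := k) (b := k + 1) hk (fun j _ hj => by simp [hj.1, hj.2]) (by simp)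
    (by simp)]
  simp [hk.symm, sectorPt]

lemma coef_adj {j l : Fin 6} {v : Plane} (hj : coef j v ≠ 0) (hl : coef l v ≠ 0) (hne : j ≠ l) :
    l = j + 1 ∨ j = l + 1 := by
  obtain ⟨k, s, t, hs, ht, rfl⟩ := exists_sectorPt v
  rw [coef_sectorPt _ _ hs ht] at hj hl
  split_ifs at hj hl with h1 h2 h3 h4 h5 h6 <;> grind

/-! ### Points of the cone -/

/-- The point of the cone over a hexagon with given coordinates. -/
def pt (h : Hexagon) (v : Plane) : BPhi :=
  ⟨∑ k, Finsupp.single (h.vertex k) (coef k v), by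
    classical
    have key : ∀ x, (∑ k, Finsupp.single (h.vertex k) (coef k v)) x =
        ∑ k, if h.vertex k = x then coef k v else 0 := fun x => by
      rw [Finsupp.finsetSum_apply]
      exact Finset.sum_congr rfl fun k _ => Finsupp.single_apply
    have hex : ∀ x, (∑ k, Finsupp.single (h.vertex k) (coef k v)) x ≠ 0 →
        ∃ k, h.vertex k = x ∧ coef k v ≠ 0 := by
      intro x hx
      rw [key] at hx
      obtain ⟨k, -, hk⟩ := Finset.exists_ne_zero_of_sum_ne_zero hx
      by_cases e : h.vertex k = x
      · rw [if_pos e] at hk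
        exact ⟨k, e, hk⟩
      · rw [if_neg e] at hk
        exact (hk rfl).elim
    refine ⟨fun x => ?_, fun x y hx hy hxy => ?_⟩
    · rw [key]
      exact Finset.sum_nonneg fun k _ => by split_ifs <;> simp [coef_nonneg]
    · obtain ⟨k, rfl, hk⟩ := hex x hx
      obtain ⟨l, rfl, hl⟩ := hex y hy
      exact h.adj_iff.2 (coef_adj hk hl fun e => hxy (by rw [e]))⟩

lemma pt_vertex (h : Hexagon) (v : Plane) (k : Fin 6) : (pt h v).1 (h.vertex k) = coef k v := by
  classical
  change (∑ k, Finsupp.single (h.vertex k) (coef k v)) (h.vertex k) = _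
  rw [Finsupp.finsetSum_apply]
  simp [Finsupp.single_apply, h.injective.eq_iff]

lemma pt_mem (h : Hexagon) (v : Plane) : pt h v ∈ coneApartment h := by
  classical
  intro x hx
  by_contra hr
  refine hx ?_
  change (∑ k, Finsupp.single (h.vertex k) (coef k v)) x = 0
  rw [Finsupp.finsetSum_apply]
  exact Finset.sum_eq_zero fun k _ => Finsupp.single_eq_of_ne fun e => hr ⟨k, e.symm⟩

lemma develop_pt (h : Hexagon) (v : Plane) : develop h (pt h v) = v := by
  simp only [develop, pt_vertex, sum_coef_smul_ray]

lemma bPhi_ext {h : Hexagon} {c d : BPhi} (hc : c ∈ coneApartment h) (hd : d ∈ coneApartment h)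
    (e : ∀ k, c.1 (h.vertex k) = d.1 (h.vertex k)) : c = d := by
  apply Subtype.ext
  ext x
  by_cases hx : x ∈ range h.vertex
  · obtain ⟨k, rfl⟩ := hx
    exact e k
  · have h1 : c.1 x = 0 := by_contra fun h1 => hx (hc x h1)
    have h2 : d.1 x = 0 := by_contra fun h2 => hx (hd x h2)
    rw [h1, h2]

/-- A point of the cone over a hexagon lies in a closed sector. -/
lemma exists_develop_eq_sectorPt (h : Hexagon) (c : BPhi) : ∃ k,
    develop h c = sectorPt k (c.1 (h.vertex k)) (c.1 (h.vertex (k + 1))) ∧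
    ∀ j, j ≠ k → j ≠ k + 1 → c.1 (h.vertex j) = 0 := by
  have hadj : ∀ {j l : Fin 6}, c.1 (h.vertex j) ≠ 0 → c.1 (h.vertex l) ≠ 0 → j ≠ l →
      l = j + 1 ∨ j = l + 1 := fun hj hl hjl =>
    h.adj_iff.1 (c.2.2 _ _ hj hl fun e => hjl (h.injective e))
  have hex : ∃ k, ∀ j, j ≠ k → j ≠ k + 1 → c.1 (h.vertex j) = 0 := by
    by_cases h0 : ∀ j, c.1 (h.vertex j) = 0
    · exact ⟨0, fun j _ _ => h0 j⟩
    push Not at h0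
    obtain ⟨j, hj⟩ := h0
    by_cases h1 : c.1 (h.vertex (j + 1)) = 0
    · refine ⟨j - 1, fun l hl hl' => ?_⟩
      by_contra hne
      rw [sub_add_cancel] at hl'
      rcases hadj hj hne hl'.symm with rfl | rfl
      · exact hne h1
      · exact hl (by abel)
    · refine ⟨j, fun l hl hl' => ?_⟩
      by_contra hne
      have := hadj hj hne hl.symm
      have := hadj h1 hne hl'.symm
      have hdec : ∀ j l : Fin 6, l ≠ j → l ≠ j + 1 → (l = j + 1 ∨ j = l + 1) →
          (l = j + 1 + 1 ∨ j + 1 = l + 1) → False := by decide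
      exact hdec j l hl hl' ‹_› ‹_›
  obtain ⟨k, hk⟩ := hex
  refine ⟨k, ?_, hk⟩
  have hne : k ≠ k + 1 := by clear hk; revert k; decide
  rw [develop, Finset.sum_eq_add (a := k) (b := k + 1) hne
    (fun j _ hj => by rw [hk j hj.1 hj.2, zero_smul]) (by simp) (by simp)]
  rfl

lemma coef_develop (h : Hexagon) (c : BPhi) (j : Fin 6) :
    coef j (develop h c) = c.1 (h.vertex j) := by
  obtain ⟨k, e, hk⟩ := exists_develop_eq_sectorPt h c
  rw [e, coef_sectorPt _ _ (c.2.1 _) (c.2.1 _)]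
  split_ifs with h1 h2
  · rw [h1]
  · rw [h2]
  · exact (hk j h1 h2).symm

lemma pt_develop {h : Hexagon} {c : BPhi} (hc : c ∈ coneApartment h) : pt h (develop h c) = c :=
  bPhi_ext (pt_mem h _) hc fun k => by rw [pt_vertex, coef_develop]

lemma pt_injective (h : Hexagon) : Function.Injective (pt h) :=
  Function.LeftInverse.injective (develop_pt h)

/-- The coordinates on two apartments differ on their intersection by a symmetry of the plane. -/
lemma exists_change (h h' : Hexagon) : ∃ L : Plane →ₗ[ℝ] Plane, IsAut L ∧
    ∀ c ∈ coneApartment h ∩ coneApartment h', develop h' c = L (develop h c) := by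
  obtain ⟨f, ⟨hf, hf'⟩, hff⟩ := h.exists_dihedral h'
  obtain ⟨L, hL, hLr⟩ : ∃ L : Plane →ₗ[ℝ] Plane, IsAut L ∧ ∀ k, L (ray k) = ray (f k) := by
    rcases hf' with ⟨c, hc⟩ | ⟨c, hc⟩
    · obtain ⟨L, hL, e⟩ := exists_rotation c
      exact ⟨L, hL, fun k => by rw [e, hc]⟩
    · obtain ⟨L, hL, e⟩ := exists_reflection c
      exact ⟨L, hL, fun k => by rw [e, hc]⟩
  refine ⟨L, hL, fun c hc => ?_⟩
  have key : ∀ k, c.1 (h'.vertex (f k)) = c.1 (h.vertex k) := by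
    intro k
    by_cases h1 : c.1 (h.vertex k) = 0
    · by_contra h2
      rw [h1] at h2
      obtain ⟨m, hm⟩ := hc.1 _ h2
      have := hf (hff m _ hm)
      subst this
      rw [← hm] at h2
      exact h2 h1
    · obtain ⟨l, hl⟩ := hc.2 _ h1
      rw [← hff k l hl.symm, hl]
  simp only [develop, map_sum, map_smul, hLr]
  rw [← (Equiv.ofBijective f (Finite.injective_iff_bijective.1 hf)).sum_comp
    fun k => c.1 (h'.vertex k) • ray k]
  exact Finset.sum_congr rfl fun k _ => by rw [Equiv.ofBijective_apply, key]

open MetricChamberSystem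

/-- A facet of the cone may be witnessed by another hexagon; by `exists_change` the two sets of
coordinates then differ by an automorphism, which preserves facets. -/
lemma chart_pt (h : Hexagon) : Chart bPhi h (pt h) := by
  refine ⟨pt_injective h, ?_, fun a b => ?_, fun σ => ⟨?_, fun hσ => ⟨h, ?_, ?_⟩⟩⟩
  · ext c
    exact ⟨fun ⟨v, hv⟩ => hv ▸ pt_mem h v, fun hc => ⟨_, pt_develop hc⟩⟩
  · change Dist.dist (develop h (pt h a)) (develop h (pt h b)) = _
    rw [develop_pt, develop_pt]
  · rintro ⟨h', hm, hf⟩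
    obtain ⟨L, hL, e⟩ := exists_change h h'
    rw [Filter.map_map] at hf
    have : σ.map (develop h' ∘ pt h) = σ.map L := Filter.map_congr (by
      filter_upwards [Filter.mem_map.1 hm] with v hv
      rw [Function.comp_apply, e _ ⟨pt_mem h v, hv⟩, develop_pt])
    rw [this] at hf
    exact (hL.2.2 σ).1 hf
  · exact Filter.mem_map.2 (mem_of_superset univ_mem fun v _ => pt_mem h v)
  · rw [Filter.map_map, show develop h ∘ pt h = id from funext (develop_pt h), Filter.map_id]
    exact hσ

/-- The closed sector over the edge `{x, y}`. -/
def edgeSector (x y : B8) : Set BPhi := {c | ∀ z, c.1 z ≠ 0 → z = x ∨ z = y}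

lemma pt_mem_edgeSector {h : Hexagon} {k : Fin 6} {v : Plane} (hv : v ∈ closedSector k) :
    pt h v ∈ edgeSector (h.vertex k) (h.vertex (k + 1)) := by
  intro z hz
  obtain ⟨j, rfl⟩ := pt_mem h v z hz
  obtain ⟨s, t, hs, ht, rfl⟩ := exists_of_mem_closedSector hv
  rw [pt_vertex, coef_sectorPt _ _ hs ht] at hz
  split_ifs at hz with h1 h2
  · exact Or.inl (by rw [h1])
  · exact Or.inr (by rw [h2])
  · exact (hz rfl).elim

/-- The edge is listed with its vertex of colour 0 first, so that two such edges satisfy the colour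
condition of `exists_hexagon_of_edges`. -/
lemma exists_edgeSector_mem {τ : Filter BPhi} (hτ : τ ∈ bPhi.facets) :
    ∃ x y, b8Graph.Adj x y ∧ b8Col x = 0 ∧ edgeSector x y ∈ τ := by
  obtain ⟨h, hm, hf⟩ := hτ
  obtain ⟨k, hk⟩ := exists_closedSector_mem hf
  have hs : edgeSector (h.vertex k) (h.vertex (k + 1)) ∈ τ := by
    filter_upwards [hm, Filter.mem_map.1 hk] with c h1 h2
    rw [← pt_develop h1]
    exact pt_mem_edgeSector h2
  have hc := isLinear_b8.col_adj (h.adj k)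
  rcases (by decide : ∀ c : ZMod 2, c = 0 ∨ c + 1 = 0) (b8Col (h.vertex k)) with h0 | h0
  · exact ⟨_, _, h.adj k, h0, hs⟩
  · refine ⟨_, _, (h.adj k).symm, hc.trans h0, mem_of_superset hs fun c hc z hz => (hc z hz).symm⟩

lemma edgeSector_subset {h : Hexagon} {x y : B8} (hx : x ∈ range h.vertex)
    (hy : y ∈ range h.vertex) : edgeSector x y ⊆ coneApartment h := by
  intro c hc z hz
  rcases hc z hz with rfl | rfl
  · exact hx
  · exact hy

/-- Facets lie over edges and two edges lie in a hexagon, which gives common apartments. A symmetry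
matching the common vertices of two hexagons induces an isomorphism of apartments that fixes their
entire intersection. -/
theorem isBuilding_bPhi : bPhi.IsBuilding := by
  refine ⟨fun h => ⟨_, (chart_pt h).isChart⟩, fun σ hσ τ hτ => ?_, fun h h' x hx => ?_,
    fun (h h' : Hexagon) σ hσ τ hτ mσ mτ => ?_⟩
  · obtain ⟨p, l, hpl, hp, h1⟩ := exists_edgeSector_mem hσ
    obtain ⟨q, m, hqm, hq, h2⟩ := exists_edgeSector_mem hτ
    obtain ⟨h, m1, m2, m3, m4⟩ := exists_hexagon_of_edges hpl hqm (hq.trans hp.symm)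
    exact ⟨h, mem_of_superset h1 (edgeSector_subset m1 m2),
      mem_of_superset h2 (edgeSector_subset m3 m4)⟩
  · refine ⟨pure x, ?_, le_rfl, hx⟩
    rw [← pt_develop hx.1]
    exact (chart_pt h).pure_mem _
  · obtain ⟨L, hL, e⟩ := exists_change h h'
    have hfix : ∀ c ∈ coneApartment h ∩ coneApartment h', pt h' (L (develop h c)) = c :=
      fun c hc => by rw [← e c hc, pt_develop hc.2]
    -- The intersection is closed in the apartment: it is where the continuous coefficients of the
    -- vertices outside `h'` vanish. So the closure of any facet in it is fixed as well.
    have hcl : ∀ σ : Filter BPhi, coneApartment h ∩ coneApartment h' ∈ σ →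
        bPhi.FixesClosure h (fun c => pt h' (L (develop h c))) σ := by
      refine fun σ hσ => ⟨_, hσ, inter_subset_left, fun z hz => hfix z ⟨hz.1, fun x hx => ?_⟩⟩
      obtain ⟨k, rfl⟩ := hz.1 x hx
      by_contra hr
      refine hx ((coef_develop h z k).symm.trans ?_)
      have hcls : IsClosed {v : Plane | coef k v = 0} :=
        isClosed_eq (continuous_coef k) continuous_const
      refine hcls.closure_subset (Metric.mem_closure_iff.2 fun ε hε => ?_)
      obtain ⟨s, hs, hd⟩ := hz.2 ε hε
      refine ⟨develop h s, ?_, hd⟩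
      rw [mem_ofPred_eq, coef_develop]
      by_contra h0
      exact hr (hs.1.2 _ h0)
    refine ⟨fun c => pt h' (L (develop h c)), ⟨fun c _ => pt_mem h' _, fun c hc d hd hcd => ?_,
      fun c hc => ?_⟩, fun a ha b hb => ?_, fun ρ hρ => ?_, hcl σ mσ, hcl τ mτ⟩
    · rw [← pt_develop hc, ← pt_develop hd, hL.1.injective (pt_injective h' hcd)]
    · obtain ⟨v, hv⟩ := hL.2.1 (develop h' c)
      refine ⟨pt h v, pt_mem h v, ?_⟩
      change pt h' (L (develop h (pt h v))) = c
      rw [develop_pt, hv, pt_develop hc]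
    · change Dist.dist (develop h' (pt h' _)) (develop h' (pt h' _)) = Dist.dist _ _
      rw [develop_pt, develop_pt, hL.1.dist_eq]
    · have e1 : (ρ.map (develop h)).map (pt h) = ρ := by
        rw [Filter.map_map]
        exact (Filter.map_congr (by filter_upwards [hρ] with c hc using pt_develop hc)).trans
          Filter.map_id
      have e2 : ρ.map (fun c => pt h' (L (develop h c))) =
          ((ρ.map (develop h)).map L).map (pt h') := by
        rw [Filter.map_map, Filter.map_map]; rfl
      rw [e2, (chart_pt h').facets, hL.2.2, ← (chart_pt h).facets, e1]

end BNR

end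

/-! ### Uniformization of the cameral cover and its periods -/

noncomputable section

namespace BNR

/-! ### A uniformization of the cameral cover -/

/-- The covering map `ζ ↦ 2 cosh 3ζ` of the `x`-line. -/
def xCoord (ζ : ℂ) : ℂ := 2 * Complex.cosh (3 * ζ)

def thirdTurn : ℂ := (2 * Real.pi / 3 : ℝ) * Complex.I

def shift : Fin 3 → ℂ := ![-thirdTurn, thirdTurn, 0]

lemma cosh_thirdTurn : Complex.cosh thirdTurn = -1 / 2 := by
  rw [thirdTurn, Complex.cosh_mul_I, ← Complex.ofReal_cos,
    show (2 * Real.pi / 3 : ℝ) = Real.pi - Real.pi / 3 by ring, Real.cos_pi_sub,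
    Real.cos_pi_div_three]
  push_cast
  ring

lemma sinh_thirdTurn : Complex.sinh thirdTurn = (Real.sqrt 3 : ℂ) / 2 * Complex.I := by
  rw [thirdTurn, Complex.sinh_mul_I, ← Complex.ofReal_sin,
    show (2 * Real.pi / 3 : ℝ) = Real.pi - Real.pi / 3 by ring, Real.sin_pi_sub,
    Real.sin_pi_div_three]
  push_cast
  ring

lemma sqrt_three_sq : (Real.sqrt 3 : ℂ) ^ 2 = 3 := by
  rw [← Complex.ofReal_pow, Real.sq_sqrt (by norm_num)]
  norm_num

lemma cosh_add_thirdTurn (ζ : ℂ) : Complex.cosh (ζ + thirdTurn) =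
    -1 / 2 * Complex.cosh ζ + (Real.sqrt 3 : ℂ) / 2 * Complex.I * Complex.sinh ζ := by
  rw [Complex.cosh_add, cosh_thirdTurn, sinh_thirdTurn]
  ring

lemma cosh_sub_thirdTurn (ζ : ℂ) : Complex.cosh (ζ - thirdTurn) =
    -1 / 2 * Complex.cosh ζ - (Real.sqrt 3 : ℂ) / 2 * Complex.I * Complex.sinh ζ := by
  rw [Complex.cosh_sub, cosh_thirdTurn, sinh_thirdTurn]
  ring

lemma cosh_add_three_thirdTurn (ζ : ℂ) : Complex.cosh (ζ + 3 * thirdTurn) = Complex.cosh ζ := by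
  have : 3 * thirdTurn = (2 * Real.pi : ℝ) * Complex.I := by
    rw [thirdTurn]
    push_cast
    ring
  rw [this, Complex.cosh_add, Complex.cosh_mul_I, Complex.sinh_mul_I, ← Complex.ofReal_cos,
    ← Complex.ofReal_sin, Real.cos_two_pi, Real.sin_two_pi]
  simp

/-- The uniformization of the cameral cover. -/
def cam (ζ : ℂ) : Cameral :=
  ⟨(xCoord ζ, fun i => -2 * Complex.cosh (ζ + shift i)), fun z => by
    have hs : ∀ i, shift i = ![-thirdTurn, thirdTurn, 0] i := fun _ => rfl
    simp only [Fin.prod_univ_three, hs, Matrix.cons_val_zero, Matrix.cons_val_one,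
      Matrix.cons_val, ← sub_eq_add_neg, cosh_add_thirdTurn, cosh_sub_thirdTurn, add_zero, xCoord,
      Complex.cosh_three_mul]
    have h1 := Complex.cosh_sq_sub_sinh_sq ζ
    have h3 := sqrt_three_sq
    have hI := Complex.I_sq
    generalize Complex.cosh ζ = c at *
    generalize Complex.sinh ζ = s at *
    generalize (Real.sqrt 3 : ℂ) = r at *
    have hs : s ^ 2 = c ^ 2 - 1 := by linear_combination -h1
    have : (z - -2 * (-1 / 2 * c - r / 2 * Complex.I * s)) *
        (z - -2 * (-1 / 2 * c + r / 2 * Complex.I * s)) = (z - c) ^ 2 + 3 * s ^ 2 := by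
      linear_combination (-s ^ 2 * r ^ 2) * hI + s ^ 2 * h3
    rw [this, hs]
    ring⟩

lemma proj_cam (ζ : ℂ) : proj (cam ζ) = xCoord ζ := rfl

lemma root_cam (ζ : ℂ) (i : Fin 3) : root (cam ζ) i = -2 * Complex.cosh (ζ + shift i) := rfl

lemma proj_permCameral (w : Equiv.Perm (Fin 3)) (P : Cameral) : proj (permCameral w P) = proj P :=
  rfl

lemma root_permCameral (w : Equiv.Perm (Fin 3)) (P : Cameral) (i : Fin 3) :
    root (permCameral w P) i = root P (w.symm i) := rfl

lemma cameral_ext {P Q : Cameral} (h : proj P = proj Q) (hr : ∀ i, root P i = root Q i) : P = Q :=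
  Subtype.ext (Prod.ext h (funext hr))

lemma permCameral_permCameral (w w' : Equiv.Perm (Fin 3)) (P : Cameral) :
    permCameral w (permCameral w' P) = permCameral (w * w') P := rfl

lemma permCameral_one (P : Cameral) : permCameral 1 P = P := rfl

lemma continuous_root (i : Fin 3) : Continuous fun P : Cameral => root P i := by
  unfold root
  fun_prop

lemma continuous_permCameral (w : Equiv.Perm (Fin 3)) : Continuous (permCameral w) := by
  unfold permCameral
  fun_prop

lemma continuous_xCoord : Continuous xCoord := by
  unfold xCoord
  fun_prop

lemma continuous_cam : Continuous cam := by
  refine Continuous.subtype_mk (continuous_xCoord.prodMk (continuous_pi fun i => ?_)) _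
  fun_prop

lemma xCoord_neg (ζ : ℂ) : xCoord (-ζ) = xCoord ζ := by
  rw [xCoord, mul_neg, Complex.cosh_neg, xCoord]

lemma xCoord_add_thirdTurn (ζ : ℂ) : xCoord (ζ + thirdTurn) = xCoord ζ := by
  rw [xCoord, mul_add, cosh_add_three_thirdTurn, xCoord]

lemma cam_neg (ζ : ℂ) : cam (-ζ) = permCameral (Equiv.swap 0 1) (cam ζ) := by
  refine cameral_ext (xCoord_neg ζ) fun i => ?_
  have key : ∀ j : Fin 3, shift (Equiv.swap 0 1 j) = -shift j := by
    intro j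
    induction j using fin_three_cases <;> simp [shift, Equiv.swap_apply_def]
  rw [root_permCameral, root_cam, root_cam, Equiv.symm_swap, key, ← Complex.cosh_neg]
  congr 2
  ring

lemma cam_add_thirdTurn (ζ : ℂ) :
    cam (ζ + thirdTurn) = permCameral (finRotate 3) (cam ζ) := by
  refine cameral_ext (xCoord_add_thirdTurn ζ) fun i => ?_
  rw [root_permCameral, root_cam, root_cam]
  induction i using fin_three_cases
  · change _ = -2 * Complex.cosh (ζ + shift 2)
    simp [shift]
  · change _ = -2 * Complex.cosh (ζ + shift 0)
    rw [← cosh_add_three_thirdTurn (ζ + shift 0)]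
    congr 2
    simp [shift]
    ring
  · change _ = -2 * Complex.cosh (ζ + shift 1)
    simp [shift]

lemma cam_sub_thirdTurn (ζ : ℂ) :
    cam (ζ - thirdTurn) = permCameral (finRotate 3)⁻¹ (cam ζ) := by
  conv_rhs => rw [show ζ = ζ - thirdTurn + thirdTurn by ring, cam_add_thirdTurn]
  rw [permCameral_permCameral, inv_mul_cancel, permCameral_one]

/-- The right-hand side is continuous on the cameral cover, so this inverts `cam` up to `2πi` and
shows that `cam` is open. -/
lemma exp_eq_of_cam (ζ : ℂ) : Complex.exp ζ = -root (cam ζ) 2 / 2 +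
    (root (cam ζ) 0 - root (cam ζ) 1) / (2 * (Real.sqrt 3 : ℂ) * Complex.I) := by
  have h3 : (Real.sqrt 3 : ℂ) ≠ 0 := by
    intro h
    have := sqrt_three_sq
    rw [h] at this
    norm_num at this
  rw [root_cam, root_cam, root_cam, ← Complex.cosh_add_sinh]
  simp only [shift, Matrix.cons_val_zero, Matrix.cons_val_one, Matrix.cons_val,
    ← sub_eq_add_neg, cosh_add_thirdTurn, cosh_sub_thirdTurn, add_zero]
  have hI := Complex.I_ne_zero
  field_simp
  ring

lemma cam_eq_of_exp_eq {ζ ζ' : ℂ} (h : Complex.exp ζ = Complex.exp ζ') : cam ζ = cam ζ' := by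
  have h' : Complex.exp (-ζ) = Complex.exp (-ζ') := by rw [Complex.exp_neg, Complex.exp_neg, h]
  have hc : Complex.cosh ζ = Complex.cosh ζ' := by
    rw [Complex.cosh, Complex.cosh, h, h']
  have hs : Complex.sinh ζ = Complex.sinh ζ' := by
    rw [Complex.sinh, Complex.sinh, h, h']
  refine cameral_ext ?_ fun i => ?_
  · rw [proj_cam, proj_cam, xCoord, xCoord, Complex.cosh_three_mul, Complex.cosh_three_mul, hc]
  · rw [root_cam, root_cam, Complex.cosh_add, Complex.cosh_add, hc, hs]

lemma sum_root (P : Cameral) : root P 0 + root P 1 + root P 2 = 0 ∧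
    root P 0 * root P 1 + root P 0 * root P 2 + root P 1 * root P 2 = -3 ∧
    proj P = -(root P 0 * root P 1 * root P 2) := by
  have h0 := P.2 0
  have h1 := P.2 1
  have h2 := P.2 (-1)
  simp only [Fin.prod_univ_three] at h0 h1 h2
  simp only [root, proj]
  refine ⟨?_, ?_, ?_⟩
  · linear_combination (h1 + h2) / 2 - h0
  · linear_combination (h2 - h1) / 2
  · linear_combination h0

/-- The prospective values `c` and `s` of `cosh` and `sinh` are linear in the roots. The second
symmetric function being `-3` means `c ^ 2 - s ^ 2 = 1`, so `c + s` is nonzero and its logarithm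
works. -/
lemma cam_surjective : Function.Surjective cam := by
  intro P
  obtain ⟨h1, h2, h3⟩ := sum_root P
  have hs3 := sqrt_three_sq
  have h30 : (Real.sqrt 3 : ℂ) ≠ 0 := by
    intro h
    rw [h] at hs3
    norm_num at hs3
  have hI := Complex.I_sq
  have hI0 := Complex.I_ne_zero
  obtain ⟨c, hc⟩ : ∃ c, c = -root P 2 / 2 := ⟨_, rfl⟩
  obtain ⟨s, hs⟩ : ∃ s, s = (root P 0 - root P 1) / (2 * (Real.sqrt 3 : ℂ) * Complex.I) := ⟨_, rfl⟩
  have hs' : root P 0 - root P 1 = 2 * (Real.sqrt 3 : ℂ) * Complex.I * s := by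
    rw [hs]
    field_simp
  have e0 : root P 0 = c + (Real.sqrt 3 : ℂ) * Complex.I * s := by
    linear_combination hs' / 2 + h1 / 2 - hc
  have e1 : root P 1 = c - (Real.sqrt 3 : ℂ) * Complex.I * s := by
    linear_combination -hs' / 2 + h1 / 2 - hc
  have e2 : root P 2 = -2 * c := by linear_combination 2 * hc
  have hcs : c ^ 2 - s ^ 2 = 1 := by
    rw [e0, e1, e2] at h2
    linear_combination -h2 / 3 - (s ^ 2 * (Real.sqrt 3 : ℂ) ^ 2) * hI / 3 + s ^ 2 * hs3 / 3
  have hne : c + s ≠ 0 := by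
    intro h
    have : (c + s) * (c - s) = 1 := by linear_combination hcs
    rw [h, zero_mul] at this
    exact zero_ne_one this
  have hexp : Complex.exp (Complex.log (c + s)) = c + s := Complex.exp_log hne
  have hexp' : Complex.exp (-Complex.log (c + s)) = c - s := by
    rw [Complex.exp_neg, hexp]
    field_simp
    linear_combination -hcs
  have hcosh : Complex.cosh (Complex.log (c + s)) = c := by
    rw [Complex.cosh, hexp, hexp']
    ring
  have hsinh : Complex.sinh (Complex.log (c + s)) = s := by
    rw [Complex.sinh, hexp, hexp']
    ring
  have hr : ∀ i, root (cam (Complex.log (c + s))) i = root P i := by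
    intro i
    induction i using fin_three_cases
    · simp only [root_cam, shift, Matrix.cons_val_zero, ← sub_eq_add_neg, cosh_sub_thirdTurn,
        hcosh, hsinh, e0]
      ring
    · simp only [root_cam, shift, Matrix.cons_val_one, Matrix.cons_val_zero, cosh_add_thirdTurn,
        hcosh, hsinh, e1]
      ring
    · simp only [root_cam, shift, Matrix.cons_val, add_zero, hcosh, e2]
  refine ⟨Complex.log (c + s), cameral_ext ?_ hr⟩
  rw [h3, (sum_root _).2.2, hr, hr, hr]

lemma isOpen_cam_image {T : Set ℂ} (hT : IsOpen T) : IsOpen (cam '' T) := by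
  have : cam '' T = (fun P : Cameral => -root P 2 / 2 +
      (root P 0 - root P 1) / (2 * (Real.sqrt 3 : ℂ) * Complex.I)) ⁻¹' (Complex.exp '' T) := by
    ext P
    constructor
    · rintro ⟨ζ, hζ, rfl⟩
      exact ⟨ζ, hζ, exp_eq_of_cam ζ⟩
    · rintro ⟨ζ, hζ, h⟩
      obtain ⟨ζ', rfl⟩ := cam_surjective P
      exact ⟨ζ, hζ, cam_eq_of_exp_eq (h.trans (exp_eq_of_cam ζ').symm)⟩
  rw [this]
  refine (Complex.isOpenMap_exp T hT).preimage ?_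
  have := continuous_root
  fun_prop

/-- The fibres are orbits of the infinite dihedral group generated by `ζ ↦ -ζ` and the translation
by `thirdTurn`, which acts on the cameral cover through `S₃`. -/
lemma xCoord_eq_iff {ζ ζ' : ℂ} : xCoord ζ = xCoord ζ' ↔
    ∃ n : ℤ, ζ' = ζ + n * thirdTurn ∨ ζ' = -ζ + n * thirdTurn := by
  have key : ∀ z : ℂ, xCoord z = 2 * Complex.cos (3 * z * Complex.I) := by
    intro z
    rw [xCoord, Complex.cos_mul_I]
  rw [key, key, mul_right_inj' two_ne_zero, Complex.cos_eq_cos_iff]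
  have hI := Complex.I_sq
  constructor
  · rintro ⟨n, h | h⟩
    · refine ⟨-n, Or.inl ?_⟩
      rw [thirdTurn]
      push_cast
      linear_combination (-Complex.I / 3) * h + (ζ' - ζ) * hI
    · refine ⟨-n, Or.inr ?_⟩
      rw [thirdTurn]
      push_cast
      linear_combination (-Complex.I / 3) * h + (ζ' + ζ) * hI
  · rintro ⟨n, h | h⟩
    · refine ⟨-n, Or.inl ?_⟩
      rw [h, thirdTurn]
      push_cast
      linear_combination (2 * Real.pi * n) * hI
    · refine ⟨-n, Or.inr ?_⟩
      rw [h, thirdTurn]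
      push_cast
      linear_combination (2 * Real.pi * n) * hI

lemma isOpenMap_xCoord : IsOpenMap xCoord := by
  have han : AnalyticOnNhd ℂ xCoord univ := by
    apply DifferentiableOn.analyticOnNhd _ isOpen_univ
    unfold xCoord
    fun_prop
  rcases han.is_constant_or_isOpen isPreconnected_univ with ⟨w, hw⟩ | h
  · exfalso
    have h1 := (hw 0 (mem_univ _)).trans (hw (1 / 3 : ℝ) (mem_univ _)).symm
    have h2 : (Real.cosh 1 : ℂ) = Real.cosh 0 := by
      have e : (3 : ℂ) * ((1 / 3 : ℝ) : ℂ) = (1 : ℝ) := by push_cast; ring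
      rw [xCoord, xCoord, e, mul_zero, ← Complex.ofReal_cosh] at h1
      rw [Real.cosh_zero]
      simpa using h1.symm
    have h3 := Complex.ofReal_injective h2
    have := Real.cosh_lt_cosh.2 (show |(0 : ℝ)| < |1| by norm_num)
    linarith
  · exact fun U hU => h U (subset_univ U) hU

/-! ### Periods -/

/-- The real period map based at a common zero. -/
def phi (P : Cameral) : Plane :=
  mkPlane (fun i => (primitive (root P i)).re + 3 / 2) (by
    rw [Finset.sum_add_distrib, ← Complex.re_sum, sum_primitive]
    simp
    norm_num)

lemma coord_phi (P : Cameral) (i : Fin 3) : coord (phi P) i = (primitive (root P i)).re + 3 / 2 :=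
  rfl

lemma period_eq (P Q : Cameral) : period P Q = phi Q - phi P := by
  refine plane_ext fun i => ?_
  rw [coord_sub, coord_phi, coord_phi]
  change (primitive (root Q i)).re - (primitive (root P i)).re = _
  ring

lemma phi_permCameral (w : Equiv.Perm (Fin 3)) (P : Cameral) :
    phi (permCameral w P) = permPlane w (phi P) := plane_ext fun _ => rfl

lemma continuous_plane {α : Type*} [TopologicalSpace α] {f : α → Plane}
    (h : ∀ i, Continuous fun a => coord (f a) i) : Continuous f := by
  refine Continuous.subtype_mk (f := fun a => (f a : EuclideanSpace ℝ (Fin 3))) ?_ fun a => (f a).2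
  exact (PiLp.continuous_toLp 2 _).comp (continuous_pi h)

lemma continuous_phi : Continuous phi := by
  refine continuous_plane fun i => ?_
  simp only [coord_phi, primitive]
  have := continuous_root
  fun_prop

/-- The real part of the primitive along the uniformization. -/
def wave (η θ : ℝ) : ℝ :=
  -3 * (Real.cosh (2 * η) * Real.cos (2 * θ)) - 3 / 2 * (Real.cosh (4 * η) * Real.cos (4 * θ))

lemma re_cosh (a : ℝ) (z : ℂ) :
    (Complex.cosh (a * z)).re = Real.cosh (a * z.re) * Real.cos (a * z.im) := by
  have : (a * z : ℂ) = ((a * z.re : ℝ) : ℂ) + ((a * z.im : ℝ) : ℂ) * Complex.I := by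
    conv_lhs => rw [← Complex.re_add_im z]
    push_cast
    ring
  rw [this, Complex.cosh_add, Complex.cosh_mul_I, Complex.sinh_mul_I, ← Complex.ofReal_cosh,
    ← Complex.ofReal_cos, ← Complex.ofReal_sinh, ← Complex.ofReal_sin]
  simp only [Complex.add_re, Complex.mul_re, Complex.ofReal_re, Complex.ofReal_im, Complex.I_re,
    Complex.I_im, Complex.mul_im]
  ring

/-- In terms of `z` the primitive is `-3 cosh 2z - 3/2 cosh 4z - 3/2`; the constant is what the
normalization of `phi` removes. -/
lemma re_primitive (z : ℂ) :
    (primitive (-2 * Complex.cosh z)).re + 3 / 2 = wave z.re z.im := by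
  have h : primitive (-2 * Complex.cosh z) =
      -(3 : ℝ) * Complex.cosh ((2 : ℝ) * z) - (3 / 2 : ℝ) * Complex.cosh ((4 : ℝ) * z)
        - (3 / 2 : ℝ) := by
    have e : ((4 : ℝ) : ℂ) * z = 2 * (2 * z) := by push_cast; ring
    have h1 := Complex.cosh_sq_sub_sinh_sq z
    have h2 := Complex.cosh_sq_sub_sinh_sq (2 * z)
    rw [e, Complex.cosh_two_mul (2 * z), primitive]
    push_cast
    have h3 := Complex.cosh_two_mul z
    have h5 : Complex.cosh (2 * z) = 2 * Complex.cosh z ^ 2 - 1 := by linear_combination h3 - h1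
    have h4 : Complex.sinh (2 * z) ^ 2 = Complex.cosh (2 * z) ^ 2 - 1 := by
      linear_combination -h2
    rw [h4, h5]
    ring
  rw [h]
  simp only [Complex.sub_re, ← Complex.ofReal_neg, Complex.re_ofReal_mul, re_cosh,
    Complex.ofReal_re, wave]
  ring

lemma coord_phi_cam (ζ : ℂ) : coord (phi (cam ζ)) 0 = wave ζ.re (ζ.im - 2 * Real.pi / 3) ∧
    coord (phi (cam ζ)) 1 = wave ζ.re (ζ.im + 2 * Real.pi / 3) ∧
    coord (phi (cam ζ)) 2 = wave ζ.re ζ.im := by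
  have hre : thirdTurn.re = 0 := by rw [thirdTurn, Complex.re_ofReal_mul]; simp
  have him : thirdTurn.im = 2 * Real.pi / 3 := by rw [thirdTurn, Complex.im_ofReal_mul]; simp
  simp only [coord_phi, root_cam, re_primitive, shift]
  simp [hre, him, ← sub_eq_add_neg]

/-- The difference of two coordinates of the period map, up to a positive factor. -/
def wall (η θ : ℝ) : ℝ := Real.cosh (2 * η) - Real.cosh (4 * η) * Real.cos (2 * θ)

lemma cos_four_pi_div_three : Real.cos (2 * (2 * Real.pi / 3)) = -1 / 2 ∧
    Real.sin (2 * (2 * Real.pi / 3)) = -(Real.sqrt 3 / 2) := by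
  rw [show 2 * (2 * Real.pi / 3) = Real.pi / 3 + Real.pi by ring, Real.cos_add_pi, Real.sin_add_pi,
    Real.cos_pi_div_three, Real.sin_pi_div_three]
  constructor <;> ring

/-- The terms with `sin 4θ` contain the factor `sin 2θ` too, so the difference splits into a sine of
known sign and `wall`. All three root forms reduce to this by symmetry. -/
lemma wave_sub_wave (η θ : ℝ) : wave η (θ + 2 * Real.pi / 3) - wave η (θ - 2 * Real.pi / 3) =
    -(3 * Real.sqrt 3 * Real.sin (2 * θ) * wall η θ) := by
  obtain ⟨h1, h2⟩ := cos_four_pi_div_three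
  have h3 : Real.sin (4 * (2 * Real.pi / 3)) = Real.sqrt 3 / 2 := by
    rw [show 4 * (2 * Real.pi / 3) = 2 * (2 * (2 * Real.pi / 3)) by ring, Real.sin_two_mul, h1, h2]
    ring
  have h4 : Real.sin (4 * θ) = 2 * Real.sin (2 * θ) * Real.cos (2 * θ) := by
    rw [show 4 * θ = 2 * (2 * θ) by ring, Real.sin_two_mul]
  simp only [wave, wall, mul_add, mul_sub, Real.cos_add, Real.cos_sub, h1, h2, h3, h4]
  ring

lemma wave_sub_pi (η θ : ℝ) : wave η (θ - Real.pi) = wave η θ := by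
  rw [wave, wave, show 2 * (θ - Real.pi) = 2 * θ - 2 * Real.pi by ring,
    show 4 * (θ - Real.pi) = 4 * θ - 2 * Real.pi - 2 * Real.pi by ring, Real.cos_sub_two_pi,
    Real.cos_sub_two_pi, Real.cos_sub_two_pi]

lemma wave_neg (η θ : ℝ) : wave η (-θ) = wave η θ := by
  simp [wave]

lemma rootForm_one_phi (ζ : ℂ) : rootForm 1 (phi (cam ζ)) =
    -(3 * Real.sqrt 3 * Real.sin (2 * ζ.im) * wall ζ.re ζ.im) := by
  obtain ⟨h0, h1, h2⟩ := coord_phi_cam ζ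
  rw [rootForm_one, h0, h1, wave_sub_wave]

lemma rootForm_five_phi (ζ : ℂ) : rootForm 5 (phi (cam ζ)) =
    3 * Real.sqrt 3 * Real.sin (2 * (Real.pi / 3 - ζ.im)) * wall ζ.re (Real.pi / 3 - ζ.im) := by
  obtain ⟨h0, h1, h2⟩ := coord_phi_cam ζ
  have h := wave_sub_wave ζ.re (Real.pi / 3 - ζ.im)
  rw [show Real.pi / 3 - ζ.im + 2 * Real.pi / 3 = -(ζ.im - Real.pi) by ring,
    show Real.pi / 3 - ζ.im - 2 * Real.pi / 3 = -(ζ.im + Real.pi / 3) by ring, wave_neg, wave_neg,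
    wave_sub_pi] at h
  have e : wave ζ.re (ζ.im + Real.pi / 3) = wave ζ.re (ζ.im - 2 * Real.pi / 3) := by
    rw [← wave_sub_pi]
    congr 1
    ring
  rw [rootForm_five, h0, h2, ← e]
  linarith

lemma rootForm_three_phi (ζ : ℂ) : rootForm 3 (phi (cam ζ)) =
    3 * Real.sqrt 3 * Real.sin (2 * ζ.im - Real.pi / 3) *
      (Real.cosh (2 * ζ.re) + Real.cosh (4 * ζ.re) * Real.cos (2 * ζ.im - Real.pi / 3)) := by
  obtain ⟨h0, h1, h2⟩ := coord_phi_cam ζ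
  have h := wave_sub_wave ζ.re (ζ.im + Real.pi / 3)
  rw [show ζ.im + Real.pi / 3 - 2 * Real.pi / 3 = ζ.im + 2 * Real.pi / 3 - Real.pi by ring,
    show ζ.im + Real.pi / 3 + 2 * Real.pi / 3 = ζ.im + 2 * Real.pi - Real.pi by ring,
    wave_sub_pi, wave_sub_pi, show ζ.im + 2 * Real.pi = ζ.im + Real.pi - -Real.pi by ring] at h
  have e : wave ζ.re (ζ.im + Real.pi - -Real.pi) = wave ζ.re ζ.im := by
    rw [← wave_sub_pi, ← wave_sub_pi]
    congr 1
    ring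
  rw [e, wall, show 2 * (ζ.im + Real.pi / 3) = 2 * ζ.im - Real.pi / 3 + Real.pi by ring,
    Real.sin_add_pi, Real.cos_add_pi] at h
  rw [rootForm_three, h2, h1, h]
  ring

end BNR

end

/-! ### The preimages of the regions in the strip -/

noncomputable section

namespace BNR

/-! ### The walls in the strip `0 < Im ζ < π / 3` -/

lemma continuous_wall : Continuous fun ζ : ℂ => wall ζ.re ζ.im := by
  unfold wall
  fun_prop

lemma continuous_wall' : Continuous fun ζ : ℂ => wall ζ.re (Real.pi / 3 - ζ.im) := by
  unfold wall
  fun_prop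

lemma wall_neg_right (η θ : ℝ) : wall η (-θ) = wall η θ := by
  simp [wall]

lemma cosh_four_mul (η : ℝ) : Real.cosh (4 * η) = 2 * Real.cosh (2 * η) ^ 2 - 1 := by
  have h := Real.cosh_sq (2 * η)
  rw [show 4 * η = 2 * (2 * η) by ring, Real.cosh_two_mul]
  linarith

lemma wall_lt_wall (η : ℝ) {θ θ' : ℝ} (h0 : 0 ≤ θ) (h : θ < θ') (h1 : θ' ≤ Real.pi / 2) :
    wall η θ < wall η θ' := by
  have := Real.cos_lt_cos_of_nonneg_of_le_pi (x := 2 * θ) (y := 2 * θ') (by linarith)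
    (by linarith) (by linarith)
  have := mul_lt_mul_of_pos_left this (Real.cosh_pos (4 * η))
  simp only [wall]
  linarith

/-- With `C = cosh 2η` the quotient `C / (2C² - 1)` decreases for `C ≥ 1`. Hence for fixed `θ` the
sign of `wall` can change only from positive to negative as `|η|` grows. -/
lemma cosh_ratio_le {η η' : ℝ} (h : |η| ≤ |η'|) : 
    Real.cosh (2 * η') * Real.cosh (4 * η) ≤ Real.cosh (2 * η) * Real.cosh (4 * η') := by
  have h1 : Real.cosh (2 * η) ≤ Real.cosh (2 * η') := by
    rw [Real.cosh_le_cosh, abs_mul, abs_mul]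
    gcongr
  have h2 := Real.one_le_cosh (2 * η)
  rw [cosh_four_mul, cosh_four_mul]
  nlinarith [mul_nonneg (sub_nonneg.2 h1) (by positivity : 0 ≤ Real.cosh (2 * η) * Real.cosh (2 * η'))]

lemma wall_nonpos {η η' θ : ℝ} (h : |η| ≤ |η'|) (hw : wall η θ ≤ 0) : wall η' θ ≤ 0 := by
  have h1 := cosh_ratio_le h
  have h2 := Real.cosh_pos (4 * η)
  have h3 := Real.cosh_pos (4 * η')
  simp only [wall] at *
  have : Real.cosh (4 * η) * (Real.cosh (2 * η') - Real.cosh (4 * η') * Real.cos (2 * θ)) ≤ 0 := by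
    nlinarith [mul_nonpos_of_nonneg_of_nonpos h3.le hw]
  exact nonpos_of_mul_nonpos_right this h2

lemma wall_neg {η η' θ : ℝ} (h : |η| ≤ |η'|) (hw : wall η θ < 0) : wall η' θ < 0 := by
  have h1 := cosh_ratio_le h
  have h2 := Real.cosh_pos (4 * η)
  have h3 := Real.cosh_pos (4 * η')
  simp only [wall] at *
  have : Real.cosh (4 * η) * (Real.cosh (2 * η') - Real.cosh (4 * η') * Real.cos (2 * θ)) < 0 := by
    nlinarith [mul_neg_of_pos_of_neg h3 hw]
  exact neg_of_mul_neg_right this h2.le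

lemma wall_pos {η η' θ : ℝ} (h : |η| ≤ |η'|) (hw : 0 < wall η' θ) : 0 < wall η θ := by
  by_contra hc
  exact absurd (wall_nonpos h (not_lt.1 hc)) (not_le.2 hw)

lemma wall_pos_of_cos_nonpos (η : ℝ) {θ : ℝ} (h : Real.cos (2 * θ) ≤ 0) : 0 < wall η θ := by
  have h2 := Real.cosh_pos (4 * η)
  have h3 := Real.cosh_pos (2 * η)
  simp only [wall]
  nlinarith

lemma wall_zero_pos {θ : ℝ} (h0 : 0 < θ) (h1 : θ < Real.pi) : 0 < wall 0 θ := by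
  have h : wall 0 θ = 2 * Real.sin θ ^ 2 := by
    have := Real.sin_sq_add_cos_sq θ
    simp only [wall, mul_zero, Real.cosh_zero, Real.cos_two_mul]
    linarith
  rw [h]
  have := Real.sin_pos_of_pos_of_lt_pi h0 h1
  positivity

def openSector (k : Fin 6) : Set Plane := {v | 0 < rootForm (k + 4) v ∧ 0 < rootForm k v}

lemma openSector_subset (k : Fin 6) : openSector k ⊆ closedSector k := fun _ h => ⟨h.1.le, h.2.le⟩

lemma continuous_rootForm (k : Fin 6) : Continuous (rootForm k) := by
  unfold rootForm
  have := continuous_coord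
  fun_prop

lemma isOpen_openSector (k : Fin 6) : IsOpen (openSector k) :=
  (isOpen_lt continuous_const (continuous_rootForm _)).inter
    (isOpen_lt continuous_const (continuous_rootForm _))

lemma isClosed_closedSector (k : Fin 6) : IsClosed (closedSector k) :=
  (isClosed_le continuous_const (continuous_rootForm _)).inter
    (isClosed_le continuous_const (continuous_rootForm _))

lemma rootForm_add_three (k : Fin 6) (v : Plane) : rootForm (k + 3) v = -rootForm k v := by
  induction k using fin_six_cases <;> simp

lemma openSector_disjoint {j k : Fin 6} {v : Plane} (hj : v ∈ openSector j)
    (hk : v ∈ openSector k) : j = k := by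
  obtain ⟨h1, h2⟩ := hj
  obtain ⟨h3, h4⟩ := hk
  induction j using fin_six_cases <;> induction k using fin_six_cases <;>
    first | rfl | (exfalso; simp at h1 h2 h3 h4; linarith)

lemma exists_openSector {v : Plane} (h : ∀ i j, i ≠ j → coord v i ≠ coord v j) :
    ∃ k, v ∈ openSector k := by
  have h01 := h 0 1 (by decide)
  have h02 := h 0 2 (by decide)
  have h12 := h 1 2 (by decide)
  obtain ⟨k, s, t, hs, ht, rfl⟩ := exists_sectorPt v
  obtain ⟨h1, h2⟩ := rootForm_sectorPt k s t
  have hs' : s ≠ 0 := by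
    rintro rfl
    rw [mul_zero] at h1
    induction k using fin_six_cases <;> simp at h1 <;>
      first
      | exact h01 (by linarith)
      | exact h02 (by linarith)
      | exact h12 (by linarith)
  have ht' : t ≠ 0 := by
    rintro rfl
    rw [mul_zero] at h2
    clear h1
    induction k using fin_six_cases <;> simp at h2 <;>
      first
      | exact h01 (by linarith)
      | exact h02 (by linarith)
      | exact h12 (by linarith)
  refine ⟨k, ?_, ?_⟩
  · rw [h1]
    have := lt_of_le_of_ne hs hs'.symm
    positivity
  · rw [h2]
    have := lt_of_le_of_ne ht ht'.symm
    positivity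

lemma mul_neg_iff_of_pos {p a : ℝ} (hp : 0 < p) : p * a < 0 ↔ a < 0 :=
  ⟨fun h => neg_of_mul_neg_right h hp.le, mul_neg_of_pos_of_neg hp⟩

/-- Inside the strip the sine is positive, so the root form has the sign of `-wall`. The lemmas for
the other forms play the same role. -/
lemma exists_rootForm_one {ζ : ℂ} (h0 : 0 < ζ.im) (h1 : ζ.im < Real.pi / 3) :
    ∃ p > (0 : ℝ), rootForm 1 (phi (cam ζ)) = -(p * wall ζ.re ζ.im) := by
  have := Real.sin_pos_of_pos_of_lt_pi (x := 2 * ζ.im) (by linarith) (by linarith)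
  exact ⟨3 * Real.sqrt 3 * Real.sin (2 * ζ.im), by positivity, rootForm_one_phi ζ⟩

lemma exists_rootForm_five {ζ : ℂ} (h0 : 0 < ζ.im) (h1 : ζ.im < Real.pi / 3) :
    ∃ p > (0 : ℝ),
    rootForm 5 (phi (cam ζ)) = p * wall ζ.re (Real.pi / 3 - ζ.im) := by
  have := Real.sin_pos_of_pos_of_lt_pi (x := 2 * (Real.pi / 3 - ζ.im)) (by linarith) (by linarith)
  exact ⟨3 * Real.sqrt 3 * Real.sin (2 * (Real.pi / 3 - ζ.im)), by positivity, rootForm_five_phi ζ⟩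

/-- Here the second factor never vanishes in the strip, because the cosine in it is positive; the
only wall is the line `Im ζ = π/6`. -/
lemma exists_rootForm_three {ζ : ℂ} (h0 : 0 < ζ.im) (h1 : ζ.im < Real.pi / 3) :
    ∃ p > (0 : ℝ),
    rootForm 3 (phi (cam ζ)) = p * Real.sin (2 * ζ.im - Real.pi / 3) := by
  have h2 := Real.cos_pos_of_mem_Ioo (x := 2 * ζ.im - Real.pi / 3) ⟨by linarith, by linarith⟩
  have h3 := Real.cosh_pos (2 * ζ.re)
  have h4 := Real.cosh_pos (4 * ζ.re)
  exact ⟨3 * Real.sqrt 3 * (Real.cosh (2 * ζ.re) + Real.cosh (4 * ζ.re) *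
    Real.cos (2 * ζ.im - Real.pi / 3)), by positivity, by rw [rootForm_three_phi]; ring⟩

lemma rootForm_one_pos_iff {ζ : ℂ} (h0 : 0 < ζ.im) (h1 : ζ.im < Real.pi / 3) :
    0 < rootForm 1 (phi (cam ζ)) ↔ wall ζ.re ζ.im < 0 := by
  obtain ⟨p, hp, h⟩ := exists_rootForm_one h0 h1
  rw [h, neg_pos, mul_neg_iff_of_pos hp]

lemma rootForm_four_pos_iff {ζ : ℂ} (h0 : 0 < ζ.im) (h1 : ζ.im < Real.pi / 3) :
    0 < rootForm 4 (phi (cam ζ)) ↔ 0 < wall ζ.re ζ.im := by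
  obtain ⟨p, hp, h⟩ := exists_rootForm_one h0 h1
  rw [show (4 : Fin 6) = 1 + 3 from rfl, rootForm_add_three, h, neg_neg, mul_pos_iff_of_pos_left hp]

lemma rootForm_five_pos_iff {ζ : ℂ} (h0 : 0 < ζ.im) (h1 : ζ.im < Real.pi / 3) :

    0 < rootForm 5 (phi (cam ζ)) ↔ 0 < wall ζ.re (Real.pi / 3 - ζ.im) := by
  obtain ⟨p, hp, h⟩ := exists_rootForm_five h0 h1
  rw [h, mul_pos_iff_of_pos_left hp]

lemma rootForm_two_pos_iff {ζ : ℂ} (h0 : 0 < ζ.im) (h1 : ζ.im < Real.pi / 3) :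

    0 < rootForm 2 (phi (cam ζ)) ↔ wall ζ.re (Real.pi / 3 - ζ.im) < 0 := by
  obtain ⟨p, hp, h⟩ := exists_rootForm_five h0 h1
  rw [show (2 : Fin 6) = 5 + 3 from rfl, rootForm_add_three, h, neg_pos,
    mul_neg_iff_of_pos hp]

lemma rootForm_three_pos_iff {ζ : ℂ} (h0 : 0 < ζ.im) (h1 : ζ.im < Real.pi / 3) :
    0 < rootForm 3 (phi (cam ζ)) ↔ Real.pi / 6 < ζ.im := by
  obtain ⟨p, hp, h⟩ := exists_rootForm_three h0 h1
  rw [h, mul_pos_iff_of_pos_left hp]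
  constructor
  · intro h
    by_contra hc
    exact absurd (Real.sin_nonpos_of_nonpos_of_neg_pi_le (x := 2 * ζ.im - Real.pi / 3)
      (by linarith) (by linarith)) (not_le.2 h)
  · intro h
    exact Real.sin_pos_of_pos_of_lt_pi (by linarith) (by linarith)

lemma rootForm_zero_pos_iff {ζ : ℂ} (h0 : 0 < ζ.im) (h1 : ζ.im < Real.pi / 3) :
    0 < rootForm 0 (phi (cam ζ)) ↔ ζ.im < Real.pi / 6 := by
  obtain ⟨p, hp, h⟩ := exists_rootForm_three h0 h1
  rw [show (0 : Fin 6) = 3 + 3 from rfl, rootForm_add_three, h, neg_pos,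
    mul_neg_iff_of_pos hp]
  constructor
  · intro h
    by_contra hc
    exact absurd (Real.sin_nonneg_of_nonneg_of_le_pi (x := 2 * ζ.im - Real.pi / 3)
      (by linarith) (by linarith)) (not_le.2 h)
  · intro h
    exact Real.sin_neg_of_neg_of_neg_pi_lt (by linarith) (by linarith)

/-! ### The regions -/

/-- The sector that contains the periods of a region. -/
def center : Fin 10 → Fin 6 := ![1, 2, 3, 4, 4, 3, 2, 1, 0, 5]

/-- The half of the strip that contains a region. -/
def half (k : Fin 10) (η : ℝ) : Prop := (k < 4 → 0 < η) ∧ (4 ≤ k → k < 8 → η < 0)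

/-- The preimages of the regions in the strip. -/
def zone (k : Fin 10) : Set ℂ :=
  {ζ | 0 < ζ.im ∧ ζ.im < Real.pi / 3 ∧ phi (cam ζ) ∈ openSector (center k) ∧ half k ζ.re}

/-- The bound `π/6` is a consequence of the other two sign conditions, since the root form 0 is the
sum of the forms 5 and 1. -/
lemma mem_zone_zero {ζ : ℂ} : ζ ∈ zone 0 ↔ 0 < ζ.im ∧ ζ.im < Real.pi / 6 ∧ wall ζ.re ζ.im < 0 ∧
    0 < wall ζ.re (Real.pi / 3 - ζ.im) ∧ 0 < ζ.re := by
  have hpi := Real.pi_pos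
  have hh : half 0 ζ.re ↔ 0 < ζ.re := by simp [half]
  change (_ ∧ _ ∧ (0 < rootForm 5 _ ∧ 0 < rootForm 1 _) ∧ half 0 ζ.re) ↔ _
  rw [hh]
  constructor
  · rintro ⟨h0, h1, ⟨h2, h3⟩, h4⟩
    have h5 : 0 < rootForm 0 (phi (cam ζ)) := by simp at h2 h3 ⊢; linarith
    exact ⟨h0, (rootForm_zero_pos_iff h0 h1).1 h5, (rootForm_one_pos_iff h0 h1).1 h3,
      (rootForm_five_pos_iff h0 h1).1 h2, h4⟩
  · rintro ⟨h0, h1, h2, h3, h4⟩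
    have h1' : ζ.im < Real.pi / 3 := by linarith
    exact ⟨h0, h1', ⟨(rootForm_five_pos_iff h0 h1').2 h3, (rootForm_one_pos_iff h0 h1').2 h2⟩, h4⟩

lemma mem_zone_one {ζ : ℂ} : ζ ∈ zone 1 ↔ 0 < ζ.im ∧ ζ.im < Real.pi / 6 ∧
    wall ζ.re (Real.pi / 3 - ζ.im) < 0 ∧ 0 < ζ.re := by
  have hpi := Real.pi_pos
  have hh : half 1 ζ.re ↔ 0 < ζ.re := by simp [half]
  change (_ ∧ _ ∧ (0 < rootForm 0 _ ∧ 0 < rootForm 2 _) ∧ half 1 ζ.re) ↔ _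
  rw [hh]
  constructor
  · rintro ⟨h0, h1, ⟨h2, h3⟩, h4⟩
    exact ⟨h0, (rootForm_zero_pos_iff h0 h1).1 h2, (rootForm_two_pos_iff h0 h1).1 h3, h4⟩
  · rintro ⟨h0, h1, h2, h4⟩
    have h1' : ζ.im < Real.pi / 3 := by linarith
    exact ⟨h0, h1', ⟨(rootForm_zero_pos_iff h0 h1').2 h1, (rootForm_two_pos_iff h0 h1').2 h2⟩, h4⟩

lemma mem_zone_eight {ζ : ℂ} : ζ ∈ zone 8 ↔ 0 < ζ.im ∧ ζ.im < Real.pi / 6 ∧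
    0 < wall ζ.re ζ.im := by
  have hpi := Real.pi_pos
  have hh : half 8 ζ.re := by simp [half]
  change (_ ∧ _ ∧ (0 < rootForm 4 _ ∧ 0 < rootForm 0 _) ∧ half 8 ζ.re) ↔ _
  constructor
  · rintro ⟨h0, h1, ⟨h2, h3⟩, h4⟩
    exact ⟨h0, (rootForm_zero_pos_iff h0 h1).1 h3, (rootForm_four_pos_iff h0 h1).1 h2⟩
  · rintro ⟨h0, h1, h2⟩
    have h1' : ζ.im < Real.pi / 3 := by linarith
    exact ⟨h0, h1', ⟨(rootForm_four_pos_iff h0 h1').2 h2, (rootForm_zero_pos_iff h0 h1').2 h1⟩, hh⟩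

/-- The two reflections of the strip. -/
def flipRe (ζ : ℂ) : ℂ := -(starRingEnd ℂ) ζ

def flipIm (ζ : ℂ) : ℂ := (starRingEnd ℂ) ζ + (Real.pi / 3 : ℝ) * Complex.I

@[simp] lemma re_flipRe (ζ : ℂ) : (flipRe ζ).re = -ζ.re := by simp [flipRe]
@[simp] lemma im_flipRe (ζ : ℂ) : (flipRe ζ).im = ζ.im := by simp [flipRe]
@[simp] lemma re_flipIm (ζ : ℂ) : (flipIm ζ).re = ζ.re := by
  rw [flipIm, Complex.add_re, Complex.re_ofReal_mul]
  simp
@[simp] lemma im_flipIm (ζ : ℂ) : (flipIm ζ).im = Real.pi / 3 - ζ.im := by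
  rw [flipIm, Complex.add_im, Complex.im_ofReal_mul]
  simp
  ring

lemma flipRe_flipRe (ζ : ℂ) : flipRe (flipRe ζ) = ζ := by
  apply Complex.ext <;> simp

lemma flipIm_flipIm (ζ : ℂ) : flipIm (flipIm ζ) = ζ := by
  apply Complex.ext <;> simp

lemma continuous_flipRe : Continuous flipRe := by
  unfold flipRe
  exact Complex.continuous_conj.neg

lemma continuous_flipIm : Continuous flipIm := by
  unfold flipIm
  exact Complex.continuous_conj.add continuous_const

lemma xCoord_conj (ζ : ℂ) : xCoord ((starRingEnd ℂ) ζ) = (starRingEnd ℂ) (xCoord ζ) := by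
  simp only [xCoord, map_mul, ← Complex.cosh_conj, Complex.conj_ofNat]

lemma xCoord_flipRe (ζ : ℂ) : xCoord (flipRe ζ) = (starRingEnd ℂ) (xCoord ζ) := by
  rw [flipRe, xCoord_neg, xCoord_conj]

lemma xCoord_flipIm (ζ : ℂ) : xCoord (flipIm ζ) = -(starRingEnd ℂ) (xCoord ζ) := by
  rw [← xCoord_conj, xCoord, xCoord, flipIm, mul_add,
    show 3 * (((Real.pi / 3 : ℝ) : ℂ) * Complex.I) = Real.pi * Complex.I by push_cast; ring,
    Complex.cosh_add, Complex.cosh_mul_I, Complex.sinh_mul_I, Complex.cos_pi, Complex.sin_pi]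
  ring

lemma phi_flipRe (ζ : ℂ) : phi (cam (flipRe ζ)) = phi (cam ζ) := by
  obtain ⟨h0, h1, -⟩ := coord_phi_cam ζ
  obtain ⟨h0', h1', -⟩ := coord_phi_cam (flipRe ζ)
  refine plane_ext' ?_ ?_
  · rw [h0, h0']
    simp [wave]
  · rw [h1, h1']
    simp [wave]

lemma phi_flipIm (ζ : ℂ) : phi (cam (flipIm ζ)) = permPlane (Equiv.swap 1 2) (phi (cam ζ)) := by
  obtain ⟨h0, h1, h2⟩ := coord_phi_cam ζ
  obtain ⟨h0', h1', h2'⟩ := coord_phi_cam (flipIm ζ)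
  refine plane_ext' ?_ ?_
  · change _ = coord (phi (cam ζ)) 0
    rw [h0, h0', re_flipIm, im_flipIm, ← wave_neg, ← wave_sub_pi]
    congr 1
    ring
  · change _ = coord (phi (cam ζ)) 2
    rw [h2, h1', re_flipIm, im_flipIm, ← wave_neg,
      show -(Real.pi / 3 - ζ.im + 2 * Real.pi / 3) = ζ.im - Real.pi by ring, wave_sub_pi]

lemma rootForm_swap (j : Fin 6) (v : Plane) :
    rootForm j (permPlane (Equiv.swap 1 2) v) = rootForm (3 - j) v := by
  induction j using fin_six_cases
  · change coord v 2 - coord v 1 = coord v 2 - coord v 1; rfl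
  · change coord v 2 - coord v 0 = coord v 2 - coord v 0; rfl
  · change coord v 1 - coord v 0 = coord v 1 - coord v 0; rfl
  · change coord v 1 - coord v 2 = coord v 1 - coord v 2; rfl
  · change coord v 0 - coord v 2 = coord v 0 - coord v 2; rfl
  · change coord v 0 - coord v 1 = coord v 0 - coord v 1; rfl

/-- The effect of complex conjugation of `x` on the indices of the regions. -/
def upDown : Fin 10 → Fin 10 := ![7, 6, 5, 4, 3, 2, 1, 0, 8, 9]

/-- The effect of `x ↦ -x̄` on the indices of the regions. -/
def leftRight : Fin 10 → Fin 10 := ![3, 2, 1, 0, 7, 6, 5, 4, 9, 8]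

lemma flipRe_mem_zone {k : Fin 10} {ζ : ℂ} (h : ζ ∈ zone k) : flipRe ζ ∈ zone (upDown k) := by
  obtain ⟨h0, h1, h2, h3⟩ := h
  refine ⟨by simpa, by simpa, ?_, ?_⟩
  · rwa [phi_flipRe, (by decide : ∀ k, center (upDown k) = center k) k]
  · rw [re_flipRe]
    unfold half at *
    simp only [Left.neg_pos_iff, Left.neg_neg_iff]
    revert h3
    clear h2
    fin_cases k <;> simp [upDown]

lemma flipIm_mem_zone {k : Fin 10} {ζ : ℂ} (h : ζ ∈ zone k) : flipIm ζ ∈ zone (leftRight k) := by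
  obtain ⟨h0, h1, h2, h3⟩ := h
  refine ⟨by simpa, by simpa, ?_, ?_⟩
  · rw [phi_flipIm, (by decide : ∀ k, center (leftRight k) = 5 - center k) k]
    refine ⟨?_, ?_⟩
    · rw [rootForm_swap, (by decide : ∀ c : Fin 6, 3 - (5 - c + 4) = c) (center k)]
      exact h2.2
    · rw [rootForm_swap, (by decide : ∀ c : Fin 6, 3 - (5 - c) = c + 4) (center k)]
      exact h2.1
  · rw [re_flipIm]
    unfold half at *
    revert h3
    clear h2
    fin_cases k <;> simp [leftRight]

/-- The image of a zone in the `x`-line. -/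
def chamber (k : Fin 10) : Set ℂ := xCoord '' zone k

lemma isOpen_zone (k : Fin 10) : IsOpen (zone k) := by
  have h1 : IsOpen {ζ : ℂ | 0 < ζ.im} := isOpen_lt continuous_const Complex.continuous_im
  have h2 : IsOpen {ζ : ℂ | ζ.im < Real.pi / 3} := isOpen_lt Complex.continuous_im continuous_const
  have h3 : IsOpen {ζ : ℂ | phi (cam ζ) ∈ openSector (center k)} :=
    (isOpen_openSector _).preimage (continuous_phi.comp continuous_cam)
  have h4 : IsOpen {ζ : ℂ | half k ζ.re} := by
    have : IsOpen {η : ℝ | half k η} := by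
      refine IsOpen.inter (s := {η : ℝ | k < 4 → 0 < η})
        (t := {η : ℝ | 4 ≤ k → k < 8 → η < 0}) ?_ ?_
      · by_cases h : k < 4
        · simp only [h, forall_const]
          exact isOpen_Ioi
        · simp only [h, IsEmpty.forall_iff]
          exact isOpen_univ
      · by_cases h : 4 ≤ k ∧ k < 8
        · simp only [h.1, h.2, forall_const]
          exact isOpen_Iio
        · have : {η : ℝ | 4 ≤ k → k < 8 → η < 0} = univ :=
            eq_univ_of_forall fun η h1 h2 => absurd ⟨h1, h2⟩ h
          rw [this]
          exact isOpen_univ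
    exact this.preimage Complex.continuous_re
  exact h1.inter (h2.inter (h3.inter h4))

lemma isOpen_chamber (k : Fin 10) : IsOpen (chamber k) := isOpenMap_xCoord _ (isOpen_zone k)

end BNR

end

/-! ### Adjacency and connectedness of the regions -/

noncomputable section

namespace BNR

lemma mem_closure_of_right {S : Set ℂ} {γ : ℝ → ℂ} (hγ : Continuous γ)
    (h : ∀ᶠ t in 𝓝[>] (0 : ℝ), γ t ∈ S) : γ 0 ∈ closure S :=
  mem_closure_of_tendsto ((hγ.tendsto 0).mono_left nhdsWithin_le_nhds) h

lemma eventually_right {U : Set ℂ} (hU : IsOpen U) {ζ : ℂ} (h : ζ ∈ U) (d : ℂ) :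
    ∀ᶠ t : ℝ in 𝓝[>] (0 : ℝ), 0 < t ∧ ζ + t * d ∈ U := by
  have hc : Continuous fun t : ℝ => ζ + t * d := by fun_prop
  have h1 : ∀ᶠ t : ℝ in 𝓝 (0 : ℝ), ζ + t * d ∈ U :=
    hc.continuousAt.eventually (hU.mem_nhds (by simpa using h))
  exact (eventually_mem_nhdsWithin.mono fun t ht => ht).and (nhdsWithin_le_nhds h1)

lemma mem_closure_of_direction {S U : Set ℂ} (hU : IsOpen U) {ζ : ℂ} (h : ζ ∈ U) (d : ℂ)
    (hS : ∀ t : ℝ, 0 < t → ζ + t * d ∈ U → ζ + t * d ∈ S) : ζ ∈ closure S := by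
  have hc : Continuous fun t : ℝ => ζ + t * d := by fun_prop
  have := mem_closure_of_right hc ((eventually_right hU h d).mono fun t ht => hS t ht.1 ht.2)
  simpa using this

@[simp] lemma re_add_mul_I (ζ : ℂ) (t : ℝ) : (ζ + t * Complex.I).re = ζ.re := by simp

@[simp] lemma im_add_mul_I (ζ : ℂ) (t : ℝ) : (ζ + t * Complex.I).im = ζ.im + t := by simp

/-! ### Adjacent regions -/

/-- The two regions meet along a wall. -/
def Meets (j k : Fin 10) : Prop :=
  ∃ x, x ∈ closure (chamber j) ∧ x ∈ closure (chamber k) ∧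
    x ∈ interior (closure (chamber j ∪ chamber k))

lemma Meets.symm {j k : Fin 10} (h : Meets j k) : Meets k j := by
  obtain ⟨x, h1, h2, h3⟩ := h
  exact ⟨x, h2, h1, by rwa [union_comm]⟩

/-- A function that is strictly increasing in the vertical direction has a zero set approached from
both sides. So `U` lies in the closure of `Z ∪ Z'`, and the open map `xCoord` transports this to the
`x`-plane. -/
lemma meets_of_sign_change {j k : Fin 10} {Z Z' U : Set ℂ} (f : ℂ → ℝ) {ζ : ℂ}
    (hZ : xCoord '' Z ⊆ chamber j) (hZ' : xCoord '' Z' ⊆ chamber k) (hU : IsOpen U) (hζ : ζ ∈ U)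
    (hf : f ζ = 0) (hpos : ∀ z ∈ U, 0 < f z → z ∈ Z) (hneg : ∀ z ∈ U, f z < 0 → z ∈ Z')
    (hmono : ∀ z ∈ U, ∀ t : ℝ, 0 < t → z + t * Complex.I ∈ U → f z < f (z + t * Complex.I)) :
    Meets j k := by
  have h1 : ∀ z ∈ U, f z = 0 → z ∈ closure Z := fun z hz hz0 =>
    mem_closure_of_direction hU hz Complex.I fun t ht h =>
      hpos _ h (by rw [← hz0]; exact hmono z hz t ht h)
  have h2 : ζ ∈ closure Z' :=
    mem_closure_of_direction hU hζ (-Complex.I) fun t ht h =>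
      hneg _ h (by
        have := hmono _ h t ht (by simpa using hζ)
        simpa [hf] using this)
  have h3 : U ⊆ closure (Z ∪ Z') := by
    intro z hz
    rcases lt_trichotomy (f z) 0 with h | h | h
    · exact subset_closure (Or.inr (hneg z hz h))
    · exact closure_mono subset_union_left (h1 z hz h)
    · exact subset_closure (Or.inl (hpos z hz h))
  have hcl : ∀ S : Set ℂ, xCoord '' closure S ⊆ closure (xCoord '' S) := fun S =>
    image_closure_subset_closure_image continuous_xCoord
  refine ⟨xCoord ζ, closure_mono hZ (hcl _ ⟨ζ, h1 ζ hζ hf, rfl⟩),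
    closure_mono hZ' (hcl _ ⟨ζ, h2, rfl⟩), ?_⟩
  refine mem_interior.2 ⟨xCoord '' U, ?_, isOpenMap_xCoord U hU, ⟨ζ, hζ, rfl⟩⟩
  refine (image_mono h3).trans ((hcl _).trans (closure_mono ?_))
  rw [image_union]
  exact union_subset_union hZ hZ'

lemma exists_cosh_eq {C : ℝ} (hC : 1 < C) : ∃ η > (0 : ℝ), Real.cosh (2 * η) = C := by
  refine ⟨Real.arsinh (Real.sqrt (C ^ 2 - 1)) / 2, ?_, ?_⟩
  · have : 0 < Real.sqrt (C ^ 2 - 1) := Real.sqrt_pos.2 (by nlinarith)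
    have := Real.arsinh_pos_iff.2 this
    positivity
  · rw [mul_div_cancel₀ _ two_ne_zero, Real.cosh_arsinh, Real.sq_sqrt (by nlinarith),
      add_sub_cancel, Real.sqrt_sq (by linarith)]

lemma wall_eq_of_cosh {η C : ℝ} (h : Real.cosh (2 * η) = C) (θ : ℝ) :
    wall η θ = C - (2 * C ^ 2 - 1) * Real.cos (2 * θ) := by
  rw [wall, cosh_four_mul, h]

lemma wall_pi_div_six {η C : ℝ} (h : Real.cosh (2 * η) = C) :
    wall η (Real.pi / 6) = C - (2 * C ^ 2 - 1) / 2 := by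
  rw [wall_eq_of_cosh h, show 2 * (Real.pi / 6) = Real.pi / 3 by ring, Real.cos_pi_div_three]
  ring

lemma mem_zone_two {ζ : ℂ} (h0 : Real.pi / 6 < ζ.im) (h1 : ζ.im < Real.pi / 3)
    (h2 : wall ζ.re ζ.im < 0) (h3 : 0 < ζ.re) : ζ ∈ zone 2 := by
  have : flipIm ζ ∈ zone 1 := mem_zone_one.2 ⟨by simpa, by rw [im_flipIm]; linarith,
    by simpa, by simpa⟩
  simpa [flipIm_flipIm, leftRight] using flipIm_mem_zone this

lemma mem_zone_nine {ζ : ℂ} (h0 : Real.pi / 6 < ζ.im) (h1 : ζ.im < Real.pi / 3)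
    (h2 : 0 < wall ζ.re (Real.pi / 3 - ζ.im)) : ζ ∈ zone 9 := by
  have : flipIm ζ ∈ zone 8 := mem_zone_eight.2 ⟨by simpa, by rw [im_flipIm]; linarith, by simpa⟩
  simpa [flipIm_flipIm, leftRight] using flipIm_mem_zone this

lemma isOpen_band (a b : ℝ) : IsOpen {ζ : ℂ | a < ζ.im ∧ ζ.im < b} :=
  (isOpen_lt continuous_const Complex.continuous_im).inter
    (isOpen_lt Complex.continuous_im continuous_const)

lemma isOpen_right : IsOpen {ζ : ℂ | 0 < ζ.re} := isOpen_lt continuous_const Complex.continuous_re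

lemma meets_zero_one : Meets 0 1 := by
  have hpi := Real.pi_pos
  -- The collision point has `cosh 2η = (1 + √3) / 2`. The value 2 lies beyond it, where `wall η
  -- (π/6)` is negative.
  obtain ⟨η, hη, hC⟩ := exists_cosh_eq (C := 2) (by norm_num)
  have hcont : Continuous fun θ : ℝ => wall η (Real.pi / 3 - θ) := by
    unfold wall
    fun_prop
  obtain ⟨θ, ⟨h1, h2⟩, h3⟩ := intermediate_value_Ioo' (a := Real.pi / 12) (b := Real.pi / 6)
    (by linarith) hcont.continuousOn (show (0 : ℝ) ∈ Ioo _ _ from ⟨by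
      rw [show Real.pi / 3 - Real.pi / 6 = Real.pi / 6 by ring, wall_pi_div_six hC]
      norm_num, by
      refine wall_pos_of_cos_nonpos _ ?_
      rw [show 2 * (Real.pi / 3 - Real.pi / 12) = Real.pi / 2 by ring, Real.cos_pi_div_two]⟩)
  have h4 : wall η θ < 0 := by
    rw [← h3]
    exact wall_lt_wall η (by linarith) (by linarith) (by linarith)
  refine Meets.symm (meets_of_sign_change (Z := zone 1) (Z' := zone 0)
    (U := {ζ | 0 < ζ.im ∧ ζ.im < Real.pi / 6} ∩ ({ζ | 0 < ζ.re} ∩ {ζ | wall ζ.re ζ.im < 0}))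
    (fun ζ => -wall ζ.re (Real.pi / 3 - ζ.im)) (ζ := ⟨η, θ⟩) subset_rfl subset_rfl
    ((isOpen_band _ _).inter (isOpen_right.inter (isOpen_lt continuous_wall continuous_const)))
    ⟨⟨by change 0 < θ; linarith, h2⟩, hη, h4⟩ (by simpa using h3) ?_ ?_ ?_)
  · rintro z ⟨⟨a1, a2⟩, a3, a4⟩ h
    exact mem_zone_one.2 ⟨a1, a2, by linarith, a3⟩
  · rintro z ⟨⟨a1, a2⟩, a3, a4⟩ h
    exact mem_zone_zero.2 ⟨a1, a2, a4, by linarith, a3⟩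
  · rintro z ⟨⟨a1, a2⟩, a3, a4⟩ t ht ⟨⟨b1, b2⟩, b3, b4⟩
    simp only [im_add_mul_I, re_add_mul_I] at *
    exact neg_lt_neg (wall_lt_wall _ (by linarith) (by linarith) (by linarith))

lemma meets_zero_eight : Meets 0 8 := by
  have hpi := Real.pi_pos
  -- The value `11/10` lies between the branch point and the collision point, where `wall η (π/6)`
  -- is positive.
  obtain ⟨η, hη, hC⟩ := exists_cosh_eq (C := 11 / 10) (by norm_num)
  have hcont : Continuous fun θ : ℝ => wall η θ := by
    unfold wall
    fun_prop
  obtain ⟨θ, ⟨h1, h2⟩, h3⟩ := intermediate_value_Ioo (a := 0) (b := Real.pi / 6)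
    (by linarith) hcont.continuousOn (show (0 : ℝ) ∈ Ioo _ _ from ⟨by
      rw [wall_eq_of_cosh hC, mul_zero, Real.cos_zero]
      norm_num, by
      rw [wall_pi_div_six hC]
      norm_num⟩)
  refine Meets.symm (meets_of_sign_change (Z := zone 8) (Z' := zone 0)
    (U := {ζ | 0 < ζ.im ∧ ζ.im < Real.pi / 6} ∩
      ({ζ | 0 < ζ.re} ∩ {ζ | 0 < wall ζ.re (Real.pi / 3 - ζ.im)}))
    (fun ζ => wall ζ.re ζ.im) (ζ := ⟨η, θ⟩) subset_rfl subset_rfl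
    ((isOpen_band _ _).inter (isOpen_right.inter (isOpen_lt continuous_const continuous_wall')))
    ⟨⟨h1, h2⟩, hη, ?_⟩ h3 ?_ ?_ ?_)
  · change 0 < wall η (Real.pi / 3 - θ)
    rw [← h3]
    exact wall_lt_wall η (by linarith) (by linarith) (by linarith)
  · rintro z ⟨⟨a1, a2⟩, a3, a4⟩ h
    exact mem_zone_eight.2 ⟨a1, a2, h⟩
  · rintro z ⟨⟨a1, a2⟩, a3, a4⟩ h
    exact mem_zone_zero.2 ⟨a1, a2, h, a4, a3⟩
  · rintro z ⟨⟨a1, a2⟩, a3, a4⟩ t ht ⟨⟨b1, b2⟩, b3, b4⟩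
    simp only [im_add_mul_I, re_add_mul_I] at *
    exact wall_lt_wall _ (by linarith) (by linarith) (by linarith)

lemma meets_one_two : Meets 1 2 := by
  have hpi := Real.pi_pos
  obtain ⟨η, hη, hC⟩ := exists_cosh_eq (C := 2) (by norm_num)
  have h6 : wall η (Real.pi / 6) < 0 := by
    rw [wall_pi_div_six hC]
    norm_num
  refine Meets.symm (meets_of_sign_change (Z := zone 2) (Z' := zone 1)
    (U := {ζ | 0 < ζ.im ∧ ζ.im < Real.pi / 3} ∩ ({ζ | 0 < ζ.re} ∩
      ({ζ | wall ζ.re ζ.im < 0} ∩ {ζ | wall ζ.re (Real.pi / 3 - ζ.im) < 0})))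
    (fun ζ => ζ.im - Real.pi / 6) (ζ := ⟨η, Real.pi / 6⟩) subset_rfl subset_rfl
    ((isOpen_band _ _).inter (isOpen_right.inter ((isOpen_lt continuous_wall continuous_const).inter
      (isOpen_lt continuous_wall' continuous_const))))
    ⟨⟨by change 0 < Real.pi / 6; linarith, by change Real.pi / 6 < Real.pi / 3; linarith⟩, hη, h6,
      ?_⟩ (sub_self _) ?_ ?_ ?_)
  · change wall η (Real.pi / 3 - Real.pi / 6) < 0
    rwa [show Real.pi / 3 - Real.pi / 6 = Real.pi / 6 by ring]
  · rintro z ⟨⟨a1, a2⟩, a3, a4, a5⟩ h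
    exact mem_zone_two (by linarith) a2 a4 a3
  · rintro z ⟨⟨a1, a2⟩, a3, a4, a5⟩ h
    exact mem_zone_one.2 ⟨a1, by linarith, a5, a3⟩
  · intro z _ t ht _
    simp only [im_add_mul_I]
    linarith

lemma meets_eight_nine : Meets 8 9 := by
  have hpi := Real.pi_pos
  have h6 : 0 < wall 0 (Real.pi / 6) := wall_zero_pos (by linarith) (by linarith)
  refine Meets.symm (meets_of_sign_change (Z := zone 9) (Z' := zone 8)
    (U := {ζ | 0 < ζ.im ∧ ζ.im < Real.pi / 3} ∩
      ({ζ | 0 < wall ζ.re ζ.im} ∩ {ζ | 0 < wall ζ.re (Real.pi / 3 - ζ.im)}))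
    (fun ζ => ζ.im - Real.pi / 6) (ζ := ⟨0, Real.pi / 6⟩) subset_rfl subset_rfl
    ((isOpen_band _ _).inter ((isOpen_lt continuous_const continuous_wall).inter
      (isOpen_lt continuous_const continuous_wall')))
    ⟨⟨by change 0 < Real.pi / 6; linarith, by change Real.pi / 6 < Real.pi / 3; linarith⟩, h6,
      ?_⟩ (sub_self _) ?_ ?_ ?_)
  · change 0 < wall 0 (Real.pi / 3 - Real.pi / 6)
    rwa [show Real.pi / 3 - Real.pi / 6 = Real.pi / 6 by ring]
  · rintro z ⟨⟨a1, a2⟩, a3, a4⟩ h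
    exact mem_zone_nine (by linarith) a2 a4
  · rintro z ⟨⟨a1, a2⟩, a3, a4⟩ h
    exact mem_zone_eight.2 ⟨a1, by linarith, a3⟩
  · intro z _ t ht _
    simp only [im_add_mul_I]
    linarith

lemma wall_zero_right_neg {η : ℝ} (hη : 0 < η) : wall η 0 < 0 := by
  have h1 : 1 < Real.cosh (2 * η) := Real.one_lt_cosh.2 (by positivity)
  rw [wall, cosh_four_mul, mul_zero, Real.cos_zero]
  nlinarith

/-- The common boundary is on the line `Im ζ = 0`, the edge of the strip. Points below it represent
region 7 through the evenness of `xCoord`. -/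
lemma meets_zero_seven : Meets 0 7 := by
  have hpi := Real.pi_pos
  have hcont : Continuous fun ζ : ℂ => wall ζ.re (Real.pi / 3 + ζ.im) := by
    unfold wall
    fun_prop
  have h3 : 0 < wall 1 (Real.pi / 3) := wall_pos_of_cos_nonpos 1
    (Real.cos_nonpos_of_pi_div_two_le_of_le (by linarith) (by linarith))
  refine meets_of_sign_change (Z := zone 0) (Z' := {ζ | -ζ ∈ zone 7})
    (U := {ζ | -(Real.pi / 6) < ζ.im ∧ ζ.im < Real.pi / 6} ∩ ({ζ | 0 < ζ.re} ∩
      ({ζ | wall ζ.re ζ.im < 0} ∩ ({ζ | 0 < wall ζ.re (Real.pi / 3 - ζ.im)} ∩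
        {ζ | 0 < wall ζ.re (Real.pi / 3 + ζ.im)}))))
    (fun ζ => ζ.im) (ζ := ⟨1, 0⟩) subset_rfl ?_
    ((isOpen_band _ _).inter (isOpen_right.inter ((isOpen_lt continuous_wall continuous_const).inter
      ((isOpen_lt continuous_const continuous_wall').inter (isOpen_lt continuous_const hcont)))))
    ⟨⟨by change -(Real.pi / 6) < 0; linarith, by change 0 < Real.pi / 6; linarith⟩, ?_,
      wall_zero_right_neg one_pos, ?_, ?_⟩ rfl ?_ ?_ ?_
  · rintro _ ⟨z, hz, rfl⟩
    exact ⟨-z, hz, xCoord_neg z⟩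
  · exact one_pos (α := ℝ)
  · simpa using h3
  · simpa using h3
  · rintro z ⟨⟨a1, a2⟩, a3, a4, a5, a6⟩ h
    exact mem_zone_zero.2 ⟨h, a2, a4, a5, a3⟩
  · rintro z ⟨⟨a1, a2⟩, a3, a4, a5, a6⟩ h
    have : (starRingEnd ℂ) z ∈ zone 0 := mem_zone_zero.2 ⟨by simpa using h,
      by rw [Complex.conj_im]; linarith, by simpa [wall_neg_right] using a4,
      by simpa using a6, by simpa using a3⟩
    simpa [flipRe, upDown] using flipRe_mem_zone this
  · intro z _ t ht _
    simp only [im_add_mul_I]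
    linarith

def conjHomeo : ℂ ≃ₜ ℂ := Complex.conjCLE.toHomeomorph

lemma conjHomeo_apply (x : ℂ) : conjHomeo x = (starRingEnd ℂ) x := rfl

lemma chamber_upDown (k : Fin 10) : chamber (upDown k) = conjHomeo '' chamber k := by
  apply Subset.antisymm
  · rintro _ ⟨ζ, hζ, rfl⟩
    refine ⟨_, ⟨_, ?_, rfl⟩, (conjHomeo_apply _).trans ((xCoord_flipRe (flipRe ζ)).symm.trans
      (by rw [flipRe_flipRe]))⟩
    have := flipRe_mem_zone hζ
    rwa [(by decide : ∀ k, upDown (upDown k) = k) k] at this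
  · rintro _ ⟨_, ⟨ζ, hζ, rfl⟩, rfl⟩
    exact ⟨_, flipRe_mem_zone hζ, xCoord_flipRe ζ⟩

def negConjHomeo : ℂ ≃ₜ ℂ := conjHomeo.trans (Homeomorph.neg ℂ)

lemma negConjHomeo_apply (x : ℂ) : negConjHomeo x = -(starRingEnd ℂ) x := rfl

lemma chamber_leftRight (k : Fin 10) : chamber (leftRight k) = negConjHomeo '' chamber k := by
  apply Subset.antisymm
  · rintro _ ⟨ζ, hζ, rfl⟩
    refine ⟨_, ⟨_, ?_, rfl⟩, (negConjHomeo_apply _).trans ((xCoord_flipIm (flipIm ζ)).symm.trans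
      (by rw [flipIm_flipIm]))⟩
    have := flipIm_mem_zone hζ
    rwa [(by decide : ∀ k, leftRight (leftRight k) = k) k] at this
  · rintro _ ⟨_, ⟨ζ, hζ, rfl⟩, rfl⟩
    exact ⟨_, flipIm_mem_zone hζ, xCoord_flipIm ζ⟩

lemma Meets.image {e : ℂ ≃ₜ ℂ} {ν : Fin 10 → Fin 10} (he : ∀ k, chamber (ν k) = e '' chamber k)
    {j k : Fin 10} (h : Meets j k) : Meets (ν j) (ν k) := by
  obtain ⟨x, h1, h2, h3⟩ := h
  refine ⟨e x, ?_, ?_, ?_⟩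
  · rw [he, ← e.image_closure]
    exact mem_image_of_mem e h1
  · rw [he, ← e.image_closure]
    exact mem_image_of_mem e h2
  · rw [he, he, ← image_union, ← e.image_closure, ← e.image_interior]
    exact mem_image_of_mem e h3

/-- The pairs of adjacent regions. -/
def adjacentPairs : List (Fin 10 × Fin 10) :=
  [(0, 1), (1, 2), (2, 3), (3, 4), (4, 5), (5, 6), (6, 7), (7, 0), (0, 8), (7, 8), (8, 9), (3, 9),
    (4, 9)]

lemma meets_of_mem {p : Fin 10 × Fin 10} (hp : p ∈ adjacentPairs) : Meets p.1 p.2 := by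
  have hu : ∀ {j k j' k'}, upDown j = j' → upDown k = k' → Meets j k → Meets j' k' := by
    rintro j k _ _ rfl rfl h
    exact h.image chamber_upDown
  have hl : ∀ {j k j' k'}, leftRight j = j' → leftRight k = k' → Meets j k → Meets j' k' := by
    rintro j k _ _ rfl rfl h
    exact h.image chamber_leftRight
  have h32 : Meets 3 2 := hl (by decide) (by decide) meets_zero_one
  have h39 : Meets 3 9 := hl (by decide) (by decide) meets_zero_eight
  have h34 : Meets 3 4 := hl (by decide) (by decide) meets_zero_seven
  have h45 : Meets 4 5 := hu (by decide) (by decide) h32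
  have h65 : Meets 6 5 := hu (by decide) (by decide) meets_one_two
  have h76 : Meets 7 6 := hu (by decide) (by decide) meets_zero_one
  have h78 : Meets 7 8 := hu (by decide) (by decide) meets_zero_eight
  have h49 : Meets 4 9 := hu (by decide) (by decide) h39
  simp only [adjacentPairs, List.mem_cons, List.not_mem_nil, or_false] at hp
  rcases hp with rfl | rfl | rfl | rfl | rfl | rfl | rfl | rfl | rfl | rfl | rfl | rfl | rfl
  exacts [meets_zero_one, meets_one_two, h32.symm, h34, h45, h65.symm, h76.symm,
    meets_zero_seven.symm, meets_zero_eight, h78, meets_eight_nine, h39, h49]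

/-! ### The zones are connected -/

lemma joinedIn_vertical {S : Set ℂ} {a b c : ℝ} (h : ∀ θ ∈ uIcc b c, (⟨a, θ⟩ : ℂ) ∈ S) :
    JoinedIn S ⟨a, b⟩ ⟨a, c⟩ := by
  refine JoinedIn.ofLine (f := fun t => (a : ℂ) + ((b + t * (c - b) : ℝ) : ℂ) * Complex.I)
    (by fun_prop) (by apply Complex.ext <;> simp) (by apply Complex.ext <;> simp) ?_
  rintro _ ⟨t, ht, rfl⟩
  have := h (b + t * (c - b)) (by
    rw [← segment_eq_uIcc, segment_eq_image']
    exact ⟨t, ht, by simp⟩)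
  convert this using 1
  apply Complex.ext <;> simp

lemma joinedIn_horizontal {S : Set ℂ} {a b c : ℝ} (h : ∀ η ∈ uIcc a b, (⟨η, c⟩ : ℂ) ∈ S) :
    JoinedIn S ⟨a, c⟩ ⟨b, c⟩ := by
  refine JoinedIn.ofLine (f := fun t => ((a + t * (b - a) : ℝ) : ℂ) + (c : ℂ) * Complex.I)
    (by fun_prop) (by apply Complex.ext <;> simp) (by apply Complex.ext <;> simp) ?_
  rintro _ ⟨t, ht, rfl⟩
  have := h (a + t * (b - a)) (by
    rw [← segment_eq_uIcc, segment_eq_image']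
    exact ⟨t, ht, by simp⟩)
  convert this using 1
  apply Complex.ext <;> simp

lemma isPreconnected_of_joinedIn {S : Set ℂ} (h : ∀ p ∈ S, ∀ q ∈ S, JoinedIn S p q) :
    IsPreconnected S := by
  rcases S.eq_empty_or_nonempty with rfl | hne
  · exact isPreconnected_empty
  · exact (isPathConnected_iff.2 ⟨hne, h⟩).isConnected.isPreconnected

lemma wall_le_wall (η : ℝ) {θ θ' : ℝ} (h0 : 0 ≤ θ) (h : θ ≤ θ') (h1 : θ' ≤ Real.pi / 2) :
    wall η θ ≤ wall η θ' := by
  rcases h.eq_or_lt with rfl | h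
  · exact le_rfl
  · exact (wall_lt_wall η h0 h h1).le

/-- Moving down and then to the right preserves the inequalities: `wall` is monotone in `θ`, its
negativity persists as `|η|` grows, and for `θ ≤ π/12` the other wall is positive for every `η`. -/
lemma isPreconnected_zone_zero : IsPreconnected (zone 0) := by
  have hpi := Real.pi_pos
  have key : ∀ p ∈ zone 0, ∀ θ η : ℝ, 0 < θ → θ ≤ p.im → θ ≤ Real.pi / 12 → p.re ≤ η →
      JoinedIn (zone 0) p ⟨η, θ⟩ := by
    intro p hp θ η h0 h1 h2 h3
    obtain ⟨a1, a2, a3, a4, a5⟩ := mem_zone_zero.1 hp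
    refine (joinedIn_vertical (a := p.re) (b := p.im) (c := θ) fun t ht => ?_).trans
      (joinedIn_horizontal fun t ht => ?_)
    · rw [uIcc_of_ge h1] at ht
      obtain ⟨b1, b2⟩ := ht
      refine mem_zone_zero.2 ⟨by change 0 < t; linarith, by change t < _; linarith, ?_, ?_, a5⟩
      · exact (wall_le_wall p.re (by linarith) b2 (by linarith)).trans_lt a3
      · exact a4.trans_le (wall_le_wall p.re (by linarith) (by change _ ≤ _ - t; linarith)
          (by change _ - t ≤ _; linarith))
    · rw [uIcc_of_le h3] at ht
      obtain ⟨b1, b2⟩ := ht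
      refine mem_zone_zero.2 ⟨h0, by change θ < _; linarith, ?_, ?_, by change 0 < t; linarith⟩
      · refine wall_neg (η := p.re) ?_ ((wall_le_wall p.re h0.le h1 (by linarith)).trans_lt a3)
        change |p.re| ≤ |t|
        rw [abs_of_pos a5, abs_of_pos (by linarith)]
        exact b1
      · exact wall_pos_of_cos_nonpos t (Real.cos_nonpos_of_pi_div_two_le_of_le
          (by change _ ≤ 2 * (_ - θ); linarith) (by change 2 * (_ - θ) ≤ _; linarith))
  refine isPreconnected_of_joinedIn fun p hp q hq => ?_
  have hp0 := (mem_zone_zero.1 hp).1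
  have hq0 := (mem_zone_zero.1 hq).1
  have h0 : 0 < min (min p.im q.im) (Real.pi / 12) := lt_min (lt_min hp0 hq0) (by positivity)
  exact (key p hp _ (max p.re q.re) h0 ((min_le_left _ _).trans (min_le_left _ _))
    (min_le_right _ _) (le_max_left _ _)).trans (key q hq _ (max p.re q.re) h0
    ((min_le_left _ _).trans (min_le_right _ _)) (min_le_right _ _) (le_max_right _ _)).symm

/-- Points can be moved to the right and then up, towards the line `Im ζ = π/6`. -/
lemma isPreconnected_zone_one : IsPreconnected (zone 1) := by
  have hpi := Real.pi_pos
  have key : ∀ p ∈ zone 1, ∀ θ η : ℝ, p.im ≤ θ → θ < Real.pi / 6 → p.re ≤ η →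
      JoinedIn (zone 1) p ⟨η, θ⟩ := by
    intro p hp θ η h1 h2 h3
    obtain ⟨a1, a2, a3, a4⟩ := mem_zone_one.1 hp
    have hw : ∀ t, p.re ≤ t → wall t (Real.pi / 3 - p.im) < 0 := by
      intro t ht
      refine wall_neg (η := p.re) ?_ a3
      rw [abs_of_pos a4, abs_of_pos (by linarith)]
      exact ht
    refine (joinedIn_horizontal (a := p.re) (b := η) (c := p.im) fun t ht => ?_).trans
      (joinedIn_vertical fun t ht => ?_)
    · rw [uIcc_of_le h3] at ht
      exact mem_zone_one.2 ⟨a1, a2, hw t ht.1, a4.trans_le ht.1⟩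
    · rw [uIcc_of_le h1] at ht
      obtain ⟨b1, b2⟩ := ht
      refine mem_zone_one.2 ⟨a1.trans_le b1, b2.trans_lt h2, ?_, a4.trans_le h3⟩
      exact (wall_le_wall η (by change 0 ≤ _ - t; linarith) (by change _ - t ≤ _; linarith)
        (by linarith)).trans_lt (hw η h3)
  refine isPreconnected_of_joinedIn fun p hp q hq => ?_
  have h := max_lt (mem_zone_one.1 hp).2.1 (mem_zone_one.1 hq).2.1
  exact (key p hp _ (max p.re q.re) (le_max_left _ _) h (le_max_left _ _)).trans
    (key q hq _ (max p.re q.re) (le_max_right _ _) h (le_max_right _ _)).symm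

/-- Points can be moved horizontally to the imaginary axis, on which `wall` is positive throughout.
-/
lemma isPreconnected_zone_eight : IsPreconnected (zone 8) := by
  have hpi := Real.pi_pos
  have key : ∀ p ∈ zone 8, JoinedIn (zone 8) p ⟨0, Real.pi / 12⟩ := by
    intro p hp
    obtain ⟨a1, a2, a3⟩ := mem_zone_eight.1 hp
    refine (joinedIn_horizontal (a := p.re) (b := 0) (c := p.im) fun t ht => ?_).trans
      (joinedIn_vertical fun t ht => ?_)
    · refine mem_zone_eight.2 ⟨a1, a2, wall_pos (η' := p.re) ?_ a3⟩
      change |t| ≤ |p.re|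
      rcases mem_uIcc.1 ht with h | h
      · rw [abs_of_nonpos h.2, abs_of_nonpos (by linarith)]
        linarith
      · rw [abs_of_nonneg h.1, abs_of_nonneg (by linarith)]
        exact h.2
    · have : 0 < t ∧ t < Real.pi / 6 := by
        rcases mem_uIcc.1 ht with h | h
        · exact ⟨by linarith, by linarith⟩
        · exact ⟨by linarith, by linarith⟩
      exact mem_zone_eight.2 ⟨this.1, this.2, wall_zero_pos this.1 (by change t < _; linarith)⟩
  exact isPreconnected_of_joinedIn fun p hp q hq => (key p hp).trans (key q hq).symm

@[elab_as_elim]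
lemma fin_ten_cases {P : Fin 10 → Prop} (k : Fin 10) (h0 : P 0) (h1 : P 1) (h2 : P 2) (h3 : P 3)
    (h4 : P 4) (h5 : P 5) (h6 : P 6) (h7 : P 7) (h8 : P 8) (h9 : P 9) : P k := by
  fin_cases k <;> assumption

lemma isPreconnected_zone (k : Fin 10) : IsPreconnected (zone k) := by
  have hu : ∀ k k', upDown k = k' → IsPreconnected (zone k) → IsPreconnected (zone k') := by
    rintro k _ rfl h
    convert h.image flipRe continuous_flipRe.continuousOn using 1
    apply Subset.antisymm
    · intro ζ hζ
      have := flipRe_mem_zone hζ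
      rw [(by decide : ∀ k, upDown (upDown k) = k) k] at this
      exact ⟨_, this, flipRe_flipRe ζ⟩
    · rintro _ ⟨ζ, hζ, rfl⟩
      exact flipRe_mem_zone hζ
  have hl : ∀ k k', leftRight k = k' → IsPreconnected (zone k) → IsPreconnected (zone k') := by
    rintro k _ rfl h
    convert h.image flipIm continuous_flipIm.continuousOn using 1
    apply Subset.antisymm
    · intro ζ hζ
      have := flipIm_mem_zone hζ
      rw [(by decide : ∀ k, leftRight (leftRight k) = k) k] at this
      exact ⟨_, this, flipIm_flipIm ζ⟩
    · rintro _ ⟨ζ, hζ, rfl⟩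
      exact flipIm_mem_zone hζ
  have h0 := isPreconnected_zone_zero
  have h1 := isPreconnected_zone_one
  have h2 := hl 1 2 (by decide) h1
  have h3 := hl 0 3 (by decide) h0
  exact fin_ten_cases k h0 h1 h2 h3 (hu 3 4 (by decide) h3) (hu 2 5 (by decide) h2)
    (hu 1 6 (by decide) h1) (hu 0 7 (by decide) h0) isPreconnected_zone_eight
    (hl 8 9 (by decide) isPreconnected_zone_eight)

end BNR

end

/-! ### Fibres, and identification of the regions with the images of the zones -/

noncomputable section

namespace BNR

/-! ### Fibres of the covering -/

lemma xCoord_add_int (ζ : ℂ) (n : ℤ) : xCoord (ζ + n * thirdTurn) = xCoord ζ :=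
  (xCoord_eq_iff.2 ⟨n, Or.inl rfl⟩).symm

lemma re_int_turn (n : ℤ) : ((n : ℂ) * thirdTurn).re = 0 := by
  rw [thirdTurn, ← mul_assoc, ← Complex.ofReal_intCast, ← Complex.ofReal_mul,
    Complex.re_ofReal_mul]
  simp

lemma im_int_turn (n : ℤ) : ((n : ℂ) * thirdTurn).im = n * (2 * Real.pi / 3) := by
  rw [thirdTurn, ← mul_assoc, ← Complex.ofReal_intCast, ← Complex.ofReal_mul,
    Complex.im_ofReal_mul]
  simp

lemma exists_xCoord_eq (x : ℂ) : ∃ ζ, xCoord ζ = x := by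
  obtain ⟨z, hz⟩ := Complex.cos_surjective (x / 2)
  refine ⟨-z * Complex.I / 3, ?_⟩
  rw [xCoord, show 3 * (-z * Complex.I / 3) = -(z * Complex.I) by ring, Complex.cosh_neg,
    Complex.cosh_mul_I, hz]
  ring

lemma exists_shift (ζ : ℂ) (a : ℝ) : ∃ ζ', xCoord ζ' = xCoord ζ ∧ ζ'.re = ζ.re ∧ a < ζ'.im ∧
    ζ'.im ≤ a + 2 * Real.pi / 3 := by
  have hp : 0 < 2 * Real.pi / 3 := by positivity
  have h := toIocMod_mem_Ioc hp a ζ.im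
  refine ⟨ζ + (-toIocDiv hp a ζ.im : ℤ) * thirdTurn, xCoord_add_int _ _, ?_, ?_⟩
  · rw [Complex.add_re, re_int_turn, add_zero]
  · rw [Complex.add_im, im_int_turn]
    rw [toIocMod, zsmul_eq_mul] at h
    push_cast
    constructor <;> linarith [h.1, h.2]

lemma exists_right (x : ℂ) (a : ℝ) : ∃ ζ, xCoord ζ = x ∧ 0 ≤ ζ.re ∧ a < ζ.im ∧
    ζ.im ≤ a + 2 * Real.pi / 3 := by
  obtain ⟨ζ, rfl⟩ := exists_xCoord_eq x
  rcases le_total 0 ζ.re with h | h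
  · obtain ⟨ζ', h1, h2, h3⟩ := exists_shift ζ a
    exact ⟨ζ', h1, h2 ▸ h, h3⟩
  · obtain ⟨ζ', h1, h2, h3⟩ := exists_shift (-ζ) a
    exact ⟨ζ', h1.trans (xCoord_neg ζ), by rw [h2, Complex.neg_re]; linarith, h3⟩

lemma exists_narrow (ζ : ℂ) : ∃ ζ', xCoord ζ' = xCoord ζ ∧ (ζ.re = 0 → ζ'.re = 0) ∧ 0 ≤ ζ'.im ∧
    ζ'.im ≤ Real.pi / 3 := by
  obtain ⟨ζ', h1, h2, h3, h4⟩ := exists_shift ζ (-(Real.pi / 3))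
  rcases le_total 0 ζ'.im with h | h
  · exact ⟨ζ', h1, fun h0 => h2.trans h0, h, by linarith⟩
  · exact ⟨-ζ', (xCoord_neg ζ').trans h1, fun h0 => by rw [Complex.neg_re, h2, h0, neg_zero],
      by rw [Complex.neg_im]; linarith, by rw [Complex.neg_im]; linarith⟩

lemma int_eq_zero_of_abs_lt {n : ℤ} {p : ℝ} (hp : 0 < p) (h : |n * p| < p) : n = 0 := by
  rw [abs_mul, abs_of_pos hp] at h
  have : |(n : ℝ)| < 1 := by
    by_contra hc
    nlinarith [not_lt.1 hc]
  rw [← Int.cast_abs] at this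
  exact Int.abs_lt_one_iff.1 (by exact_mod_cast this)

lemma xCoord_injOn_narrow {ζ ζ' : ℂ} (h0 : 0 < ζ.im) (h1 : ζ.im < Real.pi / 3) (h0' : 0 < ζ'.im)
    (h1' : ζ'.im < Real.pi / 3) (h : xCoord ζ = xCoord ζ') : ζ = ζ' := by
  have hp : 0 < 2 * Real.pi / 3 := by positivity
  obtain ⟨n, h | h⟩ := xCoord_eq_iff.1 h
  · have h2 := congrArg Complex.im h
    rw [Complex.add_im, im_int_turn] at h2
    have : n = 0 := int_eq_zero_of_abs_lt hp (abs_lt.2 ⟨by linarith, by linarith⟩)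
    rw [h, this]
    simp
  · have h2 := congrArg Complex.im h
    rw [Complex.add_im, im_int_turn, Complex.neg_im] at h2
    have : n = 0 := int_eq_zero_of_abs_lt hp (abs_lt.2 ⟨by linarith, by linarith⟩)
    rw [this] at h2
    simp at h2
    linarith

lemma xCoord_injOn_right {a : ℝ} {ζ ζ' : ℂ} (hr : 0 < ζ.re) (hr' : 0 < ζ'.re) (h0 : a < ζ.im)
    (h1 : ζ.im < a + 2 * Real.pi / 3) (h0' : a < ζ'.im) (h1' : ζ'.im < a + 2 * Real.pi / 3)
    (h : xCoord ζ = xCoord ζ') : ζ = ζ' := by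
  have hp : 0 < 2 * Real.pi / 3 := by positivity
  obtain ⟨n, h | h⟩ := xCoord_eq_iff.1 h
  · have h2 := congrArg Complex.im h
    rw [Complex.add_im, im_int_turn] at h2
    have : n = 0 := int_eq_zero_of_abs_lt hp (abs_lt.2 ⟨by linarith, by linarith⟩)
    rw [h, this]
    simp
  · have h2 := congrArg Complex.re h
    rw [Complex.add_re, re_int_turn, Complex.neg_re] at h2
    linarith

lemma exists_perm_cam_add (ζ : ℂ) (n : ℤ) :
    ∃ w, cam (ζ + n * thirdTurn) = permCameral w (cam ζ) := by
  induction n using Int.induction_on with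
  | zero => exact ⟨1, by simp [permCameral_one]⟩
  | succ m ih =>
    obtain ⟨w, hw⟩ := ih
    refine ⟨finRotate 3 * w, ?_⟩
    rw [← permCameral_permCameral, ← hw, ← cam_add_thirdTurn]
    congr 1
    push_cast
    ring
  | pred m ih =>
    obtain ⟨w, hw⟩ := ih
    refine ⟨(finRotate 3)⁻¹ * w, ?_⟩
    rw [← permCameral_permCameral, ← hw, ← cam_sub_thirdTurn]
    congr 1
    push_cast
    ring

lemma exists_perm_of_proj {P : Cameral} {ζ : ℂ} (h : proj P = xCoord ζ) :
    ∃ w, P = permCameral w (cam ζ) := by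
  obtain ⟨ζ', rfl⟩ := cam_surjective P
  obtain ⟨n, hn | hn⟩ := xCoord_eq_iff.1 h.symm
  · rw [hn]
    exact exists_perm_cam_add ζ n
  · obtain ⟨w, hw⟩ := exists_perm_cam_add (-ζ) n
    rw [hn, hw, cam_neg, permCameral_permCameral]
    exact ⟨_, rfl⟩

/-! ### The regions are the images of the zones -/

lemma coord_ne_of_openSector {k : Fin 6} {v : Plane} (h : v ∈ openSector k) {i j : Fin 3}
    (hij : i ≠ j) : coord v i ≠ coord v j := by
  obtain ⟨h1, h2⟩ := h
  intro he
  induction k using fin_six_cases <;> simp at h1 h2 <;> induction i using fin_three_cases <;>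
    induction j using fin_three_cases <;> first | exact hij rfl | linarith

lemma chamber_subset (k : Fin 10) : chamber k ⊆ networkᶜ := by
  rintro _ ⟨ζ, ⟨-, -, h, -⟩, rfl⟩ ⟨P, hP, i, j, hij, hPij⟩
  obtain ⟨w, rfl⟩ := exists_perm_of_proj hP
  refine coord_ne_of_openSector h (i := w.symm i) (j := w.symm j) (by simpa using hij) ?_
  rw [coord_phi, coord_phi]
  rw [root_permCameral, root_permCameral] at hPij
  rw [hPij]

/-- A preimage in the closed strip cannot be on its edges, where two periods agree. Its periods lie
in an open sector, and that sector with the sign of `Re ζ` identifies the zone. -/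
lemma compl_network_subset : networkᶜ ⊆ ⋃ k, chamber k := by
  intro x hx
  have hpi := Real.pi_pos
  obtain ⟨ζ', h⟩ := exists_xCoord_eq x
  obtain ⟨ζ, rfl, -, h0, h1⟩ := h ▸ exists_narrow ζ'
  have hne : ∀ i j, i ≠ j → coord (phi (cam ζ)) i ≠ coord (phi (cam ζ)) j := by
    intro i j hij he
    refine hx ⟨cam ζ, rfl, i, j, hij, ?_⟩
    rw [coord_phi, coord_phi] at he
    linarith
  have h0' : 0 < ζ.im := by
    refine lt_of_le_of_ne h0 fun h => hne 1 0 (by decide) ?_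
    have := rootForm_one_phi ζ
    rw [← h] at this
    simp at this
    linarith
  have h1' : ζ.im < Real.pi / 3 := by
    refine lt_of_le_of_ne h1 fun h => hne 0 2 (by decide) ?_
    have := rootForm_five_phi ζ
    rw [h] at this
    simp at this
    linarith
  obtain ⟨c, hc⟩ := exists_openSector hne
  have key : ∀ k, center k = c → half k ζ.re → xCoord ζ ∈ ⋃ k, chamber k := by
    rintro k rfl hk
    exact mem_iUnion.2 ⟨k, ζ, ⟨h0', h1', hc, hk⟩, rfl⟩
  -- On the imaginary axis both walls are positive, which leaves only the two central sectors; for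
  -- these no sign of `Re ζ` is needed.
  have hre : c = 0 ∨ c = 5 ∨ ζ.re ≠ 0 := by
    by_contra hcon
    push Not at hcon
    obtain ⟨n0, n5, hz⟩ := hcon
    have w1 : 0 < rootForm 4 (phi (cam ζ)) := by
      rw [rootForm_four_pos_iff h0' h1', hz]
      exact wall_zero_pos h0' (by linarith)
    have w2 : 0 < rootForm 5 (phi (cam ζ)) := by
      rw [rootForm_five_pos_iff h0' h1', hz]
      exact wall_zero_pos (by linarith) (by linarith)
    obtain ⟨g1, g2⟩ := hc
    clear key hne hx hz
    induction c using fin_six_cases <;> first | exact n0 rfl | exact n5 rfl |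
      (simp at g1 g2 w1 w2; linarith)
  by_cases c0 : c = 0
  · exact key 8 c0.symm (by simp [half])
  by_cases c5 : c = 5
  · exact key 9 c5.symm (by simp [half])
  rcases lt_or_gt_of_ne (hre.resolve_left c0 |>.resolve_left c5) with h | h
  · have : ∀ c : Fin 6, c ≠ 0 → c ≠ 5 → ∃ k : Fin 10, center k = c ∧ ¬ k < 4 := by decide
    obtain ⟨k, hk, hk'⟩ := this c c0 c5
    exact key k hk ⟨fun h => absurd h hk', fun _ _ => h⟩
  · have : ∀ c : Fin 6, c ≠ 0 → c ≠ 5 → ∃ k : Fin 10, center k = c ∧ k < 4 := by decide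
    obtain ⟨k, hk, hk'⟩ := this c c0 c5
    exact key k hk ⟨fun _ => h, fun h => absurd hk' (not_lt.2 h)⟩

lemma chamber_disjoint {j k : Fin 10} {x : ℂ} (hj : x ∈ chamber j) (hk : x ∈ chamber k) :
    j = k := by
  obtain ⟨ζ, ⟨a0, a1, a2, a3⟩, rfl⟩ := hj
  obtain ⟨ζ', ⟨b0, b1, b2, b3⟩, h⟩ := hk
  obtain rfl := xCoord_injOn_narrow a0 a1 b0 b1 h.symm
  have hc := openSector_disjoint a2 b2
  rcases (by decide : ∀ j k, center j = center k → j = k ∨ (j < 4 ∧ 4 ≤ k ∧ k < 8) ∨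
    (k < 4 ∧ 4 ≤ j ∧ j < 8)) j k hc with h | ⟨h1, h2, h3⟩ | ⟨h1, h2, h3⟩
  · exact h
  · exact absurd (a3.1 h1) (not_lt.2 (b3.2 h2 h3).le)
  · exact absurd (b3.1 h1) (not_lt.2 (a3.2 h2 h3).le)

lemma re_xCoord (ζ : ℂ) : (xCoord ζ).re = 2 * (Real.cosh (3 * ζ.re) * Real.cos (3 * ζ.im)) := by
  have := re_cosh 3 ζ
  rw [xCoord, show (2 : ℂ) = ((2 : ℝ) : ℂ) by norm_num, Complex.re_ofReal_mul,
    show (3 : ℂ) = ((3 : ℝ) : ℂ) by norm_num, this]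

lemma im_xCoord (ζ : ℂ) : (xCoord ζ).im = 2 * (Real.sinh (3 * ζ.re) * Real.sin (3 * ζ.im)) := by
  have h : (3 * ζ : ℂ) = ((3 * ζ.re : ℝ) : ℂ) + ((3 * ζ.im : ℝ) : ℂ) * Complex.I := by
    conv_lhs => rw [← Complex.re_add_im ζ]
    push_cast
    ring
  rw [xCoord, show (2 : ℂ) = ((2 : ℝ) : ℂ) by norm_num, Complex.im_ofReal_mul, h,
    Complex.cosh_add, Complex.cosh_mul_I, Complex.sinh_mul_I, ← Complex.ofReal_cosh,
    ← Complex.ofReal_cos, ← Complex.ofReal_sinh, ← Complex.ofReal_sin]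
  simp only [Complex.add_im, Complex.mul_re, Complex.ofReal_re, Complex.ofReal_im, Complex.I_re,
    Complex.I_im, Complex.mul_im]
  ring

/-- The position of a point of the open first quadrant in the strip. -/
lemma exists_first_quadrant {x : ℂ} (hre : 0 < x.re) (him : 0 < x.im) : ∃ ζ, xCoord ζ = x ∧
    0 < ζ.re ∧ 0 < ζ.im ∧ ζ.im < Real.pi / 6 := by
  have hpi := Real.pi_pos
  obtain ⟨ζ', h⟩ := exists_xCoord_eq x
  obtain ⟨ζ, h, -, h0, h1⟩ := exists_narrow ζ'
  have h : xCoord ζ = x := by rw [h]; assumption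
  have e1 := re_xCoord ζ
  have e2 := im_xCoord ζ
  rw [h] at e1 e2
  have hs := Real.sin_nonneg_of_nonneg_of_le_pi (x := 3 * ζ.im) (by linarith) (by linarith)
  have hc := Real.cosh_pos (3 * ζ.re)
  refine ⟨ζ, h, ?_, ?_, ?_⟩
  · have : 0 < Real.sinh (3 * ζ.re) := by
      by_contra hn
      nlinarith [mul_nonpos_of_nonpos_of_nonneg (not_lt.1 hn) hs]
    linarith [Real.sinh_pos_iff.1 this]
  · refine lt_of_le_of_ne h0 fun hn => ?_
    rw [← hn] at e2
    simp at e2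
    linarith
  · by_contra hn
    have := Real.cos_nonpos_of_pi_div_two_le_of_le (x := 3 * ζ.im) (by linarith) (by linarith)
    nlinarith [mul_nonpos_of_nonneg_of_nonpos hc.le this]

/-- The point `x` gives information on `cosh 3η`, while `wall` needs `cosh 2η`; both are polynomials
in `cosh η`, which is compared with `a`. -/
lemma le_cosh_two_of_cosh_three {η a b : ℝ} (hb : b ≤ Real.cosh (3 * η)) (ha : 1 ≤ a)
    (hab : 4 * a ^ 3 - 3 * a < b) : 2 * a ^ 2 - 1 ≤ Real.cosh (2 * η) := by
  have h1 := Real.one_le_cosh η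
  rw [Real.cosh_three_mul] at hb
  have h2 := Real.cosh_sq η
  rw [Real.cosh_two_mul]
  have : a ≤ Real.cosh η := by
    by_contra hc
    push Not at hc
    nlinarith [mul_pos (sub_pos.2 hc) (by positivity : 0 < a), mul_nonneg (sub_nonneg.2 h1) (sub_nonneg.2 hc.le)]
  nlinarith

lemma regionPoint_zero_mem : (3 + Complex.I : ℂ) ∈ chamber 0 := by
  have hpi := Real.pi_pos
  obtain ⟨ζ, h, h0, h1, h2⟩ := exists_first_quadrant (x := 3 + Complex.I) (by norm_num) (by norm_num)
  have e1 := re_xCoord ζ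
  have e2 := im_xCoord ζ
  rw [h] at e1 e2
  norm_num at e1 e2
  have hs1 := Real.cosh_sq (3 * ζ.re)
  have hs2 := Real.sin_sq_add_cos_sq (3 * ζ.im)
  have hch := Real.cosh_pos (3 * ζ.re)
  have hcs := Real.cos_pos_of_mem_Ioo (x := 3 * ζ.im) ⟨by linarith, by linarith⟩
  -- Real and imaginary part of `x` give `HK` and `(H - 1)(1 - K)`, hence the sum and the product of
  -- `H` and `K`.
  obtain ⟨H, hH⟩ : ∃ H, H = Real.cosh (3 * ζ.re) ^ 2 := ⟨_, rfl⟩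
  obtain ⟨K, hK⟩ : ∃ K, K = Real.cos (3 * ζ.im) ^ 2 := ⟨_, rfl⟩
  have hHK : H * K = 9 / 4 := by
    rw [hH, hK, ← mul_pow, show Real.cosh (3 * ζ.re) * Real.cos (3 * ζ.im) = 3 / 2 by linarith]
    norm_num
  have hHK2 : (H - 1) * (1 - K) = 1 / 4 := by
    rw [hH, hK, hs1, show 1 - Real.cos (3 * ζ.im) ^ 2 = Real.sin (3 * ζ.im) ^ 2 by linarith,
      add_sub_cancel_right, ← mul_pow,
      show Real.sinh (3 * ζ.re) * Real.sin (3 * ζ.im) = 1 / 2 by linarith]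
    norm_num
  have hK1 : K ≤ 1 := by rw [hK]; nlinarith [sq_nonneg (Real.sin (3 * ζ.im))]
  have hK0 : 0 ≤ K := by rw [hK]; positivity
  have hsum : H + K = 7 / 2 := by linarith
  have hH1 : 9 / 4 ≤ H := by nlinarith
  have hK2 : 1 / 2 < K := by nlinarith
  have hang : ζ.im ≤ Real.pi / 12 := by
    by_contra hn
    have hlt := Real.cos_lt_cos_of_nonneg_of_le_pi (x := Real.pi / 4) (y := 3 * ζ.im) (by linarith)
      (by linarith) (by linarith)
    rw [Real.cos_pi_div_four] at hlt
    have : Real.sqrt 2 ^ 2 = 2 := Real.sq_sqrt (by norm_num)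
    have : K < (Real.sqrt 2 / 2) ^ 2 := by rw [hK]; gcongr
    nlinarith
  have hc3 : 3 / 2 ≤ Real.cosh (3 * ζ.re) := by nlinarith
  have hC := le_cosh_two_of_cosh_three (a := 1025 / 1000) hc3 (by norm_num) (by norm_num)
  refine ⟨ζ, mem_zone_zero.2 ⟨h1, h2, ?_, ?_, h0⟩, h⟩
  · have hle := Real.cos_le_cos_of_nonneg_of_le_pi (x := 2 * ζ.im) (y := Real.pi / 6) (by linarith)
      (by linarith) (by linarith)
    rw [Real.cos_pi_div_six] at hle
    have hs3 : (173 / 100 : ℝ) ≤ Real.sqrt 3 := Real.le_sqrt_of_sq_le (by norm_num)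
    have hcos : (173 / 200 : ℝ) ≤ Real.cos (2 * ζ.im) := by linarith
    rw [wall_eq_of_cosh rfl]
    nlinarith [mul_le_mul_of_nonneg_left hcos (by nlinarith : 0 ≤ 2 * Real.cosh (2 * ζ.re) ^ 2 - 1)]
  · exact wall_pos_of_cos_nonpos _
      (Real.cos_nonpos_of_pi_div_two_le_of_le (by linarith) (by linarith))

lemma regionPoint_one_mem : (1 + 10 * Complex.I : ℂ) ∈ chamber 1 := by
  have hpi := Real.pi_pos
  obtain ⟨ζ, h, h0, h1, h2⟩ := exists_first_quadrant (x := 1 + 10 * Complex.I) (by norm_num)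
    (by norm_num)
  have e1 := re_xCoord ζ
  have e2 := im_xCoord ζ
  rw [h] at e1 e2
  norm_num at e1 e2
  have hs1 := Real.cosh_sq (3 * ζ.re)
  have hs2 := Real.sin_sq_add_cos_sq (3 * ζ.im)
  have hch := Real.cosh_pos (3 * ζ.re)
  have hcs := Real.cos_pos_of_mem_Ioo (x := 3 * ζ.im) ⟨by linarith, by linarith⟩
  obtain ⟨H, hH⟩ : ∃ H, H = Real.cosh (3 * ζ.re) ^ 2 := ⟨_, rfl⟩
  obtain ⟨K, hK⟩ : ∃ K, K = Real.cos (3 * ζ.im) ^ 2 := ⟨_, rfl⟩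
  have hHK : H * K = 1 / 4 := by
    rw [hH, hK, ← mul_pow, show Real.cosh (3 * ζ.re) * Real.cos (3 * ζ.im) = 1 / 2 by linarith]
    norm_num
  have hHK2 : (H - 1) * (1 - K) = 25 := by
    rw [hH, hK, hs1, show 1 - Real.cos (3 * ζ.im) ^ 2 = Real.sin (3 * ζ.im) ^ 2 by linarith,
      add_sub_cancel_right, ← mul_pow,
      show Real.sinh (3 * ζ.re) * Real.sin (3 * ζ.im) = 5 by linarith]
    norm_num
  have hK0 : 0 ≤ K := by rw [hK]; positivity
  have hK1 : K ≤ 1 := by rw [hK]; nlinarith [sq_nonneg (Real.sin (3 * ζ.im))]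
  have hH1 : 25 ≤ H := by linarith
  have hK2 : K ≤ 1 / 100 := by nlinarith [mul_le_mul_of_nonneg_right hH1 hK0]
  have hc3 : 5 ≤ Real.cosh (3 * ζ.re) := by
    rw [hH] at hH1
    exact (sq_le_sq₀ (by norm_num) hch.le).1 (by linarith)
  have hC := le_cosh_two_of_cosh_three (a := 1225 / 1000) hc3 (by norm_num) (by norm_num)
  -- The point is close to the line `Im ζ = π/6`: the small number `cos (3 Im ζ)` equals `sin 3τ`,
  -- which controls `τ`.
  obtain ⟨τ, hτ⟩ : ∃ τ, τ = Real.pi / 6 - ζ.im := ⟨_, rfl⟩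
  have hsin3 : Real.cos (3 * ζ.im) = Real.sin (3 * τ) := by
    rw [← Real.cos_pi_div_two_sub, hτ]
    congr 1
    ring
  have hsin2 : Real.sin (2 * τ) ≤ Real.sin (3 * τ) :=
    Real.sin_le_sin_of_le_of_le_pi_div_two (by linarith) (by linarith) (by linarith)
  have hsin0 := Real.sin_pos_of_pos_of_lt_pi (x := 2 * τ) (by linarith) (by linarith)
  have hsin1 : Real.sin (2 * τ) ≤ 1 / 10 := by
    rw [hK, hsin3] at hK2
    have := (sq_le_sq₀ (hsin0.le.trans hsin2) (by norm_num : (0 : ℝ) ≤ 1 / 10)).1 (by linarith)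
    linarith
  have hcos0 := Real.cos_pos_of_mem_Ioo (x := 2 * τ) ⟨by linarith, by linarith⟩
  have hcos1 : 99 / 100 ≤ Real.cos (2 * τ) := by
    have h3 := Real.sin_sq_add_cos_sq (2 * τ)
    have h4 : Real.sin (2 * τ) ^ 2 ≤ (1 / 10) ^ 2 := by gcongr
    exact (sq_le_sq₀ (by norm_num) hcos0.le).1 (by linarith)
  refine ⟨ζ, mem_zone_one.2 ⟨h1, h2, ?_, h0⟩, h⟩
  have hs3 : Real.sqrt 3 ≤ 174 / 100 := Real.sqrt_le_iff.2 ⟨by norm_num, by norm_num⟩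
  have hs0 := Real.sqrt_nonneg 3
  have hcos : 2 / 5 ≤ Real.cos (2 * (Real.pi / 3 - ζ.im)) := by
    rw [show 2 * (Real.pi / 3 - ζ.im) = Real.pi / 3 + 2 * τ by rw [hτ]; ring, Real.cos_add,
      Real.cos_pi_div_three, Real.sin_pi_div_three]
    have := mul_le_mul hs3 hsin1 hsin0.le (by norm_num)
    linarith
  rw [wall_eq_of_cosh rfl]
  generalize Real.cosh (2 * ζ.re) = C at *
  have hC2 : 2 ≤ C := by linarith
  clear hs1 hs2 hch hcs hH hK hHK hHK2 hsin3 hsin2 hsin0 hsin1 hcos0 hcos1 hs3 hs0 e1 e2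
  nlinarith [mul_le_mul_of_nonneg_left hcos (by nlinarith : 0 ≤ 2 * C ^ 2 - 1)]

lemma regionPoint_eight_mem : (1 : ℂ) ∈ chamber 8 := by
  have hpi := Real.pi_pos
  refine ⟨⟨0, Real.pi / 9⟩, mem_zone_eight.2 ⟨?_, ?_, wall_zero_pos ?_ ?_⟩, ?_⟩
  · change 0 < Real.pi / 9
    linarith
  · change Real.pi / 9 < _
    linarith
  · change 0 < Real.pi / 9
    linarith
  · change Real.pi / 9 < _
    linarith
  · apply Complex.ext
    · rw [re_xCoord]
      simp only [mul_zero, Real.cosh_zero]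
      rw [show 3 * (Real.pi / 9) = Real.pi / 3 by ring, Real.cos_pi_div_three]
      norm_num
    · rw [im_xCoord]
      simp

lemma regionPoint_mem (k : Fin 10) : regionPoint k ∈ chamber k := by
  have hu : ∀ j k, upDown j = k → (starRingEnd ℂ) (regionPoint j) = regionPoint k →
      regionPoint j ∈ chamber j → regionPoint k ∈ chamber k := by
    rintro j _ rfl h hj
    rw [← h, chamber_upDown]
    exact ⟨_, hj, rfl⟩
  have hl : ∀ j k, leftRight j = k → -(starRingEnd ℂ) (regionPoint j) = regionPoint k →
      regionPoint j ∈ chamber j → regionPoint k ∈ chamber k := by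
    rintro j _ rfl h hj
    rw [← h, chamber_leftRight]
    exact ⟨_, hj, rfl⟩
  have h0 : regionPoint 0 ∈ chamber 0 := regionPoint_zero_mem
  have h1 : regionPoint 1 ∈ chamber 1 := regionPoint_one_mem
  have h8 : regionPoint 8 ∈ chamber 8 := regionPoint_eight_mem
  have h2 := hl 1 2 (by decide) (by apply Complex.ext <;> simp [regionPoint]) h1
  have h3 := hl 0 3 (by decide) (by apply Complex.ext <;> simp [regionPoint]) h0
  exact fin_ten_cases k h0 h1 h2 h3
    (hu 3 4 (by decide) (by apply Complex.ext <;> simp [regionPoint]) h3)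
    (hu 2 5 (by decide) (by apply Complex.ext <;> simp [regionPoint]) h2)
    (hu 1 6 (by decide) (by apply Complex.ext <;> simp [regionPoint]) h1)
    (hu 0 7 (by decide) (by apply Complex.ext <;> simp [regionPoint]) h0) h8
    (hl 8 9 (by decide) (by simp [regionPoint]) h8)

/-- The chambers are open, connected, pairwise disjoint and cover the complement of the network, so
they are its components. -/
lemma region_eq (k : Fin 10) : region k = chamber k := by
  have hconn : IsPreconnected (chamber k) :=
    (isPreconnected_zone k).image _ continuous_xCoord.continuousOn
  apply Subset.antisymm
  · have hpt : regionPoint k ∈ region k :=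
      mem_connectedComponentIn (chamber_subset k (regionPoint_mem k))
    refine IsPreconnected.subset_left_of_subset_union (v := ⋃ l : {l // l ≠ k}, chamber l)
      (isOpen_chamber k) (isOpen_iUnion fun l => isOpen_chamber l) ?_ ?_
      ⟨_, hpt, regionPoint_mem k⟩ isPreconnected_connectedComponentIn
    · refine disjoint_left.2 fun x hx hx' => ?_
      obtain ⟨⟨l, hl⟩, h⟩ := mem_iUnion.1 hx'
      exact hl (chamber_disjoint h hx)
    · intro x hx
      obtain ⟨l, hl⟩ := mem_iUnion.1 (compl_network_subset (connectedComponentIn_subset _ _ hx))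
      by_cases h : l = k
      · exact Or.inl (h ▸ hl)
      · exact Or.inr (mem_iUnion.2 ⟨⟨l, h⟩, hl⟩)
  · exact hconn.subset_connectedComponentIn (regionPoint_mem k) (chamber_subset k)

lemma mar_eq (α : Fin 10) : mar α = interior (closure (⋃ k ∈ marRegions α, chamber k)) := by
  simp only [mar, region_eq]

lemma isOpen_mar (α : Fin 10) : IsOpen (mar α) := isOpen_interior

lemma chamber_subset_mar {α k : Fin 10} (hk : k ∈ marRegions α) : chamber k ⊆ mar α := by
  rw [mar_eq]
  exact interior_maximal ((subset_biUnion_of_mem (u := fun k => chamber k) hk).trans subset_closure)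
    (isOpen_chamber k)

/-- An open subset of the closure of a union of regions that comes near region `k` must meet one of
these regions inside region `k`. -/
lemma mem_marRegions {α k : Fin 10} {x : ℂ} (hx : x ∈ mar α) (hk : x ∈ closure (chamber k)) :
    k ∈ marRegions α := by
  obtain ⟨y, hy, hyk⟩ := mem_closure_iff.1 hk _ (isOpen_mar α) hx
  rw [mar_eq] at hy
  obtain ⟨z, hz, hzk⟩ := mem_closure_iff.1 (interior_subset hy) _ (isOpen_chamber k) hyk
  obtain ⟨l, hl, hzl⟩ := mem_iUnion₂.1 hzk
  exact chamber_disjoint hz hzl ▸ hl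

/-- Near each point of a maximal abelian region there are points of its regions. -/
lemma exists_chamber_near {α : Fin 10} {x : ℂ} {U : Set ℂ} (hU : IsOpen U) (hx : x ∈ mar α)
    (hxU : x ∈ U) : ∃ k ∈ marRegions α, ∃ y ∈ U, y ∈ chamber k := by
  rw [mar_eq] at hx
  obtain ⟨y, hy, hyk⟩ := mem_closure_iff.1 (interior_subset hx) U hU hxU
  obtain ⟨k, hk, hyk⟩ := mem_iUnion₂.1 hyk
  exact ⟨k, hk, y, hy, hyk⟩

end BNR

end

/-! ### Branches of the cameral cover over the maximal abelian regions -/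

noncomputable section

namespace BNR

/-! ### Points of the walls in the closures of the regions -/

lemma mem_closure_zone_zero {ζ : ℂ} (h0 : ζ.im = 0) (h1 : 0 ≤ ζ.re) : ζ ∈ closure (zone 0) := by
  have hpi := Real.pi_pos
  have key : ∀ ζ : ℂ, ζ.im = 0 → 0 < ζ.re → ζ ∈ closure (zone 0) := by
    intro ζ h0 h1
    refine mem_closure_of_direction (U := {ζ | -1 < ζ.im ∧ ζ.im < Real.pi / 6} ∩
      ({ζ | wall ζ.re ζ.im < 0} ∩ {ζ | 0 < wall ζ.re (Real.pi / 3 - ζ.im)}))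
      ((isOpen_band _ _).inter ((isOpen_lt continuous_wall continuous_const).inter
        (isOpen_lt continuous_const continuous_wall')))
      ⟨⟨by rw [h0]; norm_num, by rw [h0]; positivity⟩, ?_, ?_⟩ Complex.I fun t ht h => ?_
    · change wall ζ.re ζ.im < 0
      rw [h0]
      exact wall_zero_right_neg h1
    · change 0 < wall ζ.re (Real.pi / 3 - ζ.im)
      rw [h0]
      exact wall_pos_of_cos_nonpos _
        (Real.cos_nonpos_of_pi_div_two_le_of_le (by linarith) (by linarith))
    · obtain ⟨⟨a1, a2⟩, a3, a4⟩ := h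
      exact mem_zone_zero.2 ⟨by rw [im_add_mul_I]; linarith, a2, a3, a4, by rwa [re_add_mul_I]⟩
  -- The branch point `Re ζ = 0` is a limit of points on the line that are already known to be in
  -- the closure.
  rw [← closure_closure]
  refine mem_closure_of_direction isOpen_univ (mem_univ ζ) 1 fun t ht _ => key _ ?_ ?_
  · simp [h0]
  · simp
    linarith

lemma mem_closure_zone_eight {ζ : ℂ} (hr : ζ.re = 0) (h0 : 0 ≤ ζ.im) (h1 : ζ.im ≤ Real.pi / 6) :
    ζ ∈ closure (zone 8) := by
  have hpi := Real.pi_pos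
  have key : ∀ ζ : ℂ, ζ.re = 0 → 0 < ζ.im → ζ.im < Real.pi / 6 → ζ ∈ zone 8 := by
    intro ζ hr h0 h1
    exact mem_zone_eight.2 ⟨h0, h1, by rw [hr]; exact wall_zero_pos h0 (by linarith)⟩
  rcases h1.eq_or_lt with h | h
  · refine mem_closure_of_direction (isOpen_band 0 Real.pi) (ζ := ζ) ⟨by linarith, by linarith⟩
      (-Complex.I) fun t ht hU => key _ ?_ hU.1 ?_
    · simp [hr]
    · simp
      linarith
  · refine mem_closure_of_direction (isOpen_band (-1) (Real.pi / 6)) ⟨by linarith, h⟩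
      Complex.I fun t ht hU => key _ ?_ ?_ hU.2
    · simp [hr]
    · simp
      linarith

lemma mem_closure_zone_one {ζ : ℂ} (h : ζ.im = Real.pi / 6) (hr : 0 ≤ ζ.re)
    (hw : wall ζ.re (Real.pi / 6) ≤ 0) : ζ ∈ closure (zone 1) := by
  have hpi := Real.pi_pos
  have hr' : 0 < ζ.re := by
    refine lt_of_le_of_ne hr fun h0 => ?_
    rw [← h0] at hw
    exact absurd (wall_zero_pos (θ := Real.pi / 6) (by linarith) (by linarith)) (not_lt.2 hw)
  have key : ∀ ζ : ℂ, ζ.im = Real.pi / 6 → 0 < ζ.re → wall ζ.re (Real.pi / 6) < 0 →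
      ζ ∈ closure (zone 1) := by
    intro ζ h hr hw
    refine mem_closure_of_direction (U := {ζ | 0 < ζ.im ∧ ζ.im < Real.pi} ∩
      {ζ | wall ζ.re (Real.pi / 3 - ζ.im) < 0}) ((isOpen_band _ _).inter
      (isOpen_lt continuous_wall' continuous_const)) ⟨⟨by linarith, by linarith⟩, ?_⟩ (-Complex.I)
      fun t ht hU => mem_zone_one.2 ⟨hU.1.1, ?_, hU.2, ?_⟩
    · change wall _ _ < 0
      rwa [h, show Real.pi / 3 - Real.pi / 6 = Real.pi / 6 by ring]
    · simp
      linarith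
    · simpa
  rw [← closure_closure]
  refine mem_closure_of_direction isOpen_univ (mem_univ ζ) 1 fun t ht _ => key _ ?_ ?_ ?_
  · simp [h]
  · simp
    linarith
  · have h1 : Real.cosh (2 * ζ.re) < Real.cosh (2 * (ζ.re + t)) := by
      rw [Real.cosh_lt_cosh, abs_of_pos (by positivity), abs_of_pos (by positivity)]
      linarith
    have h2 := Real.one_le_cosh (2 * ζ.re)
    rw [wall_pi_div_six rfl] at hw
    have : (ζ + t * 1).re = ζ.re + t := by simp
    rw [this, wall_pi_div_six rfl]
    nlinarith

lemma mem_closure_zone_one_or_eight {ζ : ℂ} (h : ζ.im = Real.pi / 6) (hr : 0 ≤ ζ.re) :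
    ζ ∈ closure (zone 1) ∨ ζ ∈ closure (zone 8) := by
  have hpi := Real.pi_pos
  rcases le_or_gt (wall ζ.re (Real.pi / 6)) 0 with hw | hw
  · exact Or.inl (mem_closure_zone_one h hr hw)
  · refine Or.inr (mem_closure_of_direction (U := {ζ | 0 < ζ.im ∧ ζ.im < Real.pi} ∩
      {ζ | 0 < wall ζ.re ζ.im}) ((isOpen_band _ _).inter
      (isOpen_lt continuous_const continuous_wall)) ⟨⟨by linarith, by linarith⟩, ?_⟩ (-Complex.I)
      fun t ht hU => mem_zone_eight.2 ⟨hU.1.1, ?_, hU.2⟩)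
    · change 0 < wall _ _
      rwa [h]
    · simp
      linarith

lemma flipRe_mem_closure {j k : Fin 10} (hjk : upDown j = k) {ζ : ℂ}
    (h : ζ ∈ closure (zone j)) : flipRe ζ ∈ closure (zone k) :=
  hjk ▸ map_mem_closure continuous_flipRe h fun _ => flipRe_mem_zone

lemma flipIm_mem_closure {j k : Fin 10} (hjk : leftRight j = k) {ζ : ℂ}
    (h : ζ ∈ closure (zone j)) : flipIm ζ ∈ closure (zone k) :=
  hjk ▸ map_mem_closure continuous_flipIm h fun _ => flipIm_mem_zone

lemma xCoord_mem_closure {k : Fin 10} {ζ : ℂ} (h : ζ ∈ closure (zone k)) :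
    xCoord ζ ∈ closure (chamber k) :=
  map_mem_closure continuous_xCoord h fun _ hz => ⟨_, hz, rfl⟩

/-- The two real slits. -/
lemma xCoord_mem_closure_zero_seven {ζ : ℂ} (h : ζ.im = 0) :
    xCoord ζ ∈ closure (chamber 0) ∧ xCoord ζ ∈ closure (chamber 7) := by
  wlog hr : 0 ≤ ζ.re generalizing ζ
  · have := this (ζ := -ζ) (by simpa) (by rw [Complex.neg_re]; linarith)
    rwa [xCoord_neg] at this
  have h0 := mem_closure_zone_zero h hr
  refine ⟨xCoord_mem_closure h0, ?_⟩
  have h7 := xCoord_mem_closure (flipRe_mem_closure (k := 7) (by decide) h0)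
  have : flipRe ζ = -ζ := by apply Complex.ext <;> simp [h]
  rwa [this, xCoord_neg] at h7

lemma xCoord_mem_closure_three_four {ζ : ℂ} (h : ζ.im = Real.pi / 3) :
    xCoord ζ ∈ closure (chamber 3) ∧ xCoord ζ ∈ closure (chamber 4) := by
  have h1 := xCoord_mem_closure_zero_seven (ζ := flipIm ζ) (by simp [h])
  have h3 : xCoord ζ = negConjHomeo (xCoord (flipIm ζ)) := by
    rw [negConjHomeo_apply, ← xCoord_flipIm, flipIm_flipIm]
  have key : ∀ k, xCoord (flipIm ζ) ∈ closure (chamber k) →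
      xCoord ζ ∈ closure (chamber (leftRight k)) := by
    intro k hk
    rw [chamber_leftRight, ← negConjHomeo.image_closure, h3]
    exact mem_image_of_mem _ hk
  exact ⟨key 0 h1.1, key 7 h1.2⟩

/-- The segment between the branch points. -/
lemma xCoord_mem_closure_eight_or_nine {ζ : ℂ} (h : ζ.re = 0) :
    xCoord ζ ∈ closure (chamber 8) ∨ xCoord ζ ∈ closure (chamber 9) := by
  obtain ⟨ζ', h1, h2, h3, h4⟩ := exists_narrow ζ
  rw [← h1]
  rcases le_total ζ'.im (Real.pi / 6) with h5 | h5
  · exact Or.inl (xCoord_mem_closure (mem_closure_zone_eight (h2 h) h3 h5))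
  · have := flipIm_mem_closure (k := 9) (by decide) (mem_closure_zone_eight (ζ := flipIm ζ') (by simpa using h2 h)
      (by simpa using h4) (by rw [im_flipIm]; linarith))
    rw [flipIm_flipIm] at this
    exact Or.inr (xCoord_mem_closure this)

/-- The upper half of the imaginary axis. -/
lemma xCoord_mem_closure_two_or_nine {ζ : ℂ} (h : ζ.im = Real.pi / 6) (hr : 0 ≤ ζ.re) :
    xCoord ζ ∈ closure (chamber 2) ∨ xCoord ζ ∈ closure (chamber 9) := by
  have hf : flipIm ζ = ζ := by
    apply Complex.ext
    · simp
    · rw [im_flipIm, h]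
      ring
  rcases mem_closure_zone_one_or_eight h hr with h1 | h1
  · left
    rw [← hf]
    exact xCoord_mem_closure (flipIm_mem_closure (by decide) h1)
  · right
    rw [← hf]
    exact xCoord_mem_closure (flipIm_mem_closure (by decide) h1)

/-- The lower half of the imaginary axis. -/
lemma xCoord_mem_closure_six_or_eight {ζ : ℂ} (h : ζ.im = Real.pi / 6) (hr : ζ.re ≤ 0) :
    xCoord ζ ∈ closure (chamber 6) ∨ xCoord ζ ∈ closure (chamber 8) := by
  rcases mem_closure_zone_one_or_eight (ζ := flipRe ζ) (by simpa) (by simpa) with h1 | h1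
  · left
    rw [← flipRe_flipRe ζ]
    exact xCoord_mem_closure (flipRe_mem_closure (by decide) h1)
  · right
    rw [← flipRe_flipRe ζ]
    exact xCoord_mem_closure (flipRe_mem_closure (by decide) h1)

/-! ### Branches over the maximal abelian regions -/

/-- Domains on which the covering of the `x`-line is injective. -/
def strip : Fin 3 → Set ℂ := ![{ζ | 0 < ζ.im ∧ ζ.im < Real.pi / 3},
  {ζ | 0 < ζ.re ∧ -(Real.pi / 6) < ζ.im ∧ ζ.im < Real.pi / 2},
  {ζ | 0 < ζ.re ∧ -(Real.pi / 2) < ζ.im ∧ ζ.im < Real.pi / 6}]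

lemma isOpen_strip (d : Fin 3) : IsOpen (strip d) := by
  induction d using fin_three_cases
  · exact isOpen_band _ _
  · exact isOpen_right.inter (isOpen_band _ _)
  · exact isOpen_right.inter (isOpen_band _ _)

lemma xCoord_injOn_strip (d : Fin 3) : InjOn xCoord (strip d) := by
  have hpi := Real.pi_pos
  intro ζ h ζ' h' he
  induction d using fin_three_cases
  · exact xCoord_injOn_narrow h.1 h.2 h'.1 h'.2 he
  · exact xCoord_injOn_right h.1 h'.1 h.2.1 (h.2.2.trans_eq (by ring)) h'.2.1
      (h'.2.2.trans_eq (by ring)) he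
  · exact xCoord_injOn_right h.1 h'.1 h.2.1 (h.2.2.trans_eq (by ring)) h'.2.1
      (h'.2.2.trans_eq (by ring)) he

/-- The domain for each maximal abelian region. -/
def domain : Fin 10 → Fin 3 := ![0, 0, 1, 1, 2, 2, 2, 1, 0, 0]

/-- Every point has a preimage in the closed domain up to one edge. On the excluded boundary lines
it would be in the closure of a region that does not belong to `α`, contrary to `mem_marRegions`. -/
lemma mar_subset (α : Fin 10) : mar α ⊆ xCoord '' strip (domain α) := by
  have hpi := Real.pi_pos
  intro x hx
  have hmem : ∀ k, x ∈ closure (chamber k) → k ∈ marRegions α := fun k => mem_marRegions hx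
  have d0 : domain α = 0 → (0 ∈ marRegions α → 7 ∈ marRegions α → False) →
      (3 ∈ marRegions α → 4 ∈ marRegions α → False) → x ∈ xCoord '' strip (domain α) := by
    intro hd h07 h34
    obtain ⟨ζ', rfl⟩ := exists_xCoord_eq x
    obtain ⟨ζ, h, -, h0, h1⟩ := exists_narrow ζ'
    rw [hd]
    refine ⟨ζ, ⟨lt_of_le_of_ne h0 fun hz => ?_, lt_of_le_of_ne h1 fun hz => ?_⟩, h⟩
    · have := xCoord_mem_closure_zero_seven hz.symm
      rw [h] at this
      exact h07 (hmem _ this.1) (hmem _ this.2)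
    · have := xCoord_mem_closure_three_four hz
      rw [h] at this
      exact h34 (hmem _ this.1) (hmem _ this.2)
  have hre : ∀ ζ : ℂ, xCoord ζ = x → 0 ≤ ζ.re → 8 ∉ marRegions α → 9 ∉ marRegions α →
      0 < ζ.re := by
    intro ζ h hr h8 h9
    refine lt_of_le_of_ne hr fun hz => ?_
    have := xCoord_mem_closure_eight_or_nine hz.symm
    rw [h] at this
    exact this.elim (fun h => h8 (hmem _ h)) fun h => h9 (hmem _ h)
  have d1 : domain α = 1 → 8 ∉ marRegions α → 9 ∉ marRegions α → 6 ∉ marRegions α →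
      x ∈ xCoord '' strip (domain α) := by
    intro hd h8 h9 h6
    obtain ⟨ζ, h, hr, h0, h1⟩ := exists_right x (-(Real.pi / 6))
    rw [hd]
    refine ⟨ζ, ⟨hre ζ h hr h8 h9, h0, lt_of_le_of_ne (h1.trans_eq (by ring)) fun hz => ?_⟩, h⟩
    -- This symmetry moves the boundary line `Im ζ = π/2` to the line `Im ζ = π/6` with nonpositive
    -- real part, the lower imaginary half-axis.
    have := xCoord_mem_closure_six_or_eight (ζ := -(ζ + (-1 : ℤ) * thirdTurn)) (by
      rw [Complex.neg_im, Complex.add_im, im_int_turn, hz]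
      push_cast
      ring) (by
      rw [Complex.neg_re, Complex.add_re, re_int_turn]
      linarith)
    rw [xCoord_neg, xCoord_add_int, h] at this
    exact this.elim (fun h => h6 (hmem _ h)) fun h => h8 (hmem _ h)
  have d2 : domain α = 2 → 8 ∉ marRegions α → 9 ∉ marRegions α → 2 ∉ marRegions α →
      x ∈ xCoord '' strip (domain α) := by
    intro hd h8 h9 h2
    obtain ⟨ζ, h, hr, h0, h1⟩ := exists_right x (-(Real.pi / 2))
    rw [hd]
    refine ⟨ζ, ⟨hre ζ h hr h8 h9, h0, lt_of_le_of_ne (h1.trans_eq (by ring)) fun hz => ?_⟩, h⟩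
    have := xCoord_mem_closure_two_or_nine hz hr
    rw [h] at this
    exact this.elim (fun h => h2 (hmem _ h)) fun h => h9 (hmem _ h)
  clear hmem hre
  induction α using fin_ten_cases
  exacts [d0 (by decide) (by decide) (by decide), d0 (by decide) (by decide) (by decide),
    d1 (by decide) (by decide) (by decide) (by decide),
    d1 (by decide) (by decide) (by decide) (by decide),
    d2 (by decide) (by decide) (by decide) (by decide),
    d2 (by decide) (by decide) (by decide) (by decide),
    d2 (by decide) (by decide) (by decide) (by decide),
    d1 (by decide) (by decide) (by decide) (by decide),
    d0 (by decide) (by decide) (by decide), d0 (by decide) (by decide) (by decide)]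

/-- The symmetries that carry zones into the domains. -/
def turn : Fin 4 → ℂ → ℂ := ![id, fun ζ => -ζ, fun ζ => -ζ + thirdTurn, fun ζ => ζ - thirdTurn]

def turnPerm : Fin 4 → Equiv.Perm (Fin 3) :=
  ![1, Equiv.swap 0 1, finRotate 3 * Equiv.swap 0 1, (finRotate 3)⁻¹]

lemma fin_four_cases {P : Fin 4 → Prop} (k : Fin 4) (h0 : P 0) (h1 : P 1) (h2 : P 2) (h3 : P 3) :
    P k := by
  fin_cases k <;> assumption

lemma cam_turn (t : Fin 4) (ζ : ℂ) : cam (turn t ζ) = permCameral (turnPerm t) (cam ζ) := by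
  refine fin_four_cases (P := fun t => cam (turn t ζ) = permCameral (turnPerm t) (cam ζ)) t
    rfl (cam_neg ζ) ?_ (cam_sub_thirdTurn ζ)
  change cam (-ζ + thirdTurn) = permCameral (finRotate 3 * Equiv.swap 0 1) (cam ζ)
  rw [cam_add_thirdTurn, cam_neg, permCameral_permCameral]

/-- Selects the symmetry of `turn` that moves zone `k` into domain `d`. The entries for the central
regions 8 and 9 in the last two rows are placeholders, in view of `fits`. -/
def twist : Fin 3 → Fin 10 → Fin 4 :=
  ![fun _ => 0, ![0, 0, 0, 0, 2, 2, 1, 1, 0, 0], ![0, 0, 3, 3, 1, 1, 1, 1, 0, 0]]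

lemma zone_side {k : Fin 10} {ζ : ℂ} (h : ζ ∈ zone k) :
    (k = 0 ∨ k = 1 ∨ k = 6 ∨ k = 7 → ζ.im < Real.pi / 6) ∧
      (k = 2 ∨ k = 3 ∨ k = 4 ∨ k = 5 → Real.pi / 6 < ζ.im) := by
  obtain ⟨h0, h1, ⟨h2, h3⟩, -⟩ := h
  constructor
  · intro hk
    rw [← rootForm_zero_pos_iff h0 h1]
    rcases hk with rfl | rfl | rfl | rfl <;> simp [center] at h2 h3 ⊢ <;> linarith
  · intro hk
    rw [← rootForm_three_pos_iff h0 h1]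
    rcases hk with rfl | rfl | rfl | rfl <;> simp [center] at h2 h3 ⊢ <;> linarith

lemma turn_mem_strip {d : Fin 3} {k : Fin 10} {ζ : ℂ} (h : ζ ∈ zone k) (hk : k < 8 ∨ d = 0) :
    turn (twist d k) ζ ∈ strip d := by
  have hpi := Real.pi_pos
  obtain ⟨s1, s2⟩ := zone_side h
  obtain ⟨h0, h1, -, h2, h3⟩ := h
  have hT : thirdTurn.re = 0 ∧ thirdTurn.im = 2 * Real.pi / 3 := by
    have h1 := re_int_turn 1
    have h2 := im_int_turn 1
    simp only [Int.cast_one, one_mul] at h1 h2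
    exact ⟨h1, h2.trans (by ring)⟩
  obtain ⟨hT1, hT2⟩ := hT
  induction d using fin_three_cases
  · exact ⟨h0, h1⟩
  · have r : ∀ z : ℂ, 0 < z.re → -(Real.pi / 6) < z.im → z.im < Real.pi / 2 → z ∈ strip 1 :=
      fun z a b c => ⟨a, b, c⟩
    induction k using fin_ten_cases <;> simp at h2 h3 s1 s2 hk <;>
      refine r _ ?_ ?_ ?_ <;> simp [twist, turn, hT1, hT2] <;> linarith
  · have r : ∀ z : ℂ, 0 < z.re → -(Real.pi / 2) < z.im → z.im < Real.pi / 6 → z ∈ strip 2 :=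
      fun z a b c => ⟨a, b, c⟩
    induction k using fin_ten_cases <;> simp at h2 h3 s1 s2 hk <;>
      refine r _ ?_ ?_ ?_ <;> simp [twist, turn, hT1, hT2] <;> linarith

lemma fits {α k : Fin 10} (hk : k ∈ marRegions α) : k < 8 ∨ domain α = 0 := by
  revert α k
  decide

lemma xCoord_turn (t : Fin 4) (ζ : ℂ) : xCoord (turn t ζ) = xCoord ζ := by
  have := congrArg proj (cam_turn t ζ)
  rwa [proj_permCameral, proj_cam, proj_cam] at this

/-- The sheets of the cameral cover over the domains, labelled by the Weyl group. -/
def Labelled (d : Fin 3) (w : Equiv.Perm (Fin 3)) (P : Cameral) : Prop :=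
  ∃ ζ ∈ strip d, P = permCameral w (cam ζ)

lemma exists_labelled {α : Fin 10} {P : Cameral} (h : proj P ∈ mar α) :
    ∃ w, Labelled (domain α) w P := by
  obtain ⟨ζ, hζ, he⟩ := mar_subset α h
  obtain ⟨w, hw⟩ := exists_perm_of_proj he.symm
  exact ⟨w, ζ, hζ, hw⟩

/-- A double root `a` forces the third root to be `-2a` and `a² = 1`. Away from these branch values
`S₃` acts freely, which makes labels unique. -/
lemma proj_of_root_eq {P : Cameral} {i j : Fin 3} (hij : i ≠ j) (h : root P i = root P j) :
    proj P = 2 ∨ proj P = -2 := by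
  obtain ⟨h1, h2, h3⟩ := sum_root P
  have key : ∀ a b c : ℂ, a + b + c = 0 → a * b + a * c + b * c = -3 → proj P = -(a * b * c) →
      a = b → proj P = 2 ∨ proj P = -2 := by
    rintro a b c e1 e2 e3 rfl
    obtain rfl : c = -2 * a := by linear_combination e1
    have : (a - 1) * (a + 1) = 0 := by linear_combination -e2 / 3
    rcases mul_eq_zero.1 this with h | h
    · left
      rw [e3, sub_eq_zero.1 h]
      norm_num
    · right
      rw [e3, eq_neg_of_add_eq_zero_left h]
      norm_num
  have k01 := fun h => key _ _ _ h1 h2 h3 h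
  have k02 := fun h => key (root P 0) (root P 2) (root P 1) (by linear_combination h1)
    (by linear_combination h2) (by linear_combination h3) h
  have k12 := fun h => key (root P 1) (root P 2) (root P 0) (by linear_combination h1)
    (by linear_combination h2) (by linear_combination h3) h
  induction i using fin_three_cases <;> induction j using fin_three_cases
  exacts [absurd rfl hij, k01 h, k02 h, k01 h.symm, absurd rfl hij, k12 h, k02 h.symm,
    k12 h.symm, absurd rfl hij]

lemma xCoord_ne_of_strip {d : Fin 3} {ζ : ℂ} (hζ : ζ ∈ strip d) :
    xCoord ζ ≠ 2 ∧ xCoord ζ ≠ -2 := by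
  have hpi := Real.pi_pos
  have e1 : xCoord 0 = 2 := by simp [xCoord]
  have e2 : xCoord (Real.pi / 3 * Complex.I) = -2 := by
    rw [xCoord, show 3 * (Real.pi / 3 * Complex.I : ℂ) = Real.pi * Complex.I by ring,
      Complex.cosh_mul_I, Complex.cos_pi]
    ring
  have hre : ζ.re ≠ 0 → xCoord ζ ≠ 2 ∧ xCoord ζ ≠ -2 := by
    intro hr
    constructor
    · intro h
      obtain ⟨n, hn | hn⟩ := xCoord_eq_iff.1 (e1.trans h.symm) <;>
        exact hr (by rw [hn, Complex.add_re, re_int_turn]; simp)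
    · intro h
      obtain ⟨n, hn | hn⟩ := xCoord_eq_iff.1 (e2.trans h.symm) <;>
        exact hr (by rw [hn, Complex.add_re, re_int_turn]; simp)
  induction d using fin_three_cases
  · have hp : 0 < Real.pi / 3 := by positivity
    have him : (Real.pi / 3 * Complex.I : ℂ).im = Real.pi / 3 := by
      rw [show (Real.pi / 3 : ℂ) = ((Real.pi / 3 : ℝ) : ℂ) by push_cast; rfl,
        Complex.im_ofReal_mul]
      simp
    have key : ∀ m : ℤ, ζ.im ≠ m * (Real.pi / 3) := by
      intro m hm
      have h0 := hζ.1
      have h1 := hζ.2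
      rw [hm] at h0 h1
      have : m = 0 := int_eq_zero_of_abs_lt hp (by rwa [abs_of_pos h0])
      rw [this] at h0
      simp at h0
    constructor
    · intro h
      obtain ⟨n, hn | hn⟩ := xCoord_eq_iff.1 (e1.trans h.symm) <;>
        exact key (2 * n) (by rw [hn, Complex.add_im, im_int_turn]; push_cast; simp; ring)
    · intro h
      obtain ⟨n, hn | hn⟩ := xCoord_eq_iff.1 (e2.trans h.symm)
      · exact key (2 * n + 1) (by rw [hn, Complex.add_im, im_int_turn, him]; push_cast; ring)
      · exact key (2 * n - 1) (by
          rw [hn, Complex.add_im, im_int_turn, Complex.neg_im, him]; push_cast; ring)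
  · exact hre hζ.1.ne'
  · exact hre hζ.1.ne'

lemma permCameral_cam_injective {d : Fin 3} {ζ : ℂ} (hζ : ζ ∈ strip d)
    {w w' : Equiv.Perm (Fin 3)} (h : permCameral w (cam ζ) = permCameral w' (cam ζ)) : w = w' := by
  have key : w.symm = w'.symm := by
    ext1 i
    by_contra hi
    have h1 : root (cam ζ) (w.symm i) = root (cam ζ) (w'.symm i) := by
      rw [← root_permCameral, ← root_permCameral, h]
    rcases proj_of_root_eq hi h1 with h2 | h2
    · exact (xCoord_ne_of_strip hζ).1 h2
    · exact (xCoord_ne_of_strip hζ).2 h2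
  exact Equiv.symm_bijective.injective key

lemma Labelled.unique {d : Fin 3} {w w' : Equiv.Perm (Fin 3)} {P : Cameral}
    (h : Labelled d w P) (h' : Labelled d w' P) : w = w' := by
  obtain ⟨ζ, hζ, rfl⟩ := h
  obtain ⟨ζ', hζ', h⟩ := h'
  have := congrArg proj h
  rw [proj_permCameral, proj_permCameral] at this
  obtain rfl := xCoord_injOn_strip d hζ hζ' this
  exact permCameral_cam_injective hζ h

lemma Labelled.perm {d : Fin 3} {w : Equiv.Perm (Fin 3)} {P : Cameral} (h : Labelled d w P)
    (w' : Equiv.Perm (Fin 3)) : Labelled d (w' * w) (permCameral w' P) := by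
  obtain ⟨ζ, hζ, rfl⟩ := h
  exact ⟨ζ, hζ, rfl⟩

/-- Open disjoint label sets cover the part over a maximal abelian region, so a connected sheet
cannot change its label. -/
lemma isOpen_labelled (d : Fin 3) (w : Equiv.Perm (Fin 3)) : IsOpen {P | Labelled d w P} := by
  have : {P | Labelled d w P} = permCameral w⁻¹ ⁻¹' (cam '' strip d) := by
    ext P
    constructor
    · rintro ⟨ζ, hζ, rfl⟩
      refine ⟨ζ, hζ, ?_⟩
      rw [permCameral_permCameral, inv_mul_cancel, permCameral_one]
    · rintro ⟨ζ, hζ, h⟩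
      refine ⟨ζ, hζ, ?_⟩
      rw [h, permCameral_permCameral, mul_inv_cancel, permCameral_one]
  rw [this]
  exact (isOpen_cam_image (isOpen_strip d)).preimage (continuous_permCameral _)

/-- The labels are constant on the sheets. -/
lemma Labelled.of_mem_sheet {α : Fin 10} {U : Set ℂ} (hU : U ⊆ mar α) {w : Equiv.Perm (Fin 3)}
    {P Q : Cameral} (hP : Labelled (domain α) w P) (hPU : proj P ∈ U) (hQ : Q ∈ sheet U P) :
    Labelled (domain α) w Q := by
  have h := IsPreconnected.subset_left_of_subset_union (s := sheet U P)
    (u := {P | Labelled (domain α) w P})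
    (v := ⋃ w' : {w' // w' ≠ w}, {P | Labelled (domain α) w' P}) (isOpen_labelled _ w)
    (isOpen_iUnion fun w' => isOpen_labelled _ w') ?_ ?_
    ⟨P, mem_connectedComponentIn hPU, hP⟩ isPreconnected_connectedComponentIn
  · exact h hQ
  · refine disjoint_left.2 fun R hR hR' => ?_
    obtain ⟨⟨w', hw'⟩, h⟩ := mem_iUnion.1 hR'
    exact hw' (Labelled.unique h hR)
  · intro R hR
    have hRU : proj R ∈ U := (connectedComponentIn_subset (proj ⁻¹' U) P) hR
    obtain ⟨w', h⟩ := exists_labelled (hU hRU)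
    by_cases hw : w' = w
    · exact Or.inl (hw ▸ h)
    · exact Or.inr (mem_iUnion.2 ⟨⟨w', hw⟩, h⟩)

/-- The labelled points over a region. -/
lemma Labelled.exists_zone {α k : Fin 10} (hk : k ∈ marRegions α) {w : Equiv.Perm (Fin 3)}
    {P : Cameral} (h : Labelled (domain α) w P) (hP : proj P ∈ chamber k) :
    ∃ ζ ∈ zone k, P = permCameral (w * turnPerm (twist (domain α) k)) (cam ζ) := by
  obtain ⟨ζ', hζ', rfl⟩ := h
  obtain ⟨ζ, hζ, he⟩ := hP
  refine ⟨ζ, hζ, ?_⟩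
  rw [← permCameral_permCameral, ← cam_turn]
  congr 2
  refine xCoord_injOn_strip _ hζ' (turn_mem_strip hζ (fits hk)) ?_
  rw [xCoord_turn, he]
  rfl

lemma labelled_of_zone {α k : Fin 10} (hk : k ∈ marRegions α) (w : Equiv.Perm (Fin 3)) {ζ : ℂ}
    (hζ : ζ ∈ zone k) :
    Labelled (domain α) w (permCameral (w * turnPerm (twist (domain α) k)) (cam ζ)) :=
  ⟨_, turn_mem_strip hζ (fits hk), by rw [cam_turn, permCameral_permCameral]⟩

end BNR

end

/-! ### Sheets over the maximal abelian regions; hulls of sectors -/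

noncomputable section

namespace BNR

/-! ### The Weyl group acts on the sectors -/

def formIndex : Fin 3 → Fin 3 → Fin 6 := ![![0, 4, 5], ![1, 0, 0], ![2, 3, 0]]

def formLeft : Fin 6 → Fin 3 := ![1, 1, 2, 2, 0, 0]

def formRight : Fin 6 → Fin 3 := ![2, 0, 0, 1, 1, 2]

lemma rootForm_formIndex {a b : Fin 3} (h : a ≠ b) (v : Plane) :
    rootForm (formIndex a b) v = coord v a - coord v b := by
  induction a using fin_three_cases <;> induction b using fin_three_cases <;>
    first | exact absurd rfl h | rfl

def actForm (w : Equiv.Perm (Fin 3)) (k : Fin 6) : Fin 6 :=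
  formIndex (w (formLeft k)) (w (formRight k))

/-- The action of the Weyl group on the sectors. -/
def actSector (w : Equiv.Perm (Fin 3)) (k : Fin 6) : Fin 6 := actForm w (k + 5) + 1

lemma rootForm_actForm (w : Equiv.Perm (Fin 3)) (k : Fin 6) (v : Plane) :
    rootForm (actForm w k) (permPlane w v) = rootForm k v := by
  have h : w (formLeft k) ≠ w (formRight k) := fun h =>
    (by decide : ∀ k, formLeft k ≠ formRight k) k (w.injective h)
  rw [actForm, rootForm_formIndex h]
  change coord v (w.symm (w (formLeft k))) - coord v (w.symm (w (formRight k))) = _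
  rw [w.symm_apply_apply, w.symm_apply_apply]
  rfl

/-- An odd permutation reverses the orientation and so exchanges the two bounding walls of a sector;
hence the alternative. -/
lemma actSector_cases (w : Equiv.Perm (Fin 3)) (k : Fin 6) :
    (actForm w k = actSector w k ∧ actForm w (k + 4) = actSector w k + 4) ∨
      (actForm w k = actSector w k + 4 ∧ actForm w (k + 4) = actSector w k) := by
  revert w k
  decide +kernel

lemma permPlane_mem_closedSector (w : Equiv.Perm (Fin 3)) {k : Fin 6} {v : Plane} :
    permPlane w v ∈ closedSector (actSector w k) ↔ v ∈ closedSector k := by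
  have h1 := rootForm_actForm w k v
  have h2 := rootForm_actForm w (k + 4) v
  simp only [closedSector, mem_ofPred_eq]
  rcases actSector_cases w k with ⟨a, b⟩ | ⟨a, b⟩
  · rw [a] at h1
    rw [b] at h2
    rw [h1, h2]
  · rw [a] at h1
    rw [b] at h2
    rw [h1, h2, and_comm]

/-- The sector of a region in the chart of a maximal abelian region. -/
def sec (α k : Fin 10) : Fin 6 := actSector (turnPerm (twist (domain α) k)) (center k)

/-! ### Sheets of the cameral cover -/

/-- The labelled points over a region. -/
def slab (α : Fin 10) (w : Equiv.Perm (Fin 3)) (k : Fin 10) : Set Cameral :=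
  {P | Labelled (domain α) w P ∧ proj P ∈ chamber k}

lemma slab_eq {α k : Fin 10} (hk : k ∈ marRegions α) (w : Equiv.Perm (Fin 3)) :
    slab α w k =
      (fun ζ => permCameral (w * turnPerm (twist (domain α) k)) (cam ζ)) '' zone k := by
  ext P
  constructor
  · rintro ⟨h1, h2⟩
    obtain ⟨ζ, hζ, rfl⟩ := h1.exists_zone hk h2
    exact ⟨ζ, hζ, rfl⟩
  · rintro ⟨ζ, hζ, rfl⟩
    exact ⟨labelled_of_zone hk w hζ, ζ, hζ, rfl⟩

lemma isPreconnected_slab {α k : Fin 10} (hk : k ∈ marRegions α) (w : Equiv.Perm (Fin 3)) :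
    IsPreconnected (slab α w k) := by
  rw [slab_eq hk]
  exact (isPreconnected_zone k).image _
    ((continuous_permCameral _).comp continuous_cam).continuousOn

lemma zone_nonempty (k : Fin 10) : (zone k).Nonempty := by
  obtain ⟨ζ, hζ, -⟩ := regionPoint_mem k
  exact ⟨ζ, hζ⟩

lemma slab_nonempty {α k : Fin 10} (hk : k ∈ marRegions α) (w : Equiv.Perm (Fin 3)) :
    (slab α w k).Nonempty := by
  rw [slab_eq hk]
  exact (zone_nonempty k).image _

lemma slab_subset {α k : Fin 10} {w : Equiv.Perm (Fin 3)} {U : Set ℂ} (h : chamber k ⊆ U) :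
    slab α w k ⊆ proj ⁻¹' U := fun _ hP => h hP.2

lemma slab_subset_sheet {α k : Fin 10} (hk : k ∈ marRegions α) {w : Equiv.Perm (Fin 3)}
    {U : Set ℂ} (h : chamber k ⊆ U) {P : Cameral} (hP : P ∈ slab α w k) :
    slab α w k ⊆ sheet U P :=
  (isPreconnected_slab hk w).subset_connectedComponentIn hP (slab_subset h)

lemma mem_closure_strip {d : Fin 3} {ζ : ℂ} (hζ : ζ ∈ strip d) {k : Fin 10}
    (h : xCoord ζ ∈ closure (chamber k)) : ζ ∈ closure (strip d ∩ xCoord ⁻¹' chamber k) := by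
  refine mem_closure_iff.2 fun N hN hζN => ?_
  obtain ⟨x, ⟨z, hz, rfl⟩, hx⟩ := mem_closure_iff.1 h _
    (isOpenMap_xCoord _ (hN.inter (isOpen_strip d))) ⟨ζ, ⟨hζN, hζ⟩, rfl⟩
  exact ⟨z, hz.1, hz.2, hx⟩

lemma mem_closure_slab {α k : Fin 10} {w : Equiv.Perm (Fin 3)} {P : Cameral}
    (hP : Labelled (domain α) w P) (h : proj P ∈ closure (chamber k)) :
    P ∈ closure (slab α w k) := by
  obtain ⟨ζ, hζ, rfl⟩ := hP
  exact map_mem_closure (f := fun z => permCameral w (cam z))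
    ((continuous_permCameral w).comp continuous_cam) (mem_closure_strip hζ h)
    fun z hz => ⟨⟨z, hz.1, rfl⟩, hz.2⟩

lemma sheet_eq_of_mem {U : Set ℂ} {P Q : Cameral} (h : Q ∈ sheet U P) : sheet U P = sheet U Q :=
  connectedComponentIn_eq h

/-- The point on the common wall lifts to a point with label `w` in the closure of both slabs.
Adding it to either slab keeps that slab connected, so the two are joined. -/
lemma slab_subset_sheet_of_meets {α j k : Fin 10} (hj : j ∈ marRegions α) (hk : k ∈ marRegions α)
    (h : Meets j k) {w : Equiv.Perm (Fin 3)} {P : Cameral} (hP : P ∈ slab α w j) :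
    slab α w k ⊆ sheet (mar α) P := by
  obtain ⟨x, h1, h2, h3⟩ := h
  have hx : x ∈ mar α := by
    rw [mar_eq]
    refine interior_mono (closure_mono (union_subset ?_ ?_)) h3
    · exact subset_biUnion_of_mem (u := fun k => chamber k) hj
    · exact subset_biUnion_of_mem (u := fun k => chamber k) hk
  obtain ⟨ζ, hζ, rfl⟩ := mar_subset α hx
  obtain ⟨R, hR⟩ : ∃ R, R = permCameral w (cam ζ) := ⟨_, rfl⟩
  have hRl : Labelled (domain α) w R := ⟨ζ, hζ, hR⟩
  have hRx : proj R = xCoord ζ := by rw [hR]; rfl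
  have key : ∀ l ∈ marRegions α, xCoord ζ ∈ closure (chamber l) →
      insert R (slab α w l) ⊆ sheet (mar α) R := by
    intro l hl hc
    refine IsPreconnected.subset_connectedComponentIn
      ((isPreconnected_slab hl w).subset_closure (subset_insert _ _) ?_) (mem_insert _ _) ?_
    · exact insert_subset (mem_closure_slab hRl (by rwa [hRx])) subset_closure
    · refine insert_subset ?_ (slab_subset (chamber_subset_mar hl))
      change proj R ∈ mar α
      rwa [hRx]
  rw [← sheet_eq_of_mem (key j hj h1 (mem_insert_of_mem _ hP))]
  exact (subset_insert _ _).trans (key k hk h2)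

/-- The regions of a maximal abelian region, in the order of a path. -/
def marPath : Fin 10 → List (Fin 10) :=
  ![[3, 2, 1, 0, 8, 9], [4, 5, 6, 7, 8, 9], [1, 2, 3, 4], [2, 3, 4, 5], [3, 4, 5, 6],
    [5, 6, 7, 0], [6, 7, 0, 1], [7, 0, 1, 2], [0, 8, 9, 4], [7, 8, 9, 3]]

/-- Two adjacent regions of a maximal abelian region. -/
def IsStep (α j k : Fin 10) : Prop :=
  ((j, k) ∈ adjacentPairs ∨ (k, j) ∈ adjacentPairs) ∧ j ∈ marRegions α ∧ k ∈ marRegions α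

instance (α j k : Fin 10) : Decidable (IsStep α j k) :=
  inferInstanceAs (Decidable (_ ∧ _))

lemma isChain_marPath (α : Fin 10) : (marPath α).IsChain (IsStep α) := by
  revert α
  decide +kernel

lemma mem_marPath (α k : Fin 10) : k ∈ marPath α ↔ k ∈ marRegions α := by
  revert α k
  decide +kernel

/-- All labelled points over `k` are in the sheets of the labelled points over `j`. -/
def SheetRel (α : Fin 10) (w : Equiv.Perm (Fin 3)) (j k : Fin 10) : Prop :=
  j ∈ marRegions α ∧ k ∈ marRegions α ∧ ∀ P ∈ slab α w j, slab α w k ⊆ sheet (mar α) P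

lemma SheetRel.symm {α : Fin 10} {w : Equiv.Perm (Fin 3)} {j k : Fin 10} (h : SheetRel α w j k) :
    SheetRel α w k j := by
  obtain ⟨hj, hk, h⟩ := h
  refine ⟨hk, hj, fun Q hQ => ?_⟩
  obtain ⟨P, hP⟩ := slab_nonempty hj w
  rw [← sheet_eq_of_mem (h P hP hQ)]
  exact slab_subset_sheet hj (chamber_subset_mar hj) hP

lemma SheetRel.trans {α : Fin 10} {w : Equiv.Perm (Fin 3)} {i j k : Fin 10}
    (h : SheetRel α w i j) (h' : SheetRel α w j k) : SheetRel α w i k := by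
  obtain ⟨hi, hj, h⟩ := h
  obtain ⟨-, hk, h'⟩ := h'
  refine ⟨hi, hk, fun P hP => ?_⟩
  obtain ⟨Q, hQ⟩ := slab_nonempty hj w
  rw [sheet_eq_of_mem (h P hP hQ)]
  exact h' Q hQ

instance (α : Fin 10) (w : Equiv.Perm (Fin 3)) :
    Trans (SheetRel α w) (SheetRel α w) (SheetRel α w) :=
  ⟨SheetRel.trans⟩

lemma IsStep.sheetRel {α j k : Fin 10} (h : IsStep α j k) (w : Equiv.Perm (Fin 3)) :
    SheetRel α w j k := by
  have key : ∀ {j k}, Meets j k → j ∈ marRegions α → k ∈ marRegions α → SheetRel α w j k :=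
    fun h hj hk => ⟨hj, hk, fun P hP => slab_subset_sheet_of_meets hj hk h hP⟩
  obtain ⟨h | h, hj, hk⟩ := h
  · exact key (meets_of_mem (p := (j, k)) h) hj hk
  · exact (key (meets_of_mem (p := (k, j)) h) hk hj).symm

/-- The regions of `α` form a path of adjacent regions, and belonging to the same sheet is
transitive along it. -/
lemma slab_subset_sheet_of_mem {α j k : Fin 10} (hj : j ∈ marRegions α) (hk : k ∈ marRegions α)
    {w : Equiv.Perm (Fin 3)} {P : Cameral} (hP : P ∈ slab α w j) :
    slab α w k ⊆ sheet (mar α) P := by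
  have hpair : (marPath α).Pairwise (SheetRel α w) :=
    List.isChain_iff_pairwise.1 ((isChain_marPath α).imp fun j k h => h.sheetRel w)
  have hall : ∀ a ∈ marPath α, ∀ b ∈ marPath α, SheetRel α w a b := by
    have : Std.Symm (SheetRel α w) := ⟨fun _ _ h => h.symm⟩
    refine fun a ha b hb => hpair.forall_of_forall (fun a ha => ?_) ha hb
    have ha' := (mem_marPath α a).1 ha
    exact ⟨ha', ha', fun P hP => slab_subset_sheet ha' (chamber_subset_mar ha') hP⟩
  exact (hall j ((mem_marPath α j).2 hj) k ((mem_marPath α k).2 hk)).2.2 P hP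

lemma exists_slab_mem_sheet {α : Fin 10} {w : Equiv.Perm (Fin 3)} {P : Cameral}
    (hP : Labelled (domain α) w P) (hα : proj P ∈ mar α) :
    ∃ k ∈ marRegions α, ∃ Q ∈ slab α w k, Q ∈ sheet (mar α) P := by
  obtain ⟨ζ, hζ, rfl⟩ := hP
  have hopen : IsOpen (strip (domain α) ∩ xCoord ⁻¹' mar α) :=
    (isOpen_strip _).inter ((isOpen_mar α).preimage continuous_xCoord)
  obtain ⟨ε, hε, hball⟩ := Metric.isOpen_iff.1 hopen ζ ⟨hζ, hα⟩
  obtain ⟨k, hk, y, ⟨z, hz, rfl⟩, hy⟩ := exists_chamber_near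
    (isOpenMap_xCoord _ Metric.isOpen_ball) hα ⟨ζ, Metric.mem_ball_self hε, rfl⟩
  refine ⟨k, hk, permCameral w (cam z), ⟨⟨z, (hball hz).1, rfl⟩, hy⟩, ?_⟩
  have hconn : IsPreconnected ((fun z => permCameral w (cam z)) '' Metric.ball ζ ε) :=
    (convex_ball ζ ε).isPreconnected.image _
      ((continuous_permCameral w).comp continuous_cam).continuousOn
  refine hconn.subset_connectedComponentIn ⟨ζ, Metric.mem_ball_self hε, rfl⟩ ?_ ⟨z, hz, rfl⟩
  rintro _ ⟨z', hz', rfl⟩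
  exact (hball hz').2

/-- A sheet contains all points with the same label over the regions. -/
lemma Labelled.slab_subset {α k : Fin 10} (hk : k ∈ marRegions α) {w : Equiv.Perm (Fin 3)}
    {P : Cameral} (hP : Labelled (domain α) w P) (hα : proj P ∈ mar α) :
    slab α w k ⊆ sheet (mar α) P := by
  obtain ⟨j, hj, Q, hQ, hQP⟩ := exists_slab_mem_sheet hP hα
  rw [sheet_eq_of_mem hQP]
  exact slab_subset_sheet_of_mem hj hk hQ

/-- Undoing the label puts the periods of a region into a sector that depends only on `α` and `k`;
walls are reached as limits of slabs. -/
lemma Labelled.mem_closedSector {α k : Fin 10} (hk : k ∈ marRegions α) {w : Equiv.Perm (Fin 3)}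
    {P : Cameral} (hP : Labelled (domain α) w P) (h : proj P ∈ closure (chamber k)) :
    permPlane w⁻¹ (phi P) ∈ closedSector (sec α k) := by
  have hc : Continuous fun P => permPlane w⁻¹ (phi P) :=
    (LinearMap.continuous_of_finiteDimensional (permLin w⁻¹)).comp continuous_phi
  refine (isClosed_closedSector _).closure_subset
    (map_mem_closure (f := fun P => permPlane w⁻¹ (phi P)) hc (mem_closure_slab hP h) fun Q hQ => ?_)
  rw [slab_eq hk] at hQ
  obtain ⟨ζ, ⟨-, -, hζ, -⟩, rfl⟩ := hQ
  simp only [phi_permCameral, permPlane_permPlane, inv_mul_cancel_left]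
  exact (permPlane_mem_closedSector _).2 (openSector_subset _ hζ)

lemma exists_common_region {α β : Fin 10} {x : ℂ} (hα : x ∈ mar α) (hβ : x ∈ mar β) :
    ∃ k ∈ marRegions α ∩ marRegions β, x ∈ closure (chamber k) := by
  have : x ∈ closure (⋃ k ∈ marRegions α ∩ marRegions β, chamber k) := by
    refine mem_closure_iff.2 fun U hU hx => ?_
    obtain ⟨k, hk, y, ⟨hy1, hy2⟩, hy⟩ :=
      exists_chamber_near (hU.inter (isOpen_mar β)) hα ⟨hx, hβ⟩
    have hkβ := mem_marRegions hy2 (subset_closure hy)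
    exact ⟨y, hy1, mem_iUnion₂.2 ⟨k, Finset.mem_inter.2 ⟨hk, hkβ⟩, hy⟩⟩
  rw [Finset.closure_biUnion] at this
  obtain ⟨k, hk, h⟩ := mem_iUnion₂.1 this
  exact ⟨k, hk, h⟩

/-- Near `P` there is a point with both labels over a common region `k`. It comes from a single
point of the zone, and freeness of the action compares the labels. -/
lemma Labelled.exists_overlap {α β : Fin 10} {w w' : Equiv.Perm (Fin 3)} {P : Cameral}
    (hα : proj P ∈ mar α) (hβ : proj P ∈ mar β) (h : Labelled (domain α) w P)
    (h' : Labelled (domain β) w' P) : ∃ k ∈ marRegions α ∩ marRegions β,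
      w * turnPerm (twist (domain α) k) = w' * turnPerm (twist (domain β) k) := by
  obtain ⟨k, hk, hx⟩ := exists_common_region hα hβ
  obtain ⟨hkα, hkβ⟩ := Finset.mem_inter.1 hk
  obtain ⟨Q, hQ', hQ⟩ := mem_closure_iff.1 (mem_closure_slab h hx) _ (isOpen_labelled _ w') h'
  refine ⟨k, hk, ?_⟩
  have hQk := hQ.2
  obtain ⟨ζ, hζ, h1⟩ := hQ.1.exists_zone hkα hQk
  obtain ⟨ζ', hζ', h2⟩ := Labelled.exists_zone hkβ hQ' hQk
  have : xCoord ζ = xCoord ζ' := by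
    have := congrArg proj (h1.symm.trans h2)
    rwa [proj_permCameral, proj_permCameral, proj_cam, proj_cam] at this
  obtain rfl := xCoord_injOn_narrow hζ.1 hζ.2.1 hζ'.1 hζ'.2.1 this
  exact permCameral_cam_injective (d := 0) ⟨hζ.1, hζ.2.1⟩ (h1.symm.trans h2)

/-! ### Hulls -/

lemma hull_mono {S T : Set Plane} (h : S ⊆ T) : hull S ⊆ hull T :=
  fun _ hx H hH => hx H ⟨hH.1, h.trans hH.2⟩

lemma isEnclosure_hull (S : Set Plane) : IsEnclosure (hull S) :=
  ⟨_, fun _ hH => hH.1, rfl⟩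

lemma isHalfApartment_iff {H : Set Plane} :
    IsHalfApartment H ↔ ∃ m c, H = {v | c ≤ rootForm m v} := by
  constructor
  · rintro ⟨i, j, hij, c, rfl⟩
    exact ⟨formIndex i j, c, by simp only [rootForm_formIndex hij]⟩
  · rintro ⟨m, c, rfl⟩
    exact ⟨formLeft m, formRight m, (by decide : ∀ k, formLeft k ≠ formRight k) m, c, rfl⟩

lemma hull_preimage_subset {f : Plane → Plane}
    (hf : ∀ H, IsHalfApartment H → IsHalfApartment (f ⁻¹' H)) (S : Set Plane) :
    f '' hull S ⊆ hull (f '' S) := by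
  rintro _ ⟨x, hx, rfl⟩ H ⟨hH, hS⟩
  exact hx _ ⟨hf H hH, image_subset_iff.1 hS⟩

lemma isHalfApartment_preimage_add (b : Plane) {H : Set Plane} (hH : IsHalfApartment H) :
    IsHalfApartment ((fun v => b + v) ⁻¹' H) := by
  obtain ⟨i, j, hij, c, rfl⟩ := hH
  refine ⟨i, j, hij, c - (coord b i - coord b j), ?_⟩
  ext v
  simp only [mem_preimage, mem_ofPred_eq, coord_add]
  constructor <;> intro h <;> linarith

lemma isHalfApartment_preimage_perm (w : Equiv.Perm (Fin 3)) {H : Set Plane}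
    (hH : IsHalfApartment H) : IsHalfApartment (permPlane w ⁻¹' H) := by
  obtain ⟨i, j, hij, c, rfl⟩ := hH
  exact ⟨w.symm i, w.symm j, by simpa using hij, c, rfl⟩

lemma mem_hull_add {S : Set Plane} {b v : Plane} :
    b + v ∈ hull ((fun v => b + v) '' S) ↔ v ∈ hull S := by
  constructor
  · intro h
    have := hull_preimage_subset (f := fun v => -b + v)
      (fun H hH => isHalfApartment_preimage_add (-b) hH) _ ⟨_, h, rfl⟩
    rw [image_image] at this
    simpa only [neg_add_cancel_left, image_id'] using this
  · exact fun h => hull_preimage_subset (fun H hH => isHalfApartment_preimage_add b hH) S ⟨v, h, rfl⟩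

/-- Replacing `v` by `phi P + v` removes the base point from the periods, so that all sheets can be
compared in one fixed plane. -/
lemma mem_periodHull {U : Set ℂ} {P : Cameral} {v : Plane} :
    v ∈ periodHull U P ↔ phi P + v ∈ hull (phi '' sheet U P) := by
  rw [periodHull, ← mem_hull_add (b := phi P), image_image]
  simp only [period_eq, add_sub_cancel]

lemma rootForm_add_five (k : Fin 6) (v : Plane) :
    rootForm (k + 5) v = rootForm (k + 4) v + rootForm k v := by
  induction k using fin_six_cases <;> simp

/-- On a sector every root form is one of six. -/
lemma rootForm_cases (k m : Fin 6) : (m = k ∨ m = k + 4 ∨ m = k + 5) ∨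
    (m = k + 3 ∨ m = k + 4 + 3 ∨ m = k + 5 + 3) := by
  revert k m
  decide

/-- A half-apartment containing `S` is given by a root form of constant sign on the sector. If
nonnegative, the apex bounds its level by 0; if nonpositive, deep points of `S` would leave it. -/
lemma closedSector_subset_hull {S : Set Plane} {k : Fin 6} (h0 : (0 : Plane) ∈ closure S)
    (hdeep : ∀ M : ℝ, ∃ v ∈ S, M < rootForm (k + 4) v ∧ M < rootForm k v) :
    closedSector k ⊆ hull S := by
  rintro x ⟨hx1, hx2⟩ H ⟨hH, hS⟩
  obtain ⟨m, c, rfl⟩ := isHalfApartment_iff.1 hH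
  have hx3 : 0 ≤ rootForm (k + 5) x := by rw [rootForm_add_five]; linarith
  rcases rootForm_cases k m with hm | hm
  · have hc : c ≤ rootForm m 0 := by
      have hcl : IsClosed {v | c ≤ rootForm m v} := isClosed_le continuous_const
        (continuous_rootForm m)
      exact hcl.closure_subset (closure_mono hS h0)
    have hz : rootForm m 0 = 0 := by simp [rootForm]
    rw [hz] at hc
    refine hc.trans ?_
    rcases hm with rfl | rfl | rfl <;> assumption
  · exfalso
    obtain ⟨v, hv, h1, h2⟩ := hdeep |c|
    have h3 : |c| < rootForm (k + 5) v := by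
      rw [rootForm_add_five]
      linarith [abs_nonneg c]
    have h4 : c ≤ rootForm m v := hS hv
    have := neg_abs_le c
    rcases hm with rfl | rfl | rfl <;> rw [rootForm_add_three] at h4 <;> linarith

/-- No half-apartment contains two opposite sectors, so the hull is an empty intersection. -/
lemma hull_eq_univ {S : Set Plane} (k : Fin 6) (h : closedSector k ⊆ hull S)
    (h' : closedSector (k + 3) ⊆ hull S) : hull S = univ := by
  refine eq_univ_of_forall fun x H ⟨hH, hS⟩ => ?_
  exfalso
  obtain ⟨m, c, rfl⟩ := isHalfApartment_iff.1 hH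
  have key : ∀ k, closedSector k ⊆ hull S → ¬ (m = k + 3 ∨ m = k + 4 + 3 ∨ m = k + 5 + 3) := by
    intro k h hm
    have hp : sectorPt k (|c| + 1) (|c| + 1) ∈ closedSector k :=
      sectorPt_mem_closedSector k (by positivity) (by positivity)
    have h4 : c ≤ rootForm m (sectorPt k (|c| + 1) (|c| + 1)) := h hp _ ⟨hH, hS⟩
    obtain ⟨h1, h2⟩ := rootForm_sectorPt k (|c| + 1) (|c| + 1)
    have h3 := rootForm_add_five k (sectorPt k (|c| + 1) (|c| + 1))
    have := neg_abs_le c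
    have := abs_nonneg c
    rcases hm with rfl | rfl | rfl <;> rw [rootForm_add_three] at h4 <;> linarith
  rcases rootForm_cases k m with hm | hm
  · refine key (k + 3) h' ?_
    exact (by decide : ∀ k m : Fin 6, (m = k ∨ m = k + 4 ∨ m = k + 5) →
      (m = k + 3 + 3 ∨ m = k + 3 + 4 + 3 ∨ m = k + 3 + 5 + 3)) k m hm
  · exact key k h hm

end BNR

end

/-! ### The periods of a maximal abelian region span the whole plane -/

noncomputable section

namespace BNR

/-! ### The hulls of the periods of the regions -/

/-- The periods of the points of a zone. -/
def zonePeriods (k : Fin 10) : Set Plane := (fun ζ => phi (cam ζ)) '' zone k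

/-- The periods of a region come close to the apex and far away from the walls of its sector. -/
def FillsSector (k : Fin 10) : Prop :=
  (0 : Plane) ∈ closure (zonePeriods k) ∧ ∀ M : ℝ, ∃ v ∈ zonePeriods k,
    M < rootForm (center k + 4) v ∧ M < rootForm (center k) v

lemma zonePeriods_upDown_subset (k : Fin 10) : zonePeriods k ⊆ zonePeriods (upDown k) := by
  rintro _ ⟨ζ, hζ, rfl⟩
  exact ⟨flipRe ζ, flipRe_mem_zone hζ, phi_flipRe ζ⟩

lemma FillsSector.upDown {j k : Fin 10} (hjk : upDown j = k) (h : FillsSector j) :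
    FillsSector k := by
  subst hjk
  refine ⟨closure_mono (zonePeriods_upDown_subset j) h.1, fun M => ?_⟩
  obtain ⟨v, hv, h'⟩ := h.2 M
  rw [(by decide : ∀ k, center (BNR.upDown k) = center k) j]
  exact ⟨v, zonePeriods_upDown_subset j hv, h'⟩

lemma continuous_permPlane (w : Equiv.Perm (Fin 3)) : Continuous (permPlane w) :=
  LinearMap.continuous_of_finiteDimensional (permLin w)

lemma permPlane_zero (w : Equiv.Perm (Fin 3)) : permPlane w 0 = 0 := (permLin w).map_zero

lemma FillsSector.leftRight {j k : Fin 10} (hjk : leftRight j = k) (h : FillsSector j) :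
    FillsSector k := by
  subst hjk
  have hsub : ∀ v ∈ zonePeriods j, permPlane (Equiv.swap 1 2) v ∈
      zonePeriods (BNR.leftRight j) := by
    rintro _ ⟨ζ, hζ, rfl⟩
    exact ⟨flipIm ζ, flipIm_mem_zone hζ, phi_flipIm ζ⟩
  refine ⟨?_, fun M => ?_⟩
  · have := map_mem_closure (continuous_permPlane (Equiv.swap 1 2)) h.1 hsub
    rwa [permPlane_zero] at this
  · obtain ⟨v, hv, h1, h2⟩ := h.2 M
    refine ⟨_, hsub v hv, ?_⟩
    rw [(by decide : ∀ k, center (BNR.leftRight k) = 5 - center k) j, rootForm_swap,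
      rootForm_swap, (by decide : ∀ c : Fin 6, 3 - (5 - c + 4) = c) (center j),
      (by decide : ∀ c : Fin 6, 3 - (5 - c) = c + 4) (center j)]
    exact ⟨h2, h1⟩

/-- The collision point. -/
lemma exists_collision : ∃ ζ : ℂ, ζ.im = Real.pi / 6 ∧ 0 < ζ.re ∧ wall ζ.re (Real.pi / 6) = 0 ∧
    phi (cam ζ) = 0 := by
  have hpi := Real.pi_pos
  have h3 : Real.sqrt 3 ^ 2 = 3 := Real.sq_sqrt (by norm_num)
  have hs1 : (1 : ℝ) < Real.sqrt 3 := by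
    rw [Real.lt_sqrt (by norm_num)]
    norm_num
  -- By `wall_pi_div_six` the wall passes through `π/6` exactly when `2C² - 2C - 1 = 0`.
  obtain ⟨η, hη, hC⟩ := exists_cosh_eq (C := (1 + Real.sqrt 3) / 2) (by linarith)
  have hw : wall η (Real.pi / 6) = 0 := by
    rw [wall_pi_div_six hC]
    nlinarith
  refine ⟨⟨η, Real.pi / 6⟩, rfl, hη, hw, ?_⟩
  have h1 := rootForm_one_phi ⟨η, Real.pi / 6⟩
  have h5 := rootForm_five_phi ⟨η, Real.pi / 6⟩
  simp only [show Real.pi / 3 - Real.pi / 6 = Real.pi / 6 by ring, hw, mul_zero, neg_zero,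
    rootForm_one, rootForm_five] at h1 h5
  have hsum := coord_sum (phi (cam ⟨η, Real.pi / 6⟩))
  refine plane_ext' ?_ ?_ <;> rw [coord_zero] <;> linarith

lemma zero_mem_closure_zonePeriods {k : Fin 10} {ζ : ℂ} (h : ζ ∈ closure (zone k))
    (h0 : phi (cam ζ) = 0) : (0 : Plane) ∈ closure (zonePeriods k) := by
  rw [← h0]
  exact map_mem_closure (f := fun ζ => phi (cam ζ)) (continuous_phi.comp continuous_cam) h
    fun z hz => ⟨z, hz, rfl⟩

lemma wall_le_neg {C θ η : ℝ} (hη : Real.cosh (2 * η) = C) (hC : 2 ≤ C)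
    (h : 2 ≤ C * Real.cos (2 * θ)) : wall η θ ≤ -C := by
  rw [wall_eq_of_cosh hη]
  have := Real.cos_le_one (2 * θ)
  nlinarith

lemma le_wall {C θ η : ℝ} (hη : Real.cosh (2 * η) = C) (hC : 2 ≤ C)
    (h : Real.cos (2 * θ) ≤ 0) : C ≤ wall η θ := by
  rw [wall_eq_of_cosh hη]
  nlinarith [mul_nonpos_of_nonneg_of_nonpos (by nlinarith : 0 ≤ 2 * C ^ 2 - 1) h]

/-- A number that is large even after multiplication with given positive factors. -/
lemma exists_large {p q r : ℝ} (hp : 0 < p) (hq : 0 < q) (hr : 0 < r) (M : ℝ) :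
    ∃ C, 2 ≤ C ∧ 2 ≤ C * r ∧ M < p * C ∧ M < q * C := by
  refine ⟨2 + 2 / r + (|M| / p + |M| / q), ?_, ?_, ?_, ?_⟩
  · have : 0 ≤ 2 / r + (|M| / p + |M| / q) := by positivity
    linarith
  · have e : (2 + 2 / r + (|M| / p + |M| / q)) * r = 2 + (2 + (|M| / p + |M| / q)) * r := by
      field_simp
      ring
    rw [e]
    have : 0 ≤ (2 + (|M| / p + |M| / q)) * r := by positivity
    linarith
  · have e : p * (2 + 2 / r + (|M| / p + |M| / q)) = |M| + p * (2 + 2 / r + |M| / q) := by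
      field_simp
      ring
    rw [e]
    have : 0 < p * (2 + 2 / r + |M| / q) := by positivity
    linarith [le_abs_self M]
  · have e : q * (2 + 2 / r + (|M| / p + |M| / q)) = |M| + q * (2 + 2 / r + |M| / p) := by
      field_simp
      ring
    rw [e]
    have : 0 < q * (2 + 2 / r + |M| / p) := by positivity
    linarith [le_abs_self M]

/-- The apex is approached vertically from below the collision point. Deep points are found on the
line `Im ζ = π/24`, where one of the relevant cosines is positive and the other is nonpositive, so
both root forms tend to infinity with `η`. -/
lemma fillsSector_zero : FillsSector 0 := by
  have hpi := Real.pi_pos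
  refine ⟨?_, fun M => ?_⟩
  · obtain ⟨ζ, h1, h2, h3, h4⟩ := exists_collision
    refine zero_mem_closure_zonePeriods ?_ h4
    refine mem_closure_of_direction (isOpen_band 0 Real.pi) (ζ := ζ)
      ⟨by linarith, by linarith⟩ (-Complex.I) fun t ht hU => ?_
    have him : (ζ + t * -Complex.I).im = Real.pi / 6 - t := by simp [h1]; ring
    have hre : (ζ + t * -Complex.I).re = ζ.re := by simp
    have h0 := hU.1
    rw [him] at h0
    refine mem_zone_zero.2 ?_
    rw [him, hre]
    refine ⟨h0, by linarith, ?_, ?_, h2⟩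
    · rw [← h3]
      exact wall_lt_wall _ h0.le (by linarith) (by linarith)
    · rw [← h3]
      exact wall_lt_wall _ (by linarith) (by linarith) (by linarith)
  · have hr := Real.cos_pos_of_mem_Ioo (x := 2 * (Real.pi / 24)) ⟨by linarith, by linarith⟩
    have hs1 := Real.sin_pos_of_pos_of_lt_pi (x := 2 * (Real.pi / 24)) (by linarith) (by linarith)
    have hs2 := Real.sin_pos_of_pos_of_lt_pi (x := 2 * (Real.pi / 3 - Real.pi / 24))
      (by linarith) (by linarith)
    obtain ⟨C, hC, hCr, hM1, hM2⟩ := exists_large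
      (p := 3 * Real.sqrt 3 * Real.sin (2 * (Real.pi / 24)))
      (q := 3 * Real.sqrt 3 * Real.sin (2 * (Real.pi / 3 - Real.pi / 24))) (by positivity)
      (by positivity) hr M
    obtain ⟨η, hη, hηC⟩ := exists_cosh_eq (C := C) (by linarith)
    have hw1 := wall_le_neg hηC hC hCr
    have hw2 : C ≤ wall η (Real.pi / 3 - Real.pi / 24) := le_wall hηC hC
      (Real.cos_nonpos_of_pi_div_two_le_of_le (by linarith) (by linarith))
    refine ⟨_, ⟨⟨η, Real.pi / 24⟩, mem_zone_zero.2 ⟨?_, ?_, ?_, ?_, hη⟩, rfl⟩, ?_, ?_⟩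
    · change 0 < Real.pi / 24
      linarith
    · change Real.pi / 24 < _
      linarith
    · change wall η (Real.pi / 24) < 0
      linarith
    · change 0 < wall η (Real.pi / 3 - Real.pi / 24)
      linarith
    · refine lt_of_lt_of_eq ?_ (rootForm_five_phi ⟨η, Real.pi / 24⟩).symm
      exact hM2.trans_le (mul_le_mul_of_nonneg_left hw2 (by positivity))
    · refine lt_of_lt_of_eq ?_ (rootForm_one_phi ⟨η, Real.pi / 24⟩).symm
      rw [← mul_neg]
      exact hM1.trans_le (mul_le_mul_of_nonneg_left (by linarith) (by positivity))

/-- The same argument on the line `Im ζ = π/8`, which stays inside zone 1 for large `η`. -/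
lemma fillsSector_one : FillsSector 1 := by
  have hpi := Real.pi_pos
  refine ⟨?_, fun M => ?_⟩
  · obtain ⟨ζ, h1, h2, h3, h4⟩ := exists_collision
    exact zero_mem_closure_zonePeriods (mem_closure_zone_one h1 h2.le h3.le) h4
  · have hr := Real.cos_pos_of_mem_Ioo (x := 2 * (Real.pi / 3 - Real.pi / 8))
      ⟨by linarith, by linarith⟩
    have hc := Real.cos_pos_of_mem_Ioo (x := 2 * (Real.pi / 8) - Real.pi / 3)
      ⟨by linarith, by linarith⟩
    have hs1 := Real.sin_pos_of_pos_of_lt_pi (x := -(2 * (Real.pi / 8) - Real.pi / 3))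
      (by linarith) (by linarith)
    have hs2 := Real.sin_pos_of_pos_of_lt_pi (x := 2 * (Real.pi / 3 - Real.pi / 8))
      (by linarith) (by linarith)
    obtain ⟨C, hC, hCr, hM1, hM2⟩ := exists_large
      (p := 3 * Real.sqrt 3 * Real.sin (-(2 * (Real.pi / 8) - Real.pi / 3)))
      (q := 3 * Real.sqrt 3 * Real.sin (2 * (Real.pi / 3 - Real.pi / 8))) (by positivity)
      (by positivity) hr M
    obtain ⟨η, hη, hηC⟩ := exists_cosh_eq (C := C) (by linarith)
    have hw1 := wall_le_neg hηC hC hCr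
    refine ⟨_, ⟨⟨η, Real.pi / 8⟩, mem_zone_one.2 ⟨?_, ?_, ?_, hη⟩, rfl⟩, ?_, ?_⟩
    · change 0 < Real.pi / 8
      linarith
    · change Real.pi / 8 < _
      linarith
    · change wall η (Real.pi / 3 - Real.pi / 8) < 0
      linarith
    · change M < rootForm (3 + 3) _
      rw [rootForm_add_three]
      refine lt_of_lt_of_eq ?_ (congrArg Neg.neg (rootForm_three_phi ⟨η, Real.pi / 8⟩)).symm
      have hc4 := Real.cosh_pos (4 * η)
      rw [← neg_mul, ← mul_neg, ← Real.sin_neg]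
      refine hM1.trans_le (mul_le_mul_of_nonneg_left ?_ (by positivity))
      change C ≤ Real.cosh (2 * η) + _
      rw [hηC]
      have := mul_nonneg hc4.le hc.le
      linarith
    · change M < rootForm (5 + 3) _
      rw [rootForm_add_three]
      refine lt_of_lt_of_eq ?_ (congrArg Neg.neg (rootForm_five_phi ⟨η, Real.pi / 8⟩)).symm
      rw [← mul_neg]
      exact hM2.trans_le (mul_le_mul_of_nonneg_left (by linarith) (by positivity))

/-- The central regions are excluded: they are bounded, and so are their periods. -/
lemma fillsSector {k : Fin 10} (hk : k < 8) : FillsSector k := by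
  have h0 := fillsSector_zero
  have h1 := fillsSector_one
  have h2 := h1.leftRight (k := 2) (by decide)
  have h3 := h0.leftRight (k := 3) (by decide)
  induction k using fin_ten_cases
  exacts [h0, h1, h2, h3, h3.upDown (by decide), h2.upDown (by decide), h1.upDown (by decide),
    h0.upDown (by decide), absurd hk (by decide), absurd hk (by decide)]

lemma permPlane_mem_hull (w : Equiv.Perm (Fin 3)) {S : Set Plane} {v : Plane} (hv : v ∈ hull S) :
    permPlane w v ∈ hull (permPlane w '' S) :=
  hull_preimage_subset (fun _ hH => isHalfApartment_preimage_perm w hH) S ⟨v, hv, rfl⟩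

lemma permPlane_mem_hull_slab {α k : Fin 10} (hk : k ∈ marRegions α) (hk8 : k < 8)
    (w : Equiv.Perm (Fin 3)) {v : Plane} (hv : v ∈ closedSector (sec α k)) :
    permPlane w v ∈ hull (phi '' slab α w k) := by
  obtain ⟨h0, hdeep⟩ := fillsSector hk8
  have h1 : permPlane (turnPerm (twist (domain α) k))⁻¹ v ∈ closedSector (center k) := by
    rw [← permPlane_mem_closedSector (turnPerm (twist (domain α) k)), permPlane_permPlane,
      mul_inv_cancel, permPlane_one]
    exact hv
  have h2 := permPlane_mem_hull (w * turnPerm (twist (domain α) k))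
    (closedSector_subset_hull h0 hdeep h1)
  rw [permPlane_permPlane, mul_inv_cancel_right] at h2
  refine hull_mono ?_ h2
  rintro _ ⟨_, ⟨ζ, hζ, rfl⟩, rfl⟩
  rw [slab_eq hk]
  exact ⟨_, ⟨ζ, hζ, rfl⟩, phi_permCameral _ _⟩

/-- Two exterior regions of `α` with opposite sectors; together with `hull_eq_univ` they make the
hull the whole plane. -/
lemma exists_opposite_regions (α : Fin 10) : ∃ j ∈ marRegions α, ∃ k ∈ marRegions α,
    j < 8 ∧ k < 8 ∧ sec α k = sec α j + 3 := by
  revert α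
  decide +kernel

/-- The hull of the periods of a maximal abelian region is the whole plane. -/
lemma hull_periods_eq_univ {α : Fin 10} {P : Cameral} (hP : proj P ∈ mar α) :
    hull (phi '' sheet (mar α) P) = univ := by
  obtain ⟨w, hw⟩ := exists_labelled hP
  obtain ⟨j, hj, k, hk, hj8, hk8, hjk⟩ := exists_opposite_regions α
  have key : ∀ k ∈ marRegions α, k < 8 →
      closedSector (actSector w (sec α k)) ⊆ hull (phi '' sheet (mar α) P) := by
    intro k hk hk8 v hv
    have h1 : permPlane w⁻¹ v ∈ closedSector (sec α k) := by
      rw [← permPlane_mem_closedSector w, permPlane_permPlane, mul_inv_cancel, permPlane_one]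
      exact hv
    have h2 := permPlane_mem_hull_slab hk hk8 w h1
    rw [permPlane_permPlane, mul_inv_cancel, permPlane_one] at h2
    exact hull_mono (image_mono (hw.slab_subset hk hP)) h2
  refine hull_eq_univ _ (key j hj hj8) ?_
  have := key k hk hk8
  rwa [hjk, (by decide +kernel : ∀ (w : Equiv.Perm (Fin 3)) (c : Fin 6),
    actSector w (c + 3) = actSector w c + 3) w (sec α j)] at this

lemma periodHull_mar {α : Fin 10} {P : Cameral} (hP : proj P ∈ mar α) :
    periodHull (mar α) P = univ :=
  eq_univ_of_forall fun v => by rw [mem_periodHull, hull_periods_eq_univ hP]; exact mem_univ _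

/-- The periods over the intersection of two maximal abelian regions. -/
lemma mem_hull_of_mem_periodHull {α β : Fin 10} {w : Equiv.Perm (Fin 3)} {P : Cameral} {v : Plane}
    (hα : proj P ∈ mar α) (hβ : proj P ∈ mar β) (hw : Labelled (domain α) w P)
    (hv : v ∈ periodHull (mar α ∩ mar β) P) : permPlane w⁻¹ (phi P + v) ∈
      hull (⋃ k ∈ marRegions α ∩ marRegions β, closedSector (sec α k)) := by
  rw [mem_periodHull] at hv
  refine hull_mono ?_ (permPlane_mem_hull w⁻¹ hv)
  rintro _ ⟨_, ⟨Q, hQ, rfl⟩, rfl⟩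
  have hQm : proj Q ∈ mar α ∩ mar β := (connectedComponentIn_subset (proj ⁻¹' _) P) hQ
  obtain ⟨k, hk, hx⟩ := exists_common_region hQm.1 hQm.2
  exact mem_iUnion₂.2 ⟨k, hk, (hw.of_mem_sheet inter_subset_left ⟨hα, hβ⟩ hQ).mem_closedSector
    (Finset.mem_inter.1 hk).1 hx⟩

end BNR

end

/-! ### The ten hexagons and their changes of coordinates -/

noncomputable section

namespace BNR

/-! ### The hexagons of the maximal abelian regions -/

/-- The edges of the link and of three further pairs of edges, which join opposite vertices. -/
def tableEdges : List (Fin 12 × Fin 12) :=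
  [(0, 1), (1, 2), (2, 3), (3, 4), (4, 5), (5, 6), (6, 7), (7, 0), (0, 8), (4, 8),
    (1, 9), (5, 9), (2, 10), (6, 10), (3, 11), (7, 11)]

def TableAdj (a b : Fin 12) : Prop := (a, b) ∈ tableEdges ∨ (b, a) ∈ tableEdges

instance : DecidableRel TableAdj := fun _ _ => inferInstanceAs (Decidable (_ ∨ _))

/-- The opposite pairs of the octagon other than `0, 4`, which the link already joins. The first
completion step gives them common neighbours, numbered 9, 10 and 11 below. -/
def farEnds : Fin 3 → Fin 9 × Fin 9 := ![(1, 5), (2, 6), (3, 7)]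

lemma isOpenFour_farEnds (i : Fin 3) : IsOpenFour linkStage.G (farEnds i).1 (farEnds i).2 := by
  have key : ∀ i, (∃ a b c, LinkAdj (farEnds i).1 a ∧ LinkAdj a b ∧ LinkAdj b c ∧
      LinkAdj c (farEnds i).2 ∧ (farEnds i).1 ≠ b ∧ a ≠ c ∧ b ≠ (farEnds i).2 ∧
      (farEnds i).1 ≠ (farEnds i).2) ∧
      ¬∃ d, LinkAdj (farEnds i).1 d ∧ LinkAdj d (farEnds i).2 := by decide
  exact isLinear_link.isOpenFour_iff.2 (key i)

/-- The vertices of the link and the middle vertices of three new pairs of edges. -/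
def vertStage : Fin 12 → (stage 1).V :=
  Fin.append (m := 9) (n := 3) (fun k => Sum.inl k)
    fun i => Sum.inr ⟨s((farEnds i).1, (farEnds i).2), _, _, rfl, isOpenFour_farEnds i⟩

lemma vertStage_left (k : Fin 9) : vertStage (Fin.castAdd 3 k) = Sum.inl k := Fin.append_left _ _ _

lemma vertStage_right (i : Fin 3) : vertStage (Fin.natAdd 9 i) =
    Sum.inr ⟨s((farEnds i).1, (farEnds i).2), _, _, rfl, isOpenFour_farEnds i⟩ :=
  Fin.append_right _ _ _

lemma vertStage_adj (a b : Fin 12) :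
    (stage 1).G.Adj (vertStage a) (vertStage b) ↔ TableAdj a b := by
  have key : ∀ (k : Fin 9) (i : Fin 3),
      (stage 1).G.Adj (vertStage (Fin.castAdd 3 k)) (vertStage (Fin.natAdd 9 i)) ↔
      TableAdj (Fin.castAdd 3 k) (Fin.natAdd 9 i) := fun k i => by
    rw [vertStage_left, vertStage_right]
    refine complete_adj_inr.trans (Sym2.mem_iff.trans ?_)
    exact (by decide : ∀ (k : Fin 9) (i : Fin 3), k = (farEnds i).1 ∨ k = (farEnds i).2 ↔
      TableAdj (Fin.castAdd 3 k) (Fin.natAdd 9 i)) k i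
  have comm : ∀ {a b}, TableAdj a b ↔ TableAdj b a := or_comm
  induction a using Fin.addCases (m := 9) (n := 3) with
  | left k =>
    induction b using Fin.addCases (m := 9) (n := 3) with
    | left l =>
      rw [vertStage_left, vertStage_left]
      refine complete_adj_inl.trans (linkStage_adj.trans ?_)
      exact (by decide : ∀ k l : Fin 9, LinkAdj k l ↔
        TableAdj (Fin.castAdd 3 k) (Fin.castAdd 3 l)) k l
    | right i => exact key k i
  | right i =>
    induction b using Fin.addCases (m := 9) (n := 3) with
    | left k => rw [SimpleGraph.adj_comm, comm]; exact key k i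
    | right j =>
      rw [vertStage_right, vertStage_right]
      exact iff_of_false complete_adj_inr_inr
        ((by decide : ∀ i j : Fin 3, ¬TableAdj (Fin.natAdd 9 i) (Fin.natAdd 9 j)) i j)

lemma vertStage_injective : Function.Injective vertStage := by
  refine Fin.append_injective_iff.2 ⟨Sum.inl_injective, fun i j h => ?_, fun _ _ h => nomatch h⟩
  have h1 : s((farEnds i).1, (farEnds i).2) = s((farEnds j).1, (farEnds j).2) :=
    congrArg Subtype.val (Sum.inr_injective h)
  exact (by decide : ∀ i j : Fin 3, s((farEnds i).1, (farEnds i).2) =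
    s((farEnds j).1, (farEnds j).2) → i = j) i j h1

def vert (i : Fin 12) : B8 := B8.mk 1 (vertStage i)

lemma vert_castLE (k : Fin 9) : vert (Fin.castLE (by decide) k) = B8.mk 0 k :=
  (congrArg (B8.mk 1) (vertStage_left k)).trans (B8.mk_succ 0 k)

lemma vert_adj {a b : Fin 12} (h : TableAdj a b) : b8Graph.Adj (vert a) (vert b) :=
  b8_adj_mk.2 ((vertStage_adj a b).2 h)

/-- Entry `k` of row `α` is the vertex over `ray k` in the plane of `α`. The first two regions give
hexagons of the link; the other eight have four regions, whose path of four edges is closed by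
vertex 9, 10 or 11. -/
def tab : Fin 10 → Fin 6 → Fin 12 :=
  ![![8, 0, 1, 2, 3, 4], ![8, 0, 7, 6, 5, 4], ![5, 9, 1, 2, 3, 4], ![5, 6, 10, 2, 3, 4],
    ![7, 11, 3, 4, 5, 6], ![7, 0, 1, 9, 5, 6], ![7, 0, 1, 2, 10, 6], ![7, 0, 1, 2, 3, 11],
    ![8, 0, 1, 9, 5, 4], ![8, 0, 7, 11, 3, 4]]

/-- The hexagon of a maximal abelian region. -/
def hexM (α : Fin 10) : Hexagon where
  vertex := vert ∘ tab α
  injective := ((B8.mk_injective 1).comp vertStage_injective).comp ((by decide : ∀ α, Function.Injective (tab α)) α)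
  adj k := vert_adj
    ((by decide : ∀ α k, TableAdj (tab α k) (tab α (k + 1))) α k)

lemma tab_sec : ∀ α k, k ∈ marRegions α →
    (tab α (sec α k) = Fin.castLE (by decide) (edgeVertices k).1 ∧
      tab α (sec α k + 1) = Fin.castLE (by decide) (edgeVertices k).2) ∨
    (tab α (sec α k) = Fin.castLE (by decide) (edgeVertices k).2 ∧
      tab α (sec α k + 1) = Fin.castLE (by decide) (edgeVertices k).1) := by
  decide +kernel

/-- The action of the Weyl group on the rays. -/
def actRay (w : Equiv.Perm (Fin 3)) (j : Fin 6) : Fin 6 :=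
  if actForm w (j + 5) = actForm w (j + 4) + 1 then actForm w (j + 4) + 2 else actForm w (j + 4) + 1

lemma actRay_injective : ∀ w, Function.Injective (actRay w) := by decide +kernel

lemma actRay_cases : ∀ w j, (actRay w j + 4 = actForm w (j + 4) ∧ actRay w j + 5 = actForm w (j + 5)) ∨
    (actRay w j + 5 = actForm w (j + 4) ∧ actRay w j + 4 = actForm w (j + 5)) := by decide +kernel

lemma coef_actRay (w : Equiv.Perm (Fin 3)) (j : Fin 6) (v : Plane) :
    coef (actRay w j) (permPlane w v) = coef j v := by
  unfold coef
  rcases actRay_cases w j with ⟨h1, h2⟩ | ⟨h1, h2⟩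
  · rw [h1, h2, rootForm_actForm, rootForm_actForm]
  · rw [h1, h2, rootForm_actForm, rootForm_actForm, min_comm]

/-- Two hexagons give the same point of the cone when they agree at all vertices that carry a
nonzero coefficient. -/
lemma pt_permPlane {h h' : Hexagon} (w : Equiv.Perm (Fin 3)) {v : Plane}
    (H : ∀ j, h.vertex j = h'.vertex (actRay w j) ∨ coef j v = 0) :
    pt h' (permPlane w v) = pt h v := by
  apply Subtype.ext
  change ∑ k, Finsupp.single (h'.vertex k) (coef k (permPlane w v)) =
    ∑ k, Finsupp.single (h.vertex k) (coef k v)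
  rw [← (Equiv.ofBijective _ (Finite.injective_iff_bijective.1 (actRay_injective w))).sum_comp]
  refine Finset.sum_congr rfl fun j _ => ?_
  rw [Equiv.ofBijective_apply, coef_actRay]
  rcases H j with e | e
  · rw [e]
  · rw [e, Finsupp.single_zero, Finsupp.single_zero]

/-- The change of labels between two maximal abelian regions that share the region `k`. -/
def change (α β k : Fin 10) : Equiv.Perm (Fin 3) :=
  turnPerm (twist (domain α) k) * (turnPerm (twist (domain β) k))⁻¹

/-- Where the hexagons differ at position `j`, some root form `m` is nonnegative on all common
sectors while its negative is one of the two forms in `coef j`; so `coef j` vanishes even on the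
hull of these sectors. -/
lemma tab_change : ∀ α β k, k ∈ marRegions α ∩ marRegions β → ∀ j,
    tab α j = tab β (actRay (change α β k)⁻¹ j) ∨ ∃ m : Fin 6, (m = j + 1 ∨ m = j + 2) ∧
      ∀ l ∈ marRegions α ∩ marRegions β, m = sec α l ∨ m = sec α l + 4 ∨ m = sec α l + 5 := by
  decide +kernel

lemma pt_change {α β k : Fin 10} (hk : k ∈ marRegions α ∩ marRegions β) {v : Plane}
    (hv : v ∈ hull (⋃ k ∈ marRegions α ∩ marRegions β, closedSector (sec α k))) :
    pt (hexM β) (permPlane (change α β k)⁻¹ v) = pt (hexM α) v := by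
  refine pt_permPlane _ fun j => ?_
  rcases tab_change α β k hk j with h | ⟨m, hm, h⟩
  · exact Or.inl (congrArg vert h)
  · right
    have h0 : 0 ≤ rootForm m v := by
      refine hv {v | 0 ≤ rootForm m v} ⟨isHalfApartment_iff.2 ⟨m, 0, rfl⟩, fun x hx => ?_⟩
      simp only [mem_iUnion] at hx
      obtain ⟨l, hl, hx⟩ := hx
      have h5 := rootForm_add_five (sec α l) x
      have h1 := hx.1
      have h2 := hx.2
      simp only [mem_ofPred_eq]
      rcases h l hl with rfl | rfl | rfl <;> linarith
    have h3 := rootForm_add_three m v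
    unfold coef
    have e : m + 3 = j + 4 ∨ m + 3 = j + 5 := by
      rcases hm with rfl | rfl
      · exact Or.inl ((by decide : ∀ j : Fin 6, j + 1 + 3 = j + 4) j)
      · exact Or.inr ((by decide : ∀ j : Fin 6, j + 2 + 3 = j + 5) j)
    rw [max_eq_left, zero_div]
    rcases e with e | e
    · exact (min_le_left _ _).trans (by rw [← e]; linarith)
    · exact (min_le_right _ _).trans (by rw [← e]; linarith)

end BNR

end

/-! ### The isometry to the cone -/

noncomputable section

namespace BNR

open MetricChamberSystem

/-! ### The map to the cone -/

/-- The vector `phi P + v` does not change under a change of base point in a sheet, and the inverse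
label removes the ordering of the roots. -/
def repMap (r : Rep) : BPhi :=
  pt (hexM r.α) (permPlane (exists_labelled r.mem_mar).choose⁻¹ (phi r.P + r.v))

lemma repMap_eq {r : Rep} {w : Equiv.Perm (Fin 3)} (h : Labelled (domain r.α) w r.P) :
    repMap r = pt (hexM r.α) (permPlane w⁻¹ (phi r.P + r.v)) := by
  unfold repMap
  rw [(exists_labelled r.mem_mar).choose_spec.unique h]

lemma repMap_glue {a b : Rep} (h : Glue a b) : repMap a = repMap b := by
  obtain ⟨w, hw⟩ := exists_labelled a.mem_mar
  rw [repMap_eq hw]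
  cases h with
  | weyl s hα hP hv =>
    have hb : Labelled (domain b.α) (s * w) b.P := by
      rw [hα, hP]
      exact hw.perm s
    rw [repMap_eq hb, hα, hP, hv, phi_permCameral, ← permPlane_add, permPlane_permPlane]
    simp [mul_inv_rev, mul_assoc]
  | base hα hP hv =>
    have hb : Labelled (domain b.α) w b.P := by
      rw [hα]
      exact hw.of_mem_sheet subset_rfl a.mem_mar hP
    rw [repMap_eq hb, hα, hv, period_eq]
    congr 2
    abel
  -- The labels of the same point for the two regions differ by `change`, and the glued vectors lie
  -- in the hull of the common sectors, where `pt_change` applies.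
  | overlap hP hv hmem =>
    obtain ⟨w', hw'⟩ := exists_labelled b.mem_mar
    have hβ := b.mem_mar
    rw [repMap_eq hw', hP, hv]
    rw [hP] at hw' hβ
    obtain ⟨k, hk, e⟩ := hw.exists_overlap a.mem_mar hβ hw'
    have hc : w' = w * change a.α b.α k := by
      rw [change, ← mul_assoc, e, mul_assoc, mul_inv_cancel, mul_one]
    rw [hc, mul_inv_rev, ← permPlane_permPlane,
      pt_change hk (mem_hull_of_mem_periodHull a.mem_mar hβ hw hmem)]

/-- The map of the pre-building to the building. -/
def toCone : BPre → BPhi := Quot.lift repMap fun _ _ => repMap_glue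

lemma cubicleHull_eq (c : Cubicle) : cubicleHull c = univ := periodHull_mar c.2.2

/-- The chart of a cubicle, as a map on the whole plane. -/
def cubicleMap (c : Cubicle) (v : Plane) : BPre :=
  cubicleChart c ⟨v, by rw [cubicleHull_eq]; trivial⟩

lemma cubicleMap_val {c : Cubicle} (x : cubicleHull c) : cubicleMap c x = cubicleChart c x := rfl

lemma range_cubicleMap (c : Cubicle) : range (cubicleMap c) = bPre.carrier c := by
  refine Subset.antisymm ?_ ?_
  · rintro _ ⟨v, rfl⟩
    exact mem_range_self _
  · rintro _ ⟨x, rfl⟩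
    exact ⟨x, rfl⟩

lemma exists_toCone_cubicleMap (c : Cubicle) :
    ∃ D : Plane → Plane, IsAut D ∧ ∀ v, toCone (cubicleMap c v) = pt (hexM c.1) (D v) := by
  obtain ⟨w, hw⟩ := exists_labelled c.2.2
  exact ⟨_, (isAut_permLin w⁻¹).comp (isAut_add (phi c.2.1)), fun v =>
    repMap_eq (r := ⟨c.1, c.2.1, v, c.2.2, _⟩) hw⟩

lemma exists_chart_toCone (c : Cubicle) : bPhi.Chart (hexM c.1) (toCone ∘ cubicleMap c) := by
  obtain ⟨D, hD, h⟩ := exists_toCone_cubicleMap c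
  rw [show toCone ∘ cubicleMap c = pt (hexM c.1) ∘ D from funext h]
  exact (chart_pt _).comp_aut hD

/-- That the gluing does not collapse a cubicle is visible only in the cone, where its image is an
apartment with a chart. -/
lemma cubicleMap_injective (c : Cubicle) : Function.Injective (cubicleMap c) :=
  Function.Injective.of_comp (exists_chart_toCone c).inj

/-- By injectivity the infimum in the definition runs over a single value. -/
lemma dist_cubicleMap (c : Cubicle) (a b : Plane) :
    bPre.dist c (cubicleMap c a) (cubicleMap c b) = Dist.dist a b := by
  have : {r | ∃ x y : cubicleHull c, cubicleChart c x = cubicleMap c a ∧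
      cubicleChart c y = cubicleMap c b ∧ r = Dist.dist x y} = {Dist.dist a b} := by
    ext r
    constructor
    · rintro ⟨x, y, hx, hy, rfl⟩
      rw [← cubicleMap_val] at hx hy
      rw [mem_singleton_iff, Subtype.dist_eq, cubicleMap_injective c hx, cubicleMap_injective c hy]
    · rintro rfl
      exact ⟨⟨a, by rw [cubicleHull_eq]; trivial⟩, ⟨b, by rw [cubicleHull_eq]; trivial⟩, rfl, rfl, rfl⟩
  change sInf _ = _
  rw [this, csInf_singleton]

lemma mem_facets_bPre {τ : Filter BPre} :
    τ ∈ bPre.facets ↔ ∃ c, ∃ σ ∈ planeFacets, τ = σ.map (cubicleMap c) := by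
  have key : ∀ c, ∀ σ : Filter (cubicleHull c),
      (σ.map Subtype.val).map (cubicleMap c) = σ.map (cubicleChart c) := fun c σ => by
    rw [Filter.map_map]
    rfl
  constructor
  · rintro ⟨c, σ, hσ, rfl⟩
    exact ⟨c, _, hσ, (key c σ).symm⟩
  · rintro ⟨c, σ, hσ, rfl⟩
    have hm : (σ.comap (Subtype.val : cubicleHull c → Plane)).map Subtype.val = σ := by
      rw [Filter.map_comap, Subtype.range_coe, cubicleHull_eq, principal_univ, inf_top_eq]
    exact ⟨c, σ.comap Subtype.val, by rwa [hm], by rw [← key, hm]⟩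

lemma isMorphism_toCone : bPre.IsMorphism bPhi toCone := by
  intro τ hτ
  obtain ⟨c, σ, hσ, rfl⟩ := mem_facets_bPre.1 hτ
  rw [Filter.map_map]
  exact ((exists_chart_toCone c).facets σ).2 hσ

/-- A facet inside a cubicle could a priori come from another cubicle. Its image in the cone is a
facet, and the chart of the cone over the cubicle reflects facets. -/
lemma isPreBuilding_bPre : bPre.IsPreBuilding := by
  intro c
  refine ⟨cubicleHull c, isEnclosure_hull _, cubicleChart c, ?_, rfl, ?_, ?_⟩
  · exact fun x y h => Subtype.ext (cubicleMap_injective c h)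
  · exact fun x y => dist_cubicleMap c x y
  · intro σ
    refine ⟨fun h => ?_, fun h => ⟨c, σ, h, rfl⟩⟩
    have h1 := isMorphism_toCone _ h
    rw [Filter.map_map] at h1
    exact ((exists_chart_toCone c).facets _).1 (by rwa [Filter.map_map])

lemma isIsometry_toCone : bPre.IsIsometry bPhi toCone := by
  refine ⟨isMorphism_toCone, fun c => ?_⟩
  intro x hx y hy
  obtain ⟨a, rfl⟩ := (range_cubicleMap c).superset hx
  obtain ⟨b, rfl⟩ := (range_cubicleMap c).superset hy
  have h := exists_chart_toCone c
  refine ⟨hexM c.1, ?_, ?_, (h.dist_eq a b).trans (dist_cubicleMap c a b).symm⟩ <;>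
  · rw [← h.range_eq]
    exact mem_range_self _

lemma toCone_mem_coneSector (k : Fin 10) (a : Rep) (h : proj a.P ∈ region k) (hv : a.v = 0) :
    toCone (Quot.mk Glue a) ∈ coneSector k := by
  have hcl : proj a.P ∈ closure (chamber k) := subset_closure (region_eq k ▸ h)
  have hk := mem_marRegions a.mem_mar hcl
  obtain ⟨w, hw⟩ := exists_labelled a.mem_mar
  change repMap a ∈ _
  rw [repMap_eq hw, hv, add_zero]
  have hs := pt_mem_edgeSector (h := hexM a.α) (hw.mem_closedSector hk hcl)
  intro x hx
  have hx := hs x hx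
  change x = vert (tab a.α _) ∨ x = vert (tab a.α _) at hx
  rw [← vert_castLE, ← vert_castLE]
  rcases tab_sec a.α k hk with ⟨h1, h2⟩ | ⟨h1, h2⟩ <;> rw [h1, h2] at hx
  · exact hx
  · exact hx.symm

end BNR

end

/-! ### Folding maps from compatible families of rays -/

noncomputable section

namespace BNR

open MetricChamberSystem

variable {Y : Type u} {B : MetricChamberSystem.{u, v} Y}

/-! ### Extension of compatible rays to a folding map -/

lemma MetricChamberSystem.FlatPair.exists_chart_at {r r' : ℝ → Y} (h : B.FlatPair r r') (k : Fin 6)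
    (R : ℝ) : ∃ A g, B.Chart A g ∧
      ∀ s ∈ Icc 0 R, r s = g (s • ray k) ∧ r' s = g (s • ray (k + 1)) := by
  obtain ⟨A, g, hg, e⟩ := h R
  obtain ⟨L, hL, hLr⟩ := exists_rotation (-k)
  refine ⟨A, g ∘ L, hg.comp_aut hL, fun s hs => ?_⟩
  rw [Function.comp_apply, Function.comp_apply, map_smul, map_smul, hLr, hLr, add_neg_cancel,
    add_neg_cancel_comm]
  exact e s hs

lemma pt_sectorPt (h : Hexagon) (k : Fin 6) {s t : ℝ} (hs : 0 ≤ s) (ht : 0 ≤ t) :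
    (pt h (sectorPt k s t)).1 =
      Finsupp.single (h.vertex k) s + Finsupp.single (h.vertex (k + 1)) t := by
  change ∑ j, Finsupp.single (h.vertex j) (coef j (sectorPt k s t)) = _
  have hne : k + 1 ≠ k := (by decide : ∀ k : Fin 6, k + 1 ≠ k) k
  rw [Finset.sum_eq_add_of_mem k (k + 1) (Finset.mem_univ _) (Finset.mem_univ _) hne.symm]
  · rw [coef_sectorPt _ _ hs ht, coef_sectorPt _ _ hs ht, if_pos rfl, if_neg hne, if_pos rfl]
  · rintro j - ⟨h1, h2⟩
    rw [coef_sectorPt _ _ hs ht, if_neg h1, if_neg h2, Finsupp.single_zero]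

/-- The point `z` lies between the rays `r` as the point `c` of the cone lies in its sector. -/
def LiesAs (B : MetricChamberSystem.{u, v} Y) (r : B8 → ℝ → Y) (c : BPhi) (z : Y) : Prop :=
  ∀ x, c.1 x ≠ 0 ∨ c.1 = 0 →
    B.HasDist z (r x c.1.degree) ((c.1.degree - c.1 x) * ‖ray 1 - ray 0‖)

/-- A point `s x + t y` lies on the segment between the points at parameter `s + t` of its two rays.
Prescribing the two distances defines its image without choosing a chart; the value in the other
case is a default. -/
def extend (B : MetricChamberSystem.{u, v} Y) (r : B8 → ℝ → Y) (c : BPhi) : Y :=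
  open Classical in if h : ∃ z, LiesAs B r c z then h.choose else r (vert 0) 0

lemma dist_sectorPt (k : Fin 6) {s t : ℝ} (hs : 0 ≤ s) (ht : 0 ≤ t) :
    Dist.dist (sectorPt k s t) ((s + t) • ray k) = t * ‖ray 1 - ray 0‖ ∧
    Dist.dist (sectorPt k s t) ((s + t) • ray (k + 1)) = s * ‖ray 1 - ray 0‖ := by
  obtain ⟨L, hL, hLr⟩ := exists_rotation k
  have e : ‖ray (k + 1) - ray k‖ = ‖ray 1 - ray 0‖ := by
    have := hLr 1
    have h0 := hLr 0
    rw [add_comm] at this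
    rw [zero_add] at h0
    rw [← this, ← h0, ← dist_eq_norm, ← dist_eq_norm, hL.1.dist_eq]
  constructor
  · rw [dist_eq_norm, sectorPt, show s • ray k + t • ray (k + 1) - (s + t) • ray k =
      t • (ray (k + 1) - ray k) by module, norm_smul, e, Real.norm_of_nonneg ht]
  · rw [dist_eq_norm, sectorPt, show s • ray k + t • ray (k + 1) - (s + t) • ray (k + 1) =
      -(s • (ray (k + 1) - ray k)) by module, norm_neg, norm_smul, e, Real.norm_of_nonneg hs]

/-- The chart supplies a point with the required distances, and geodesics being unique it is the
only one. -/
lemma extend_pt (hB : B.IsBuilding) {r : B8 → ℝ → Y} (h0 : ∀ x y, r x 0 = r y 0) {A : B.Piece}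
    {g : Plane → Y} (hg : B.Chart A g) {h : Hexagon} {k : Fin 6} {s t : ℝ} (hs : 0 ≤ s)
    (ht : 0 ≤ t) (e1 : r (h.vertex k) (s + t) = g ((s + t) • ray k))
    (e2 : r (h.vertex (k + 1)) (s + t) = g ((s + t) • ray (k + 1))) :
    extend B r (pt h (sectorPt k s t)) = g (sectorPt k s t) := by
  classical
  set c := pt h (sectorPt k s t) with hc
  have hne : h.vertex (k + 1) ≠ h.vertex k := (h.adj k).ne'
  have hcv : c.1 = _ := pt_sectorPt h k hs ht
  have cx : c.1 (h.vertex k) = s := by simp [hcv, hne]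
  have cy : c.1 (h.vertex (k + 1)) = t := by simp [hcv, hne.symm]
  have hd : c.1.degree = s + t := by rw [hcv, map_add, Finsupp.degree_single, Finsupp.degree_single]
  obtain ⟨d1, d2⟩ := dist_sectorPt k hs ht
  have H1 : B.HasDist (g (sectorPt k s t)) (r (h.vertex k) (s + t)) (t * ‖ray 1 - ray 0‖) := by
    rw [e1, ← d1]; exact hg.hasDist _ _
  have H2 : B.HasDist (g (sectorPt k s t)) (r (h.vertex (k + 1)) (s + t)) (s * ‖ray 1 - ray 0‖) := by
    rw [e2, ← d2]; exact hg.hasDist _ _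
  have hval : LiesAs B r c (g (sectorPt k s t)) := by
    rintro x (hx | hx)
    · rcases pt_mem_edgeSector (sectorPt_mem_closedSector k hs ht) x hx with rfl | rfl
      · rw [hd, cx, add_sub_cancel_left]; exact H1
      · rw [hd, cy, add_sub_cancel_right]; exact H2
    · rw [hx, Finsupp.zero_apply] at cx cy
      rw [hx, map_zero, Finsupp.zero_apply, sub_zero, h0 x (h.vertex k)]
      rw [← cx, ← cy, add_zero] at H1
      rwa [← cx, ← cy]
  have hex : ∃ z, LiesAs B r c z := ⟨_, hval⟩
  have hz : LiesAs B r c (extend B r c) := by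
    rw [extend, dif_pos hex]
    exact hex.choose_spec
  have hzx : s ≠ 0 ∨ t = 0 →
      B.HasDist (extend B r c) (r (h.vertex k) (s + t)) (t * ‖ray 1 - ray 0‖) := by
    intro hst
    have := hz (h.vertex k)
    rw [hd, cx, add_sub_cancel_left] at this
    refine this ?_
    by_cases hs0 : s = 0
    · right
      rw [hcv, hs0, hst.resolve_left (not_not.2 hs0), Finsupp.single_zero, Finsupp.single_zero,
        add_zero]
    · exact Or.inl hs0
  -- On the rays, and at the apex, `LiesAs` gives no second condition, but there the remaining
  -- distance is zero.
  by_cases ht0 : t = 0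
  · have := hzx (Or.inr ht0)
    rw [ht0, zero_mul] at this H1
    rw [ht0, hB.eq_of_hasDist_zero this, hB.eq_of_hasDist_zero H1]
  have hzy : B.HasDist (extend B r c) (r (h.vertex (k + 1)) (s + t)) (s * ‖ray 1 - ray 0‖) := by
    have := hz (h.vertex (k + 1)) (Or.inl (cy ▸ ht0))
    rwa [hd, cy, add_sub_cancel_right] at this
  by_cases hs0 : s = 0
  · rw [hs0, zero_mul] at hzy H2
    rw [hs0, hB.eq_of_hasDist_zero hzy, hB.eq_of_hasDist_zero H2]
  refine hB.geodesic_unique (hB.hasDist_symm (hzx (Or.inl hs0))) (hB.hasDist_symm H1) hzy H2 ?_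
  rw [e1, e2, show t * ‖ray 1 - ray 0‖ + s * ‖ray 1 - ray 0‖ =
    Dist.dist ((s + t) • ray k) ((s + t) • ray (k + 1)) by
      have := (dist_sectorPt k (add_nonneg hs ht) le_rfl).2
      rw [sectorPt, zero_smul, add_zero, add_zero] at this
      rw [this]; ring]
  exact hg.hasDist _ _

/-- Rays that bound sectors whenever their vertices are adjacent. -/
structure Compatible (B : MetricChamberSystem.{u, v} Y) (r : B8 → ℝ → Y) : Prop where
  apex : ∀ x y, r x 0 = r y 0
  flat : ∀ {x y}, b8Graph.Adj x y → B.FlatPair (r x) (r y)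

lemma Compatible.exists_chart (hB : B.IsBuilding) {r : B8 → ℝ → Y} (hr : Compatible B r)
    (h : Hexagon) (k : Fin 6) (R : ℝ) : ∃ A g, B.Chart A g ∧
      ∀ v ∈ closedSector k, rootForm (k + 5) v ≤ R → extend B r (pt h v) = g v := by
  obtain ⟨A, g, hg, e⟩ := (hr.flat (h.adj k)).exists_chart_at k (R / 3)
  refine ⟨A, g, hg, fun v hv hR => ?_⟩
  have h5 := rootForm_add_five k v
  obtain ⟨s, t, hs, ht, rfl⟩ := exists_of_mem_closedSector hv
  obtain ⟨h1, h2⟩ := rootForm_sectorPt k s t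
  have := e (s + t) ⟨by positivity, by linarith⟩
  exact extend_pt hB hr.apex hg hs ht this.1 this.2

/-- A facet has a bounded member inside one closed sector, and there the extension coincides with a
chart of the building. -/
lemma Compatible.isMorphism (hB : B.IsBuilding) {r : B8 → ℝ → Y} (hr : Compatible B r) :
    bPhi.IsMorphism B (extend B r) := by
  rintro τ ⟨h, hm, hσ⟩
  obtain ⟨k, hk⟩ := exists_closedSector_mem hσ
  have hτ : τ = (τ.map (develop h)).map (pt h) := by
    rw [Filter.map_map]
    refine (Filter.map_id.symm.trans (Filter.map_congr ?_))
    filter_upwards [hm] with c hc using (pt_develop hc).symm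
  obtain ⟨x, a, hxa⟩ := id hσ
  obtain ⟨A, g, hg, e⟩ := hr.exists_chart hB h k (rootForm (k + 5) x + 1)
  have hbd : {v | rootForm (k + 5) v < rootForm (k + 5) x + 1} ∈ τ.map (develop h) := by
    rw [hxa]
    exact facetFilter_le_nhds x a ((isOpen_lt (continuous_rootForm _) continuous_const).mem_nhds
      (lt_add_one (rootForm (k + 5) x)))
  rw [hτ, Filter.map_map, Filter.map_congr (m₂ := g)]
  · exact (hg.facets _).2 hσ
  · filter_upwards [hk, hbd] with v h1 h2 using e v h1 (le_of_lt h2)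

def rootLin (k : Fin 6) : Plane →ₗ[ℝ] ℝ where
  toFun := rootForm k
  map_add' a b := by simp only [rootForm, coord_add]; ring
  map_smul' c a := by simp only [rootForm, coord_smul, smul_eq_mul, RingHom.id_apply]; ring

lemma rootLin_ne_zero (k : Fin 6) : rootLin k ≠ 0 := fun h => by
  have h1 := (rootForm_sectorPt k 0 1).2
  rw [show rootForm k (sectorPt k 0 1) = 0 from LinearMap.congr_fun h _] at h1
  norm_num at h1

def centralWalls : Set (AffineSubspace ℝ Plane) :=
  range fun k => (LinearMap.ker (rootLin k)).toAffineSubspace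

lemma rootForm_ne_zero {x : Plane} (hx : x ∈ (⋃ H ∈ centralWalls, (H : Set Plane))ᶜ) (k : Fin 6) :
    rootForm k x ≠ 0 := fun h => hx (mem_biUnion (mem_range_self k) (LinearMap.mem_ker.2 h))

/-- Root forms keep their sign on a component of the complement, by the intermediate value theorem.
-/
lemma exists_component_subset {x : Plane} (hx : x ∈ (⋃ H ∈ centralWalls, (H : Set Plane))ᶜ) :
    ∃ k, closure (connectedComponentIn (⋃ H ∈ centralWalls, (H : Set Plane))ᶜ x) ⊆
      closedSector k := by
  obtain ⟨k, s, t, hs, ht, e⟩ := exists_sectorPt x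
  have hxk : x ∈ closedSector k := e ▸ sectorPt_mem_closedSector k hs ht
  have key : ∀ m, 0 ≤ rootForm m x →
      ∀ y ∈ connectedComponentIn (⋃ H ∈ centralWalls, (H : Set Plane))ᶜ x, 0 ≤ rootForm m y := by
    intro m hm y hy
    by_contra! hlt
    obtain ⟨z, hz, h0⟩ := isPreconnected_connectedComponentIn.intermediate_value hy
      (mem_connectedComponentIn hx) (continuous_rootForm m).continuousOn ⟨hlt.le, hm⟩
    exact rootForm_ne_zero (connectedComponentIn_subset _ _ hz) m h0
  exact ⟨k, closure_minimal (fun y hy => ⟨key _ hxk.1 y hy, key _ hxk.2 y hy⟩)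
    (isClosed_closedSector k)⟩

theorem Compatible.isFolding (hB : B.IsBuilding) {r : B8 → ℝ → Y} (hr : Compatible B r) :
    bPhi.IsFolding B (extend B r) := by
  refine ⟨hr.isMorphism hB, fun (h : Hexagon) => ⟨_, (chart_pt h).isChart, centralWalls, ?_, ?_, ?_⟩⟩
  · rintro _ ⟨k, rfl⟩
    refine ⟨⟨0, zero_mem (LinearMap.ker (rootLin k))⟩, ?_⟩
    rw [Submodule.toAffineSubspace_direction]
    exact Module.Dual.finrank_ker_add_one_of_ne_zero (rootLin_ne_zero k)
  · have : Finite centralWalls := inferInstanceAs (Finite (range _))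
    exact locallyFinite_of_finite _
  · intro x hx a ha b hb
    obtain ⟨k, hk⟩ := exists_component_subset hx
    obtain ⟨A, g, hg, e⟩ := hr.exists_chart hB h k
      (max (rootForm (k + 5) a) (rootForm (k + 5) b))
    change B.HasDist (extend B r (pt h a)) (extend B r (pt h b)) _
    rw [e a (hk ha) (le_max_left _ _), e b (hk hb) (le_max_right _ _)]
    exact hg.hasDist a b

end BNR

end

/-! ### The flats and rays prescribed by an isometry into a building -/

noncomputable section

namespace BNR

open MetricChamberSystem

variable {Y : Type u} {B : MetricChamberSystem.{u, v} Y}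

/-! ### The flats of the maximal abelian regions -/

lemma exists_marked (α : Fin 10) : ∃ P, ∃ k ∈ marRegions α, P ∈ slab α 1 k := by
  obtain ⟨k, hk, -⟩ := exists_opposite_regions α
  obtain ⟨P, hP⟩ := slab_nonempty hk 1
  exact ⟨P, k, hk, hP⟩

/-- A base point over a maximal abelian region with the trivial label. -/
def marked (α : Fin 10) : Cameral := (exists_marked α).choose

lemma marked_spec (α : Fin 10) : ∃ k ∈ marRegions α, marked α ∈ slab α 1 k :=
  (exists_marked α).choose_spec

lemma proj_marked (α : Fin 10) : proj (marked α) ∈ mar α := by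
  obtain ⟨k, hk, h⟩ := marked_spec α
  exact chamber_subset_mar hk h.2

/-- The cubicle of a maximal abelian region in absolute coordinates. -/
def flatPt (α : Fin 10) (y : Plane) : BPre :=
  cubicleMap ⟨α, marked α, proj_marked α⟩ (-phi (marked α) + y)

/-- One Weyl relation makes the label trivial; then the marked point is in the same sheet and one
change of base point suffices. -/
lemma mk_eq_flatPt (r : Rep) {w : Equiv.Perm (Fin 3)} (hw : Labelled (domain r.α) w r.P) :
    Quot.mk Glue r = flatPt r.α (permPlane w⁻¹ (phi r.P + r.v)) := by
  have ha : proj (permCameral w⁻¹ r.P) ∈ mar r.α := r.mem_mar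
  let a : Rep := ⟨r.α, permCameral w⁻¹ r.P, permPlane w⁻¹ r.v, ha, by
    rw [periodHull_mar ha]; trivial⟩
  refine (Quot.sound (Glue.weyl r a w⁻¹ rfl rfl rfl)).trans (Quot.sound (Glue.base _ _ rfl ?_ ?_))
  · obtain ⟨k, hk, h⟩ := marked_spec r.α
    have := hw.perm w⁻¹
    rw [inv_mul_cancel] at this
    exact this.slab_subset hk ha h
  · change -phi (marked r.α) + permPlane w⁻¹ (phi r.P + r.v) = period (marked r.α) _ + permPlane w⁻¹ r.v
    rw [period_eq, phi_permCameral, permPlane_add]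
    abel

/-- A point over region `k` serves as base point for both cubicles. Since an exterior region fills
its sector, the whole sector lies in the hull along which they are glued. -/
lemma flatPt_change {α β k : Fin 10} (hα : k ∈ marRegions α) (hβ : k ∈ marRegions β) (hk : k < 8)
    {y : Plane} (hy : y ∈ closedSector (sec α k)) :
    flatPt α y = flatPt β (permPlane (change α β k)⁻¹ y) := by
  obtain ⟨Q, hQ⟩ := slab_nonempty hα 1
  have hQβ : Q ∈ slab β (change α β k) k := by
    rw [slab_eq hβ, change, inv_mul_cancel_right, ← one_mul (turnPerm _), ← slab_eq hα]
    exact hQ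
  have mα := chamber_subset_mar hα hQ.2
  have mβ := chamber_subset_mar hβ hQ.2
  let a : Rep := ⟨α, Q, -phi Q + y, mα, by rw [periodHull_mar mα]; trivial⟩
  let b : Rep := ⟨β, Q, -phi Q + y, mβ, by rw [periodHull_mar mβ]; trivial⟩
  have h1 : Quot.mk Glue a = flatPt α (permPlane 1⁻¹ (phi Q + (-phi Q + y))) := mk_eq_flatPt a hQ.1
  have h2 : Quot.mk Glue b = flatPt β (permPlane (change α β k)⁻¹ (phi Q + (-phi Q + y))) :=
    mk_eq_flatPt b hQβ.1
  rw [add_neg_cancel_left] at h1 h2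
  rw [inv_one, permPlane_one] at h1
  rw [← h1, ← h2]
  refine Quot.sound (Glue.overlap a b rfl rfl ?_)
  rw [mem_periodHull]
  change phi Q + (-phi Q + y) ∈ _
  rw [add_neg_cancel_left]
  have := permPlane_mem_hull_slab hα hk 1 hy
  rw [permPlane_one] at this
  exact hull_mono (image_mono (slab_subset_sheet hα
    (subset_inter (chamber_subset_mar hα) (chamber_subset_mar hβ)) hQ)) this

lemma toCone_flatPt (α : Fin 10) (y : Plane) : toCone (flatPt α y) = pt (hexM α) y := by
  obtain ⟨k, hk, h⟩ := marked_spec α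
  refine (repMap_eq (r := ⟨α, marked α, -phi (marked α) + y, proj_marked α, _⟩) h.1).trans ?_
  rw [inv_one, permPlane_one, add_neg_cancel_left]

lemma isFlat_flatPt {j : BPre → Y} (hj : bPre.IsIsometry B j) (α : Fin 10) :
    B.IsFlat (j ∘ flatPt α) := by
  let c : Cubicle := ⟨α, marked α, proj_marked α⟩
  constructor
  · intro a b
    have := hj.2 c _ ((range_cubicleMap c).subset (mem_range_self (-phi (marked α) + a))) _
      ((range_cubicleMap c).subset (mem_range_self (-phi (marked α) + b)))
    have e := dist_cubicleMap c (-phi (marked α) + a) (-phi (marked α) + b)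
    rw [dist_add_left] at e
    exact e ▸ this
  · intro σ hσ
    have := hj.1 _ (mem_facets_bPre.2 ⟨c, _, ((isAut_add (-phi (marked α))).2.2 σ).2 hσ, rfl⟩)
    rwa [Filter.map_map, Filter.map_map] at this

/-! ### The rays over the vertices of the hexagons -/

lemma IsFlat.exists_chart_sector (hB : B.IsBuilding) {J : Plane → Y} (hJ : B.IsFlat J) (k : Fin 6)
    (R : ℝ) : ∃ A g, B.Chart A g ∧
      ∀ s ∈ Icc 0 R, ∀ t ∈ Icc 0 R, J (sectorPt k s t) = g (sectorPt k s t) := by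
  obtain ⟨A, h1, h2⟩ := hJ.exists_pair 0 (0 + sectorPt k (max R 1) (max R 1))
  have pos : 0 < max R 1 := lt_max_of_lt_right one_pos
  obtain ⟨g, hg, e⟩ := hB.exists_chart_parallelogram hJ pos pos h1 h2
  simp only [zero_add] at e
  exact ⟨A, g, hg, fun s hs t ht => e s ⟨hs.1, hs.2.trans (le_max_left _ _)⟩ t
    ⟨ht.1, ht.2.trans (le_max_left _ _)⟩⟩

/-- Both midpoints are computed in one apartment through the common end points. -/
lemma flat_midpoint (hB : B.IsBuilding) {J J' : Plane → Y} (hJ : B.IsFlat J) (hJ' : B.IsFlat J')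
    {a b a' b' : Plane} (e1 : J a = J' a') (e2 : J b = J' b') :
    J (a + (1 / 2 : ℝ) • (b - a)) = J' (a' + (1 / 2 : ℝ) • (b' - a')) := by
  obtain ⟨A, h1, h2⟩ := hJ'.exists_pair a' b'
  obtain ⟨g, hg⟩ := hB.exists_chart A
  obtain ⟨u₁, e3⟩ := hg.exists_eq h1
  obtain ⟨u₂, e4⟩ := hg.exists_eq h2
  have ht : (1 / 2 : ℝ) ∈ Icc (0 : ℝ) 1 := by norm_num
  rw [hB.flat_segment hJ hg (e1.trans e3.symm) (e2.trans e4.symm) ht,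
    hB.flat_segment hJ' hg e3.symm e4.symm ht]

lemma permPlane_ray (w : Equiv.Perm (Fin 3)) (j : Fin 6) : permPlane w (ray j) = ray (actRay w j) := by
  have h1 : ∀ m, coef m (ray j) = if m = j then 1 else 0 := fun m => by
    have := coef_sectorPt m j zero_le_one (le_refl (0 : ℝ))
    rw [sectorPt, one_smul, zero_smul, add_zero] at this
    rw [this]
    simp
  rw [← sum_coef_smul_ray (permPlane w (ray j)),
    ← (Equiv.ofBijective _ (Finite.injective_iff_bijective.1 (actRay_injective w))).sum_comp]
  simp [coef_actRay, h1]

/-- A hexagon with all regions at a vertex, for each vertex, and the position of the vertex. -/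
def place : Fin 12 → Fin 10 × Fin 6 :=
  ![(5, 1), (0, 2), (0, 3), (0, 4), (3, 5), (3, 0), (5, 5), (5, 0), (0, 0), (2, 1), (3, 2), (4, 1)]

/-- At a vertex of the octagon every hexagon through it shares an exterior region with the reference
hexagon, so `flatPt_change` compares their rays directly. -/
lemma place_spec : ∀ α a, tab α a < 8 → ∃ k, k ∈ marRegions α ∧
    k ∈ marRegions (place (tab α a)).1 ∧ k < 8 ∧ (sec α k = a ∨ sec α k + 1 = a) ∧
    actRay (change α (place (tab α a)).1 k)⁻¹ a = (place (tab α a)).2 := by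
  decide +kernel

lemma place_neighbours : ∀ α a, ¬tab α a < 8 → tab α (a + 5) < 8 ∧ tab α (a + 1) < 8 ∧
    ((tab (place (tab α a)).1 ((place (tab α a)).2 + 5) = tab α (a + 5) ∧
      tab (place (tab α a)).1 ((place (tab α a)).2 + 1) = tab α (a + 1)) ∨
    (tab (place (tab α a)).1 ((place (tab α a)).2 + 5) = tab α (a + 1) ∧
      tab (place (tab α a)).1 ((place (tab α a)).2 + 1) = tab α (a + 5))) := by
  decide +kernel

def baseRay (j : BPre → Y) (i : Fin 12) (s : ℝ) : Y := j (flatPt (place i).1 (s • ray (place i).2))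

lemma baseRay_eq_of_lt {j : BPre → Y} {α : Fin 10} {a : Fin 6} (h : tab α a < 8) {s : ℝ}
    (hs : 0 ≤ s) : j (flatPt α (s • ray a)) = baseRay j (tab α a) s := by
  obtain ⟨k, h1, h2, h3, h4, h5⟩ := place_spec α a h
  have hm : s • ray a ∈ closedSector (sec α k) := by
    rcases h4 with e | e
    · have := sectorPt_mem_closedSector (sec α k) hs le_rfl
      rwa [sectorPt, zero_smul, add_zero, congrArg ray e] at this
    · have := sectorPt_mem_closedSector (sec α k) le_rfl hs
      rwa [sectorPt, zero_smul, zero_add, congrArg ray e] at this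
  rw [baseRay, flatPt_change h1 h2 h3 hm, ← permLin_apply, map_smul, permLin_apply, permPlane_ray, h5]

/-- Octagon vertices are covered by gluing along exterior regions. At the vertices 8 to 11 gluing
along a filled sector is not available; there the ray bisects the angle between the rays over the
two neighbours, which are octagon vertices and the same in both hexagons. -/
lemma baseRay_eq (hB : B.IsBuilding) {j : BPre → Y} (hj : bPre.IsIsometry B j) (α : Fin 10)
    (a : Fin 6) {s : ℝ} (hs : 0 ≤ s) : j (flatPt α (s • ray a)) = baseRay j (tab α a) s := by
  by_cases h : tab α a < 8
  · exact baseRay_eq_of_lt h hs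
  obtain ⟨l1, l2, h⟩ := place_neighbours α a h
  set γ := (place (tab α a)).1
  set b := (place (tab α a)).2
  have h2s : 0 ≤ 2 * s := by positivity
  have mid : ∀ c : Fin 6, s • ray c =
      (2 * s) • ray (c + 5) + (1 / 2 : ℝ) • ((2 * s) • ray (c + 1) - (2 * s) • ray (c + 5)) ∧
      s • ray c =
      (2 * s) • ray (c + 1) + (1 / 2 : ℝ) • ((2 * s) • ray (c + 5) - (2 * s) • ray (c + 1)) := by
    intro c
    have := ray_add_two (c + 5)
    rw [(by decide : ∀ c : Fin 6, c + 5 + 2 = c + 1) c,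
      (by decide : ∀ c : Fin 6, c + 5 + 1 = c) c] at this
    rw [← this]
    constructor <;> module
  have e1 := baseRay_eq_of_lt (j := j) l1 h2s
  have e2 := baseRay_eq_of_lt (j := j) l2 h2s
  have hJ := isFlat_flatPt hj α
  have hJ' := isFlat_flatPt hj γ
  change (j ∘ flatPt α) (s • ray a) = (j ∘ flatPt γ) (s • ray b)
  rw [(mid a).1]
  rcases h with ⟨h1, h2⟩ | ⟨h1, h2⟩
  · rw [(mid b).1]
    refine flat_midpoint hB hJ hJ' (e1.trans ?_) (e2.trans ?_)
    · rw [← h1]; exact (baseRay_eq_of_lt (h1 ▸ l1) h2s).symm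
    · rw [← h2]; exact (baseRay_eq_of_lt (h2 ▸ l2) h2s).symm
  · rw [(mid b).2]
    refine flat_midpoint hB hJ hJ' (e1.trans ?_) (e2.trans ?_)
    · rw [← h2]; exact (baseRay_eq_of_lt (h2 ▸ l1) h2s).symm
    · rw [← h1]; exact (baseRay_eq_of_lt (h1 ▸ l2) h2s).symm

/-- Every edge occurs in one of the ten hexagons, so its two rays bound a sector of a flat. -/
lemma tableAdj_cases : ∀ a b, TableAdj a b → ∃ α k, (tab α k = a ∧ tab α (k + 1) = b) ∨
    (tab α k = b ∧ tab α (k + 1) = a) := by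
  decide +kernel

lemma flatPair_tab (hB : B.IsBuilding) {j : BPre → Y} (hj : bPre.IsIsometry B j) (α : Fin 10)
    (k : Fin 6) : B.FlatPair (baseRay j (tab α k)) (baseRay j (tab α (k + 1))) := by
  intro R
  obtain ⟨A, g, hg, e⟩ := IsFlat.exists_chart_sector hB (isFlat_flatPt hj α) k R
  obtain ⟨L, hL, hLr⟩ := exists_rotation k
  have h0 := hLr 0
  have h1 := hLr 1
  rw [zero_add] at h0
  rw [add_comm] at h1
  refine ⟨A, g ∘ L, hg.comp_aut hL, fun s hs => ?_⟩
  have hz : (0 : ℝ) ∈ Icc 0 R := ⟨le_rfl, hs.1.trans hs.2⟩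
  have e0 := e s hs 0 hz
  have e1 := e 0 hz s hs
  simp only [sectorPt, zero_smul, add_zero, zero_add, Function.comp_apply] at e0 e1 ⊢
  rw [map_smul, map_smul, h0, h1, ← e0, ← e1, baseRay_eq hB hj α k hs.1,
    baseRay_eq hB hj α (k + 1) hs.1]
  exact ⟨rfl, rfl⟩

lemma flatPair_baseRay (hB : B.IsBuilding) {j : BPre → Y} (hj : bPre.IsIsometry B j) {a b : Fin 12}
    (h : TableAdj a b) : B.FlatPair (baseRay j a) (baseRay j b) := by
  obtain ⟨α, k, ⟨rfl, rfl⟩ | ⟨rfl, rfl⟩⟩ := tableAdj_cases a b h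
  · exact flatPair_tab hB hj α k
  · exact (flatPair_tab hB hj α k).symm

end BNR

end

/-! ### Choosing rays over all vertices, and the factorization -/

noncomputable section

namespace BNR

open MetricChamberSystem

variable {Y : Type u} {B : MetricChamberSystem.{u, v} Y}

/-! ### Rays over all vertices -/

lemma MetricChamberSystem.FlatPair.apex {r r' : ℝ → Y} (h : B.FlatPair r r') : r 0 = r' 0 := by
  obtain ⟨A, g, -, e⟩ := h 0
  obtain ⟨h1, h2⟩ := e 0 ⟨le_rfl, le_rfl⟩
  rw [h1, h2, zero_smul, zero_smul]

lemma MetricChamberSystem.FlatPair.exists_isRay {par : (Plane → Y) → ZMod 2} (hpar : B.IsParity par) {r r' : ℝ → Y}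
    (h : B.FlatPair r r') : ∃ m, B.IsRay par m r := by
  obtain ⟨A, g, hg, e⟩ := h 1
  refine ⟨par g, fun R => ?_⟩
  obtain ⟨A', g', hg', e'⟩ := h (max R 1)
  have := hpar hg' hg one_pos (z := 0) (z' := 0) (k := 0) (k' := 0) fun s hs => by
    rw [zero_add, ← (e s hs).1, ← (e' s ⟨hs.1, hs.2.trans (le_max_right _ _)⟩).1]
  exact ⟨A', g', hg', add_left_cancel this, fun s hs =>
    (e' s ⟨hs.1, hs.2.trans (le_max_left _ _)⟩).1⟩

/-- Compatible rays over the vertices of a stage that extend the given ones. -/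
structure StageRays (B : MetricChamberSystem.{u, v} Y) (par : (Plane → Y) → ZMod 2) (m : ZMod 2)
    (j : BPre → Y) (n : ℕ) (R : (stage n).V → ℝ → Y) : Prop where
  flat : ∀ {a b}, (stage n).G.Adj a b → B.FlatPair (R a) (R b)
  apex : ∀ a, R a 0 = baseRay j 0 0
  isRay : ∀ a, B.IsRay par (m + stageCol n a) (R a)
  base : ∀ a i, B8.mk n a = vert i → R a = baseRay j i

/-- Types alternate across sectors, so along walks from vertex 0 the type follows the colouring of
the connected link. -/
lemma exists_stageRays_zero (hB : B.IsBuilding) {par : (Plane → Y) → ZMod 2} (hpar : B.IsParity par)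
    {j : BPre → Y} (hj : bPre.IsIsometry B j) : ∃ m R, StageRays B par m j 0 R := by
  have hflat : ∀ {a b : Fin 9}, linkStage.G.Adj a b →
      B.FlatPair (baseRay j (Fin.castAdd 3 a)) (baseRay j (Fin.castAdd 3 b)) := fun {a b} h =>
    flatPair_baseRay hB hj ((by decide : ∀ a b : Fin 9, LinkAdj a b →
      TableAdj (Fin.castAdd 3 a) (Fin.castAdd 3 b)) a b (linkStage_adj.1 h))
  obtain ⟨m, hm⟩ := FlatPair.exists_isRay hpar
    (flatPair_baseRay hB hj (by decide : TableAdj 0 1))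
  have key : ∀ a : Fin 9, baseRay j (Fin.castAdd 3 a) 0 = baseRay j 0 0 ∧
      B.IsRay par (m + linkCol a) (baseRay j (Fin.castAdd 3 a)) := by
    have walk : ∀ {a b : Fin 9}, linkStage.G.Walk a b →
        (baseRay j (Fin.castAdd 3 a) 0 = baseRay j 0 0 ∧
          B.IsRay par (m + linkCol a) (baseRay j (Fin.castAdd 3 a))) →
        baseRay j (Fin.castAdd 3 b) 0 = baseRay j 0 0 ∧
          B.IsRay par (m + linkCol b) (baseRay j (Fin.castAdd 3 b)) := by
      intro a b p
      induction p with
      | nil => exact id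
      | cons h p ih =>
        refine fun ⟨h1, h2⟩ => ih ⟨(hflat h).apex.symm.trans h1, ?_⟩
        rw [isLinear_link.col_adj h, ← add_assoc]
        exact (hflat h).isRay hpar h2
    intro a
    obtain ⟨p⟩ := isLinear_link.reach (0 : Fin 9) a
    refine walk p ⟨rfl, ?_⟩
    rw [show linkCol 0 = 0 from rfl, add_zero]
    exact hm
  refine ⟨m, fun a : Fin 9 => baseRay j (Fin.castAdd 3 a), hflat, fun a => (key a).1,
    fun a => (key a).2, fun a i h => ?_⟩
  obtain rfl := vertStage_injective (B8.mk_injective 1 ((vert_castLE a).trans h))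
  rfl

lemma exists_mk_eq (n : ℕ) (a : (stage 1).V) : ∃ b : (stage (n + 1)).V, B8.mk 1 a = B8.mk (n + 1) b := by
  induction n with
  | zero => exact ⟨a, rfl⟩
  | succ n ih =>
    obtain ⟨b, hb⟩ := ih
    exact ⟨Sum.inl b, hb.trans (B8.mk_succ _ _).symm⟩

namespace StageRays

variable {par : (Plane → Y) → ZMod 2} {m : ZMod 2} {j : BPre → Y} {n : ℕ}
  {R : (stage n).V → ℝ → Y}

/-- Over the three distinguished vertices the ray is dictated by `j`. Over any other new vertex it
comes from `exists_common_neighbour`; the types agree because the ends of the path have the same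
colour. -/
lemma exists_ray (hB : B.IsBuilding) (hpar : B.IsParity par) (hj : bPre.IsIsometry B j)
    (hR : StageRays B par m j n R) (z : NewVertex (stage n).G) :
    ∃ q, (∀ x ∈ z.1, B.FlatPair (R x) q) ∧
      ∀ i, B8.mk (n + 1) (Sum.inr z) = vert i → q = baseRay j i := by
  by_cases h : ∃ i, B8.mk (n + 1) (Sum.inr z) = vert i
  · obtain ⟨i, hi⟩ := h
    refine ⟨baseRay j i, fun x hx => ?_, fun i' hi' => ?_⟩
    -- The distinguished vertices appear at stage 1, so they cannot be new at any later stage.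
    · cases n with
      | zero =>
        rw [hR.base x _ (vert_castLE x).symm]
        exact flatPair_baseRay hB hj ((vertStage_adj _ _).1 ((congrArg₂ (stage 1).G.Adj
          (vertStage_left x) (B8.mk_injective 1 hi).symm).mpr (complete_adj_inr.2 hx)))
      | succ n =>
        obtain ⟨b, hb⟩ := exists_mk_eq n (vertStage i)
        exact nomatch B8.mk_injective _ (hi.trans (hb.trans (B8.mk_succ _ b).symm))
    · rw [vertStage_injective (B8.mk_injective 1 (hi.symm.trans hi'))]
  · obtain ⟨x, y, -, hz, ho⟩ := newVertex_ends (isLinear_stage n) z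
    obtain ⟨b, -, -, hb, -⟩ := (isLinear_stage n).deg x
    have hy := hR.isRay y
    rw [(isLinear_stage n).openFour_col ho] at hy
    obtain ⟨q, h1, h2⟩ := hB.exists_common_neighbour hpar (hR.isRay x) hy
      ((hR.apex x).trans (hR.apex y).symm) ⟨_, hR.flat hb⟩
    refine ⟨q, fun w hw => ?_, fun i hi => absurd ⟨i, hi⟩ h⟩
    rw [hz, Sym2.mem_iff] at hw
    rcases hw with rfl | rfl
    exacts [h1, h2]

lemma exists_succ (hB : B.IsBuilding) (hpar : B.IsParity par) (hj : bPre.IsIsometry B j)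
    (hR : StageRays B par m j n R) :
    ∃ R', StageRays B par m j (n + 1) R' ∧ ∀ a, R' (Sum.inl a) = R a := by
  choose q hq hbase using hR.exists_ray hB hpar hj
  have hmem : ∀ z : NewVertex (stage n).G, ∃ x, x ∈ z.1 := fun z => by
    obtain ⟨x, y, -, hz, -⟩ := newVertex_ends (isLinear_stage n) z
    exact ⟨x, by simp [hz]⟩
  refine ⟨Sum.elim R q, ⟨?_, ?_, ?_, ?_⟩, fun a => rfl⟩
  · rintro (a | z) (b | w) hab
    · exact hR.flat (complete_adj_inl.1 hab)
    · exact hq w a (complete_adj_inr.1 hab)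
    · exact (hq z b (complete_adj_inr.1 hab.symm)).symm
    · exact (complete_adj_inr_inr hab).elim
  · rintro (a | z)
    · exact hR.apex a
    · obtain ⟨x, hx⟩ := hmem z
      exact (hq z x hx).apex.symm.trans (hR.apex x)
  · rintro (a | z)
    · exact hR.isRay a
    · obtain ⟨x, hx⟩ := hmem z
      have := (hq z x hx).isRay hpar (hR.isRay x)
      rw [add_assoc, ← completeCol_inr (isLinear_stage n) hx] at this
      exact this
  · rintro (a | z) i h
    · exact hR.base a i ((B8.mk_succ n a).symm.trans h)
    · exact hbase z i h

end StageRays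

lemma exists_compatible (hB : B.IsBuilding) {j : BPre → Y} (hj : bPre.IsIsometry B j) :
    ∃ r, Compatible B r ∧ ∀ i, r (vert i) = baseRay j i := by
  obtain ⟨par, hpar⟩ := hB.exists_parity
  obtain ⟨m, R₀, h₀⟩ := exists_stageRays_zero hB hpar hj
  -- Each stage extends the previous rays, so the choices descend to the union of the graphs.
  let F : (n : ℕ) → {R // StageRays B par m j n R} := Nat.rec ⟨R₀, h₀⟩ fun n p =>
    ⟨(p.2.exists_succ hB hpar hj).choose, (p.2.exists_succ hB hpar hj).choose_spec.1⟩
  let r : B8 → ℝ → Y := Quot.lift (fun p => (F p.1).1 p.2) (by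
    rintro ⟨n, a⟩ _ rfl
    exact (((F n).2.exists_succ hB hpar hj).choose_spec.2 a).symm)
  have hr : ∀ n a, r (B8.mk n a) = (F n).1 a := fun n a => rfl
  have hapex : ∀ x, r x 0 = baseRay j 0 0 := fun x => by
    obtain ⟨N, hN⟩ := x.exists_rep
    obtain ⟨a, rfl⟩ := hN N le_rfl
    rw [hr]
    exact (F N).2.apex a
  refine ⟨r, ⟨fun x y => (hapex x).trans (hapex y).symm, fun {x y} hxy => ?_⟩, fun i => ?_⟩
  · obtain ⟨N, hN⟩ := x.exists_rep
    obtain ⟨M, hM⟩ := y.exists_rep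
    obtain ⟨a, rfl⟩ := hN (max N M) (le_max_left _ _)
    obtain ⟨b, rfl⟩ := hM (max N M) (le_max_right _ _)
    rw [hr, hr]
    exact (F _).2.flat (b8_adj_mk.1 hxy)
  · exact (F 1).2.base _ i rfl

/-- A sector of the flat over `α` lies, up to any given size, in a chart, and its bounding rays are
the prescribed ones; `extend_pt` then recovers the flat itself. -/
lemma extend_comp_toCone (hB : B.IsBuilding) {j : BPre → Y} (hj : bPre.IsIsometry B j)
    {r : B8 → ℝ → Y} (hr : Compatible B r) (hv : ∀ i, r (vert i) = baseRay j i) :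
    extend B r ∘ toCone = j := by
  funext p
  induction p using Quot.ind with
  | mk a =>
    obtain ⟨w, hw⟩ := exists_labelled a.mem_mar
    rw [mk_eq_flatPt a hw, Function.comp_apply, toCone_flatPt]
    obtain ⟨k, s, t, hs, ht, e⟩ := exists_sectorPt (permPlane w⁻¹ (phi a.P + a.v))
    rw [e]
    obtain ⟨A, g, hg, eg⟩ := IsFlat.exists_chart_sector hB (isFlat_flatPt hj a.α) k (s + t)
    have hst : s + t ∈ Icc 0 (s + t) := ⟨by positivity, le_rfl⟩
    have h0 : (0 : ℝ) ∈ Icc 0 (s + t) := ⟨le_rfl, hst.1⟩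
    have e1 := eg _ hst _ h0
    have e2 := eg _ h0 _ hst
    simp only [sectorPt, zero_smul, add_zero, zero_add, Function.comp_apply] at e1 e2
    have hx : ∀ l, r ((hexM a.α).vertex l) (s + t) = j (flatPt a.α ((s + t) • ray l)) := fun l => by
      rw [baseRay_eq hB hj a.α l hst.1]
      exact congrFun (hv _) _
    rw [extend_pt hB hr.apex hg hs ht ((hx _).trans e1) ((hx _).trans e2)]
    exact (eg s ⟨hs, by linarith⟩ t ⟨ht, by linarith⟩).symm

end BNR

end

theorem mainTheorem11 :
    BNR.bPre.IsPreBuilding ∧ BNR.bPhi.IsBuilding ∧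
    ∃ i : BNR.BPre → BNR.BPhi,
      BNR.bPre.IsIsometry BNR.bPhi i ∧
      (∀ (k : Fin 10) (a : BNR.Rep), BNR.proj a.P ∈ BNR.region k → a.v = 0 →
        i (Quot.mk BNR.Glue a) ∈ BNR.coneSector k) ∧
      ∀ (Y : Type u) (B : BNR.MetricChamberSystem.{u, v} Y), B.IsBuilding →
        ∀ j : BNR.BPre → Y, BNR.bPre.IsIsometry B j →
          ∃ θ : BNR.BPhi → Y, BNR.bPhi.IsFolding B θ ∧ θ ∘ i = j := by
  refine ⟨BNR.isPreBuilding_bPre, BNR.isBuilding_bPhi, BNR.toCone, BNR.isIsometry_toCone,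
    BNR.toCone_mem_coneSector, fun Y B hB j hj => ?_⟩
  obtain ⟨r, hr, hv⟩ := BNR.exists_compatible hB hj
  exact ⟨_, hr.isFolding hB, BNR.extend_comp_toCone hB hj hr hv⟩
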